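/- Let $0<q,t<1$. Let $\Lambda$ be the ring of symmetric functions over $\mathbb R$, with power sums $p_n$ and elementary symmetric functions $e_r$, and let $\mathbb Y$ be the set of partitions. Let $P_{\lambda},Q_{\lambda}$ be the Macdonald symmetric functions and their duals with parameters $(q,t)$, and let $P_{\lambda/\mu},Q_{\lambda/\mu}$ be the skew functions, given by $P_\lambda(X,Y)=\sum_\mu P_{\lambda/\mu}(X)P_\mu(Y)$ and $Q_\lambda(X,Y)=\sum_\mu Q_{\lambda/\mu}(X)Q_\mu(Y)$. A specialization is an $\mathbb R$-algebra homomorphism $\rho:\Lambda\to\mathbb R$; one writes $F(\rho)=\rho(F)$, and $\rho$ is Macdonald positive if $P_\lambda(\rho)\ge 0$ for all $\lambda$. For specializations $\rho^+,\rho^-$ put $$W_u(\lambda,\mu)=u^{|\mu|}Q_{\lambda/\mu}(\rho^-)P_{\lambda/\mu}(\rho^+),\qquad \Pi=\sum_{\lambda,\mu\in\mathbb Y}W_u(\lambda,\mu),\qquad \mathbb P(\lambda)=\frac1{\Pi}\sum_{\mu\in\mathbb Y} W_u(\lambda,\mu),\qquad \mathbb E[f]=\sum_{\lambda\in\mathbb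 Y} f(\lambda)\mathbb P(\lambda)$$ (the periodic Macdonald measure and its expectation). For an integer $r\ge 0$ let $\mathcal E_r(\lambda)=e_r(q^{\lambda}t^{-\rho+1})$, where the specialization $q^\lambda t^{-\rho+1}$ is given by $$p_n(q^\lambda t^{-\rho+1})=\sum_{i=1}^{\ell(\lambda)}(q^{\lambda_i}t^{-i+1})^n+\frac{t^{-n\ell(\lambda)}}{1-t^{-n}}\qquad(n\ge1).$$ Set $(a;u)_\infty=\prod_{k\ge0}(1-au^k)$, $$\Delta_{q,t^{-1};u}(z)=\prod_{i,j=1}^r\frac{(uz_j/z_i;u)_\infty(qt^{-1}uz_j/z_i;u)_\infty}{(quz_j/z_i;u)_\infty(t^{-1}uz_j/z_i;u)_\infty},$$ $$K(z,w)=\frac1{z-t^{-1}w}\exp\Big(\sum_{n\ge1}\Big(\frac{1-t^{-n}}{1-u^n}\frac{p_n(\rho^+)}{n}z^n-\frac{1-t^{n}}{1-u^n}\frac{p_n(\rho^-)}{n}z^{-n}\Big)\Big).$$ (1) The kernel $K$ is the case $N=a=1$, $\rho^+_0=\rho^+$, $\rho^-_1=\rho^-$ of $$K^{a}(z,w)=\frac{1}{z-t^{-1}w}\prod_{n>0}\prod_{b=0}^{N-1}\exp\Big((u^n\chi[b\ge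 a]+\chi[b<a])\tfrac{1-t^{-n}}{1-u^n}\tfrac{p_n(\rho^+_b)}{n}z^n\Big)\prod_{b=1}^{N}\exp\Big(-(u^n\chi[b<a]+\chi[b\ge a])\tfrac{1-t^{n}}{1-u^n}\tfrac{p_n(\rho^-_b)}{n}z^{-n}\Big),$$ where $\chi[S]$ is $1$ if $S$ is true and $0$ otherwise. (2) As formal series, $$\mathbb E[\mathcal E_r]=\frac1{r!}\int D^rz\ \det\big(K(z_i,z_j)\big)_{1\le i,j\le r}\,\Delta_{q,t^{-1};u}(z).$$ Here $u$ is a formal variable, and $p_n(\rho^+),p_n(\rho^-)$ are replaced by $p_n(\rho^+)x^n,p_n(\rho^-)y^n$ with formal variables $x,y$, on both sides, so that both sides lie in $\mathbb R[[x,y,u]]$. The factor $(z-t^{-1}w)^{-1}$ is the formal series $\sum_{k\ge0}z^{-1}(t^{-1}w/z)^k$. The functional $\int D^rz$ takes the coefficient of $z_1^{-1}\cdots z_r^{-1}$; in each coefficient of a monomial in $x,y,u$, the series in powers of the $t^{-1}$ coming from the factors $(z_i-t^{-1}z_j)^{-1}$ is the expansion of a rational function, and it is given the value of that rational function. (3)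 Let moreover $\rho^+,\rho^-$ be Macdonald positive, let $0<u<1$ be a real number, and suppose that $\sum_{\lambda,\mu}W_u(\lambda,\mu)$, $\sum_{\lambda,\mu}\mathcal E_r(\lambda)W_u(\lambda,\mu)$ and the series on the right-hand side of (2) at $x=y=1$ and this $u$ converge absolutely. Then the numerical expectation $\mathbb E[\mathcal E_r]$ equals the value of the right-hand side of (2) at $x=y=1$ and this $u$. -/

import Mathlib

open scoped BigOperators Nat

noncomputable section

namespace PeriodicMacdonald

/-! ### Partitions -/

/-- The set of all partitions: a size `n` together with a partition of `n`. -/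
abbrev Ptn : Type := (n : ℕ) × n.Partition

/-- The weight (number of boxes) of a partition. -/
def Ptn.size (lam : Ptn) : ℕ := lam.1

/-- The length (number of nonzero parts) of a partition. -/
def Ptn.length (lam : Ptn) : ℕ := Multiset.card lam.2.parts

/-- The parts in non-increasing order. -/
def rowList {n : ℕ} (lam : n.Partition) : List ℕ := lam.parts.sort (· ≥ ·)

/-- The `i`-th largest part, rows being numbered from `0`; it is `0` beyond the length. -/
def Ptn.row (lam : Ptn) (i : ℕ) : ℕ := (rowList lam.2).getD i 0

/-- Strict dominance order on the partitions of `n`: `mu < lam`. -/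
def DominatedBy {n : ℕ} (mu lam : n.Partition) : Prop :=
  mu ≠ lam ∧ ∀ k : ℕ, ((rowList mu).take k).sum ≤ ((rowList lam).take k).sum

/-! ### Symmetric functions -/

/-- The ring of symmetric functions over `ℝ`, presented as the polynomial ring in the power sums:
the variable with index `n ≥ 1` is the power sum `p_n`. -/
abbrev Lam : Type := MvPolynomial ℕ+ ℝ

/-- The power sum `p_n`. -/
def powerSum (n : ℕ+) : Lam := MvPolynomial.X n

/-- The projection of symmetric functions onto symmetric polynomials in `k` variables,
which sends `p_n` to `x_1 ^ n + ⋯ + x_k ^ n`. -/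
def reduce (k : ℕ) : Lam →ₐ[ℝ] MvPolynomial (Fin k) ℝ :=
  MvPolynomial.aeval fun n : ℕ+ => MvPolynomial.psum (Fin k) ℝ (n : ℕ)

/-- The elementary symmetric function `e_r`, through Newton's identities
`r * e_r = ∑_{i=1}^{r} (-1)^(i-1) * e_{r-i} * p_i`. -/
def elem : ℕ → Lam
  | 0 => 1
  | r + 1 => MvPolynomial.C (((r : ℝ) + 1)⁻¹) *
      ∑ i : Fin (r + 1), (-1) ^ (i : ℕ) * elem (r - (i : ℕ)) * powerSum ⟨(i : ℕ) + 1, Nat.succ_pos _⟩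
  termination_by r => r

/-- Let `d` be the multiplicity function of a partition `lam` (the value `d i` is `m_i(lam)`).
This is `z_lam(q,t) = ∏ i, m_i! * i^{m_i} * ((1 - q^i) / (1 - t^i))^{m_i}`. -/
def zFactor (q t : ℝ) (d : ℕ+ →₀ ℕ) : ℝ :=
  d.prod fun i m => (m ! : ℝ) * ((i : ℕ) : ℝ) ^ m * ((1 - q ^ (i : ℕ)) / (1 - t ^ (i : ℕ))) ^ m

/-- The bilinear form with `⟨p_lam, p_mu⟩ = z_lam(q,t) δ_{lam,mu}`, extended linearly to symmetric
functions with coefficients in a commutative `ℝ`-algebra `A`. The products `p_lam` are the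
monomials of the polynomial ring. -/
def pairing (q t : ℝ) {A : Type*} [CommRing A] [Algebra ℝ A] (f g : MvPolynomial ℕ+ A) : A :=
  ∑ d ∈ f.support, algebraMap ℝ A (zFactor q t d) * f.coeff d * g.coeff d

/-! ### Macdonald symmetric functions -/

open Classical in
/-- The defining properties of the Macdonald symmetric functions:
`P_lam = m_lam + ∑_{mu < lam} c_{lam,mu} m_mu` (an identity of symmetric functions, that is,
of their projections to any number `k` of variables), and pairwise orthogonality. -/
def IsMacdonaldFamily (q t : ℝ) (P : Ptn → Lam) : Prop :=
  (∀ (n : ℕ) (lam : n.Partition), ∃ c : n.Partition → ℝ, ∀ k : ℕ,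
    reduce k (P ⟨n, lam⟩) = MvPolynomial.msymm (Fin k) ℝ lam +
      ∑ mu : n.Partition with DominatedBy mu lam, c mu • MvPolynomial.msymm (Fin k) ℝ mu) ∧
  ∀ lam mu : Ptn, lam ≠ mu → pairing q t (P lam) (P mu) = 0

/-- The Macdonald symmetric functions `P_lam(q,t)`: the family with the properties above, which
exists and is unique for `0 < q, t < 1`. -/
def macP (q t : ℝ) : Ptn → Lam := Classical.epsilon (IsMacdonaldFamily q t)

/-- The dual Macdonald symmetric functions `Q_lam = P_lam / ⟨P_lam, P_lam⟩`. -/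
def macQ (q t : ℝ) (lam : Ptn) : Lam :=
  (pairing q t (macP q t lam) (macP q t lam))⁻¹ • macP q t lam

/-- `f ↦ f(X, Y)`, the symmetric function `f` in the union of two sets of variables: a polynomial
in the `p_n(Y)` with coefficients in the symmetric functions of `X`. It is determined by
`p_n(X, Y) = p_n(X) + p_n(Y)`. -/
def twoSets : Lam →ₐ[ℝ] MvPolynomial ℕ+ Lam :=
  MvPolynomial.aeval fun n : ℕ+ => MvPolynomial.C (powerSum n) + MvPolynomial.X n

/-- A symmetric function regarded as a function of `Y` only. -/
def onlyY (f : Lam) : MvPolynomial ℕ+ Lam := MvPolynomial.map (algebraMap ℝ Lam) f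

/-- The skew function `P_{lam/mu}(X)`: the coefficient of `P_mu(Y)` in the expansion
`P_lam(X, Y) = ∑_mu P_{lam/mu}(X) P_mu(Y)`, read off by pairing with `Q_mu(Y)`. -/
def skewP (q t : ℝ) (lam mu : Ptn) : Lam :=
  pairing q t (twoSets (macP q t lam)) (onlyY (macQ q t mu))

/-- The skew function `Q_{lam/mu}(X)`: the coefficient of `Q_mu(Y)` in the expansion
`Q_lam(X, Y) = ∑_mu Q_{lam/mu}(X) Q_mu(Y)`, read off by pairing with `P_mu(Y)`. -/
def skewQ (q t : ℝ) (lam mu : Ptn) : Lam :=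
  pairing q t (twoSets (macQ q t lam)) (onlyY (macP q t mu))

/-- `(q,t)`-Macdonald positivity of a specialization. -/
def MacdonaldPositive (q t : ℝ) (rho : Lam →ₐ[ℝ] ℝ) : Prop :=
  ∀ lam : Ptn, 0 ≤ rho (macP q t lam)

/-! ### The observables -/

/-- The specialization `q^lam t^{-ρ+n}`:
`p_r ↦ ∑_{i=1}^{ℓ} (q^{lam_i} t^{-i+n})^r + t^{-r(ℓ-n+1)} / (1 - t^{-r})`. -/
def qtSpec (q t : ℝ) (lam : Ptn) (n : ℤ) : Lam →ₐ[ℝ] ℝ :=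
  MvPolynomial.aeval fun r : ℕ+ =>
    (∑ i ∈ Finset.range lam.length, (q ^ lam.row i * t ^ (-((i : ℤ) + 1) + n)) ^ (r : ℕ)) +
      t ^ (-((r : ℕ) : ℤ) * ((lam.length : ℤ) - n + 1)) / (1 - t ^ (-((r : ℕ) : ℤ)))

/-- The observable `E_r(lam) = e_r(q^lam t^{-ρ+1})`. -/
def obsE (q t : ℝ) (r : ℕ) (lam : Ptn) : ℝ := qtSpec q t lam 1 (elem r)

/-! ### The periodic Macdonald measure -/

/-- The weight `u^{|mu|} Q_{lam/mu}(ρ⁻) P_{lam/mu}(ρ⁺)` with values in a commutative algebra. -/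
def weight (q t : ℝ) {A : Type*} [CommRing A] [Algebra ℝ A] (u : A) (rp rm : Lam →ₐ[ℝ] A)
    (lam mu : Ptn) : A :=
  u ^ mu.size * rm (skewQ q t lam mu) * rp (skewP q t lam mu)

/-- The partition function for numerical parameters. -/
def partitionFunction (q t u : ℝ) (rp rm : Lam →ₐ[ℝ] ℝ) : ℝ :=
  ∑' s : Ptn × Ptn, weight q t u rp rm s.1 s.2

/-- The periodic Macdonald measure for numerical parameters. -/
def measure (q t u : ℝ) (rp rm : Lam →ₐ[ℝ] ℝ) (lam : Ptn) : ℝ :=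
  (∑' mu : Ptn, weight q t u rp rm lam mu) / partitionFunction q t u rp rm

/-- The expectation value for numerical parameters. -/
def expectation (q t u : ℝ) (rp rm : Lam →ₐ[ℝ] ℝ) (f : Ptn → ℝ) : ℝ :=
  ∑' lam : Ptn, f lam * measure q t u rp rm lam

/-! ### Formal series -/

/-- The coefficientwise sum of a family of formal power series in which every
monomial occurs only finitely often. -/
def formalSum {ι σ R : Type*} [CommRing R] (f : ι → MvPowerSeries σ R) : MvPowerSeries σ R :=
  fun d => ∑ᶠ i, MvPowerSeries.coeff d (f i)

/-- The infinite Pochhammer symbol `(a; v)_∞ = ∏_{i ≥ 0} (1 - a v^i)` for power series `a`, `v`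
without constant term. The factors with `i` larger than the total degree of a monomial do not
contribute to its coefficient. -/
def pochhammer {σ R : Type*} [CommRing R] (a v : MvPowerSeries σ R) : MvPowerSeries σ R :=
  fun d => MvPowerSeries.coeff d (∏ i ∈ Finset.range (d.degree + 1), (1 - a * v ^ i))

/-- The inverse of a power series with constant term `1`. -/
def inv1 {σ R : Type*} [CommRing R] (a : MvPowerSeries σ R) : MvPowerSeries σ R :=
  MvPowerSeries.invOfUnit a 1

/-- The exponential of a power series without constant term. -/
def formalExp {σ R : Type*} [CommRing R] [Algebra ℝ R] (a : MvPowerSeries σ R) :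
    MvPowerSeries σ R :=
  PowerSeries.subst a (PowerSeries.exp ℝ)

/-! ### The formal expectation value -/

/-- The ring `ℝ[[x, y, u]]` of formal results. The variables `x = X 0` and `y = X 1` record
the degrees in `ρ⁺` and `ρ⁻`, and `u = X 2` is the parameter `u`. -/
abbrev FormalRing : Type := MvPowerSeries (Fin 3) ℝ

/-- The specialization `p_n ↦ p_n(ρ) c^n`. -/
def scaled (rho : Lam →ₐ[ℝ] ℝ) (c : FormalRing) : Lam →ₐ[ℝ] FormalRing :=
  MvPolynomial.aeval fun n : ℕ+ => rho (powerSum n) • c ^ (n : ℕ)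

/-- The weight as a formal series. -/
def formalWeight (q t : ℝ) (rp rm : Lam →ₐ[ℝ] ℝ) (lam mu : Ptn) : FormalRing :=
  weight q t (MvPowerSeries.X 2) (scaled rp (MvPowerSeries.X 0)) (scaled rm (MvPowerSeries.X 1))
    lam mu

/-- The partition function as a formal series; its constant term is `1`. -/
def formalPartitionFunction (q t : ℝ) (rp rm : Lam →ₐ[ℝ] ℝ) : FormalRing :=
  formalSum fun s : Ptn × Ptn => formalWeight q t rp rm s.1 s.2

/-- The periodic Macdonald measure as a formal series. -/
def formalMeasure (q t : ℝ) (rp rm : Lam →ₐ[ℝ] ℝ) (lam : Ptn) : FormalRing :=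
  inv1 (formalPartitionFunction q t rp rm) *
    formalSum fun mu : Ptn => formalWeight q t rp rm lam mu

/-- The expectation value as a formal series. -/
def formalExpectation (q t : ℝ) (rp rm : Lam →ₐ[ℝ] ℝ) (f : Ptn → ℝ) : FormalRing :=
  formalSum fun lam : Ptn => f lam • formalMeasure q t rp rm lam

/-! ### The integrand -/

/-- Laurent polynomials in `z_1, …, z_r`. -/
abbrev Laurent (r : ℕ) : Type := AddMonoidAlgebra ℝ (Fin r → ℤ)

/-- The Laurent monomial `z_i ^ k`. -/
def zPow {r : ℕ} (i : Fin r) (k : ℤ) : Laurent r :=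
  AddMonoidAlgebra.single (Pi.single i k) 1

/-- The ring of formal integrands: power series in `s = X 0`, `x = X 1`, `y = X 2`, `u = X 3` over
the Laurent polynomials in `z_1, …, z_r`. The variable `s` stands for the `t⁻¹` in the factor
`(z - t⁻¹ w)⁻¹`, which is expanded as a geometric series in it. -/
abbrev Integrand (r : ℕ) : Type := MvPowerSeries (Fin 4) (Laurent r)

/-- The variable `s`. -/
def sVar (r : ℕ) : Integrand r := MvPowerSeries.X 0

/-- The variable `x`. -/
def xVar (r : ℕ) : Integrand r := MvPowerSeries.X 1

/-- The variable `y`. -/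
def yVar (r : ℕ) : Integrand r := MvPowerSeries.X 2

/-- The variable `u`. -/
def uVar (r : ℕ) : Integrand r := MvPowerSeries.X 3

/-- The formal series `(z_i - s z_j)⁻¹ = ∑_{k ≥ 0} z_i⁻¹ (s z_j / z_i)^k`. -/
def cauchy {r : ℕ} (i j : Fin r) : Integrand r :=
  formalSum fun k : ℕ =>
    MvPowerSeries.C (zPow i (-1) * (zPow j 1 * zPow i (-1)) ^ k) * sVar r ^ k

/-- The exponent term `(1 - t^{-n}) / (1 - u^n) * p_n(ρ⁺) / n * z_i^n`, with `p_n(ρ⁺)` weighted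
by `x^n`. -/
def plusTerm {r : ℕ} (t : ℝ) (rp : Lam →ₐ[ℝ] ℝ) (i : Fin r) (n : ℕ+) : Integrand r :=
  ((1 - t⁻¹ ^ (n : ℕ)) * rp (powerSum n) / (n : ℕ)) •
    (inv1 (1 - uVar r ^ (n : ℕ)) * xVar r ^ (n : ℕ) * MvPowerSeries.C (zPow i (n : ℕ)))

/-- The exponent term `(1 - t^n) / (1 - u^n) * p_n(ρ⁻) / n * z_i^{-n}`, with `p_n(ρ⁻)` weighted
by `y^n`. -/
def minusTerm {r : ℕ} (t : ℝ) (rm : Lam →ₐ[ℝ] ℝ) (i : Fin r) (n : ℕ+) : Integrand r :=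
  ((1 - t ^ (n : ℕ)) * rm (powerSum n) / (n : ℕ)) •
    (inv1 (1 - uVar r ^ (n : ℕ)) * yVar r ^ (n : ℕ) * MvPowerSeries.C (zPow i (-(n : ℕ))))

/-- The kernel `K^{ρ⁺,ρ⁻;a}(z_i, z_j)` of an `N`-step process: `rp b` is the specialization
`ρ⁺_b` with `b = 0, …, N-1`, and `rm b` is `ρ⁻_{b+1}`. -/
def processKernel {r : ℕ} (t : ℝ) (N : ℕ) (rp rm : Fin N → Lam →ₐ[ℝ] ℝ) (a : ℕ) (i j : Fin r) :
    Integrand r :=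
  cauchy i j *
    (∏ b : Fin N, formalExp (formalSum fun n : ℕ+ =>
      (if a ≤ (b : ℕ) then uVar r ^ (n : ℕ) else 1) * plusTerm t (rp b) i n)) *
    ∏ b : Fin N, formalExp (formalSum fun n : ℕ+ =>
      -((if (b : ℕ) + 1 < a then uVar r ^ (n : ℕ) else 1) * minusTerm t (rm b) i n))

/-- The kernel `K^{ρ⁺,ρ⁻}(z_i, z_j)` of a periodic Macdonald measure. -/
def kernel {r : ℕ} (t : ℝ) (rp rm : Lam →ₐ[ℝ] ℝ) (i j : Fin r) : Integrand r :=
  cauchy i j * formalExp (formalSum fun n : ℕ+ => plusTerm t rp i n - minusTerm t rm i n)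

/-- `(c u z_j / z_i; u)_∞`. -/
def ratioPoch {r : ℕ} (c : ℝ) (i j : Fin r) : Integrand r :=
  pochhammer (c • (uVar r * MvPowerSeries.C (zPow j 1 * zPow i (-1)))) (uVar r)

/-- The function `Δ_{p₁,p₂;u}(z_1, …, z_r)` of a single group of variables. -/
def deltaPart (r : ℕ) (p₁ p₂ : ℝ) : Integrand r :=
  ∏ i : Fin r, ∏ j : Fin r, ratioPoch 1 i j * ratioPoch (p₁ * p₂) i j *
    inv1 (ratioPoch p₁ i j * ratioPoch p₂ i j)

/-- The value at the point `s₀` of a power series that is the expansion at `0` of a rational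
function `N / D` without pole at `s₀`. It does not depend on the choice of `N` and `D`. -/
def rationalValue (f : PowerSeries ℝ) (s₀ : ℝ) : ℝ :=
  open Classical in
  if h : ∃ w : Polynomial ℝ × Polynomial ℝ,
      w.2.eval s₀ ≠ 0 ∧ (w.2 : PowerSeries ℝ) * f = (w.1 : PowerSeries ℝ) then
    h.choose.1.eval s₀ / h.choose.2.eval s₀
  else 0

/-- The functional `∫ D^r z`: it takes the coefficient of `(z_1 ⋯ z_r)⁻¹`, and then sums the
geometric series in `s = t⁻¹` that it contains as rational functions. -/
def residue {r : ℕ} (t : ℝ) (F : Integrand r) : FormalRing :=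
  fun d => rationalValue
    (PowerSeries.mk fun k => (MvPowerSeries.coeff (Finsupp.cons k d) F).coeff fun _ => -1) t⁻¹

/-- The formal series
`(1 / r!) ∫ D^r z det (K(z_i, z_j))_{1 ≤ i, j ≤ r} Δ_{q,t⁻¹;u}(z_1, …, z_r)`. -/
def firstSeriesIntegral (q t : ℝ) (rp rm : Lam →ₐ[ℝ] ℝ) (r : ℕ) : FormalRing :=
  ((r ! : ℝ)⁻¹) • residue t
    (Matrix.det (Matrix.of fun i j : Fin r => kernel t rp rm i j) * deltaPart r q t⁻¹)

end PeriodicMacdonald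

end

/-!
The proof diagonalizes a family of operators on the ring `Lam` of symmetric functions, a polynomial
ring in the power sums `p_n`, and evaluates a trace over this ring.

**The operators.** Let `E_r` (`opE`) be the operator
`f ↦ (1 / r!) ∫ D^r z det (1 / (z_i - t⁻¹ z_j)) exp (∑ β_n p_n) f(p + γ)`, where
`β_n = (1 - t^{-n}) / n ∑ z_i^n` and `γ_n = -(1 - q^n) ∑ z_i^{-n}`. The functional on Laurent
polynomials that occurs here is `circForm`; the geometric series in `t⁻¹` are rational because the
set of exponents that belongs to a permutation is stable under the shifts by the indicators of its
orbits (`exists_hasRatVal_countSeries`). Three properties of `E_r` are needed.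

* In `k` variables, `E_r` becomes a `q`-difference operator (`aeval_opE`, `det_mul_reduce_opE`).
  The integral against `∏_i A(1 / z_i)` is a sum of principal minors of a Toeplitz matrix
  (`sum_det_submatrix`, `formal_base`), whose characteristic determinant is computed by
  `toeplitz_det`; polarization in `A` (`polarize`) gives all products of power sums. The leading
  terms of the difference operator show that `E_r` is triangular for the dominance order
  (`leading_opE`), and Newton's identities identify its eigenvalues with the observables
  `e_r(q^λ t^{-ρ+1})` (`obsE_eq_eigenvalue`).
* `E_r` is self-adjoint for the Macdonald scalar product (`pairing_opE`): up to inversion of the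
  `z_i`, under which `circForm` is invariant, multiplication by `exp (∑ β_n p_n)` is adjoint to
  translation by `γ`.
* The eigenvalues for all `r` together separate partitions (`eq_of_obsE_eq`).

It follows that the Macdonald symmetric functions exist (`isMacdonaldFamily_macP`), so that the
chosen family `macP` is the intended one, and that they are the eigenfunctions of the `E_r`
(`opE_macP`). They form an orthogonal basis with norms that are positive.

**The trace.** In the sum of `e_r(q^λ t^{-ρ+1}) u^{|μ|} Q_{λ/μ}(ρ⁻) P_{λ/μ}(ρ⁺)` the eigenvalue is
absorbed by `E_r`, and the dual bases `P`, `Q` may be replaced by the monomials in the `p_n` and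
their duals (`formalSum_weight`). The result is the trace of `u^D exp (α ∂) E_r exp (δ p)`, where
`D` is the degree, `α_n = p_n(ρ⁺) x^n`, and `δ_n` is `p_n(ρ⁻) y^n` normalized by the scalar
product. For fixed `z` this is a product of exponentials in `p` and `∂`, and normal ordering
evaluates the trace (`gaussian_trace`). The part of the exponent that does not involve `z` is the
partition function (`formalPartitionFunction_eq`). The terms linear in `β` or `γ` give the
exponentials of the kernel, and the terms `γ β` give the products of Pochhammer symbols, by
`pochhammer_eq_formalExp`. Hence the sum is the partition function times the integral
(`formalSum_obsE_weight_eq`), once `residue_det_cauchy` has shown that `residue` acts on a multiple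
of the Cauchy determinant through `circForm`.

**Convergence.** At a numerical value of `u` the formal sums are evaluated by collecting the
coefficients of the absolutely convergent families (`hasSum_coeff_formalSum`). The product of the
partition function and the integral becomes a Cauchy product of absolutely convergent series, and
one may divide by the partition function because it is positive: for Macdonald positive
specializations its coefficients are nonnegative (`nonnegCoeff_formalPartitionFunction`), its
closed form being a product of Cauchy sums, and its constant term is `1`.
-/

noncomputable section

set_option linter.unusedSectionVars false

namespace PeriodicMacdonald

/-! ### Locally finite families of power series -/

section Formal

variable {ι κ σ R : Type*} [CommRing R]

/-- The coefficients of total degree less than `n` vanish. -/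
def VanishBelow (n : ℕ) (F : MvPowerSeries σ R) : Prop :=
  ∀ d : σ →₀ ℕ, d.degree < n → MvPowerSeries.coeff d F = 0

theorem vanishBelow_zero (F : MvPowerSeries σ R) : VanishBelow 0 F := fun _ h => by omega

theorem VanishBelow.mono {m n : ℕ} {F : MvPowerSeries σ R} (h : VanishBelow n F) (hmn : m ≤ n) :
    VanishBelow m F := fun d hd => h d (by omega)

theorem VanishBelow.add {n : ℕ} {F G : MvPowerSeries σ R} (hF : VanishBelow n F)
    (hG : VanishBelow n G) : VanishBelow n (F + G) := fun d hd => by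
  rw [map_add, hF d hd, hG d hd, add_zero]

theorem VanishBelow.neg {n : ℕ} {F : MvPowerSeries σ R} (hF : VanishBelow n F) :
    VanishBelow n (-F) := fun d hd => by rw [map_neg, hF d hd, neg_zero]

theorem VanishBelow.sum {n : ℕ} {s : Finset ι} {F : ι → MvPowerSeries σ R}
    (h : ∀ i ∈ s, VanishBelow n (F i)) : VanishBelow n (∑ i ∈ s, F i) := fun d hd => by
  rw [map_sum]
  exact Finset.sum_eq_zero fun i hi => h i hi d hd

theorem VanishBelow.mul {m n : ℕ} {F G : MvPowerSeries σ R} (hF : VanishBelow m F)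
    (hG : VanishBelow n G) : VanishBelow (m + n) (F * G) := fun d hd => by
  classical
  rw [MvPowerSeries.coeff_mul]
  refine Finset.sum_eq_zero fun p hp => ?_
  have hp' : p.1.degree + p.2.degree = d.degree := by
    rw [← Finset.HasAntidiagonal.mem_antidiagonal.mp hp, map_add]
  by_cases h : p.1.degree < m
  · rw [hF _ h, zero_mul]
  · rw [hG _ (by omega), mul_zero]

theorem VanishBelow.mul_left {n : ℕ} {F : MvPowerSeries σ R} (hF : VanishBelow n F)
    (G : MvPowerSeries σ R) : VanishBelow n (G * F) := by
  simpa using (vanishBelow_zero G).mul hF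

theorem VanishBelow.mul_right {n : ℕ} {F : MvPowerSeries σ R} (hF : VanishBelow n F)
    (G : MvPowerSeries σ R) : VanishBelow n (F * G) := by
  simpa using hF.mul (vanishBelow_zero G)

theorem VanishBelow.pow {m : ℕ} {F : MvPowerSeries σ R} (hF : VanishBelow m F) (k : ℕ) :
    VanishBelow (m * k) (F ^ k) := by
  induction k with
  | zero => exact vanishBelow_zero _
  | succ k ih => rw [pow_succ, mul_add, mul_one]; exact ih.mul hF

theorem VanishBelow.prod {s : Finset ι} {n : ι → ℕ} {F : ι → MvPowerSeries σ R}
    (h : ∀ i ∈ s, VanishBelow (n i) (F i)) : VanishBelow (∑ i ∈ s, n i) (∏ i ∈ s, F i) := by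
  classical
  induction s using Finset.induction_on with
  | empty => exact vanishBelow_zero _
  | insert a s ha ih =>
    rw [Finset.sum_insert ha, Finset.prod_insert ha]
    exact (h a (Finset.mem_insert_self _ _)).mul
      (ih fun i hi => h i (Finset.mem_insert_of_mem hi))

theorem VanishBelow.smul {S : Type*} [Semiring S] [Module S R] {n : ℕ} {F : MvPowerSeries σ R}
    (hF : VanishBelow n F) (c : S) : VanishBelow n (c • F) := fun d hd => by
  have : MvPowerSeries.coeff d (c • F) = c • MvPowerSeries.coeff d F := rfl
  rw [this, hF d hd, smul_zero]

theorem vanishBelow_X (i : σ) : VanishBelow 1 (MvPowerSeries.X i : MvPowerSeries σ R) :=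
  fun d hd => by
    have : d = 0 := (Finsupp.degree_eq_zero_iff d).mp (by omega)
    rw [this, MvPowerSeries.coeff_zero_X]

theorem vanishBelow_X_pow (i : σ) (n : ℕ) :
    VanishBelow n ((MvPowerSeries.X i : MvPowerSeries σ R) ^ n) := by
  simpa using (vanishBelow_X (R := R) i).pow n

theorem vanishBelow_one_iff {F : MvPowerSeries σ R} :
    VanishBelow 1 F ↔ MvPowerSeries.constantCoeff F = 0 := by
  constructor
  · intro h
    rw [← MvPowerSeries.coeff_zero_eq_constantCoeff_apply]
    exact h 0 (by simp)
  · intro h d hd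
    have : d = 0 := (Finsupp.degree_eq_zero_iff d).mp (by omega)
    rw [this, MvPowerSeries.coeff_zero_eq_constantCoeff_apply, h]

/-- Every monomial occurs in only finitely many members of the family. -/
def LocFin (f : ι → MvPowerSeries σ R) : Prop :=
  ∀ d, (Function.support fun i => MvPowerSeries.coeff d (f i)).Finite

theorem locFin_of_vanishBelow {f : ι → MvPowerSeries σ R} (w : ι → ℕ)
    (hf : ∀ i, VanishBelow (w i) (f i)) (hw : ∀ n, {i | w i ≤ n}.Finite) : LocFin f := by
  intro d
  refine (hw d.degree).subset fun i hi => ?_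
  by_contra h
  exact hi (hf i d (by simpa using h))

theorem LocFin.add {f g : ι → MvPowerSeries σ R} (hf : LocFin f) (hg : LocFin g) :
    LocFin fun i => f i + g i := fun d => by
  refine ((hf d).union (hg d)).subset fun i hi => ?_
  by_contra h
  simp only [Set.mem_union, Function.mem_support, not_or, not_not] at h
  exact hi (by simp [h.1, h.2])

theorem LocFin.neg {f : ι → MvPowerSeries σ R} (hf : LocFin f) : LocFin fun i => -f i := fun d => by
  refine (hf d).subset fun i hi h => ?_
  exact hi (by simpa using h)

theorem LocFin.smul {f : ι → MvPowerSeries σ R} {S : Type*} [Semiring S] [Module S R]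
    (hf : LocFin f) (c : ι → S) : LocFin fun i => c i • f i := fun d => by
  refine (hf d).subset fun i hi h => hi ?_
  change c i • MvPowerSeries.coeff d (f i) = 0
  rw [show MvPowerSeries.coeff d (f i) = 0 from h, smul_zero]

theorem LocFin.comp_injective {f : ι → MvPowerSeries σ R} (hf : LocFin f) {g : κ → ι}
    (hg : Function.Injective g) : LocFin fun k => f (g k) := fun d =>
  (hf d).preimage hg.injOn

theorem coeff_formalSum (f : ι → MvPowerSeries σ R) (d : σ →₀ ℕ) :
    MvPowerSeries.coeff d (formalSum f) = ∑ᶠ i, MvPowerSeries.coeff d (f i) := rfl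

theorem formalSum_congr {f g : ι → MvPowerSeries σ R} (h : ∀ i, f i = g i) :
    formalSum f = formalSum g := by rw [funext h]

theorem VanishBelow.formalSum {n : ℕ} {f : ι → MvPowerSeries σ R}
    (h : ∀ i, VanishBelow n (f i)) : VanishBelow n (formalSum f) := fun d hd => by
  rw [coeff_formalSum]
  exact finsum_eq_zero_of_forall_eq_zero fun i => h i d hd

theorem formalSum_zero : formalSum (fun _ : ι => (0 : MvPowerSeries σ R)) = 0 := by
  ext d
  rw [coeff_formalSum]
  simp

theorem formalSum_add {f g : ι → MvPowerSeries σ R} (hf : LocFin f) (hg : LocFin g) :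
    formalSum (fun i => f i + g i) = formalSum f + formalSum g := by
  ext d
  rw [map_add, coeff_formalSum, coeff_formalSum, coeff_formalSum, ← finsum_add_distrib (hf d) (hg d)]
  simp

theorem formalSum_neg (f : ι → MvPowerSeries σ R) :
    formalSum (fun i => -f i) = -formalSum f := by
  ext d
  rw [map_neg, coeff_formalSum, coeff_formalSum, ← finsum_neg_distrib]
  simp

theorem formalSum_sub {f g : ι → MvPowerSeries σ R} (hf : LocFin f) (hg : LocFin g) :
    formalSum (fun i => f i - g i) = formalSum f - formalSum g := by
  simp only [sub_eq_add_neg]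
  rw [formalSum_add hf hg.neg, formalSum_neg]

theorem formalSum_mul_left {f : ι → MvPowerSeries σ R} (hf : LocFin f) (a : MvPowerSeries σ R) :
    formalSum (fun i => a * f i) = a * formalSum f := by
  classical
  ext d
  rw [coeff_formalSum, MvPowerSeries.coeff_mul]
  simp only [MvPowerSeries.coeff_mul, coeff_formalSum]
  rw [finsum_sum_comm _ _ fun p _ =>
    (hf p.2).subset fun i hi h => hi (by
      change _ * MvPowerSeries.coeff p.2 (f i) = _
      rw [show MvPowerSeries.coeff p.2 (f i) = 0 from h, mul_zero])]
  exact Finset.sum_congr rfl fun p _ => (mul_finsum' _ _ (hf p.2)).symm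

theorem formalSum_mul_right {f : ι → MvPowerSeries σ R} (hf : LocFin f) (a : MvPowerSeries σ R) :
    formalSum (fun i => f i * a) = formalSum f * a := by
  simp only [mul_comm _ a]
  exact formalSum_mul_left hf a

theorem formalSum_smul {S : Type*} [Semiring S] [Module S R] {f : ι → MvPowerSeries σ R}
    (hf : LocFin f) (c : S) : formalSum (fun i => c • f i) = c • formalSum f := by
  ext d
  change _ = c • MvPowerSeries.coeff d (formalSum f)
  rw [coeff_formalSum, coeff_formalSum, smul_finsum' c (hf d)]
  rfl

theorem formalSum_fintype [Fintype ι] (f : ι → MvPowerSeries σ R) :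
    formalSum f = ∑ i, f i := by
  ext d
  rw [coeff_formalSum, finsum_eq_sum_of_fintype, map_sum]

theorem formalSum_prod {f : ι × κ → MvPowerSeries σ R} (hf : LocFin f) :
    formalSum f = formalSum fun i => formalSum fun k => f (i, k) := by
  ext d
  simp only [coeff_formalSum]
  exact finsum_curry (fun p => MvPowerSeries.coeff d (f p)) (hf d)

theorem formalSum_equiv (e : κ ≃ ι) (f : ι → MvPowerSeries σ R) :
    formalSum (fun k => f (e k)) = formalSum f := by
  ext d
  exact finsum_comp_equiv e (f := fun i => MvPowerSeries.coeff d (f i))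

theorem formalSum_comm {f : ι × κ → MvPowerSeries σ R} (hf : LocFin f) :
    (formalSum fun i => formalSum fun k => f (i, k)) =
      formalSum fun k => formalSum fun i => f (i, k) := by
  rw [← formalSum_prod hf, ← formalSum_equiv (Equiv.prodComm κ ι)]
  exact formalSum_prod (hf.comp_injective (Equiv.prodComm κ ι).injective)

theorem formalSum_injective {g : κ → ι} (hg : Function.Injective g) {f : ι → MvPowerSeries σ R}
    (h : ∀ i, i ∉ Set.range g → f i = 0) : formalSum (fun k => f (g k)) = formalSum f := by
  ext d
  rw [coeff_formalSum, coeff_formalSum,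
    ← finsum_mem_range (f := fun i => MvPowerSeries.coeff d (f i)) hg]
  refine finsum_congr fun i => ?_
  by_cases hi : i ∈ Set.range g
  · simp only [hi, finsum_true]
  · simp [h i hi]

theorem LocFin.formalSum {f : ι × κ → MvPowerSeries σ R} (hf : LocFin f) :
    LocFin fun i => formalSum fun k => f (i, k) := fun d => by
  refine ((hf d).image Prod.fst).subset fun i hi => ?_
  by_contra h
  refine hi (finsum_eq_zero_of_forall_eq_zero fun k => ?_)
  by_contra hk
  exact h ⟨(i, k), hk, rfl⟩

/-! ### Formal exponentials and the Euler derivation -/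

/-- The Euler derivation, which multiplies a monomial by its total degree. Formal exponentials are
identified by the differential equation `θ F = θ a * F`. -/
def euler (F : MvPowerSeries σ R) : MvPowerSeries σ R :=
  fun d => (d.degree : R) * MvPowerSeries.coeff d F

theorem coeff_euler (F : MvPowerSeries σ R) (d : σ →₀ ℕ) :
    MvPowerSeries.coeff d (euler F) = (d.degree : R) * MvPowerSeries.coeff d F := rfl

theorem euler_add (F G : MvPowerSeries σ R) : euler (F + G) = euler F + euler G := by
  ext d; simp [coeff_euler, mul_add]

theorem euler_neg (F : MvPowerSeries σ R) : euler (-F) = -euler F := by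
  ext d; simp [coeff_euler]

theorem euler_one : euler (1 : MvPowerSeries σ R) = 0 := by
  classical
  ext d
  rw [coeff_euler, MvPowerSeries.coeff_one]
  split_ifs with h <;> simp [h]

theorem euler_mul (F G : MvPowerSeries σ R) : euler (F * G) = euler F * G + F * euler G := by
  classical
  ext d
  rw [coeff_euler, map_add, MvPowerSeries.coeff_mul, MvPowerSeries.coeff_mul,
    MvPowerSeries.coeff_mul, ← Finset.sum_add_distrib, Finset.mul_sum]
  refine Finset.sum_congr rfl fun p hp => ?_
  rw [← Finset.HasAntidiagonal.mem_antidiagonal.mp hp, map_add, coeff_euler, coeff_euler]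
  push_cast
  ring

theorem euler_pow (F : MvPowerSeries σ R) (n : ℕ) :
    euler (F ^ (n + 1)) = ((n : R) + 1) • (F ^ n * euler F) := by
  induction n with
  | zero => simp
  | succ n ih =>
    rw [pow_succ, euler_mul, ih, MvPowerSeries.smul_eq_C_mul, MvPowerSeries.smul_eq_C_mul]
    simp only [map_add, map_one, Nat.cast_add, Nat.cast_one]
    ring

theorem euler_smul {S : Type*} [CommRing S] [Algebra S R] (c : S) (F : MvPowerSeries σ R) :
    euler (c • F) = c • euler F := by
  ext d
  change (d.degree : R) * (c • MvPowerSeries.coeff d F) = c • ((d.degree : R) * _)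
  rw [mul_smul_comm]

theorem euler_formalSum {f : ι → MvPowerSeries σ R} (hf : LocFin f) :
    euler (formalSum f) = formalSum fun i => euler (f i) := by
  ext d
  rw [coeff_euler, coeff_formalSum, coeff_formalSum, mul_finsum' _ _ (hf d)]
  rfl

theorem VanishBelow.euler {n : ℕ} {F : MvPowerSeries σ R} (h : VanishBelow n F) :
    VanishBelow n (euler F) := fun d hd => by rw [coeff_euler, h d hd, mul_zero]

theorem LocFin.euler {f : ι → MvPowerSeries σ R} (hf : LocFin f) :
    LocFin fun i => euler (f i) := fun d => by
  refine (hf d).subset fun i hi h => hi ?_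
  change (d.degree : R) * MvPowerSeries.coeff d (f i) = 0
  rw [show MvPowerSeries.coeff d (f i) = 0 from h, mul_zero]

variable [Algebra ℝ R]

theorem natCast_mul_eq_zero {n : ℕ} (hn : n ≠ 0) {a : R} (h : (n : R) * a = 0) : a = 0 := by
  have h1 : a = ((n : ℝ)⁻¹ * (n : ℝ)) • a := by
    rw [inv_mul_cancel₀ (Nat.cast_ne_zero.mpr hn), one_smul]
  rw [h1, mul_smul, Algebra.smul_def (n : ℝ) a, map_natCast, h, smul_zero]

/-- A power series is determined by its constant term and its logarithmic Euler derivative. -/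
theorem eq_of_euler_eq {F G A : MvPowerSeries σ R} (hA : VanishBelow 1 A)
    (h0 : MvPowerSeries.constantCoeff F = MvPowerSeries.constantCoeff G)
    (hF : euler F = A * F) (hG : euler G = A * G) : F = G := by
  classical
  have hH : euler (F - G) = A * (F - G) := by
    rw [sub_eq_add_neg, euler_add, euler_neg, hF, hG]; ring
  have key : ∀ n : ℕ, ∀ d : σ →₀ ℕ, d.degree = n → MvPowerSeries.coeff d (F - G) = 0 := by
    intro n
    induction n using Nat.strong_induction_on with
    | _ n ih =>
    intro d hd
    by_cases hn : n = 0
    · have : d = 0 := (Finsupp.degree_eq_zero_iff d).mp (hd.trans hn)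
      rw [this, MvPowerSeries.coeff_zero_eq_constantCoeff_apply, map_sub, h0, sub_self]
    · refine natCast_mul_eq_zero (hd ▸ hn : d.degree ≠ 0) ?_
      rw [← coeff_euler, hH, MvPowerSeries.coeff_mul]
      refine Finset.sum_eq_zero fun p hp => ?_
      have hp' : p.1.degree + p.2.degree = d.degree := by
        rw [← Finset.HasAntidiagonal.mem_antidiagonal.mp hp, map_add]
      by_cases h1 : p.1.degree < 1
      · rw [hA _ h1, zero_mul]
      · rw [ih p.2.degree (by omega) _ rfl, mul_zero]
  rw [← sub_eq_zero]
  ext d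
  simpa using key _ d rfl

theorem formalExp_eq_formalSum {a : MvPowerSeries σ R} (ha : VanishBelow 1 a) :
    formalExp a = formalSum fun n : ℕ => ((n ! : ℝ)⁻¹) • a ^ n := by
  ext d
  rw [formalExp, PowerSeries.coeff_subst
    (PowerSeries.HasSubst.of_constantCoeff_zero (vanishBelow_one_iff.mp ha)), coeff_formalSum]
  refine finsum_congr fun n => ?_
  rw [PowerSeries.coeff_exp]
  rw [show algebraMap ℚ ℝ (1 / (n ! : ℚ)) = ((n ! : ℝ)⁻¹) by simp]
  rfl

theorem locFin_pow {a : MvPowerSeries σ R} (ha : VanishBelow 1 a) (c : ℕ → ℝ) :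
    LocFin fun n : ℕ => c n • a ^ n :=
  locFin_of_vanishBelow id (fun n => by simpa using (ha.pow n).smul (c n))
    fun n => Set.finite_le_nat n

theorem constantCoeff_formalExp {a : MvPowerSeries σ R} (ha : VanishBelow 1 a) :
    MvPowerSeries.constantCoeff (formalExp a) = 1 := by
  rw [formalExp_eq_formalSum ha, ← MvPowerSeries.coeff_zero_eq_constantCoeff_apply,
    coeff_formalSum, finsum_eq_single _ 0]
  · simp
  · intro n hn
    exact ((ha.pow n).smul _) 0 (by simpa using Nat.pos_of_ne_zero hn)

theorem euler_formalExp {a : MvPowerSeries σ R} (ha : VanishBelow 1 a) :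
    euler (formalExp a) = euler a * formalExp a := by
  rw [formalExp_eq_formalSum ha, euler_formalSum (locFin_pow ha _),
    ← formalSum_mul_left (locFin_pow ha _),
    ← formalSum_injective (g := Nat.succ) Nat.succ_injective]
  · refine formalSum_congr fun n => ?_
    rw [euler_smul, euler_pow, mul_smul_comm, mul_comm (euler a)]
    have : ((n : R) + 1) = algebraMap ℝ R ((n : ℝ) + 1) := by simp
    rw [this, algebraMap_smul, smul_smul]
    congr 1
    rw [Nat.factorial_succ]
    have := Nat.factorial_ne_zero n
    push_cast
    field_simp
  · intro n hn
    have : n = 0 := by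
      by_contra h
      exact hn ⟨n - 1, Nat.succ_pred_eq_of_pos (Nat.pos_of_ne_zero h)⟩
    subst this
    rw [pow_zero, euler_smul, euler_one, smul_zero]

theorem eq_formalExp {F a : MvPowerSeries σ R} (ha : VanishBelow 1 a)
    (h0 : MvPowerSeries.constantCoeff F = 1) (hF : euler F = euler a * F) : F = formalExp a :=
  eq_of_euler_eq ha.euler (h0.trans (constantCoeff_formalExp ha).symm) hF (euler_formalExp ha)

theorem formalExp_add {a b : MvPowerSeries σ R} (ha : VanishBelow 1 a) (hb : VanishBelow 1 b) :
    formalExp (a + b) = formalExp a * formalExp b := by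
  symm
  refine eq_formalExp (ha.add hb) ?_ ?_
  · rw [map_mul, constantCoeff_formalExp ha, constantCoeff_formalExp hb, one_mul]
  · rw [euler_mul, euler_formalExp ha, euler_formalExp hb, euler_add]; ring

theorem formalExp_zero : formalExp (0 : MvPowerSeries σ R) = 1 := by
  symm
  refine eq_formalExp (fun d _ => map_zero _) (map_one _) ?_
  rw [euler_one, ← zero_smul R (0 : MvPowerSeries σ R), euler_smul]
  simp

theorem formalExp_sum {s : Finset ι} {a : ι → MvPowerSeries σ R}
    (ha : ∀ i ∈ s, VanishBelow 1 (a i)) :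
    formalExp (∑ i ∈ s, a i) = ∏ i ∈ s, formalExp (a i) := by
  classical
  induction s using Finset.induction_on with
  | empty => simp [formalExp_zero]
  | insert i s hi ih =>
    have h2 : ∀ j ∈ s, VanishBelow 1 (a j) := fun j hj => ha j (Finset.mem_insert_of_mem hj)
    rw [Finset.sum_insert hi, Finset.prod_insert hi, formalExp_add (ha i (Finset.mem_insert_self _ _))
      (VanishBelow.sum h2), ih h2]

end Formal

/-! ### Multi-indices and exponentials in infinitely many variables -/

section MultiIndex

variable {ι : Type*}

/-- The product of the factorials of the entries of a multi-index. -/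
def mfact (j : ι →₀ ℕ) : ℝ := j.prod fun _ m => (m ! : ℝ)

theorem mfact_pos (j : ι →₀ ℕ) : 0 < mfact j :=
  Finset.prod_pos fun _ _ => Nat.cast_pos.mpr (Nat.factorial_pos _)

theorem mfact_ne_zero (j : ι →₀ ℕ) : mfact j ≠ 0 := (mfact_pos j).ne'

@[simp] theorem mfact_zero : mfact (0 : ι →₀ ℕ) = 1 := by simp [mfact]

/-- The effect of increasing one entry of a multi-index on a product over its entries. -/
theorem prod_add_single {A : Type*} [CommMonoid A] (j : ι →₀ ℕ) (n : ι) (f : ι → ℕ → A)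
    (h0 : ∀ i, f i 0 = 1) {c : A} (hc : f n (j n + 1) = c * f n (j n)) :
    (j + Finsupp.single n 1).prod f = c * j.prod f := by
  classical
  rw [← Finsupp.mul_prod_erase' (j + Finsupp.single n 1) n f (fun i => h0 i),
    ← Finsupp.mul_prod_erase' j n f (fun i => h0 i)]
  have : (j + Finsupp.single n 1).erase n = j.erase n := by
    ext i
    by_cases hi : i = n
    · simp [hi]
    · simp [Finsupp.erase_ne hi]
  rw [this, ← mul_assoc]
  simp [hc]

theorem mfact_add_single (j : ι →₀ ℕ) (n : ι) :
    mfact (j + Finsupp.single n 1) = ((j n : ℝ) + 1) * mfact j := by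
  refine prod_add_single j n _ (fun _ => by simp) ?_
  rw [Nat.factorial_succ]
  push_cast
  ring

/-- The monomial `∏ i, g i ^ j i`. -/
def mpow {A : Type*} [CommMonoid A] (g : ι → A) (j : ι →₀ ℕ) : A := j.prod fun i m => g i ^ m

@[simp] theorem mpow_zero {A : Type*} [CommMonoid A] (g : ι → A) : mpow g 0 = 1 := by simp [mpow]

theorem mpow_add {A : Type*} [CommMonoid A] (g : ι → A) (j k : ι →₀ ℕ) :
    mpow g (j + k) = mpow g j * mpow g k := by
  classical
  exact Finsupp.prod_add_index' (by simp) (by simp [pow_add])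

@[simp] theorem mpow_single {A : Type*} [CommMonoid A] (g : ι → A) (n : ι) (m : ℕ) :
    mpow g (Finsupp.single n m) = g n ^ m := by simp [mpow]

theorem mpow_mul {A : Type*} [CommMonoid A] (f g : ι → A) (j : ι →₀ ℕ) :
    mpow (fun i => f i * g i) j = mpow f j * mpow g j := by
  simp only [mpow, mul_pow]
  exact Finsupp.prod_mul

theorem map_mpow {A B F : Type*} [CommMonoid A] [CommMonoid B] [FunLike F A B]
    [MonoidHomClass F A B] (f : F) (g : ι → A) (j : ι →₀ ℕ) :
    f (mpow g j) = mpow (fun i => f (g i)) j := by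
  simp [mpow, Finsupp.prod, map_prod]

/-- The divided power `∏ i, g i ^ j i / (j i)!`. -/
def dpow {A : Type*} [CommRing A] [Algebra ℝ A] (g : ι → A) (j : ι →₀ ℕ) : A :=
  (mfact j)⁻¹ • mpow g j

variable {A : Type*} [CommRing A] [Algebra ℝ A]

@[simp] theorem dpow_zero (g : ι → A) : dpow g 0 = 1 := by simp [dpow]

theorem dpow_add_single (g : ι → A) (j : ι →₀ ℕ) (n : ι) :
    ((j n : ℝ) + 1) • dpow g (j + Finsupp.single n 1) = g n * dpow g j := by
  rw [dpow, dpow, mfact_add_single, mpow_add, mpow_single, pow_one, smul_smul, mul_smul_comm,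
    mul_comm (mpow g j)]
  congr 1
  have : (j n : ℝ) + 1 ≠ 0 := by positivity
  have := mfact_ne_zero j
  field_simp

theorem map_dpow {B : Type*} [CommRing B] [Algebra ℝ B] (f : A →ₐ[ℝ] B) (g : ι → A)
    (j : ι →₀ ℕ) : f (dpow g j) = dpow (fun i => f (g i)) j := by
  rw [dpow, map_smul, map_mpow, dpow]

theorem dpow_mul (f g : ι → A) (j : ι →₀ ℕ) :
    dpow (fun i => f i * g i) j = dpow f j * mpow g j := by
  rw [dpow, dpow, mpow_mul, smul_mul_assoc]

/-- The weight `∑ n, n * j n` of a multi-index. -/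
def wt (j : ℕ+ →₀ ℕ) : ℕ := j.sum fun n m => (n : ℕ) * m

@[simp] theorem wt_zero : wt 0 = 0 := by simp [wt]

theorem wt_add (j k : ℕ+ →₀ ℕ) : wt (j + k) = wt j + wt k := by
  classical
  exact Finsupp.sum_add_index' (by simp) (by simp [mul_add])

@[simp] theorem wt_single (n : ℕ+) (m : ℕ) : wt (Finsupp.single n m) = n * m := by simp [wt]

theorem mul_le_wt (j : ℕ+ →₀ ℕ) (n : ℕ+) : (n : ℕ) * j n ≤ wt j := by
  classical
  by_cases h : j n = 0
  · simp [h]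
  · exact Finset.single_le_sum (f := fun n : ℕ+ => (n : ℕ) * j n) (fun _ _ => Nat.zero_le _)
      (Finsupp.mem_support_iff.mpr h)

theorem le_wt {j : ℕ+ →₀ ℕ} {n : ℕ+} (h : j n ≠ 0) : (n : ℕ) ≤ wt j :=
  (Nat.le_mul_of_pos_right _ (Nat.pos_of_ne_zero h)).trans (mul_le_wt j n)

theorem finite_pnat_le (N : ℕ) : {n : ℕ+ | (n : ℕ) ≤ N}.Finite :=
  (Set.finite_le_nat N).preimage PNat.coe_injective.injOn

theorem finite_wt_le (N : ℕ) : {j : ℕ+ →₀ ℕ | wt j ≤ N}.Finite := by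
  classical
  let J : ℕ+ →₀ ℕ := Finsupp.indicator (finite_pnat_le N).toFinset fun _ _ => N
  refine (Set.finite_Iic J).subset fun j hj n => ?_
  by_cases h : j n = 0
  · simp [h]
  · have h1 : (n : ℕ) ≤ N := (le_wt h).trans hj
    have h2 : j n ≤ N := (Nat.le_mul_of_pos_left _ n.pos).trans ((mul_le_wt j n).trans hj)
    have : J n = N := by
      simp only [J, Finsupp.indicator_apply, Set.Finite.mem_toFinset, Set.mem_ofPred_eq, h1,
        dite_true]
    rw [this]
    exact h2

end MultiIndex

section Exponential

variable {σ R : Type*} [CommRing R] [Algebra ℝ R]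

theorem vanishBelow_dpow {g : ℕ+ → MvPowerSeries σ R} (hg : ∀ n : ℕ+, VanishBelow n (g n))
    (j : ℕ+ →₀ ℕ) : VanishBelow (wt j) (dpow g j) := by
  rw [dpow, mpow, wt]
  exact (VanishBelow.prod fun n _ => (hg n).pow (j n)).smul _

theorem locFin_pnat {g : ℕ+ → MvPowerSeries σ R} (hg : ∀ n : ℕ+, VanishBelow n (g n)) :
    LocFin g := locFin_of_vanishBelow (fun n : ℕ+ => (n : ℕ)) hg finite_pnat_le

theorem locFin_wt {g : (ℕ+ →₀ ℕ) → MvPowerSeries σ R} (hg : ∀ j, VanishBelow (wt j) (g j)) :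
    LocFin g := locFin_of_vanishBelow wt hg finite_wt_le

theorem locFin_dpow {g : ℕ+ → MvPowerSeries σ R} (hg : ∀ n : ℕ+, VanishBelow n (g n)) :
    LocFin (dpow g) := locFin_wt (vanishBelow_dpow hg)

theorem vanishBelow_formalSum_pnat {g : ℕ+ → MvPowerSeries σ R}
    (hg : ∀ n : ℕ+, VanishBelow n (g n)) : VanishBelow 1 (formalSum g) :=
  VanishBelow.formalSum fun n => (hg n).mono n.pos

theorem euler_prod {ι : Type*} [DecidableEq ι] (s : Finset ι) (f : ι → MvPowerSeries σ R) :
    euler (∏ i ∈ s, f i) = ∑ i ∈ s, euler (f i) * ∏ j ∈ s.erase i, f j := by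
  induction s using Finset.induction_on with
  | empty => simp [euler_one]
  | insert a s ha ih =>
    rw [Finset.prod_insert ha, euler_mul, ih, Finset.sum_insert ha, Finset.erase_insert ha,
      Finset.mul_sum]
    congr 1
    refine Finset.sum_congr rfl fun i hi => ?_
    have hia : a ≠ i := fun h => ha (h ▸ hi)
    rw [Finset.erase_insert_of_ne hia, Finset.prod_insert (by simp [ha])]
    ring

theorem euler_dpow (g : ℕ+ → MvPowerSeries σ R) (j : ℕ+ →₀ ℕ) :
    euler (dpow g j) =
      ∑ n ∈ j.support, euler (g n) * dpow g (j - Finsupp.single n 1) := by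
  classical
  rw [dpow, euler_smul, mpow, Finsupp.prod, euler_prod, Finset.smul_sum]
  refine Finset.sum_congr rfl fun n hn => ?_
  obtain ⟨k, rfl⟩ : ∃ k : ℕ+ →₀ ℕ, j = k + Finsupp.single n 1 := by
    refine ⟨j - Finsupp.single n 1, (tsub_add_cancel_of_le ?_).symm⟩
    rw [Finsupp.single_le_iff]
    exact Nat.pos_of_ne_zero (Finsupp.mem_support_iff.mp hn)
  rw [add_tsub_cancel_right]
  have hk : ∏ i ∈ (k + Finsupp.single n 1).support.erase n, g i ^ ((k + Finsupp.single n 1 : ℕ+ →₀ ℕ) i) =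
      ∏ i ∈ k.support.erase n, g i ^ k i := by
    refine Finset.prod_congr ?_ fun i hi => ?_
    · ext i
      by_cases hi : i = n
      · simp [hi]
      · simp [hi]
    · have := Finset.ne_of_mem_erase hi
      simp [this]
  have hm : g n ^ k n * ∏ i ∈ k.support.erase n, g i ^ k i = mpow g k := by
    rw [mpow, ← Finsupp.mul_prod_erase' k n _ (fun _ => pow_zero _), Finsupp.prod,
      Finsupp.support_erase]
    congr 1
    exact Finset.prod_congr rfl fun i hi => by rw [Finsupp.erase_ne (Finset.ne_of_mem_erase hi)]
  rw [hk, Finsupp.add_apply, Finsupp.single_eq_same, euler_pow, mfact_add_single, dpow, ← hm]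
  have e1 : ((k n : R) + 1) = algebraMap ℝ R ((k n : ℝ) + 1) := by simp
  rw [e1, algebraMap_smul, smul_mul_assoc, smul_smul, mul_smul_comm]
  have h1 : (k n : ℝ) + 1 ≠ 0 := by positivity
  have h2 := mfact_ne_zero k
  congr 1
  · field_simp
  · ring

/-- The exponential of `∑ n, g n`, expanded in the multi-indices. -/
def mexp (g : ℕ+ → MvPowerSeries σ R) : MvPowerSeries σ R := formalSum (dpow g)

/-- Both sides have constant term `1` and satisfy the same first-order Euler equation. -/
theorem mexp_eq_formalExp {g : ℕ+ → MvPowerSeries σ R} (hg : ∀ n : ℕ+, VanishBelow n (g n)) :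
    mexp g = formalExp (formalSum g) := by
  classical
  refine eq_formalExp (vanishBelow_formalSum_pnat hg) ?_ ?_
  · rw [mexp, ← MvPowerSeries.coeff_zero_eq_constantCoeff_apply, coeff_formalSum,
      finsum_eq_single _ 0]
    · simp
    · intro j hj
      refine vanishBelow_dpow hg j 0 ?_
      obtain ⟨n, hn⟩ := Finsupp.ne_iff.mp hj
      have := le_wt (n := n) hn
      have := n.pos
      simp only [map_zero]
      omega
  · rw [mexp, euler_formalSum (locFin_dpow hg), euler_formalSum (locFin_pnat hg),
      ← formalSum_mul_right (locFin_pnat hg).euler]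
    have hr : LocFin fun p : ℕ+ × (ℕ+ →₀ ℕ) => euler (g p.1) * dpow g p.2 := by
      refine locFin_of_vanishBelow (fun p => (p.1 : ℕ) + wt p.2)
        (fun p => (hg p.1).euler.mul (vanishBelow_dpow hg p.2)) fun N => ?_
      refine ((finite_pnat_le N).prod (finite_wt_le N)).subset fun p hp => ?_
      simp only [Set.mem_ofPred_eq] at hp
      exact ⟨by simp only [Set.mem_ofPred_eq]; omega, by simp only [Set.mem_ofPred_eq]; omega⟩
    have hr' : (formalSum fun n => euler (g n) * formalSum (dpow g)) =
        formalSum fun p : ℕ+ × (ℕ+ →₀ ℕ) => euler (g p.1) * dpow g p.2 := by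
      rw [formalSum_prod hr]
      exact formalSum_congr fun n => (formalSum_mul_left (locFin_dpow hg) _).symm
    rw [hr']
    let f : (ℕ+ →₀ ℕ) × ℕ+ → MvPowerSeries σ R := fun p =>
      if p.1 p.2 = 0 then 0 else euler (g p.2) * dpow g (p.1 - Finsupp.single p.2 1)
    have hf : LocFin f := by
      refine locFin_of_vanishBelow (fun p => max (wt p.1) p.2) (fun p => ?_) fun N => ?_
      · by_cases h : p.1 p.2 = 0
        · simp only [f, h, if_true]; exact fun _ _ => map_zero _
        · simp only [f, h, if_false]
          have h1 : p.1 - Finsupp.single p.2 1 + Finsupp.single p.2 1 = p.1 :=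
            tsub_add_cancel_of_le (by
              rw [Finsupp.single_le_iff]; exact Nat.pos_of_ne_zero h)
          have h2 := congrArg wt h1
          rw [wt_add, wt_single, mul_one] at h2
          refine ((hg p.2).euler.mul (vanishBelow_dpow hg _)).mono ?_
          have := le_wt h
          omega
      · refine ((finite_wt_le N).prod (finite_pnat_le N)).subset fun p hp => ?_
        simp only [Set.mem_ofPred_eq, max_le_iff] at hp
        exact ⟨hp.1, hp.2⟩
    have h1 : (formalSum fun j => euler (dpow g j)) = formalSum f := by
      rw [formalSum_prod hf]
      refine formalSum_congr fun j => ?_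
      rw [euler_dpow]
      ext d
      rw [coeff_formalSum, map_sum, finsum_eq_sum_of_support_subset (s := j.support)]
      · refine Finset.sum_congr rfl fun n hn => ?_
        simp only [f, Finsupp.mem_support_iff.mp hn, if_false]
      · intro n hn
        by_contra h
        refine hn ?_
        simp only [Finset.mem_coe, Finsupp.mem_support_iff, not_not] at h
        simp [f, h]
    rw [h1, ← formalSum_injective
      (g := fun p : ℕ+ × (ℕ+ →₀ ℕ) => (p.2 + Finsupp.single p.1 1, p.1))]
    · refine formalSum_congr fun p => ?_
      simp [f]
    · intro p p' h
      simp only [Prod.mk.injEq] at h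
      obtain ⟨h1, h2⟩ := h
      rw [h2] at h1
      exact Prod.ext h2 (add_right_cancel h1)
    · intro p hp
      simp only [f]
      split_ifs with h
      · rfl
      · exact absurd ⟨(p.2, p.1 - Finsupp.single p.2 1), Prod.ext (tsub_add_cancel_of_le (by
          rw [Finsupp.single_le_iff]; exact Nat.pos_of_ne_zero h)) rfl⟩ hp

theorem mexp_add {f g : ℕ+ → MvPowerSeries σ R} (hf : ∀ n : ℕ+, VanishBelow n (f n))
    (hg : ∀ n : ℕ+, VanishBelow n (g n)) : mexp (fun n => f n + g n) = mexp f * mexp g := by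
  rw [mexp_eq_formalExp fun n => (hf n).add (hg n), mexp_eq_formalExp hf, mexp_eq_formalExp hg,
    formalSum_add (locFin_pnat hf) (locFin_pnat hg),
    formalExp_add (vanishBelow_formalSum_pnat hf) (vanishBelow_formalSum_pnat hg)]

end Exponential

/-! ### The trace of an exponential of creation and annihilation operators -/

section Shift

variable {ι : Type*}

theorem multiIndex_induction {p : (ι →₀ ℕ) → Prop} (h0 : p 0)
    (h : ∀ j n, p j → p (j + Finsupp.single n 1)) (j : ι →₀ ℕ) : p j := by
  classical
  have key : ∀ j k : ι →₀ ℕ, p k → p (k + j) := by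
    intro j
    induction j using Finsupp.induction_linear with
    | zero => intro k hk; simpa using hk
    | add f g hf hg => intro k hk; rw [← add_assoc]; exact hg _ (hf _ hk)
    | single n m =>
      induction m with
      | zero => intro k hk; simpa using hk
      | succ m ih =>
        intro k hk
        rw [Finsupp.single_add, ← add_assoc]
        exact h _ _ (ih k hk)
  simpa using key j 0 h0

theorem exists_add_single {d : ι →₀ ℕ} {n : ι} (h : d n ≠ 0) :
    ∃ k : ι →₀ ℕ, d = k + Finsupp.single n 1 :=
  ⟨d - Finsupp.single n 1, (tsub_add_cancel_of_le (by
    rw [Finsupp.single_le_iff]; exact Nat.pos_of_ne_zero h)).symm⟩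

variable {A : Type*} [CommRing A] [Algebra ℝ A]

theorem coeff_add_single_X_mul (n : ι) (d : ι →₀ ℕ) (G : MvPowerSeries ι A) :
    MvPowerSeries.coeff (d + Finsupp.single n 1) (MvPowerSeries.X n * G) =
      MvPowerSeries.coeff d G := by
  rw [add_comm, MvPowerSeries.X_def, MvPowerSeries.coeff_add_monomial_mul, one_mul]

theorem coeff_X_mul_of_eq_zero {n : ι} {d : ι →₀ ℕ} (h : d n = 0) (G : MvPowerSeries ι A) :
    MvPowerSeries.coeff d (MvPowerSeries.X n * G) = 0 := by
  classical
  rw [MvPowerSeries.X_def, MvPowerSeries.coeff_monomial_mul, if_neg]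
  rw [Finsupp.single_le_iff, h]
  omega

/-- The product `∏ n, (X n + c n) ^ e n`: the image of a monomial under a translation. -/
def shiftPow (c : ι → A) (e : ι →₀ ℕ) : MvPowerSeries ι A :=
  mpow (fun n => MvPowerSeries.X n + MvPowerSeries.C (c n)) e

theorem shiftPow_zero (c : ι → A) : shiftPow c 0 = 1 := by simp [shiftPow]

theorem shiftPow_add (c : ι → A) (e f : ι →₀ ℕ) :
    shiftPow c (e + f) = shiftPow c e * shiftPow c f := mpow_add _ _ _

theorem shiftPow_add_single (c : ι → A) (e : ι →₀ ℕ) (n : ι) :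
    shiftPow c (e + Finsupp.single n 1) =
      (MvPowerSeries.X n + MvPowerSeries.C (c n)) * shiftPow c e := by
  rw [shiftPow_add, mul_comm]
  simp [shiftPow]

/-- The binomial theorem for multi-indices. -/
theorem coeff_shiftPow [DecidableLE (ι →₀ ℕ)] (c : ι → A) (e d : ι →₀ ℕ) :
    MvPowerSeries.coeff d (shiftPow c e) =
      if d ≤ e then (mfact e / mfact d) • dpow c (e - d) else 0 := by
  classical
  induction e using multiIndex_induction generalizing d with
  | h0 =>
    rw [shiftPow_zero, MvPowerSeries.coeff_one]
    by_cases h : d = 0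
    · simp [h]
    · rw [if_neg h, if_neg]
      simpa using h
  | h e n ih =>
    rw [shiftPow_add_single, add_mul, map_add, MvPowerSeries.coeff_C_mul, ih d]
    have hd1 : mfact d ≠ 0 := mfact_ne_zero d
    by_cases hd : d ≤ e
    · obtain ⟨h, rfl⟩ := exists_add_of_le hd
      have h1 : d + h + Finsupp.single n 1 - d = h + Finsupp.single n 1 := by
        rw [add_assoc, add_tsub_cancel_left]
      rw [if_pos hd, if_pos (hd.trans le_self_add), h1, add_tsub_cancel_left, mul_smul_comm,
        ← dpow_add_single, mfact_add_single]
      by_cases h0 : d n = 0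
      · rw [coeff_X_mul_of_eq_zero h0, zero_add, smul_smul]
        congr 1
        simp only [Finsupp.add_apply, h0]
        push_cast
        ring
      · obtain ⟨k, rfl⟩ := exists_add_single h0
        have h2 : k + Finsupp.single n 1 + h - k = h + Finsupp.single n 1 := by
          rw [add_assoc, add_tsub_cancel_left, add_comm]
        rw [coeff_add_single_X_mul, ih, if_pos (le_self_add.trans hd), h2, smul_smul, ← add_smul]
        congr 1
        rw [mfact_add_single] at hd1 ⊢
        have hk := mfact_ne_zero k
        have hk1 : (k n : ℝ) + 1 ≠ 0 := by positivity
        simp only [Finsupp.add_apply, Finsupp.single_eq_same]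
        push_cast
        field_simp
        ring
    · rw [if_neg hd, mul_zero, add_zero]
      by_cases h0 : d n = 0
      · rw [coeff_X_mul_of_eq_zero h0, if_neg]
        intro hle
        refine hd fun i => ?_
        by_cases hi : i = n
        · subst hi; omega
        · simpa [Finsupp.single_apply, Ne.symm hi] using hle i
      · obtain ⟨k, rfl⟩ := exists_add_single h0
        rw [coeff_add_single_X_mul, ih]
        by_cases hk : k ≤ e
        · obtain ⟨h, rfl⟩ := exists_add_of_le hk
          have hn : h n = 0 := by
            by_contra hn
            obtain ⟨l, rfl⟩ := exists_add_single hn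
            exact hd fun i => by simp only [Finsupp.add_apply]; omega
          rw [if_pos hk, if_pos (add_le_add_left hk _), add_tsub_add_eq_tsub_right]
          congr 1
          rw [mfact_add_single, mfact_add_single]
          have := mfact_ne_zero k
          have hk1 : (k n : ℝ) + 1 ≠ 0 := by positivity
          simp only [Finsupp.add_apply, hn]
          push_cast
          field_simp
          ring
        · rw [if_neg hk, if_neg]
          intro hle
          exact hk (le_of_add_le_add_right hle)

theorem coeff_shiftPow_add (c : ι → A) (d h : ι →₀ ℕ) :
    MvPowerSeries.coeff d (shiftPow c (d + h)) = (mfact (d + h) / mfact d) • dpow c h := by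
  classical
  rw [coeff_shiftPow, if_pos le_self_add, add_tsub_cancel_left]

theorem coeff_shiftPow_of_not_le {c : ι → A} {e d : ι →₀ ℕ} (h : ¬ d ≤ e) :
    MvPowerSeries.coeff d (shiftPow c e) = 0 := by
  classical
  rw [coeff_shiftPow, if_neg h]

/-- The exponential `exp (∑ n, c n * X n)`. -/
def expLin (c : ι → A) : MvPowerSeries ι A := fun d => dpow c d

theorem coeff_expLin (c : ι → A) (d : ι →₀ ℕ) :
    MvPowerSeries.coeff d (expLin c) = dpow c d := rfl

theorem pderiv_expLin (c : ι → A) (n : ι) :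
    MvPowerSeries.pderiv A n (expLin c) = MvPowerSeries.C (c n) * expLin c := by
  ext d
  rw [MvPowerSeries.coeff_pderiv, MvPowerSeries.coeff_C_mul, coeff_expLin, coeff_expLin,
    ← dpow_add_single, Algebra.smul_def]
  simp [mul_comm]

/-- The exponential is characterized by its partial derivatives and its constant term. -/
theorem eq_expLin {F : MvPowerSeries ι A} {c : ι → A} (h0 : MvPowerSeries.coeff 0 F = 1)
    (h : ∀ n, MvPowerSeries.pderiv A n F = MvPowerSeries.C (c n) * F) : F = expLin c := by
  ext d
  induction d using multiIndex_induction with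
  | h0 => rw [h0, coeff_expLin, dpow_zero]
  | h j n ih =>
    have h1 := congrArg (MvPowerSeries.coeff j) (h n)
    rw [MvPowerSeries.coeff_pderiv, MvPowerSeries.coeff_C_mul, ih, coeff_expLin,
      ← dpow_add_single] at h1
    rw [coeff_expLin]
    have h2 : ((j n : ℝ) + 1) • MvPowerSeries.coeff (j + Finsupp.single n 1) F =
        ((j n : ℝ) + 1) • dpow c (j + Finsupp.single n 1) := by
      rw [← h1, Algebra.smul_def]
      simp [mul_comm]
    have h3 : (j n : ℝ) + 1 ≠ 0 := by positivity
    rw [← inv_smul_smul₀ h3 (MvPowerSeries.coeff _ F), h2, inv_smul_smul₀ h3]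

theorem expLin_add (b c : ι → A) :
    expLin (fun n => b n + c n) = expLin b * expLin c := by
  classical
  symm
  refine eq_expLin ?_ fun n => ?_
  · rw [MvPowerSeries.coeff_mul]
    simp [coeff_expLin]
  · rw [Derivation.leibniz, pderiv_expLin, pderiv_expLin, map_add, smul_eq_mul, smul_eq_mul]
    ring

end Shift

section Antidiagonal

variable {ι σ R : Type*} [CommRing R]

theorem formalSum_antidiagonal [DecidableEq ι] {f : (ι →₀ ℕ) × (ι →₀ ℕ) → MvPowerSeries σ R}
    (hf : LocFin f) :
    formalSum f = formalSum fun d => ∑ p ∈ Finset.HasAntidiagonal.antidiagonal d, f p := by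
  classical
  let F : (ι →₀ ℕ) × ((ι →₀ ℕ) × (ι →₀ ℕ)) → MvPowerSeries σ R := fun q =>
    if q.2.1 + q.2.2 = q.1 then f q.2 else 0
  have hF : LocFin F := by
    intro d
    refine ((hf d).image fun p => (p.1 + p.2, p)).subset fun q hq => ?_
    by_cases h : q.2.1 + q.2.2 = q.1
    · refine ⟨q.2, ?_, Prod.ext h rfl⟩
      have : F q = f q.2 := if_pos h
      simpa only [Function.mem_support, this] using hq
    · refine absurd ?_ hq
      simp [F, h]
  have h1 : formalSum f = formalSum fun p => formalSum fun d => F (d, p) := by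
    refine formalSum_congr fun p => ?_
    ext e
    rw [coeff_formalSum, finsum_eq_single _ (p.1 + p.2)]
    · simp [F]
    · intro d hd
      simp [F, Ne.symm hd]
  rw [h1, ← formalSum_comm hF]
  refine formalSum_congr fun d => ?_
  ext e
  rw [coeff_formalSum, map_sum,
    finsum_eq_sum_of_support_subset (s := Finset.HasAntidiagonal.antidiagonal d)]
  · refine Finset.sum_congr rfl fun p hp => ?_
    simp [F, Finset.HasAntidiagonal.mem_antidiagonal.mp hp]
  · intro p hp
    rw [Finset.mem_coe, Finset.HasAntidiagonal.mem_antidiagonal]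
    by_contra h
    exact hp (by simp [F, h])

end Antidiagonal

section Trace

variable {σ R : Type*} [CommRing R] [Algebra ℝ R]

theorem VanishBelow.mul_dpow {a : ℕ+ → MvPowerSeries σ R} (ha : ∀ n : ℕ+, VanishBelow n (a n))
    (j : ℕ+ →₀ ℕ) (F : MvPowerSeries σ R) : VanishBelow (wt j) (dpow a j * F) :=
  (vanishBelow_dpow ha j).mul_right F

/-- The coefficients of the translate `G (X + a)`, where `a n` is divisible by monomials of degree
at least `n`. -/
def translate (a : ℕ+ → MvPowerSeries σ R) (G : MvPowerSeries ℕ+ (MvPowerSeries σ R)) :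
    MvPowerSeries ℕ+ (MvPowerSeries σ R) :=
  fun d => formalSum fun h : ℕ+ →₀ ℕ =>
    (mfact (d + h) / mfact d) • (dpow a h * MvPowerSeries.coeff (d + h) G)

variable {a : ℕ+ → MvPowerSeries σ R} (ha : ∀ n : ℕ+, VanishBelow n (a n))

theorem coeff_translate (a : ℕ+ → MvPowerSeries σ R)
    (G : MvPowerSeries ℕ+ (MvPowerSeries σ R)) (d : ℕ+ →₀ ℕ) :
    MvPowerSeries.coeff d (translate a G) = formalSum fun h : ℕ+ →₀ ℕ =>
      (mfact (d + h) / mfact d) • (dpow a h * MvPowerSeries.coeff (d + h) G) := rfl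

include ha in
theorem locFin_translate (c : (ℕ+ →₀ ℕ) → ℝ) (G : (ℕ+ →₀ ℕ) → MvPowerSeries σ R) :
    LocFin fun h : ℕ+ →₀ ℕ => c h • (dpow a h * G h) :=
  locFin_wt fun h => (VanishBelow.mul_dpow ha h _).smul _

include ha in
/-- Translation is compatible with the multiplication by a variable. With additivity this makes it
multiplicative against polynomials. -/
theorem translate_X_mul (n : ℕ+) (G : MvPowerSeries ℕ+ (MvPowerSeries σ R)) :
    translate a (MvPowerSeries.X n * G) =
      (MvPowerSeries.X n + MvPowerSeries.C (a n)) * translate a G := by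
  classical
  ext1 d
  rw [add_mul, map_add, MvPowerSeries.coeff_C_mul, coeff_translate, coeff_translate,
    ← formalSum_mul_left (locFin_translate ha _ _)]
  -- the terms in which the variable `X n` is contracted with the translation
  have h2 : (formalSum fun h : ℕ+ →₀ ℕ => a n * ((mfact (d + h) / mfact d) •
        (dpow a h * MvPowerSeries.coeff (d + h) G))) =
      formalSum fun h : ℕ+ →₀ ℕ => ((h n : ℝ) * mfact (d + h) / (((d + h) n : ℕ) * mfact d)) •
        (dpow a h * MvPowerSeries.coeff (d + h) (MvPowerSeries.X n * G)) := by
    refine Eq.trans (formalSum_congr fun h => ?_) (formalSum_injective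
      (g := fun h : ℕ+ →₀ ℕ => h + Finsupp.single n 1) (add_left_injective _) ?_)
    · rw [← add_assoc, coeff_add_single_X_mul, mul_smul_comm, ← mul_assoc, ← dpow_add_single,
        smul_mul_assoc, smul_smul, mfact_add_single]
      congr 1
      have := mfact_ne_zero d
      have h1 : ((d n : ℝ) + h n) + 1 ≠ 0 := by positivity
      simp only [Finsupp.add_apply, Finsupp.single_eq_same]
      push_cast
      field_simp
    · intro h hh
      by_cases h0 : h n = 0
      · simp [h0]
      · obtain ⟨k, rfl⟩ := exists_add_single h0
        exact absurd ⟨k, rfl⟩ hh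
  have h1 : MvPowerSeries.coeff d (MvPowerSeries.X n * translate a G) =
      formalSum fun h : ℕ+ →₀ ℕ => ((d n : ℝ) * mfact (d + h) / (((d + h) n : ℕ) * mfact d)) •
        (dpow a h * MvPowerSeries.coeff (d + h) (MvPowerSeries.X n * G)) := by
    by_cases h0 : d n = 0
    · rw [coeff_X_mul_of_eq_zero h0]
      simp [h0, formalSum_zero]
    · obtain ⟨k, rfl⟩ := exists_add_single h0
      rw [coeff_add_single_X_mul, coeff_translate]
      refine formalSum_congr fun h => ?_
      rw [add_right_comm, coeff_add_single_X_mul, mfact_add_single, mfact_add_single]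
      congr 1
      have := mfact_ne_zero k
      have h1 : ((k n : ℝ) + h n) + 1 ≠ 0 := by positivity
      have h2 : (k n : ℝ) + 1 ≠ 0 := by positivity
      simp only [Finsupp.add_apply, Finsupp.single_eq_same]
      push_cast
      field_simp
  rw [h1, h2, ← formalSum_add (locFin_translate ha _ _) (locFin_translate ha _ _)]
  refine formalSum_congr fun h => ?_
  rw [← add_smul]
  by_cases h0 : (d + h) n = 0
  · rw [coeff_X_mul_of_eq_zero h0, mul_zero, smul_zero, smul_zero]
  · congr 1
    have h3 : (((d + h) n : ℕ) : ℝ) ≠ 0 := Nat.cast_ne_zero.mpr h0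
    have := mfact_ne_zero d
    have h4 : (((d + h) n : ℕ) : ℝ) = d n + h n := by simp
    rw [h4] at h3 ⊢
    field_simp

include ha in
theorem translate_C_mul (c : MvPowerSeries σ R) (G : MvPowerSeries ℕ+ (MvPowerSeries σ R)) :
    translate a (MvPowerSeries.C c * G) = MvPowerSeries.C c * translate a G := by
  ext1 d
  rw [MvPowerSeries.coeff_C_mul, coeff_translate, coeff_translate,
    ← formalSum_mul_left (locFin_translate ha _ _)]
  refine formalSum_congr fun h => ?_
  rw [MvPowerSeries.coeff_C_mul, mul_smul_comm]
  congr 1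
  ring

include ha in
theorem translate_add (F G : MvPowerSeries ℕ+ (MvPowerSeries σ R)) :
    translate a (F + G) = translate a F + translate a G := by
  ext1 d
  rw [map_add, coeff_translate, coeff_translate, coeff_translate,
    ← formalSum_add (locFin_translate ha _ _) (locFin_translate ha _ _)]
  refine formalSum_congr fun h => ?_
  rw [map_add, mul_add, smul_add]

include ha in
theorem translate_shiftPow_mul (c : ℕ+ → MvPowerSeries σ R) (e : ℕ+ →₀ ℕ)
    (G : MvPowerSeries ℕ+ (MvPowerSeries σ R)) :
    translate a (shiftPow c e * G) = shiftPow (fun n => c n + a n) e * translate a G := by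
  induction e using multiIndex_induction with
  | h0 => rw [shiftPow_zero, shiftPow_zero, one_mul, one_mul]
  | h e n ih =>
    rw [shiftPow_add_single, shiftPow_add_single, mul_assoc, add_mul, translate_add ha,
      translate_X_mul ha, translate_C_mul ha, ih, map_add]
    ring

include ha in
theorem vanishBelow_mul_left (b : ℕ+ → MvPowerSeries σ R) (n : ℕ+) :
    VanishBelow n (a n * b n) := (ha n).mul_right _

include ha in
theorem translate_expLin (b : ℕ+ → MvPowerSeries σ R) :
    translate a (expLin b) = MvPowerSeries.C (mexp fun n => a n * b n) * expLin b := by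
  ext1 d
  rw [MvPowerSeries.coeff_C_mul, coeff_translate, coeff_expLin, mexp,
    ← formalSum_mul_right (locFin_dpow (vanishBelow_mul_left ha b))]
  refine formalSum_congr fun h => ?_
  rw [coeff_expLin, dpow_mul, dpow, dpow, dpow, mpow_add, mul_smul_comm, smul_smul,
    mul_smul_comm]
  have := mfact_ne_zero d
  have := mfact_ne_zero (d + h)
  congr 1
  · field_simp
  · ring

/-- `∑ h, δ ^ h / h! * (X + c) ^ h = exp (δ (X + c))`, read off in one coefficient. -/
theorem formalSum_dpow_mul_shiftPow {d : ℕ+ → MvPowerSeries σ R}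
    (hd : ∀ n : ℕ+, VanishBelow n (d n)) (c : ℕ+ → MvPowerSeries σ R) (b : ℕ+ →₀ ℕ) :
    (formalSum fun h => dpow d h * MvPowerSeries.coeff b (shiftPow c h)) =
      dpow d b * mexp fun n => d n * c n := by
  rw [mexp, ← formalSum_mul_left (locFin_dpow (vanishBelow_mul_left hd c)),
    ← formalSum_injective (g := fun h : ℕ+ →₀ ℕ => b + h) (add_right_injective _)]
  · refine formalSum_congr fun h => ?_
    rw [coeff_shiftPow_add, dpow_mul, dpow, dpow, dpow, dpow, mpow_add]
    simp only [smul_mul_assoc, mul_smul_comm, smul_smul]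
    have := mfact_ne_zero b
    have := mfact_ne_zero (b + h)
    congr 1
    · field_simp
    · ring
  · intro h hh
    rw [coeff_shiftPow_of_not_le, mul_zero]
    intro hle
    exact hh ⟨h - b, add_tsub_cancel_of_le hle⟩

/-- Normal ordering: the operator `exp (δ X)` is moved to the left of the translations. -/
theorem formalSum_translate {δ : ℕ+ → MvPowerSeries σ R} (hδ : ∀ n : ℕ+, VanishBelow n (δ n))
    (ha : ∀ n : ℕ+, VanishBelow n (a n)) (b c : ℕ+ → MvPowerSeries σ R) (d : ℕ+ →₀ ℕ) :
    (formalSum fun h => dpow δ h *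
        MvPowerSeries.coeff d (translate a (shiftPow c (d + h) * expLin b))) =
      (mexp fun n => a n * b n) * (mexp fun n => δ n * (c n + a n)) *
        MvPowerSeries.coeff d (expLin (fun n => b n + δ n) * shiftPow (fun n => c n + a n) d) := by
  classical
  set ε : ℕ+ → MvPowerSeries σ R := fun n => c n + a n with hε
  have h1 : ∀ h, MvPowerSeries.coeff d (translate a (shiftPow c (d + h) * expLin b)) =
      (mexp fun n => a n * b n) * MvPowerSeries.coeff d
        (shiftPow ε d * expLin b * shiftPow ε h) := by
    intro h
    rw [translate_shiftPow_mul ha, translate_expLin ha, ← MvPowerSeries.coeff_C_mul, shiftPow_add]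
    congr 1
    ring
  have hl : LocFin fun h => dpow δ h * MvPowerSeries.coeff d
      (shiftPow ε d * expLin b * shiftPow ε h) := locFin_wt fun h => VanishBelow.mul_dpow hδ h _
  have h2 : (formalSum fun h => dpow δ h * MvPowerSeries.coeff d
      (shiftPow ε d * expLin b * shiftPow ε h)) =
      (mexp fun n => δ n * ε n) * MvPowerSeries.coeff d
        (shiftPow ε d * expLin b * expLin δ) := by
    have h0 : ∀ G, MvPowerSeries.coeff d (shiftPow ε d * expLin b * G) =
        ∑ p ∈ Finset.HasAntidiagonal.antidiagonal d,
          MvPowerSeries.coeff p.1 (shiftPow ε d * expLin b) * MvPowerSeries.coeff p.2 G :=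
      fun G => MvPowerSeries.coeff_mul _ _ _
    simp only [h0, Finset.mul_sum]
    ext q
    rw [coeff_formalSum]
    simp only [map_sum]
    rw [finsum_sum_comm]
    · refine Finset.sum_congr rfl fun p _ => ?_
      have h3 := formalSum_dpow_mul_shiftPow hδ ε p.2
      have h4 : LocFin fun h => dpow δ h * MvPowerSeries.coeff p.2 (shiftPow ε h) :=
        locFin_wt fun h => VanishBelow.mul_dpow hδ h _
      have h5 := formalSum_mul_left h4 (MvPowerSeries.coeff p.1 (shiftPow ε d * expLin b))
      rw [h3] at h5
      have h6 := congrArg (MvPowerSeries.coeff q) h5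
      rw [coeff_formalSum] at h6
      rw [coeff_expLin]
      refine Eq.trans (finsum_congr fun h => ?_) (h6.trans ?_)
      · congr 1; ring
      · congr 1; ring
    · intro p _
      exact (locFin_wt (g := fun h => dpow δ h * _) fun h => VanishBelow.mul_dpow hδ h _) q
  calc _ = formalSum fun h => (mexp fun n => a n * b n) * (dpow δ h * MvPowerSeries.coeff d
        (shiftPow ε d * expLin b * shiftPow ε h)) := formalSum_congr fun h => by rw [h1]; ring
    _ = _ := by
      rw [formalSum_mul_left hl, h2, mul_assoc (shiftPow ε d), ← expLin_add,
        mul_comm (shiftPow ε d), ← mul_assoc]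

/-- The series `∑ d, w ^ d`. -/
def geomZ (w : ℕ+ → MvPowerSeries σ R) : MvPowerSeries σ R := formalSum (mpow w)

theorem vanishBelow_mpow {w : ℕ+ → MvPowerSeries σ R} (hw : ∀ n : ℕ+, VanishBelow n (w n))
    (j : ℕ+ →₀ ℕ) : VanishBelow (wt j) (mpow w j) := by
  rw [mpow, wt]
  exact VanishBelow.prod fun n _ => (hw n).pow (j n)

theorem inv1_mul {F : MvPowerSeries σ R} (h : VanishBelow 1 F) :
    inv1 (1 - F) * (1 - F) = 1 :=
  MvPowerSeries.invOfUnit_mul _ _ (by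
    rw [map_sub, vanishBelow_one_iff.mp h, map_one, sub_zero, Units.val_one])

theorem vanishBelow_pnat_one {w : ℕ+ → MvPowerSeries σ R} (hw : ∀ n : ℕ+, VanishBelow n (w n))
    (n : ℕ+) : VanishBelow 1 (w n) := (hw n).mono n.pos

/-- `∑ i, binom (i + j) j * w ^ i = (∑ i, w ^ i) * ∏ n, (1 - w n) ^ (-j n)`. -/
theorem formalSum_choose {w : ℕ+ → MvPowerSeries σ R} (hw : ∀ n : ℕ+, VanishBelow n (w n))
    (j : ℕ+ →₀ ℕ) :
    (formalSum fun i => (mfact (i + j) / (mfact i * mfact j)) • mpow w i) =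
      geomZ w * mpow (fun n => inv1 (1 - w n)) j := by
  induction j using multiIndex_induction with
  | h0 =>
    rw [mpow_zero, mul_one, geomZ]
    refine formalSum_congr fun i => ?_
    rw [add_zero, mfact_zero, mul_one, div_self (mfact_ne_zero i), one_smul]
  | h j n ih =>
    have hl : ∀ c : (ℕ+ →₀ ℕ) → ℝ, LocFin fun i => c i • mpow w i :=
      fun c => locFin_wt fun i => (vanishBelow_mpow hw i).smul _
    set S := formalSum fun i : ℕ+ →₀ ℕ =>
      (mfact (i + (j + Finsupp.single n 1)) / (mfact i * mfact (j + Finsupp.single n 1))) •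
        mpow w i with hS
    have hw' : w n * S = formalSum fun i : ℕ+ →₀ ℕ =>
        ((i n : ℝ) / (j n + 1) * (mfact (i + j) / (mfact i * mfact j))) • mpow w i := by
      rw [hS, ← formalSum_mul_left (hl _)]
      refine Eq.trans (formalSum_congr fun i => ?_) (formalSum_injective
        (g := fun h : ℕ+ →₀ ℕ => h + Finsupp.single n 1) (add_left_injective _) ?_)
      · rw [mpow_add, mpow_single, pow_one, mul_smul_comm, mul_comm (w n), add_right_comm,
          ← add_assoc, mfact_add_single, mfact_add_single, mfact_add_single]
        congr 1
        have := mfact_ne_zero i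
        have := mfact_ne_zero j
        have h1 : (i n : ℝ) + 1 ≠ 0 := by positivity
        have h2 : (j n : ℝ) + 1 ≠ 0 := by positivity
        simp only [Finsupp.add_apply, Finsupp.single_eq_same]
        push_cast
        field_simp
      · intro h hh
        by_cases h0 : h n = 0
        · simp [h0]
        · obtain ⟨k, rfl⟩ := exists_add_single h0
          exact absurd ⟨k, rfl⟩ hh
    have hrec : (1 - w n) * S = formalSum fun i : ℕ+ →₀ ℕ =>
        (mfact (i + j) / (mfact i * mfact j)) • mpow w i := by
      rw [sub_mul, one_mul, sub_eq_iff_eq_add, hw', ← formalSum_add (hl _) (hl _), hS]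
      refine formalSum_congr fun i => ?_
      rw [← add_smul, ← add_assoc, mfact_add_single, mfact_add_single]
      congr 1
      have := mfact_ne_zero i
      have := mfact_ne_zero j
      have h2 : (j n : ℝ) + 1 ≠ 0 := by positivity
      simp only [Finsupp.add_apply]
      push_cast
      field_simp
      ring
    have := inv1_mul (vanishBelow_pnat_one hw n)
    calc S = inv1 (1 - w n) * ((1 - w n) * S) := by rw [← mul_assoc, this, one_mul]
      _ = _ := by rw [hrec, ih, mpow_add, mpow_single, pow_one]; ring

/-- The trace of `w ^ D * exp (b X) * exp (c ∂)` over the polynomial ring. -/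
theorem formalSum_trace {w : ℕ+ → MvPowerSeries σ R} (hw : ∀ n : ℕ+, VanishBelow n (w n))
    (b c : ℕ+ → MvPowerSeries σ R) :
    (formalSum fun d => mpow w d * MvPowerSeries.coeff d (expLin b * shiftPow c d)) =
      geomZ w * mexp fun n => w n * (b n * c n * inv1 (1 - w n)) := by
  classical
  let f : (ℕ+ →₀ ℕ) × (ℕ+ →₀ ℕ) → MvPowerSeries σ R := fun p =>
    (mpow w p.1 * mpow w p.2) *
      ((mfact (p.2 + p.1) / mfact p.2) • (dpow b p.1 * dpow c p.1))
  have hf : LocFin f := by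
    refine locFin_of_vanishBelow (fun p => wt p.1 + wt p.2) (fun p =>
      ((vanishBelow_mpow hw p.1).mul (vanishBelow_mpow hw p.2)).mul_right _) fun N => ?_
    refine ((finite_wt_le N).prod (finite_wt_le N)).subset fun p hp => ?_
    simp only [Set.mem_ofPred_eq] at hp
    exact ⟨by simp only [Set.mem_ofPred_eq]; omega, by simp only [Set.mem_ofPred_eq]; omega⟩
  have h1 : (formalSum fun d => mpow w d * MvPowerSeries.coeff d (expLin b * shiftPow c d)) =
      formalSum f := by
    rw [formalSum_antidiagonal hf]
    refine formalSum_congr fun d => ?_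
    rw [MvPowerSeries.coeff_mul, Finset.mul_sum]
    refine Finset.sum_congr rfl fun p hp => ?_
    obtain rfl := Finset.HasAntidiagonal.mem_antidiagonal.mp hp
    rw [coeff_expLin, add_comm p.1 p.2, coeff_shiftPow_add, mpow_add, mul_smul_comm]
    simp only [f, mul_smul_comm]
    congr 1
    ring
  rw [h1, formalSum_prod hf, mexp, ← formalSum_mul_left (locFin_dpow fun n => (hw n).mul_right _)]
  refine formalSum_congr fun j => ?_
  have hl : LocFin fun i => (mfact (i + j) / (mfact i * mfact j)) • mpow w i :=
    locFin_wt fun i => (vanishBelow_mpow hw i).smul _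
  calc (formalSum fun i => f (j, i)) = formalSum fun i =>
        (mfact j • (mpow w j * (dpow b j * dpow c j))) *
          ((mfact (i + j) / (mfact i * mfact j)) • mpow w i) := by
        refine formalSum_congr fun i => ?_
        simp only [f, mul_smul_comm, smul_mul_assoc, smul_smul]
        have := mfact_ne_zero j
        have := mfact_ne_zero i
        congr 1
        · field_simp
        · ring
    _ = _ := by
        rw [formalSum_mul_left hl, formalSum_choose hw]
        have h3 : dpow (fun n => w n * (b n * c n * inv1 (1 - w n))) j =
            (mfact j)⁻¹ • (mpow w j * (mpow b j * mpow c j * mpow (fun n => inv1 (1 - w n)) j)) := by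
          rw [dpow, mpow_mul, mpow_mul, mpow_mul]
        rw [h3, dpow, dpow]
        simp only [mul_smul_comm, smul_mul_assoc, smul_smul]
        have := mfact_ne_zero j
        congr 1
        · field_simp
        · ring

/-- The trace of `w ^ D * exp (α ∂) * exp (β X) * exp (γ ∂) * exp (δ X)` over the polynomial ring. -/
theorem gaussian_trace {α δ w : ℕ+ → MvPowerSeries σ R} (hα : ∀ n : ℕ+, VanishBelow n (α n))
    (hδ : ∀ n : ℕ+, VanishBelow n (δ n)) (hw : ∀ n : ℕ+, VanishBelow n (w n))
    (β γ : ℕ+ → MvPowerSeries σ R) :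
    (formalSum fun d => mpow w d * formalSum fun h => dpow δ h *
        MvPowerSeries.coeff d (translate α (shiftPow γ (d + h) * expLin β))) =
      geomZ w * mexp fun n => inv1 (1 - w n) *
        (α n * β n + α n * δ n + γ n * δ n + w n * (γ n * β n)) := by
  simp only [formalSum_translate hδ hα]
  have hl : LocFin fun d => mpow w d * MvPowerSeries.coeff d
      (expLin (fun n => β n + δ n) * shiftPow (fun n => γ n + α n) d) :=
    locFin_wt fun d => (vanishBelow_mpow hw d).mul_right _
  have h1 : ∀ n : ℕ+, VanishBelow n (α n * β n) := fun n => (hα n).mul_right _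
  have h2 : ∀ n : ℕ+, VanishBelow n (δ n * (γ n + α n)) := fun n => (hδ n).mul_right _
  have h3 : ∀ n : ℕ+, VanishBelow n
      (w n * ((β n + δ n) * (γ n + α n) * inv1 (1 - w n))) := fun n => (hw n).mul_right _
  calc _ = formalSum fun d => ((mexp fun n => α n * β n) * mexp fun n => δ n * (γ n + α n)) *
        (mpow w d * MvPowerSeries.coeff d
          (expLin (fun n => β n + δ n) * shiftPow (fun n => γ n + α n) d)) :=
        formalSum_congr fun d => by ring
    _ = geomZ w * ((mexp fun n => α n * β n) * (mexp fun n => δ n * (γ n + α n)) *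
        mexp fun n => w n * ((β n + δ n) * (γ n + α n) * inv1 (1 - w n))) := by
        rw [formalSum_mul_left hl, formalSum_trace hw]; ring
    _ = _ := by
        rw [← mexp_add h1 h2, ← mexp_add (fun n => (h1 n).add (h2 n)) h3]
        congr 2
        funext n
        have h4 := inv1_mul (vanishBelow_pnat_one hw n)
        linear_combination -(α n * β n + α n * δ n + γ n * δ n) * h4

end Trace

/-! ### Infinite Pochhammer symbols as exponentials -/

section Pochhammer

variable {σ R : Type*} [CommRing R]

theorem coeff_mul_of_vanishBelow {m : ℕ} {F G : MvPowerSeries σ R} (hG : VanishBelow m (G - 1))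
    {d : σ →₀ ℕ} (hd : d.degree < m) :
    MvPowerSeries.coeff d (F * G) = MvPowerSeries.coeff d F := by
  have h : F * G = F + F * (G - 1) := by ring
  rw [h, map_add, (hG.mul_left F) d hd, add_zero]

/-- Any sufficiently long partial product has the right coefficient. -/
theorem coeff_pochhammer {a v : MvPowerSeries σ R} (ha : VanishBelow 1 a) (hv : VanishBelow 1 v)
    {d : σ →₀ ℕ} {K : ℕ} (hK : d.degree < K) :
    MvPowerSeries.coeff d (pochhammer a v) =
      MvPowerSeries.coeff d (∏ i ∈ Finset.range K, (1 - a * v ^ i)) := by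
  obtain ⟨k, rfl⟩ := Nat.exists_eq_add_of_lt hK
  induction k with
  | zero => rfl
  | succ k ih =>
    have h : VanishBelow (1 + 1 * (d.degree + k + 1)) (a * v ^ (d.degree + k + 1)) :=
      ha.mul (hv.pow _)
    have h' : VanishBelow (d.degree + 1) (1 - a * v ^ (d.degree + k + 1) - 1) := by
      rw [sub_sub_cancel_left]
      exact (h.mono (by omega)).neg
    rw [ih (by omega), ← add_assoc d.degree k 1, Finset.prod_range_succ _ (d.degree + k + 1),
      coeff_mul_of_vanishBelow (d := d) h' (by omega)]

variable [Algebra ℝ R]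

theorem VanishBelow.formalExp_sub_one {m : ℕ} {a : MvPowerSeries σ R} (ha : VanishBelow m a)
    (hm : 1 ≤ m) : VanishBelow m (formalExp a - 1) := by
  intro d hd
  rw [formalExp_eq_formalSum (ha.mono hm), map_sub, coeff_formalSum, finsum_eq_single _ 0]
  · simp
  · intro n hn
    refine ((ha.pow n).smul _) d (lt_of_lt_of_le hd ?_)
    exact Nat.le_mul_of_pos_right _ (Nat.pos_of_ne_zero hn)

/-- `1 - b = exp (-∑ n, b ^ n / n)`. -/
theorem one_sub_eq_formalExp {b : MvPowerSeries σ R} (hb : VanishBelow 1 b) :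
    1 - b = formalExp (formalSum fun n : ℕ+ => -((((n : ℕ) : ℝ)⁻¹) • b ^ (n : ℕ))) := by
  have hn : ∀ n : ℕ+, VanishBelow n (-((((n : ℕ) : ℝ)⁻¹) • b ^ (n : ℕ))) := fun n => by
    simpa using ((hb.pow n).smul _).neg
  refine eq_formalExp (vanishBelow_formalSum_pnat hn) ?_ ?_
  · rw [map_sub, vanishBelow_one_iff.mp hb, sub_zero, map_one]
  · have hl : LocFin fun n : ℕ => b ^ n := by
      simpa using locFin_pow hb fun _ => (1 : ℝ)
    have hgeom : (formalSum fun n : ℕ => b ^ n) * (1 - b) = 1 := by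
      rw [mul_sub, mul_one, ← formalSum_mul_right hl, sub_eq_iff_eq_add]
      ext d
      have hfin : (Function.support fun n : ℕ => MvPowerSeries.coeff d (b ^ n)).Finite := hl d
      have hins : (Set.univ : Set ℕ) = insert 0 (Set.range Nat.succ) := by
        ext n
        cases n <;> simp
      rw [map_add, coeff_formalSum, coeff_formalSum, ← finsum_mem_univ, hins,
        finsum_mem_insert' _ (by simp) (hfin.subset Set.inter_subset_right),
        finsum_mem_range Nat.succ_injective, pow_zero]
      simp only [Nat.succ_eq_add_one, pow_succ]
    have h1 : euler (formalSum fun n : ℕ+ => -((((n : ℕ) : ℝ)⁻¹) • b ^ (n : ℕ))) =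
        -euler b * formalSum fun n : ℕ => b ^ n := by
      rw [euler_formalSum (locFin_pnat hn), ← formalSum_mul_left hl,
        ← formalSum_equiv Equiv.pnatEquivNat.symm]
      refine formalSum_congr fun n => ?_
      have h2 : ((Equiv.pnatEquivNat.symm n : ℕ+) : ℕ) = n + 1 := rfl
      rw [h2, euler_neg, euler_smul, euler_pow]
      have h3 : ((n : R) + 1) = algebraMap ℝ R ((n : ℝ) + 1) := by simp
      rw [h3, algebraMap_smul, smul_smul]
      have h4 : (n : ℝ) + 1 ≠ 0 := by positivity
      push_cast
      rw [inv_mul_cancel₀ h4, one_smul]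
      ring
    have h5 : euler (1 - b) = -euler b := by
      rw [sub_eq_add_neg, euler_add, euler_one, euler_neg, zero_add]
    rw [h5, h1, mul_assoc, hgeom, mul_one]

/-- `(a; v)_∞ = exp (-∑ n, a ^ n / (n * (1 - v ^ n)))`. -/
theorem pochhammer_eq_formalExp {a v : MvPowerSeries σ R} (ha : VanishBelow 1 a)
    (hv : VanishBelow 1 v) :
    pochhammer a v = formalExp (formalSum fun n : ℕ+ =>
      -((((n : ℕ) : ℝ)⁻¹) • (a ^ (n : ℕ) * inv1 (1 - v ^ (n : ℕ))))) := by
  ext d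
  set K := d.degree + 1
  have hinv : ∀ n : ℕ+, inv1 (1 - v ^ (n : ℕ)) * (1 - v ^ (n : ℕ)) = 1 := fun n =>
    inv1_mul ((hv.pow n).mono (by rw [one_mul]; exact n.pos))
  have ha' : ∀ n : ℕ+, VanishBelow n (a ^ (n : ℕ)) := fun n => by simpa using ha.pow n
  have hav : ∀ i : ℕ, VanishBelow 1 (a * v ^ i) := fun i => ha.mul_right _
  have hS : ∀ i, ∀ n : ℕ+, VanishBelow n (-((((n : ℕ) : ℝ)⁻¹) • (a * v ^ i) ^ (n : ℕ))) :=
    fun i n => by simpa using (((hav i).pow n).smul _).neg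
  -- the factors with index at least `K` contribute only to higher degrees
  have hT : ∀ n : ℕ+, VanishBelow (n * (1 + K)) (-((((n : ℕ) : ℝ)⁻¹) •
      (a ^ (n : ℕ) * v ^ (K * (n : ℕ)) * inv1 (1 - v ^ (n : ℕ))))) := fun n => by
    have h := ((((ha.pow n).mul (hv.pow (K * (n : ℕ)))).mul_right
      (inv1 (1 - v ^ (n : ℕ)))).smul ((((n : ℕ) : ℝ)⁻¹))).neg
    refine h.mono (le_of_eq ?_)
    ring
  have hT' : ∀ n : ℕ+, VanishBelow n (-((((n : ℕ) : ℝ)⁻¹) •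
      (a ^ (n : ℕ) * v ^ (K * (n : ℕ)) * inv1 (1 - v ^ (n : ℕ))))) := fun n =>
    (hT n).mono (Nat.le_mul_of_pos_right _ (by omega))
  have hT1 : VanishBelow (1 + K) (formalSum fun n : ℕ+ => -((((n : ℕ) : ℝ)⁻¹) •
      (a ^ (n : ℕ) * v ^ (K * (n : ℕ)) * inv1 (1 - v ^ (n : ℕ))))) :=
    VanishBelow.formalSum fun n => (hT n).mono (Nat.le_mul_of_pos_left _ n.pos)
  have hsplit : (formalSum fun n : ℕ+ =>
      -((((n : ℕ) : ℝ)⁻¹) • (a ^ (n : ℕ) * inv1 (1 - v ^ (n : ℕ))))) =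
      (∑ i ∈ Finset.range K, formalSum fun n : ℕ+ =>
        -((((n : ℕ) : ℝ)⁻¹) • (a * v ^ i) ^ (n : ℕ))) +
      formalSum fun n : ℕ+ => -((((n : ℕ) : ℝ)⁻¹) •
        (a ^ (n : ℕ) * v ^ (K * (n : ℕ)) * inv1 (1 - v ^ (n : ℕ)))) := by
    have h1 : (∑ i ∈ Finset.range K, formalSum fun n : ℕ+ =>
        -((((n : ℕ) : ℝ)⁻¹) • (a * v ^ i) ^ (n : ℕ))) = formalSum fun n : ℕ+ =>
        ∑ i ∈ Finset.range K, -((((n : ℕ) : ℝ)⁻¹) • (a * v ^ i) ^ (n : ℕ)) := by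
      induction Finset.range K using Finset.induction_on with
      | empty => simp [formalSum_zero]
      | insert i s hi ih =>
        simp only [Finset.sum_insert hi]
        rw [ih, formalSum_add (locFin_pnat (hS i))
          (locFin_pnat fun n => VanishBelow.sum fun i _ => hS i n)]
    rw [h1, ← formalSum_add (locFin_pnat fun n => VanishBelow.sum fun i _ => hS i n)
      (locFin_pnat hT')]
    refine formalSum_congr fun n => ?_
    rw [Finset.sum_neg_distrib, ← Finset.smul_sum, ← neg_add, ← smul_add]
    congr 2
    have h2 : ∑ i ∈ Finset.range K, (a * v ^ i) ^ (n : ℕ) =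
        a ^ (n : ℕ) * ∑ i ∈ Finset.range K, (v ^ (n : ℕ)) ^ i := by
      rw [Finset.mul_sum]
      refine Finset.sum_congr rfl fun i _ => ?_
      rw [mul_pow, ← pow_mul, ← pow_mul, mul_comm i]
    have h3 := geom_sum_mul (v ^ (n : ℕ)) K
    rw [h2, mul_comm K, pow_mul]
    linear_combination (a ^ (n : ℕ) * inv1 (1 - v ^ (n : ℕ))) * h3 +
      (a ^ (n : ℕ) * ∑ i ∈ Finset.range K, (v ^ (n : ℕ)) ^ i) * hinv n
  rw [coeff_pochhammer ha hv (K := K) (by omega), hsplit, formalExp_add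
    (VanishBelow.sum fun i _ => vanishBelow_formalSum_pnat (hS i)) (hT1.mono (by omega)),
    formalExp_sum fun i _ => vanishBelow_formalSum_pnat (hS i),
    coeff_mul_of_vanishBelow (hT1.formalExp_sub_one (by omega)) (by omega)]
  congr 1
  exact Finset.prod_congr rfl fun i _ => one_sub_eq_formalExp (hav i)

theorem inv1_formalExp {a : MvPowerSeries σ R} (ha : VanishBelow 1 a) :
    inv1 (formalExp a) = formalExp (-a) := by
  have h1 : inv1 (formalExp a) * formalExp a = 1 :=
    MvPowerSeries.invOfUnit_mul _ _ (by rw [constantCoeff_formalExp ha, Units.val_one])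
  have h2 : formalExp a * formalExp (-a) = 1 := by
    rw [← formalExp_add ha ha.neg, add_neg_cancel, formalExp_zero]
  calc inv1 (formalExp a) = inv1 (formalExp a) * (formalExp a * formalExp (-a)) := by
        rw [h2, mul_one]
    _ = _ := by rw [← mul_assoc, h1, one_mul]

end Pochhammer

/-! ### Values of rational power series -/

section RationalValue

/-- The power series `f` is the expansion at `0` of a rational function without pole at `s₀`, and
this rational function has the value `v` at `s₀`. -/
def HasRatVal (s₀ : ℝ) (f : PowerSeries ℝ) (v : ℝ) : Prop :=
  ∃ N D : Polynomial ℝ, D.eval s₀ ≠ 0 ∧ (D : PowerSeries ℝ) * f = N ∧ v * D.eval s₀ = N.eval s₀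

variable {s₀ : ℝ} {f g : PowerSeries ℝ} {v w : ℝ}

theorem HasRatVal.unique (hf : HasRatVal s₀ f v) (hg : HasRatVal s₀ f w) : v = w := by
  obtain ⟨N, D, hD, h, hv⟩ := hf
  obtain ⟨N', D', hD', h', hw⟩ := hg
  have h1 : N * D' = D * N' := by
    have : ((N * D' : Polynomial ℝ) : PowerSeries ℝ) = ((D * N' : Polynomial ℝ) : PowerSeries ℝ) := by
      rw [Polynomial.coe_mul, Polynomial.coe_mul, ← h, ← h']
      ring
    exact_mod_cast this
  have h2 := congrArg (Polynomial.eval s₀) h1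
  rw [Polynomial.eval_mul, Polynomial.eval_mul, ← hv, ← hw] at h2
  have h3 : (v - w) * (D.eval s₀ * D'.eval s₀) = 0 := by linear_combination h2
  rcases mul_eq_zero.mp h3 with h4 | h4
  · exact sub_eq_zero.mp h4
  · exact absurd h4 (mul_ne_zero hD hD')

theorem HasRatVal.rationalValue_eq (hf : HasRatVal s₀ f v) : rationalValue f s₀ = v := by
  have hex : ∃ w : Polynomial ℝ × Polynomial ℝ,
      w.2.eval s₀ ≠ 0 ∧ (w.2 : PowerSeries ℝ) * f = (w.1 : PowerSeries ℝ) := by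
    obtain ⟨N, D, hD, h, -⟩ := hf
    exact ⟨(N, D), hD, h⟩
  rw [rationalValue, dif_pos hex]
  refine HasRatVal.unique (f := f) ⟨_, _, hex.choose_spec.1, hex.choose_spec.2, ?_⟩ hf
  exact div_mul_cancel₀ _ hex.choose_spec.1

theorem hasRatVal_coe (p : Polynomial ℝ) : HasRatVal s₀ p (p.eval s₀) :=
  ⟨p, 1, by simp, by simp, by simp⟩

theorem HasRatVal.add (hf : HasRatVal s₀ f v) (hg : HasRatVal s₀ g w) :
    HasRatVal s₀ (f + g) (v + w) := by
  obtain ⟨N, D, hD, h, hv⟩ := hf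
  obtain ⟨N', D', hD', h', hw⟩ := hg
  refine ⟨N * D' + D * N', D * D', by rw [Polynomial.eval_mul]; exact mul_ne_zero hD hD', ?_, ?_⟩
  · push_cast
    rw [← h, ← h']
    ring
  · simp only [Polynomial.eval_mul, Polynomial.eval_add, ← hv, ← hw]
    ring

theorem HasRatVal.mul (hf : HasRatVal s₀ f v) (hg : HasRatVal s₀ g w) :
    HasRatVal s₀ (f * g) (v * w) := by
  obtain ⟨N, D, hD, h, hv⟩ := hf
  obtain ⟨N', D', hD', h', hw⟩ := hg
  refine ⟨N * N', D * D', by rw [Polynomial.eval_mul]; exact mul_ne_zero hD hD', ?_, ?_⟩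
  · push_cast
    rw [← h, ← h']
    ring
  · simp only [Polynomial.eval_mul, ← hv, ← hw]
    ring

theorem hasRatVal_zero : HasRatVal s₀ 0 0 := by simpa using hasRatVal_coe (s₀ := s₀) 0

theorem HasRatVal.smul (c : ℝ) (hf : HasRatVal s₀ f v) : HasRatVal s₀ (c • f) (c * v) := by
  have := (hasRatVal_coe (s₀ := s₀) (Polynomial.C c)).mul hf
  rwa [Polynomial.coe_C, Polynomial.eval_C, ← PowerSeries.smul_eq_C_mul] at this

theorem HasRatVal.sum {ι : Type*} {s : Finset ι} {f : ι → PowerSeries ℝ} {v : ι → ℝ}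
    (h : ∀ i ∈ s, HasRatVal s₀ (f i) (v i)) : HasRatVal s₀ (∑ i ∈ s, f i) (∑ i ∈ s, v i) := by
  classical
  induction s using Finset.induction_on with
  | empty => simpa using hasRatVal_zero
  | insert a s ha ih =>
    rw [Finset.sum_insert ha, Finset.sum_insert ha]
    exact (h a (Finset.mem_insert_self _ _)).add (ih fun i hi => h i (Finset.mem_insert_of_mem hi))

/-- A series that satisfies `D * f = g` has the value `value of g / D(s₀)`. -/
theorem HasRatVal.of_mul_eq {D : Polynomial ℝ} (hD : D.eval s₀ ≠ 0)
    (h : (D : PowerSeries ℝ) * f = g) (hg : HasRatVal s₀ g (v * D.eval s₀)) : HasRatVal s₀ f v := by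
  obtain ⟨N', D', hD', h', hw⟩ := hg
  refine ⟨N', D * D', by rw [Polynomial.eval_mul]; exact mul_ne_zero hD hD', ?_, ?_⟩
  · push_cast
    rw [← h', ← h]
    ring
  · rw [← hw, Polynomial.eval_mul]
    ring

end RationalValue

/-! ### Coefficients of the Cauchy determinant -/

section Count

variable {r : ℕ}

open Classical in
/-- The generating series `∑_{k ∈ K} s^{k_1 + ⋯ + k_r}`. -/
def countSeries (K : Set (Fin r → ℕ)) : PowerSeries ℝ :=
  PowerSeries.mk fun m => (((Finset.univ.piAntidiag m).filter (· ∈ K)).card : ℝ)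

theorem mem_piAntidiag_univ {m : ℕ} {k : Fin r → ℕ} :
    k ∈ (Finset.univ : Finset (Fin r)).piAntidiag m ↔ ∑ i, k i = m := by
  simp

/-- The elements of `K` without a zero on `o` are the shifts of the elements of `K` by the indicator
of `o`. -/
theorem countSeries_stable (K : Set (Fin r → ℕ)) (o : Finset (Fin r))
    (hK : ∀ k, k ∈ K ↔ k + (fun j => if j ∈ o then 1 else 0) ∈ K) :
    (1 - PowerSeries.X ^ o.card) * countSeries K = countSeries {k ∈ K | ∃ j ∈ o, k j = 0} := by
  classical
  have hone : ∑ i, (if i ∈ o then 1 else 0) = o.card := by simp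
  rw [sub_mul, one_mul, sub_eq_iff_eq_add]
  ext m
  rw [map_add, PowerSeries.coeff_X_pow_mul']
  simp only [countSeries, PowerSeries.coeff_mk]
  rw [← Finset.card_filter_add_card_filter_not (s := (Finset.univ.piAntidiag m).filter (· ∈ K))
    (fun k => ∃ j ∈ o, k j = 0)]
  push_cast
  congr 1
  · rw [Finset.filter_filter]
    congr 2
    ext k
    simp only [Finset.mem_filter, Set.mem_sep_iff]
  · split_ifs with hm
    · norm_cast
      refine Finset.card_nbij' (fun k => k - fun j => if j ∈ o then 1 else 0)
        (fun k => k + fun j => if j ∈ o then 1 else 0) ?_ ?_ ?_ ?_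
      · intro k hk
        simp only [Finset.coe_filter, Finset.mem_filter, mem_piAntidiag_univ, not_exists, not_and,
          Set.mem_ofPred_eq] at hk ⊢
        obtain ⟨⟨h1, h2⟩, h3⟩ := hk
        have h4 : k - (fun j => if j ∈ o then 1 else 0) + (fun j => if j ∈ o then 1 else 0) = k := by
          funext j
          have := h3 j
          simp only [Pi.add_apply, Pi.sub_apply]
          split_ifs with hj
          · have := this hj; omega
          · omega
        refine ⟨?_, (hK _).mpr (by rw [h4]; exact h2)⟩
        have h5 := congrArg (fun f => ∑ i, f i) h4
        simp only [Pi.add_apply, Finset.sum_add_distrib, h1] at h5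
        rw [hone] at h5
        omega
      · intro k hk
        simp only [Finset.coe_filter, Finset.mem_filter, mem_piAntidiag_univ, not_exists, not_and,
          Set.mem_ofPred_eq] at hk ⊢
        refine ⟨⟨?_, (hK _).mp hk.2⟩, fun j hj => by simp [hj]⟩
        simp only [Pi.add_apply, Finset.sum_add_distrib, hk.1]
        rw [hone]
        omega
      · intro k hk
        simp only [Finset.coe_filter, Finset.mem_filter, mem_piAntidiag_univ, not_exists, not_and,
          Set.mem_ofPred_eq] at hk
        funext j
        have := hk.2 j
        simp only [Pi.add_apply, Pi.sub_apply]
        split_ifs with hj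
        · have := this hj; omega
        · omega
      · intro k _
        funext j
        simp
    · rw [Nat.cast_eq_zero, Finset.card_eq_zero, Finset.filter_eq_empty_iff]
      intro k hk
      simp only [Finset.mem_filter, mem_piAntidiag_univ] at hk
      rw [not_not]
      by_contra hne
      push Not at hne
      apply hm
      rw [← hk.1, Finset.card_eq_sum_ones]
      calc ∑ j ∈ o, 1 ≤ ∑ j ∈ o, k j :=
            Finset.sum_le_sum fun j hj => Nat.one_le_iff_ne_zero.mpr (hne j hj)
        _ ≤ ∑ j, k j := Finset.sum_le_univ_sum_of_nonneg fun _ => Nat.zero_le _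

/-- If `K` is stable under the shifts by the indicators of pairwise disjoint sets, and only finitely
many elements of `K` have a zero on each of these sets, then its generating series is rational. -/
theorem countSeries_rational (os : Finset (Finset (Fin r)))
    (hdisj : (os : Set (Finset (Fin r))).PairwiseDisjoint id) (K : Set (Fin r → ℕ))
    (hK : ∀ o ∈ os, ∀ k, k ∈ K ↔ k + (fun j => if j ∈ o then 1 else 0) ∈ K)
    (hfin : {k ∈ K | ∀ o ∈ os, ∃ j ∈ o, k j = 0}.Finite) :
    ∃ N : Polynomial ℝ,
      (∏ o ∈ os, (1 - PowerSeries.X ^ o.card)) * countSeries K = (N : PowerSeries ℝ) := by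
  classical
  induction os using Finset.induction_on generalizing K with
  | empty =>
    have hK' : K.Finite := by simpa using hfin
    refine ⟨∑ k ∈ hK'.toFinset, Polynomial.X ^ (∑ i, k i), ?_⟩
    ext m
    rw [Finset.prod_empty, one_mul, Polynomial.coeff_coe, Polynomial.finsetSum_coeff]
    simp only [Polynomial.coeff_X_pow, countSeries, PowerSeries.coeff_mk]
    rw [Finset.sum_boole]
    congr 2
    ext k
    simp only [Finset.mem_filter, mem_piAntidiag_univ, Set.Finite.mem_toFinset]
    tauto
  | insert o os ho ih =>
    rw [Finset.prod_insert ho, mul_comm (1 - PowerSeries.X ^ o.card), mul_assoc,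
      countSeries_stable K o (hK o (Finset.mem_insert_self _ _))]
    refine ih (hdisj.subset (by simp)) _ ?_ ?_
    · intro o' ho' k
      have hne : o ≠ o' := fun h => ho (h ▸ ho')
      have hd : Disjoint o o' := hdisj (by simp) (by simp [ho']) hne
      have h1 : ∀ j ∈ o, k j + (if j ∈ o' then 1 else 0) = k j := fun j hj => by
        have : j ∉ o' := Finset.disjoint_left.mp hd hj
        simp [this]
      simp only [Set.mem_sep_iff]
      rw [hK o' (Finset.mem_insert_of_mem ho') k]
      refine and_congr_right fun _ => exists_congr fun j => and_congr_right fun hj => ?_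
      rw [Pi.add_apply, h1 j hj]
    · refine hfin.subset fun k hk => ?_
      simp only [Set.mem_sep_iff] at hk ⊢
      refine ⟨hk.1.1, fun o' ho' => ?_⟩
      rcases Finset.mem_insert.mp ho' with rfl | h
      · exact hk.1.2
      · exact hk.2 o' h

/-- The exponents `k` with `k ∘ σ - k = a`. -/
def shiftSet (σ : Equiv.Perm (Fin r)) (a : Fin r → ℤ) : Set (Fin r → ℕ) :=
  {k | ∀ i, (k (σ i) : ℤ) - k i = a i}

theorem mem_shiftSet {σ : Equiv.Perm (Fin r)} {a : Fin r → ℤ} {k : Fin r → ℕ} :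
    k ∈ shiftSet σ a ↔ ∀ i, (k (σ i) : ℤ) - k i = a i := Iff.rfl

/-- The set of exponents is stable under the shifts by the indicators of the orbits of `σ`, and a
zero on each orbit bounds an exponent. The denominator is the product of the `1 - s^|o|` over the
orbits `o`, which does not vanish at `s₀ > 1`. -/
theorem exists_hasRatVal_countSeries {s₀ : ℝ} (hs : 1 < s₀) (σ : Equiv.Perm (Fin r))
    (a : Fin r → ℤ) : ∃ v, HasRatVal s₀ (countSeries (shiftSet σ a)) v := by
  classical
  -- the orbits of `σ`
  set orb : Fin r → Finset (Fin r) := fun i => Finset.univ.filter fun j => σ.SameCycle i j with horb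
  have hmem : ∀ i j, j ∈ orb i ↔ σ.SameCycle i j := fun i j => by simp [horb]
  obtain ⟨N, hN⟩ := countSeries_rational (Finset.univ.image orb) (by
    intro o ho o' ho' hne
    obtain ⟨i, -, rfl⟩ := Finset.mem_image.mp (Finset.mem_coe.mp ho)
    obtain ⟨i', -, rfl⟩ := Finset.mem_image.mp (Finset.mem_coe.mp ho')
    refine Finset.disjoint_left.mpr fun j hj hj' => hne ?_
    simp only [id, hmem] at hj hj'
    ext l
    rw [hmem, hmem]
    exact ⟨fun h => (hj'.trans hj.symm).trans h, fun h => (hj.trans hj'.symm).trans h⟩)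
    (shiftSet σ a) (by
    intro o ho k
    obtain ⟨i, -, rfl⟩ := Finset.mem_image.mp ho
    refine forall_congr' fun j => ?_
    have : (σ j ∈ orb i) ↔ (j ∈ orb i) := by
      rw [hmem, hmem]
      exact Equiv.Perm.sameCycle_apply_right
    simp only [Pi.add_apply, this]
    push_cast
    rw [add_sub_add_right_eq_sub]) (by
    -- such an exponent is bounded, since it can be reached from a zero along the orbit
    set A : ℕ := ∑ i, (a i).natAbs
    refine (Set.Finite.pi' (t := fun _ : Fin r => Set.Iic (orderOf σ * A))
      fun _ => Set.finite_Iic _).subset ?_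
    intro k hk i
    simp only [mem_shiftSet] at hk
    obtain ⟨j, hj, hj0⟩ := hk.2 (orb i) (Finset.mem_image_of_mem _ (Finset.mem_univ _))
    rw [hmem] at hj
    obtain ⟨m, hm, rfl⟩ := hj.exists_pow_eq'
    have hstep : ∀ j, k j ≤ k (σ j) + A := fun j => by
      have h1 := hk.1 j
      have h2 : (a j).natAbs ≤ A :=
        Finset.single_le_sum (f := fun i => (a i).natAbs) (fun _ _ => Nat.zero_le _)
          (Finset.mem_univ j)
      omega
    have hiter : ∀ n j, k j ≤ k ((σ ^ n) j) + n * A := by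
      intro n
      induction n with
      | zero => intro j; simp
      | succ n ih =>
        intro j
        have h1 := ih (σ j)
        have h2 := hstep j
        rw [pow_succ, Equiv.Perm.mul_apply, Nat.succ_mul]
        omega
    have h1 := hiter m i
    rw [hj0] at h1
    have h3 : m * A ≤ orderOf σ * A := Nat.mul_le_mul_right _ hm.le
    exact Set.mem_Iic.mpr (by omega))
  have hD : (∏ o ∈ Finset.univ.image orb, (1 - Polynomial.X ^ o.card : Polynomial ℝ)).eval s₀ ≠ 0 := by
    rw [Polynomial.eval_prod, Finset.prod_ne_zero_iff]
    intro o ho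
    obtain ⟨i, -, rfl⟩ := Finset.mem_image.mp ho
    have hc : (orb i).card ≠ 0 := Finset.card_ne_zero_of_mem (a := i) (by rw [hmem])
    have := one_lt_pow₀ hs hc
    simp only [Polynomial.eval_sub, Polynomial.eval_one, Polynomial.eval_pow, Polynomial.eval_X]
    exact (by linarith : 1 - s₀ ^ (orb i).card < 0).ne
  refine ⟨N.eval s₀ / _, N, _, hD, ?_, div_mul_cancel₀ _ hD⟩
  rw [← hN]
  congr 1
  rw [← Polynomial.coeToPowerSeries.ringHom_apply, map_prod]
  exact Finset.prod_congr rfl fun o _ => by simp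

/-- Precomposition of the exponents with `σ` is a bijection which preserves their sum. -/
theorem countSeries_shiftSet_neg (σ : Equiv.Perm (Fin r)) (a : Fin r → ℤ) :
    countSeries (shiftSet σ (-a)) = countSeries (shiftSet σ⁻¹ a) := by
  classical
  ext m
  simp only [countSeries, PowerSeries.coeff_mk]
  congr 1
  refine Finset.card_equiv (Equiv.arrowCongr σ⁻¹ (Equiv.refl ℕ)) fun k => ?_
  have h1 : ∀ i, (Equiv.arrowCongr σ⁻¹ (Equiv.refl ℕ)) k i = k (σ i) := fun i => rfl
  have h2 : ∀ i, σ (σ⁻¹ i) = i := fun i => σ.apply_symm_apply i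
  simp only [Finset.mem_filter, mem_piAntidiag_univ, mem_shiftSet, h1, h2, Pi.neg_apply]
  refine and_congr (by rw [Equiv.sum_comp]) (forall_congr' fun i => ?_)
  omega

/-- The coefficient of `(z_1 ⋯ z_r)⁻¹ z^{-a}` in the determinant of the `(z_i - s z_j)⁻¹`, as a
power series in `s`. -/
def circSeries (a : Fin r → ℤ) : PowerSeries ℝ :=
  ∑ σ : Equiv.Perm (Fin r), (Equiv.Perm.sign σ : ℤ) • countSeries (shiftSet σ a)

theorem countSeries_eq_zero {σ : Equiv.Perm (Fin r)} {a : Fin r → ℤ} (h : ∑ i, a i ≠ 0) :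
    countSeries (shiftSet σ a) = 0 := by
  classical
  ext m
  simp only [countSeries, PowerSeries.coeff_mk, map_zero, Nat.cast_eq_zero]
  rw [Finset.card_eq_zero, Finset.filter_eq_empty_iff]
  intro k _ hk
  apply h
  rw [← Finset.sum_congr rfl fun i _ => hk i, Finset.sum_sub_distrib,
    Equiv.sum_comp σ fun i => (k i : ℤ), sub_self]

theorem circSeries_neg (a : Fin r → ℤ) : circSeries (-a) = circSeries a := by
  rw [circSeries, circSeries, ← Equiv.sum_comp (Equiv.inv _)]
  refine Finset.sum_congr rfl fun σ _ => ?_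
  rw [Equiv.inv_apply, Equiv.Perm.sign_inv, countSeries_shiftSet_neg, inv_inv]

theorem circSeries_eq_zero {a : Fin r → ℤ} (h : ∑ i, a i ≠ 0) : circSeries a = 0 := by
  rw [circSeries]
  exact Finset.sum_eq_zero fun σ _ => by rw [countSeries_eq_zero h, smul_zero]

end Count

/-! ### The functional `∫ D^r z` on Laurent polynomials -/

section CircForm

variable {r : ℕ}

/-- The linear map with prescribed values on the Laurent monomials. -/
def laurentLift {M : Type*} [AddCommGroup M] [Module ℝ M] (v : (Fin r → ℤ) → M) :
    Laurent r →ₗ[ℝ] M where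
  toFun G := Finsupp.linearCombination ℝ v G.coeff
  map_add' F G := by rw [AddMonoidAlgebra.coeff_add, map_add]
  map_smul' c G := by rw [AddMonoidAlgebra.coeff_smul, map_smul, RingHom.id_apply]

theorem laurentLift_single {M : Type*} [AddCommGroup M] [Module ℝ M] (v : (Fin r → ℤ) → M)
    (a : Fin r → ℤ) (c : ℝ) : laurentLift v (AddMonoidAlgebra.single a c) = c • v a := by
  show Finsupp.linearCombination ℝ v (AddMonoidAlgebra.single a c).coeff = _
  rw [AddMonoidAlgebra.coeff_single, Finsupp.linearCombination_single]

theorem laurent_hom_ext {M : Type*} [AddCommGroup M] [Module ℝ M] {f g : Laurent r →ₗ[ℝ] M}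
    (h : ∀ a, f (AddMonoidAlgebra.single a 1) = g (AddMonoidAlgebra.single a 1)) : f = g := by
  refine LinearMap.ext fun G => ?_
  induction G using AddMonoidAlgebra.induction_linear with
  | zero => rw [map_zero, map_zero]
  | add F G hF hG => rw [map_add, map_add, hF, hG]
  | single a c =>
    have : (AddMonoidAlgebra.single a c : Laurent r) = c • AddMonoidAlgebra.single a 1 := by
      rw [AddMonoidAlgebra.smul_single, smul_eq_mul, mul_one]
    rw [this, map_smul, map_smul, h]

/-- The functional `∫ D^r z det (1 / (z_i - t⁻¹ z_j)) G` of a Laurent polynomial `G`. -/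
def circForm (t : ℝ) : Laurent r →ₗ[ℝ] ℝ := laurentLift fun a => rationalValue (circSeries a) t⁻¹

theorem hasRatVal_circSeries {t : ℝ} (ht : 1 < t⁻¹) (a : Fin r → ℤ) :
    HasRatVal t⁻¹ (circSeries a) (rationalValue (circSeries a) t⁻¹) := by
  have h : ∃ v, HasRatVal t⁻¹ (circSeries a) v := by
    choose v hv using fun σ : Equiv.Perm (Fin r) => exists_hasRatVal_countSeries ht σ a
    refine ⟨_, HasRatVal.sum (v := fun σ => ((Equiv.Perm.sign σ : ℤ) : ℝ) * v σ) fun σ _ => ?_⟩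
    rw [← Int.cast_smul_eq_zsmul ℝ]
    exact (hv σ).smul _
  obtain ⟨v, hv⟩ := h
  rwa [hv.rationalValue_eq]

theorem hasRatVal_circForm {t : ℝ} (ht : 1 < t⁻¹) (G : Laurent r) :
    HasRatVal t⁻¹ (laurentLift circSeries G) (circForm t G) :=
  HasRatVal.sum fun a _ => (hasRatVal_circSeries ht a).smul _

theorem circForm_single_neg (t : ℝ) (a : Fin r → ℤ) :
    circForm t (AddMonoidAlgebra.single (-a) 1) = circForm t (AddMonoidAlgebra.single a 1) := by
  rw [circForm, laurentLift_single, laurentLift_single, circSeries_neg]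

theorem circForm_single_eq_zero {t : ℝ} {a : Fin r → ℤ} (h : ∑ i, a i ≠ 0) (c : ℝ) :
    circForm t (AddMonoidAlgebra.single a c) = 0 := by
  rw [circForm, laurentLift_single, circSeries_eq_zero h, hasRatVal_zero.rationalValue_eq, smul_zero]

theorem single_prod {ι : Type*} (s : Finset ι) (a : ι → Fin r → ℤ) :
    ∏ i ∈ s, (AddMonoidAlgebra.single (a i) 1 : Laurent r) =
      AddMonoidAlgebra.single (∑ i ∈ s, a i) 1 := by
  classical
  induction s using Finset.induction_on with
  | empty => rfl
  | insert i s hi ih =>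
    rw [Finset.prod_insert hi, Finset.sum_insert hi, ih, AddMonoidAlgebra.single_mul_single, one_mul]

/-- The contribution of one permutation to the Cauchy determinant: the geometric exponents `k` that
produce the monomial complementary to `z^a` are those with `k ∘ σ - k = a`, up to relabelling. -/
theorem coeff_cauchy_prod (σ : Equiv.Perm (Fin r)) (m : ℕ) (G : Laurent r) :
    ((PowerSeries.coeff m (∏ i, PowerSeries.mk fun k =>
      (zPow i (-1) * (zPow (σ i) 1 * zPow i (-1)) ^ k : Laurent r))) * G).coeff (fun _ => -1) =
      PowerSeries.coeff m (laurentLift (fun a => countSeries (shiftSet σ a)) G) := by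
  classical
  set H := PowerSeries.coeff m (∏ i, PowerSeries.mk fun k =>
      (zPow i (-1) * (zPow (σ i) 1 * zPow i (-1)) ^ k : Laurent r)) with hH
  let f : Laurent r →ₗ[ℝ] ℝ :=
    { toFun := fun G => (H * G).coeff fun _ => -1
      map_add' := fun F G => by rw [mul_add, AddMonoidAlgebra.coeff_add, Finsupp.add_apply]
      map_smul' := fun c G => by
        rw [mul_smul_comm, AddMonoidAlgebra.coeff_smul, Finsupp.smul_apply, RingHom.id_apply] }
  have hfg : f = (PowerSeries.coeff (R := ℝ) m).comp
      (laurentLift fun a => countSeries (shiftSet σ a)) := by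
    refine laurent_hom_ext fun a => ?_
    show (H * AddMonoidAlgebra.single a 1).coeff (fun _ => -1) = PowerSeries.coeff m
      (laurentLift (fun a => countSeries (shiftSet σ a)) (AddMonoidAlgebra.single a 1))
    rw [laurentLift_single, one_smul, countSeries, PowerSeries.coeff_mk, hH, PowerSeries.coeff_prod]
    simp only [PowerSeries.coeff_mk]
    have h1 : ∀ l : Fin r →₀ ℕ, (∏ i, (zPow i (-1) * (zPow (σ i) 1 * zPow i (-1)) ^ l i : Laurent r)) *
        AddMonoidAlgebra.single a 1 =
        AddMonoidAlgebra.single (fun j => -1 + ((l (σ⁻¹ j) : ℤ) - l j) + a j) 1 := by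
      intro l
      have h2 : ∀ i, (zPow i (-1) * (zPow (σ i) 1 * zPow i (-1)) ^ l i : Laurent r) =
          AddMonoidAlgebra.single (Pi.single i (-1) +
            l i • (Pi.single (σ i) 1 + Pi.single i (-1))) 1 := fun i => by
        simp only [zPow, AddMonoidAlgebra.single_mul_single, AddMonoidAlgebra.single_pow, one_pow,
          one_mul]
      rw [Finset.prod_congr rfl fun i _ => h2 i, single_prod, AddMonoidAlgebra.single_mul_single,
        one_mul]
      congr 1
      funext j
      simp only [Pi.add_apply, Finset.sum_apply, Finset.sum_add_distrib, smul_add,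
        nsmul_eq_mul, Pi.mul_apply, Pi.natCast_apply, Pi.single_apply, mul_ite, mul_zero, mul_one,
        mul_neg]
      have h3 : ∀ i, (j = σ i) ↔ (σ⁻¹ j = i) := fun i => σ.symm_apply_eq.symm
      simp only [h3, Finset.sum_ite_eq, Finset.mem_univ, if_true]
      ring
    rw [Finset.sum_mul, Finset.sum_congr rfl fun l _ => h1 l, AddMonoidAlgebra.coeff_sum,
      Finsupp.finsetSum_apply]
    simp only [AddMonoidAlgebra.coeff_single, Finsupp.single_apply]
    rw [Finset.sum_boole]
    congr 1
    refine Finset.card_equiv (Finsupp.equivFunOnFinite.trans (Equiv.arrowCongr σ (Equiv.refl ℕ)))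
      fun l => ?_
    have h4 : ∀ i, (Finsupp.equivFunOnFinite.trans (Equiv.arrowCongr σ (Equiv.refl ℕ))) l i =
        l (σ⁻¹ i) := fun i => rfl
    have h5 : ∀ i, σ⁻¹ (σ i) = i := fun i => σ.symm_apply_apply i
    simp only [Finset.mem_filter, mem_piAntidiag_univ, mem_shiftSet, h4, h5,
      Finset.mem_finsuppAntidiag, Finset.subset_univ, and_true]
    rw [Equiv.sum_comp σ⁻¹ fun i => l i]
    refine and_congr Iff.rfl ?_
    rw [funext_iff]
    refine forall_congr' fun i => ?_
    omega
  exact LinearMap.congr_fun hfg G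

/-- A series without `s`, regarded as a formal integrand. -/
def liftSeries (r : ℕ) : MvPowerSeries (Fin 3) (Laurent r) →ₐ[Laurent r] Integrand r :=
  MvPowerSeries.rename (Fin.succEmb 3)

theorem coeff_cons_liftSeries (Y : MvPowerSeries (Fin 3) (Laurent r)) (d : Fin 3 →₀ ℕ) :
    MvPowerSeries.coeff (Finsupp.cons 0 d) (liftSeries r Y) = MvPowerSeries.coeff d Y := by
  have h : Finsupp.cons 0 d = Finsupp.embDomain (Fin.succEmb 3) d := by
    ext i
    refine Fin.cases ?_ (fun i => ?_) i
    · rw [Finsupp.cons_zero, Finsupp.embDomain_of_notMem_range]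
      simp
    · rw [Finsupp.cons_succ]
      exact (Finsupp.embDomain_apply_self (Fin.succEmb 3) d i).symm
  rw [h, liftSeries, MvPowerSeries.coeff_embDomain_rename]

theorem coeff_liftSeries_of_ne_zero (Y : MvPowerSeries (Fin 3) (Laurent r)) {D : Fin 4 →₀ ℕ}
    (hD : D 0 ≠ 0) : MvPowerSeries.coeff D (liftSeries r Y) = 0 := by
  refine MvPowerSeries.coeff_rename_eq_zero _ _ ?_
  rintro ⟨x, rfl⟩
  exact hD (Finsupp.mapDomain_of_notMem_range _ _ (by simp))

/-- The embedding of the variable `s` into the variables `s, x, y, u`. -/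
def sEmb : Unit ↪ Fin 4 := ⟨fun _ => 0, fun _ _ _ => rfl⟩

theorem coeff_single_rename (A : PowerSeries (Laurent r)) (m : ℕ) :
    MvPowerSeries.coeff (Finsupp.single 0 m) (MvPowerSeries.rename sEmb A) =
      PowerSeries.coeff m A := by
  have h : (Finsupp.single 0 m : Fin 4 →₀ ℕ) = Finsupp.embDomain sEmb (Finsupp.single () m) := by
    rw [Finsupp.embDomain_single]
    rfl
  rw [h, MvPowerSeries.coeff_embDomain_rename]
  rfl

theorem coeff_rename_of_ne_zero (A : PowerSeries (Laurent r)) {D : Fin 4 →₀ ℕ} {i : Fin 4}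
    (hi : i ≠ 0) (hD : D i ≠ 0) : MvPowerSeries.coeff D (MvPowerSeries.rename sEmb A) = 0 := by
  refine MvPowerSeries.coeff_rename_eq_zero _ _ ?_
  rintro ⟨x, rfl⟩
  exact hD (Finsupp.mapDomain_of_notMem_range _ _ (by rintro ⟨_, h⟩; exact hi h.symm))

theorem coeff_rename_mul_liftSeries (A : PowerSeries (Laurent r))
    (Y : MvPowerSeries (Fin 3) (Laurent r)) (m : ℕ) (d : Fin 3 →₀ ℕ) :
    MvPowerSeries.coeff (Finsupp.cons m d) (MvPowerSeries.rename sEmb A * liftSeries r Y) =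
      PowerSeries.coeff m A * MvPowerSeries.coeff d Y := by
  classical
  rw [MvPowerSeries.coeff_mul, Finset.sum_eq_single (Finsupp.single 0 m, Finsupp.cons 0 d)]
  · rw [coeff_single_rename, coeff_cons_liftSeries]
  · rintro ⟨D, E⟩ hp hne
    have hDE : D + E = Finsupp.cons m d := Finset.HasAntidiagonal.mem_antidiagonal.mp hp
    by_cases hE : E 0 = 0
    · by_cases hD : ∃ i : Fin 4, i ≠ 0 ∧ D i ≠ 0
      · obtain ⟨i, hi, hi'⟩ := hD
        rw [coeff_rename_of_ne_zero A hi hi', zero_mul]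
      · push Not at hD
        exfalso
        apply hne
        have h0 := DFunLike.congr_fun hDE 0
        rw [Finsupp.add_apply, Finsupp.cons_zero, hE, add_zero] at h0
        refine Prod.ext (Finsupp.ext fun i => ?_) (Finsupp.ext fun i => ?_)
        · refine Fin.cases ?_ (fun i => ?_) i
          · simpa using h0
          · simpa [Finsupp.single_apply, Fin.succ_ne_zero, (Fin.succ_ne_zero _).symm] using
              hD i.succ (Fin.succ_ne_zero i)
        · refine Fin.cases ?_ (fun i => ?_) i
          · simpa using hE
          · have h1 := DFunLike.congr_fun hDE i.succ
            rw [Finsupp.add_apply, hD _ (Fin.succ_ne_zero i), zero_add] at h1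
            simpa using h1
    · rw [coeff_liftSeries_of_ne_zero Y hE, mul_zero]
  · intro h
    exfalso
    refine h (Finset.HasAntidiagonal.mem_antidiagonal.mpr (Finsupp.ext fun i => ?_))
    refine Fin.cases ?_ (fun i => ?_) i <;> simp

theorem cauchy_eq_rename (i j : Fin r) :
    cauchy i j = MvPowerSeries.rename sEmb (PowerSeries.mk fun k =>
      (zPow i (-1) * (zPow j 1 * zPow i (-1)) ^ k : Laurent r)) := by
  classical
  ext1 D
  rw [cauchy, coeff_formalSum]
  have hc : ∀ k : ℕ, MvPowerSeries.coeff D (MvPowerSeries.C (zPow i (-1) *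
      (zPow j 1 * zPow i (-1)) ^ k) * sVar r ^ k) =
      if D = Finsupp.single 0 k then (zPow i (-1) * (zPow j 1 * zPow i (-1)) ^ k : Laurent r)
        else 0 := fun k => by
    rw [MvPowerSeries.coeff_C_mul, sVar, MvPowerSeries.coeff_X_pow]
    split_ifs <;> simp
  simp only [hc]
  by_cases hD : ∃ i : Fin 4, i ≠ 0 ∧ D i ≠ 0
  · obtain ⟨i', hi, hi'⟩ := hD
    rw [coeff_rename_of_ne_zero _ hi hi']
    refine (finsum_congr fun k => if_neg ?_).trans finsum_zero
    rintro rfl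
    exact hi' (Finsupp.single_eq_of_ne hi)
  · push Not at hD
    have hD' : D = Finsupp.single 0 (D 0) := by
      ext i'
      by_cases h : i' = 0
      · rw [h, Finsupp.single_eq_same]
      · rw [hD i' h, Finsupp.single_eq_of_ne h]
    rw [hD', coeff_single_rename, PowerSeries.coeff_mk, finsum_eq_single _ (D 0)]
    · rw [if_pos rfl]
    · intro k hk
      exact if_neg fun h => hk (Finsupp.single_injective 0 h).symm

/-- For a series `Y` without `s`, the functional `∫ D^r z` of the Cauchy determinant times `Y`
acts coefficientwise. -/
theorem residue_det_cauchy {t : ℝ} (ht : 1 < t⁻¹) (Y : MvPowerSeries (Fin 3) (Laurent r)) :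
    residue t (Matrix.det (Matrix.of fun i j : Fin r => cauchy i j) * liftSeries r Y) =
      fun d => circForm t (MvPowerSeries.coeff d Y) := by
  funext d
  rw [residue, ← (hasRatVal_circForm ht (MvPowerSeries.coeff d Y)).rationalValue_eq]
  congr 1
  ext m
  have h1 : laurentLift circSeries = ∑ σ : Equiv.Perm (Fin r), (Equiv.Perm.sign σ : ℤ) •
      laurentLift (r := r) fun a => countSeries (shiftSet σ a) := by
    refine laurent_hom_ext fun a => ?_
    rw [laurentLift_single, one_smul, LinearMap.sum_apply, circSeries]
    refine Finset.sum_congr rfl fun σ _ => ?_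
    rw [LinearMap.smul_apply, laurentLift_single, one_smul]
  rw [PowerSeries.coeff_mk, h1, LinearMap.sum_apply, map_sum, ← Matrix.det_transpose,
    Matrix.det_apply, Finset.sum_mul, map_sum, AddMonoidAlgebra.coeff_sum, Finsupp.finsetSum_apply]
  refine Finset.sum_congr rfl fun σ _ => ?_
  rw [LinearMap.smul_apply, map_zsmul, ← coeff_cauchy_prod]
  simp only [Matrix.transpose_apply, Matrix.of_apply, cauchy_eq_rename]
  rw [← map_prod, Units.smul_def, smul_mul_assoc, map_zsmul, coeff_rename_mul_liftSeries]
  simp only [← Int.cast_smul_eq_zsmul ℝ]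
  rfl

end CircForm

/-! ### A determinant of Toeplitz type -/

section Toeplitz

open Polynomial

variable {R : Type*} [CommRing R]

/-- The operator `G ↦` polynomial part of `g(1/z) G(z)`, for a power series `g` and a polynomial
`G`. It sends `z^n` to `∑_{e ≤ n} g_e z^{n-e}`. -/
def opT (g : PowerSeries R) : R[X] →ₗ[R] R[X] :=
  Polynomial.lsum fun n => LinearMap.toSpanSingleton R R[X]
    (∑ p ∈ Finset.HasAntidiagonal.antidiagonal n, C (PowerSeries.coeff p.1 g) * X ^ p.2)

theorem opT_X_pow (g : PowerSeries R) (n : ℕ) :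
    opT g (X ^ n) =
      ∑ p ∈ Finset.HasAntidiagonal.antidiagonal n, C (PowerSeries.coeff p.1 g) * X ^ p.2 := by
  rw [opT, Polynomial.lsum_apply, ← Polynomial.monomial_one_right_eq_X_pow,
    Polynomial.sum_monomial_index]
  · rw [LinearMap.toSpanSingleton_apply, one_smul]
  · rw [map_zero]

theorem linearMap_ext_X_pow {M : Type*} [AddCommMonoid M] [Module R M] {f g : R[X] →ₗ[R] M}
    (h : ∀ n, f (X ^ n) = g (X ^ n)) : f = g := by
  refine Polynomial.lhom_ext' fun n => LinearMap.ext_ring ?_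
  simpa [Polynomial.monomial_one_right_eq_X_pow] using h n

theorem coeff_opT_X_pow (g : PowerSeries R) (n i : ℕ) :
    (opT g (X ^ n)).coeff i = if i ≤ n then PowerSeries.coeff (n - i) g else 0 := by
  rw [opT_X_pow, Polynomial.finsetSum_coeff]
  simp only [Polynomial.coeff_C_mul, Polynomial.coeff_X_pow]
  split_ifs with h
  · rw [Finset.sum_eq_single (n - i, i)]
    · simp
    · rintro ⟨a, b⟩ hp hne
      have hab : a + b = n := Finset.HasAntidiagonal.mem_antidiagonal.mp hp
      rw [if_neg, mul_zero]
      rintro rfl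
      exact hne (Prod.ext (by simp only; omega) rfl)
    · intro hn
      exact absurd (Finset.HasAntidiagonal.mem_antidiagonal.mpr (by simp only; omega)) hn
  · refine Finset.sum_eq_zero fun p hp => ?_
    have hab : p.1 + p.2 = n := Finset.HasAntidiagonal.mem_antidiagonal.mp hp
    rw [if_neg (by omega), mul_zero]

theorem coeff_opT (g : PowerSeries R) {G : R[X]} {L : ℕ} (hL : G.natDegree < L) (i : ℕ) :
    (opT g G).coeff i =
      ∑ n ∈ Finset.range L, if i ≤ n then PowerSeries.coeff (n - i) g * G.coeff n else 0 := by
  conv_lhs => rw [G.as_sum_range' L hL]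
  rw [map_sum, Polynomial.finsetSum_coeff]
  refine Finset.sum_congr rfl fun n _ => ?_
  have : monomial n (G.coeff n) = G.coeff n • (X ^ n : R[X]) := by
    rw [← Polynomial.C_mul_X_pow_eq_monomial, Polynomial.smul_eq_C_mul]
  rw [this, map_smul, Polynomial.coeff_smul, coeff_opT_X_pow, smul_eq_mul]
  split_ifs <;> ring

theorem opT_mul (g h : PowerSeries R) (G : R[X]) : opT (g * h) G = opT g (opT h G) := by
  suffices opT (g * h) = (opT g).comp (opT h) from LinearMap.congr_fun this G
  refine linearMap_ext_X_pow fun n => ?_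
  rw [LinearMap.comp_apply, opT_X_pow h, map_sum, opT_X_pow]
  simp only [← Polynomial.smul_eq_C_mul, map_smul, opT_X_pow, PowerSeries.coeff_mul, Finset.smul_sum,
    Finset.sum_smul, smul_smul]
  rw [Finset.sum_sigma', Finset.sum_sigma']
  refine Finset.sum_bij' (fun x _ => ⟨(x.2.2, x.2.1 + x.1.2), (x.2.1, x.1.2)⟩)
    (fun x _ => ⟨(x.2.1 + x.1.1, x.2.2), (x.2.1, x.1.1)⟩) ?_ ?_ ?_ ?_ ?_
  · rintro ⟨⟨a, b⟩, ⟨c, d⟩⟩ hx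
    simp only [Finset.mem_sigma, Finset.HasAntidiagonal.mem_antidiagonal] at hx ⊢
    exact ⟨by omega, trivial⟩
  · rintro ⟨⟨a, b⟩, ⟨c, d⟩⟩ hx
    simp only [Finset.mem_sigma, Finset.HasAntidiagonal.mem_antidiagonal] at hx ⊢
    exact ⟨by omega, trivial⟩
  · rintro ⟨⟨a, b⟩, ⟨c, d⟩⟩ hx
    simp only [Finset.mem_sigma, Finset.HasAntidiagonal.mem_antidiagonal] at hx
    obtain ⟨-, rfl⟩ := hx
    rfl
  · rintro ⟨⟨a, b⟩, ⟨c, d⟩⟩ hx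
    simp only [Finset.mem_sigma, Finset.HasAntidiagonal.mem_antidiagonal] at hx
    obtain ⟨-, rfl⟩ := hx
    rfl
  · rintro ⟨⟨a, b⟩, ⟨c, d⟩⟩ _
    rw [mul_comm]

theorem opT_one (G : R[X]) : opT (1 : PowerSeries R) G = G := by
  ext i
  rw [coeff_opT 1 (lt_add_one G.natDegree)]
  simp only [PowerSeries.coeff_one, ite_mul, one_mul, zero_mul]
  by_cases h : i ∈ Finset.range (G.natDegree + 1)
  · rw [Finset.sum_eq_single_of_mem i h]
    · simp
    · intro n _ hn
      split_ifs <;> first | rfl | omega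
  · rw [Polynomial.coeff_eq_zero_of_natDegree_lt (by simpa [Nat.lt_succ_iff] using h)]
    refine Finset.sum_eq_zero fun n hn => ?_
    rw [Finset.mem_range] at h hn
    rw [if_neg (by omega)]

/-- If `w` is a polynomial of degree at most `k`, then `opT w` commutes with the multiplication by
polynomials on the multiples of `z^k`. -/
theorem opT_mul_X_pow {w : PowerSeries R} {k : ℕ} (hw : ∀ e, k < e → PowerSeries.coeff e w = 0)
    {j : ℕ} (hj : k ≤ j) (A : R[X]) : opT w (A * X ^ j) = A * opT w (X ^ j) := by
  suffices h : (opT w).comp (LinearMap.mulRight R (X ^ j)) =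
      LinearMap.mulRight R (opT w (X ^ j)) from LinearMap.congr_fun h A
  refine linearMap_ext_X_pow fun n => ?_
  rw [LinearMap.comp_apply, LinearMap.mulRight_apply, LinearMap.mulRight_apply, ← pow_add]
  ext i
  rw [coeff_opT_X_pow, Polynomial.coeff_X_pow_mul', coeff_opT_X_pow]
  by_cases h1 : n ≤ i
  · rw [if_pos h1]
    by_cases h2 : i ≤ n + j
    · rw [if_pos h2, if_pos (by omega)]
      congr 2
      omega
    · rw [if_neg h2, if_neg (by omega)]
  · rw [if_neg h1, if_pos (by omega), hw _ (by omega)]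

theorem coeff_zero_opT_geom (y : R) (G : R[X]) :
    (opT (PowerSeries.mk fun n => y ^ n) G).coeff 0 = G.eval y := by
  rw [coeff_opT _ (lt_add_one G.natDegree), Polynomial.eval_eq_sum_range]
  refine Finset.sum_congr rfl fun n _ => ?_
  rw [if_pos (Nat.zero_le n), PowerSeries.coeff_mk, Nat.sub_zero, mul_comm]

variable {k : ℕ} (y : Fin k → R)

/-- The polynomial `∏_j (1 - y_j X)`. -/
def revPoly : R[X] := ∏ j, (1 - C (y j) * X)

/-- The polynomial `∏_{m ≠ l} (1 - y_m X)`. -/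
def revPolyErase (l : Fin k) : R[X] := ∏ m ∈ Finset.univ.erase l, (1 - C (y m) * X)

theorem natDegree_one_sub_le (c : R) : (1 - C c * X : R[X]).natDegree ≤ 1 := by
  compute_degree

theorem natDegree_revPoly_le : (revPoly y).natDegree ≤ k := by
  refine (Polynomial.natDegree_prod_le _ _).trans ?_
  refine (Finset.sum_le_sum fun i _ => natDegree_one_sub_le (y i)).trans ?_
  simp

theorem natDegree_revPolyErase_lt (l : Fin k) : (revPolyErase y l).natDegree < k := by
  refine lt_of_le_of_lt (Polynomial.natDegree_prod_le _ _) ?_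
  refine lt_of_le_of_lt (Finset.sum_le_sum fun i _ => natDegree_one_sub_le (y i)) ?_
  have := l.pos
  rw [Finset.sum_const, Finset.card_erase_of_mem (Finset.mem_univ l), Finset.card_univ,
    Fintype.card_fin]
  simp only [smul_eq_mul, mul_one]
  omega

theorem revPolyErase_mul (l : Fin k) : revPolyErase y l * (1 - C (y l) * X) = revPoly y :=
  Finset.prod_erase_mul _ _ (Finset.mem_univ l)

/-- The matrix with entries `coeff_i ∏_{m ≠ l} (1 - y_m X) = (-1)^i e_i(y without y_l)`. -/
def esymMatrix : Matrix (Fin k) (Fin k) R := Matrix.of fun i l => (revPolyErase y l).coeff i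

theorem geom_mul (c : R) : (PowerSeries.mk fun n => c ^ n) * (1 - PowerSeries.C c * PowerSeries.X) = 1 := by
  ext n
  rw [mul_sub, mul_one, map_sub, mul_comm (PowerSeries.C c), ← mul_assoc]
  cases n with
  | zero => simp
  | succ n =>
    rw [PowerSeries.coeff_mul_C, PowerSeries.coeff_succ_mul_X, PowerSeries.coeff_mk, PowerSeries.coeff_mk,
      PowerSeries.coeff_one, if_neg (Nat.succ_ne_zero n), pow_succ, sub_self]

variable {l : ℕ} {u : PowerSeries R} (hu : u * (revPoly y : PowerSeries R) = 1) (A : R[X])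

include hu in
theorem geom_mul_revPoly (i : Fin k) :
    (PowerSeries.mk fun n => y i ^ n) * (revPoly y : PowerSeries R) = revPolyErase y i ∧
    (revPolyErase y i : PowerSeries R) * u = PowerSeries.mk fun n => y i ^ n := by
  have h1 : (PowerSeries.mk fun n => y i ^ n) * (revPoly y : PowerSeries R) = revPolyErase y i := by
    rw [← revPolyErase_mul y i]
    push_cast
    rw [mul_left_comm, geom_mul, mul_one]
  refine ⟨h1, ?_⟩
  rw [← h1, mul_assoc, mul_comm _ u, hu, mul_one]

include hu in
/-- The rows of the transpose of `esymMatrix` are eigenvectors. -/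
theorem sum_revPolyErase_mul (a : Fin k) (j : ℕ) :
    ∑ i : Fin k, (revPolyErase y a).coeff i *
      (opT u (A * opT (revPoly y : PowerSeries R) (X ^ j))).coeff i =
      A.eval (y a) * (revPolyErase y a).coeff j := by
  have h0 : ∀ G : R[X], (opT (revPolyErase y a : PowerSeries R) G).coeff 0 =
      ∑ i : Fin k, (revPolyErase y a).coeff i * G.coeff i := fun G => by
    rw [coeff_opT _ (L := max k (G.natDegree + 1)) (by omega)]
    rw [← Finset.sum_subset (Finset.range_subset_range.mpr (le_max_left k (G.natDegree + 1)))]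
    · rw [Finset.sum_range]
      simp
    · intro n _ hn
      rw [Finset.mem_range, not_lt] at hn
      have := natDegree_revPolyErase_lt y a
      simp only [Nat.zero_le, if_true, Nat.sub_zero, Polynomial.coeff_coe]
      rw [Polynomial.coeff_eq_zero_of_natDegree_lt (by omega), zero_mul]
  rw [← h0, ← opT_mul, (geom_mul_revPoly y hu a).2, coeff_zero_opT_geom, Polynomial.eval_mul,
    ← coeff_zero_opT_geom (y a) (opT _ _), ← opT_mul, (geom_mul_revPoly y hu a).1, coeff_opT_X_pow,
    if_pos (Nat.zero_le j), Nat.sub_zero, Polynomial.coeff_coe]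

include hu in
/-- Let `w = ∏_j (1 - y_j z)`. The matrix `B` on the left is that of the Toeplitz operator with symbol
`w(s/z) w(1/z)⁻¹ A(z)`, multiplied by `S = diag(s^i)`. It factors as `W S C₀` with the Toeplitz
matrices `W` of `w(1/z)` and `C₀` of `w(1/z)⁻¹ A(z)`, because `S` intertwines `w(s/z)` and `w(1/z)`.
Since `det (1 + X W S C₀) = det (1 + X S C₀ W)`, only `D = C₀ W` matters. As `w` has degree at most
`k`, the columns of `D` from the `k`-th on are those of the multiplication by `A`, so that
`1 + X S D` is block triangular. Its lower block has determinant `∏_m (1 + X s^{k+m})`, and the upper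
block of `D` is diagonalized by `esymMatrix y`, with eigenvalues `A(y_l)`. -/
theorem toeplitz_det {s : R} (hs : s ^ (k + l) = 0) (hA : A.coeff 0 = 1) :
    C (esymMatrix y).det * (1 + (X : R[X]) • (Matrix.of fun i j : Fin (k + l) => s ^ (i : ℕ) *
      (opT (PowerSeries.rescale s (revPoly y : PowerSeries R) * u) (A * X ^ (j : ℕ))).coeff i).map
        C).det =
      (Matrix.of fun a i : Fin k => C (esymMatrix y i a) *
        (1 + X * C (A.eval (y a) * s ^ (i : ℕ)))).det * ∏ m : Fin l, (1 + X * C (s ^ (k + (m : ℕ)))) := by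
  classical
  set w : PowerSeries R := (revPoly y : PowerSeries R) with hw
  have hwk : ∀ e, k < e → PowerSeries.coeff e w = 0 := fun e he => by
    rw [hw, Polynomial.coeff_coe, Polynomial.coeff_eq_zero_of_natDegree_lt]
    exact lt_of_le_of_lt (natDegree_revPoly_le y) he
  -- the finite sections of the Toeplitz operators of `w(1/z)` and of `w(1/z)⁻¹ A(z)`
  let W : Matrix (Fin (k + l)) (Fin (k + l)) R :=
    Matrix.of fun i j => if (i : ℕ) ≤ j then PowerSeries.coeff ((j : ℕ) - i) w else 0
  let S : Matrix (Fin (k + l)) (Fin (k + l)) R := Matrix.diagonal fun i => s ^ (i : ℕ)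
  let C0 : Matrix (Fin (k + l)) (Fin (k + l)) R :=
    Matrix.of fun i j => (opT u (A * X ^ (j : ℕ))).coeff i
  let D : Matrix (Fin (k + l)) (Fin (k + l)) R :=
    Matrix.of fun i j => (opT u (A * opT w (X ^ (j : ℕ)))).coeff i
  have hB : (Matrix.of fun i j : Fin (k + l) => s ^ (i : ℕ) *
      (opT (PowerSeries.rescale s w * u) (A * X ^ (j : ℕ))).coeff i) = W * (S * C0) := by
    ext i j
    set G := opT u (A * X ^ (j : ℕ)) with hG
    rw [Matrix.of_apply, opT_mul, ← hG,
      coeff_opT _ (L := max (k + l) (G.natDegree + 1)) (by omega), Finset.mul_sum,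
      ← Finset.sum_subset (Finset.range_subset_range.mpr (le_max_left (k + l) (G.natDegree + 1))),
      Finset.sum_range, Matrix.mul_apply]
    · refine Finset.sum_congr rfl fun m _ => ?_
      simp only [W, S, C0, Matrix.diagonal_mul, Matrix.of_apply, ← hG, PowerSeries.coeff_rescale]
      split_ifs with him
      · have : s ^ (m : ℕ) = s ^ (i : ℕ) * s ^ ((m : ℕ) - i) := by
          rw [← pow_add]
          congr 1
          omega
        rw [this]
        ring
      · rw [mul_zero, zero_mul]
    · intro m _ hm
      rw [Finset.mem_range, not_lt] at hm
      split_ifs with him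
      · have : s ^ (i : ℕ) * s ^ (m - i) = 0 := by
          rw [← pow_add, show (i : ℕ) + (m - i) = k + l + (m - (k + l)) by omega, pow_add, hs,
            zero_mul]
        rw [PowerSeries.coeff_rescale]
        linear_combination (PowerSeries.coeff (m - i) w * G.coeff m) * this
      · rw [mul_zero]
  have hD : C0 * W = D := by
    ext i j
    have h1 : opT w (X ^ (j : ℕ)) = ∑ m : Fin (k + l), W m j • (X ^ (m : ℕ) : R[X]) := by
      ext i'
      rw [coeff_opT_X_pow, Polynomial.finsetSum_coeff]
      simp only [Polynomial.coeff_smul, Polynomial.coeff_X_pow, smul_eq_mul, mul_ite, mul_one,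
        mul_zero]
      by_cases hi' : i' < k + l
      · rw [Finset.sum_eq_single ⟨i', hi'⟩]
        · rw [if_pos rfl]
          rfl
        · intro m _ hm
          rw [if_neg]
          rintro rfl
          exact hm rfl
        · intro h
          exact absurd (Finset.mem_univ _) h
      · rw [if_neg (by have := j.isLt; omega)]
        refine (Finset.sum_eq_zero fun m _ => if_neg ?_).symm
        have := m.isLt
        omega
    simp only [D, Matrix.of_apply, Matrix.mul_apply, C0]
    rw [h1, Finset.mul_sum, map_sum, Polynomial.finsetSum_coeff]
    refine Finset.sum_congr rfl fun m _ => ?_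
    rw [mul_smul_comm, map_smul, Polynomial.coeff_smul, smul_eq_mul, mul_comm]
  -- the columns from the `k`-th on
  have hDge : ∀ i j : Fin (k + l), k ≤ (j : ℕ) →
      D i j = if (j : ℕ) ≤ i then A.coeff (i - j) else 0 := fun i j hj => by
    simp only [D, Matrix.of_apply]
    rw [← opT_mul_X_pow hwk hj, ← opT_mul, hu, opT_one, Polynomial.coeff_mul_X_pow']
  rw [hB]
  have hmap : (X : R[X]) • (W * (S * C0)).map C = ((X : R[X]) • W.map C) * (S * C0).map C := by
    rw [Matrix.map_mul, Matrix.smul_mul]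
  have hmap' : (S * C0).map C * ((X : R[X]) • W.map C) = (X : R[X]) • (S * D).map C := by
    rw [Matrix.mul_smul, ← Matrix.map_mul, Matrix.mul_assoc, hD]
  rw [hmap, Matrix.det_one_add_mul_comm, hmap', ← Matrix.det_submatrix_equiv_self finSumFinEquiv]
  have hent : ∀ i j : Fin (k + l), (1 + (X : R[X]) • (S * D).map C) i j =
      (if i = j then 1 else 0) + X * C (s ^ (i : ℕ) * D i j) := fun i j => by
    rw [Matrix.add_apply, Matrix.smul_apply, Matrix.map_apply, Matrix.one_apply, smul_eq_mul]
    simp only [S, Matrix.diagonal_mul]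
  set N := (1 + (X : R[X]) • (S * D).map C).submatrix finSumFinEquiv finSumFinEquiv with hN
  have h12 : N.toBlocks₁₂ = 0 := by
    ext1 i j
    rw [Matrix.toBlocks₁₂, Matrix.of_apply, hN, Matrix.submatrix_apply, hent, if_neg, hDge, if_neg]
    · simp
    · simp
      omega
    · simp
    · intro h
      have := congrArg Fin.val h
      simp at this
      omega
  rw [← Matrix.fromBlocks_toBlocks N, h12, Matrix.det_fromBlocks_zero₁₂]
  have h22 : N.toBlocks₂₂.det = ∏ m : Fin l, (1 + X * C (s ^ (k + (m : ℕ)))) := by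
    rw [Matrix.det_of_isLowerTriangular]
    · refine Finset.prod_congr rfl fun m _ => ?_
      rw [Matrix.toBlocks₂₂, Matrix.of_apply, hN, Matrix.submatrix_apply, hent, if_pos rfl, hDge]
      · simp [hA]
      · simp
    · intro i j hij
      have hij' : (i : ℕ) < j := hij
      rw [Matrix.toBlocks₂₂, Matrix.of_apply, hN, Matrix.submatrix_apply, hent, hDge, if_neg, if_neg]
      · simp
      · simp
        omega
      · intro h
        have := congrArg Fin.val h
        simp at this
        omega
      · simp
  -- `esymMatrix` diagonalizes the upper left block of `D`
  have h11 : C (esymMatrix y).det * N.toBlocks₁₁.det = (Matrix.of fun a i : Fin k =>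
      C (esymMatrix y i a) * (1 + X * C (A.eval (y a) * s ^ (i : ℕ)))).det := by
    let D1 : Matrix (Fin k) (Fin k) R := Matrix.of fun i j => D (Fin.castAdd l i) (Fin.castAdd l j)
    let S1 : Matrix (Fin k) (Fin k) R := Matrix.diagonal fun i => s ^ (i : ℕ)
    have h3 : N.toBlocks₁₁ = 1 + S1.map C * ((X : R[X]) • D1.map C) := by
      ext1 i j
      rw [Matrix.toBlocks₁₁, Matrix.of_apply, hN, Matrix.submatrix_apply, hent, Matrix.mul_smul,
        ← Matrix.map_mul, Matrix.add_apply, Matrix.smul_apply, Matrix.map_apply, Matrix.one_apply,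
        smul_eq_mul]
      simp only [S1, D1, Matrix.diagonal_mul, Matrix.of_apply, finSumFinEquiv_apply_left,
        Fin.val_castAdd, Fin.castAdd_inj]
    have h4 : (esymMatrix y).transpose * D1 = Matrix.diagonal (fun a => A.eval (y a)) * (esymMatrix y).transpose := by
      ext a j
      rw [Matrix.mul_apply, Matrix.diagonal_mul]
      exact sum_revPolyErase_mul y hu A a j
    have h5 : C (esymMatrix y).det = ((esymMatrix y).transpose.map C).det := by
      rw [← Matrix.det_transpose, RingHom.map_det]
      rfl
    rw [h3, Matrix.det_one_add_mul_comm, h5, ← Matrix.det_mul]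
    congr 1
    rw [Matrix.mul_add, Matrix.mul_one, Matrix.smul_mul, Matrix.mul_smul, ← Matrix.map_mul,
      ← Matrix.map_mul, ← Matrix.mul_assoc, h4]
    ext1 a i
    rw [Matrix.add_apply, Matrix.smul_apply, Matrix.map_apply, Matrix.map_apply, Matrix.mul_assoc,
      Matrix.diagonal_mul, Matrix.mul_diagonal, Matrix.transpose_apply, Matrix.of_apply, smul_eq_mul]
    simp only [map_mul]
    ring
  rw [← mul_assoc, h11, h22]

end Toeplitz

/-! ### Sums of principal minors -/

section Minors

open Polynomial

variable {R : Type*} [CommRing R]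

/-- The non-injective maps do not contribute, and each principal minor of size `r` is counted `r!`
times. -/
theorem sum_det_submatrix {n : Type*} [Fintype n] [DecidableEq n] (r : ℕ) (B : Matrix n n R) :
    ∑ g : Fin r → n, (B.submatrix g g).det =
      (r ! : R) * (1 + (X : R[X]) • B.map C).det.coeff r := by
  classical
  rw [Matrix.coeff_det_one_add_X_smul_eq_sum_minors, Finset.mul_sum]
  have h0 : ∑ g : Fin r → n, (B.submatrix g g).det =
      ∑ g ∈ Finset.univ.filter (fun g : Fin r → n => Function.Injective g), (B.submatrix g g).det := by
    symm
    refine Finset.sum_subset (Finset.subset_univ _) fun g _ hg => ?_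
    have hg : ¬ Function.Injective g := fun h => hg (Finset.mem_filter.mpr ⟨Finset.mem_univ _, h⟩)
    simp only [Function.Injective, not_forall] at hg
    obtain ⟨i, j, hij, hne⟩ := hg
    exact Matrix.det_zero_of_row_eq hne (by funext a; simp [hij])
  rw [h0, ← Finset.sum_fiberwise_of_maps_to (t := Finset.univ.powersetCard r)
    (g := fun g : Fin r → n => Finset.univ.image g)]
  · refine Finset.sum_congr rfl fun s hs => ?_
    have hs' := (Finset.mem_powersetCard.mp hs).2
    have hcard : Fintype.card (Fin r ≃ s) = r ! := by
      rw [Fintype.card_equiv (Fintype.equivOfCardEq (by simp [hs'])), Fintype.card_fin]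
    rw [← hcard, ← nsmul_eq_mul, ← Finset.card_univ, ← Finset.sum_const]
    symm
    refine Finset.sum_bij (fun e _ => fun a => ((e a : s) : n)) ?_ ?_ ?_ ?_
    · intro e _
      simp only [Finset.mem_filter, Finset.mem_univ, true_and]
      refine ⟨fun a b h => e.injective (Subtype.ext h), ?_⟩
      ext x
      simp only [Finset.mem_image, Finset.mem_univ, true_and]
      exact ⟨fun ⟨a, ha⟩ => ha ▸ (e a).2, fun hx => ⟨e.symm ⟨x, hx⟩, by simp⟩⟩
    · intro e _ e' _ h
      ext a
      exact congrFun h a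
    · intro g hg
      simp only [Finset.mem_filter, Finset.mem_univ, true_and] at hg
      obtain ⟨hinj, him⟩ := hg
      have hmem : ∀ a, g a ∈ s := fun a => him ▸ Finset.mem_image_of_mem _ (Finset.mem_univ a)
      refine ⟨Equiv.ofBijective (fun a => (⟨g a, hmem a⟩ : s)) ⟨fun a b h => ?_, ?_⟩,
        Finset.mem_univ _, rfl⟩
      · exact hinj (congrArg Subtype.val h)
      · rintro ⟨x, hx⟩
        rw [← him] at hx
        obtain ⟨a, -, rfl⟩ := Finset.mem_image.mp hx
        exact ⟨a, rfl⟩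
    · intro e _
      rw [← Matrix.det_submatrix_equiv_self e, Matrix.submatrix_submatrix]
      rfl
  · intro g hg
    simp only [Finset.mem_filter, Finset.mem_univ, true_and] at hg
    rw [Finset.mem_powersetCard]
    exact ⟨Finset.subset_univ _, by rw [Finset.card_image_of_injective _ hg, Finset.card_fin]⟩

variable {k : ℕ}

/-- The determinant of the matrix `esymMatrix y` in which the rows of the columns `l ∈ I` are
multiplied by the powers of `s`. -/
def detShift (y : Fin k → R) (s : R) (I : Finset (Fin k)) : R :=
  (Matrix.of fun a i : Fin k => esymMatrix y i a * if a ∈ I then s ^ (i : ℕ) else 1).det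

theorem esymMatrix_map {S : Type*} [CommRing S] (f : R →+* S) (y : Fin k → R) (i a : Fin k) :
    esymMatrix (f ∘ y) i a = f (esymMatrix y i a) := by
  simp only [esymMatrix, Matrix.of_apply, revPolyErase]
  rw [← Polynomial.coeff_map, Polynomial.map_prod]
  simp [Polynomial.map_sub]

theorem det_esymMatrix_map {S : Type*} [CommRing S] (f : R →+* S) (y : Fin k → R) :
    (esymMatrix (f ∘ y)).det = f (esymMatrix y).det := by
  rw [RingHom.map_det]
  congr 1
  ext i a
  exact esymMatrix_map f y i a

theorem detShift_map {S : Type*} [CommRing S] (f : R →+* S) (y : Fin k → R) (s : R)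
    (I : Finset (Fin k)) : detShift (f ∘ y) (f s) I = f (detShift y s I) := by
  rw [detShift, detShift, RingHom.map_det]
  congr 1
  ext a i
  simp only [Matrix.of_apply, RingHom.mapMatrix_apply, Matrix.map_apply, esymMatrix_map, map_mul]
  split_ifs <;> simp

/-- Expansion of the determinant by rows. -/
theorem det_one_add_X_mul (F : Matrix (Fin k) (Fin k) R) (c : Fin k → R) (s : R) :
    (Matrix.of fun a i : Fin k => C (F i a) * (1 + X * C (c a * s ^ (i : ℕ)))).det =
      ∑ I : Finset (Fin k), C ((∏ a ∈ I, c a) *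
        (Matrix.of fun a i : Fin k => F i a * if a ∈ I then s ^ (i : ℕ) else 1).det) * X ^ I.card := by
  classical
  rw [← Matrix.det_transpose, Matrix.det_apply]
  have h1 : ∀ I : Finset (Fin k), C ((∏ a ∈ I, c a) *
      (Matrix.of fun a i : Fin k => F i a * if a ∈ I then s ^ (i : ℕ) else 1).det) * X ^ I.card =
      ∑ σ : Equiv.Perm (Fin k), (Equiv.Perm.sign σ : ℤ) • ((∏ a, C (F (σ a) a)) *
        ∏ a ∈ I, X * C (c a * s ^ (σ a : ℕ))) := fun I => by
    rw [← Matrix.det_transpose, Matrix.det_apply, Finset.mul_sum, map_sum, Finset.sum_mul]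
    refine Finset.sum_congr rfl fun σ _ => ?_
    simp only [Matrix.transpose_apply, Matrix.of_apply, Units.smul_def, Finset.prod_mul_distrib,
      Finset.prod_ite_mem, Finset.univ_inter, zsmul_eq_mul, map_mul, map_intCast, map_prod,
      Finset.prod_const]
    ring
  rw [Finset.sum_congr rfl fun I _ => h1 I, Finset.sum_comm]
  refine Finset.sum_congr rfl fun σ _ => ?_
  rw [Units.smul_def, ← Finset.smul_sum]
  simp only [Matrix.transpose_apply, Matrix.of_apply]
  rw [Finset.prod_mul_distrib, Finset.prod_one_add, Finset.mul_sum, Finset.powerset_univ]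

/-- The recursion for the coefficients of `G(X) = ∏_m (1 + s^{k+m} X)`: since `s^{k+l} = 0`, the
product satisfies `G(X) = (1 + s^k X) G(s X)`. -/
theorem coeff_prod_one_add {l : ℕ} {s : R} (hs : s ^ (k + l) = 0) :
    (∏ m : Fin l, (1 + X * C (s ^ (k + (m : ℕ)))) : R[X]).coeff 0 = 1 ∧
    ∀ j, (1 - s ^ (j + 1)) * (∏ m : Fin l, (1 + X * C (s ^ (k + (m : ℕ)))) : R[X]).coeff (j + 1) =
      s ^ (k + j) * (∏ m : Fin l, (1 + X * C (s ^ (k + (m : ℕ)))) : R[X]).coeff j := by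
  have hr := Finset.prod_range (n := l) fun m => (1 + X * C (s ^ (k + m)) : R[X])
  rw [← hr]
  set G := ∏ m ∈ Finset.range l, (1 + X * C (s ^ (k + m)) : R[X]) with hG
  have h1 : (1 + X * C (s ^ k)) * G.comp (C s * X) = G := by
    have h2 := Finset.prod_range_succ (fun m => (1 + X * C (s ^ (k + m)) : R[X])) l
    rw [Finset.prod_range_succ', hs, map_zero, mul_zero, add_zero, add_zero, mul_one, ← hG] at h2
    refine Eq.trans ?_ h2
    rw [mul_comm, hG, Polynomial.prod_comp]
    congr 1
    refine Finset.prod_congr rfl fun m _ => ?_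
    simp only [add_comp, one_comp, mul_comp, X_comp, C_comp, ← add_assoc, pow_succ, map_mul]
    ring
  refine ⟨?_, fun j => ?_⟩
  · rw [Polynomial.coeff_zero_eq_eval_zero, hG, Polynomial.eval_prod]
    simp
  · have h2 := congrArg (fun p => Polynomial.coeff p (j + 1)) h1
    simp only [add_mul, one_mul, Polynomial.coeff_add, mul_assoc, Polynomial.coeff_X_mul,
      Polynomial.coeff_C_mul, Polynomial.comp_C_mul_X_coeff] at h2
    rw [pow_add]
    linear_combination -h2

end Minors

/-! ### The elementary symmetric functions of a geometric progression -/

section Tau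

/-- The elementary symmetric function `e_m(s^k, s^{k+1}, …)` as a power series in `s`. -/
def tauSeries (k : ℕ) : ℕ → PowerSeries ℝ
  | 0 => 1
  | m + 1 => PowerSeries.X ^ (k + m) * tauSeries k m * (1 - PowerSeries.X ^ (m + 1))⁻¹

/-- The value of the rational function `e_m(s^k, s^{k+1}, …)` of `s`. -/
def tauValue (s : ℝ) (k : ℕ) : ℕ → ℝ
  | 0 => 1
  | m + 1 => s ^ (k + m) * tauValue s k m / (1 - s ^ (m + 1))

theorem tauSeries_succ (k m : ℕ) : (1 - PowerSeries.X ^ (m + 1)) * tauSeries k (m + 1) =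
    PowerSeries.X ^ (k + m) * tauSeries k m := by
  rw [tauSeries, mul_left_comm, PowerSeries.mul_inv_cancel _ (by simp), mul_one]

theorem hasRatVal_tauSeries {s : ℝ} (hs : 1 < s) (k m : ℕ) :
    HasRatVal s (tauSeries k m) (tauValue s k m) := by
  induction m with
  | zero => simpa [tauSeries, tauValue] using hasRatVal_coe (s₀ := s) 1
  | succ m ih =>
    have h1 : 1 < s ^ (m + 1) := one_lt_pow₀ hs (Nat.succ_ne_zero m)
    have h2 : (1 - Polynomial.X ^ (m + 1) : Polynomial ℝ).eval s ≠ 0 := by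
      simp only [Polynomial.eval_sub, Polynomial.eval_one, Polynomial.eval_pow, Polynomial.eval_X]
      exact (by linarith : 1 - s ^ (m + 1) < 0).ne
    refine HasRatVal.of_mul_eq h2 (g := PowerSeries.X ^ (k + m) * tauSeries k m) ?_ ?_
    · rw [← tauSeries_succ]
      push_cast
      rfl
    · have h3 := (hasRatVal_coe (s₀ := s) (Polynomial.X ^ (k + m))).mul ih
      rw [Polynomial.coe_pow, Polynomial.coe_X] at h3
      convert h3 using 1
      rw [tauValue, Polynomial.eval_pow, Polynomial.eval_X]
      simp only [Polynomial.eval_sub, Polynomial.eval_one, Polynomial.eval_pow,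
        Polynomial.eval_X] at h2 ⊢
      exact div_mul_cancel₀ _ h2

end Tau

/-! ### The Cauchy determinant against a product, in finitely many variables -/

section Base

open Polynomial

variable {k : ℕ} (y : Fin k → ℝ)

/-- The coefficient of `X^a` in `∏_j (1 - s y_j X) / (1 - y_j X)`. -/
def phiCoeff {R : Type*} [CommRing R] [Algebra ℝ R] (s : R) (a : ℕ) : R :=
  ∑ p ∈ Finset.HasAntidiagonal.antidiagonal a, s ^ p.1 *
    algebraMap ℝ R ((revPoly y).coeff p.1 * PowerSeries.coeff p.2 ((revPoly y : PowerSeries ℝ)⁻¹))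

variable {R S : Type*} [CommRing R] [Algebra ℝ R] [CommRing S] [Algebra ℝ S]

theorem map_phiCoeff (f : R →ₐ[ℝ] S) (s : R) (a : ℕ) : f (phiCoeff y s a) = phiCoeff y (f s) a := by
  simp only [phiCoeff, map_sum, map_mul, map_pow, AlgHom.commutes]

theorem revPoly_map (f : R →+* S) (y : Fin k → R) : revPoly (f ∘ y) = (revPoly y).map f := by
  simp [revPoly, Polynomial.map_prod]

theorem constantCoeff_revPoly : PowerSeries.constantCoeff (revPoly y : PowerSeries ℝ) = 1 := by
  rw [← PowerSeries.coeff_zero_eq_constantCoeff_apply, Polynomial.coeff_coe,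
    Polynomial.coeff_zero_eq_eval_zero, revPoly, Polynomial.eval_prod]
  simp

theorem revPoly_inv_mul :
    (revPoly y : PowerSeries ℝ)⁻¹ * (revPoly y : PowerSeries ℝ) = 1 :=
  PowerSeries.inv_mul_cancel _ (by rw [constantCoeff_revPoly]; exact one_ne_zero)

theorem map_revPoly_inv_mul : PowerSeries.map (algebraMap ℝ R) ((revPoly y : PowerSeries ℝ)⁻¹) *
    (revPoly (algebraMap ℝ R ∘ y) : PowerSeries R) = 1 := by
  have h := congrArg (PowerSeries.map (algebraMap ℝ R)) (revPoly_inv_mul y)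
  rw [map_mul, map_one, ← Polynomial.polynomial_map_coe] at h
  rw [revPoly_map, h]

theorem phiCoeff_eq (s : R) (a : ℕ) : phiCoeff y s a = PowerSeries.coeff a
    (PowerSeries.rescale s (revPoly (algebraMap ℝ R ∘ y) : PowerSeries R) *
      PowerSeries.map (algebraMap ℝ R) ((revPoly y : PowerSeries ℝ)⁻¹)) := by
  rw [PowerSeries.coeff_mul, phiCoeff]
  refine Finset.sum_congr rfl fun p _ => ?_
  rw [PowerSeries.coeff_rescale, PowerSeries.coeff_map, revPoly_map, Polynomial.coeff_coe,
    Polynomial.coeff_map, map_mul, mul_assoc]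

theorem coeff_opT_phi (s : R) (A : ℝ[X]) {D : ℕ} (hD : A.natDegree ≤ D) (i j : ℕ) :
    (opT (PowerSeries.rescale s (revPoly (algebraMap ℝ R ∘ y) : PowerSeries R) *
      PowerSeries.map (algebraMap ℝ R) ((revPoly y : PowerSeries ℝ)⁻¹))
      (A.map (algebraMap ℝ R) * X ^ j)).coeff i =
    ∑ b ∈ Finset.range (D + 1), algebraMap ℝ R (A.coeff b) *
      if i ≤ b + j then phiCoeff y s (b + j - i) else 0 := by
  have h : A.map (algebraMap ℝ R) * X ^ j =
      ∑ b ∈ Finset.range (D + 1), algebraMap ℝ R (A.coeff b) • (X ^ (b + j) : R[X]) := by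
    conv_lhs => rw [A.as_sum_range' (D + 1) (by omega)]
    rw [Polynomial.map_sum, Finset.sum_mul]
    refine Finset.sum_congr rfl fun b _ => ?_
    rw [Polynomial.map_monomial, ← Polynomial.C_mul_X_pow_eq_monomial, mul_assoc, ← pow_add,
      Polynomial.smul_eq_C_mul]
  rw [h, map_sum, Polynomial.finsetSum_coeff]
  refine Finset.sum_congr rfl fun b _ => ?_
  rw [map_smul, Polynomial.coeff_smul, coeff_opT_X_pow, smul_eq_mul, phiCoeff_eq]

variable {r : ℕ}

/-- For given geometric exponents `g`, at most one choice of the exponents `a` matches. -/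
theorem prod_phiCoeff (s : R) {D N : ℕ} (hN : r * D < N) (σ : Equiv.Perm (Fin r)) (g : Fin r → ℕ)
    {b : Fin r → ℕ} (hb : b ∈ Fintype.piFinset fun _ : Fin r => Finset.range (D + 1)) :
    ∏ i, (if g i ≤ b i + g (σ i) then phiCoeff y s (b i + g (σ i) - g i) else 0) =
      ∑ a ∈ Fintype.piFinset fun _ : Fin r => Finset.range N,
        if (∀ i, (g (σ i) : ℤ) - g i = a i - b i) then ∏ i, phiCoeff y s (a i) else 0 := by
  classical
  by_cases h : ∀ i, g i ≤ b i + g (σ i)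
  · rw [Finset.sum_eq_single fun i => b i + g (σ i) - g i]
    · rw [if_pos]
      · exact Finset.prod_congr rfl fun i _ => if_pos (h i)
      · intro i
        have := h i
        show _ = ((b i + g (σ i) - g i : ℕ) : ℤ) - b i
        omega
    · intro a _ hne
      refine if_neg fun h' => hne (funext fun i => ?_)
      have := h' i
      omega
    · intro hn
      refine absurd (Fintype.mem_piFinset.mpr fun i => ?_) hn
      have h1 : ∑ i, (b i + g (σ i) - g i) + ∑ i, g i = ∑ i, b i + ∑ i, g i := by
        have h0 : ∀ i, b i + g (σ i) - g i + g i = b i + g (σ i) := fun i => by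
          have := h i
          omega
        rw [← Finset.sum_add_distrib, Finset.sum_congr rfl fun i _ => h0 i, Finset.sum_add_distrib,
          Equiv.sum_comp σ g]
      have h2 : ∑ i, b i ≤ r * D := by
        refine (Finset.sum_le_sum fun i _ => Nat.lt_succ_iff.mp
          (Finset.mem_range.mp (Fintype.mem_piFinset.mp hb i))).trans ?_
        simp
      have h3 : b i + g (σ i) - g i ≤ ∑ i, (b i + g (σ i) - g i) :=
        Finset.single_le_sum (f := fun i => b i + g (σ i) - g i)
          (fun _ _ => Nat.zero_le _) (Finset.mem_univ i)
      refine Finset.mem_range.mpr (lt_of_le_of_lt h3 ?_)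
      omega
  · push Not at h
    obtain ⟨i, hi⟩ := h
    rw [Finset.prod_eq_zero (Finset.mem_univ i) (if_neg (by omega)), Finset.sum_eq_zero]
    intro a _
    refine if_neg fun h' => ?_
    have := h' i
    omega

/-- Modulo `s^M` only exponents less than `M` contribute. -/
theorem mk_countSeries (K : Set (Fin r → ℕ)) (M : ℕ) :
    Ideal.Quotient.mk (Ideal.span {(PowerSeries.X : PowerSeries ℝ) ^ M}) (countSeries K) =
      open Classical in ∑ g : Fin r → Fin M, if (fun i => (g i : ℕ)) ∈ K then
        Ideal.Quotient.mk (Ideal.span {(PowerSeries.X : PowerSeries ℝ) ^ M}) PowerSeries.X ^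
          (∑ i, (g i : ℕ)) else 0 := by
  classical
  have h : Ideal.Quotient.mk (Ideal.span {(PowerSeries.X : PowerSeries ℝ) ^ M}) (countSeries K) =
      Ideal.Quotient.mk (Ideal.span {(PowerSeries.X : PowerSeries ℝ) ^ M})
        (∑ g : Fin r → Fin M, if (fun i => (g i : ℕ)) ∈ K then
          (PowerSeries.X : PowerSeries ℝ) ^ (∑ i, (g i : ℕ)) else 0) := by
    rw [Ideal.Quotient.eq, Ideal.mem_span_singleton, PowerSeries.X_pow_dvd_iff]
    intro m hm
    rw [map_sub, map_sum, countSeries, PowerSeries.coeff_mk, sub_eq_zero]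
    have h1 : ∀ g : Fin r → Fin M, PowerSeries.coeff m (if (fun i => (g i : ℕ)) ∈ K then
        (PowerSeries.X : PowerSeries ℝ) ^ (∑ i, (g i : ℕ)) else 0) =
        if (fun i => (g i : ℕ)) ∈ K ∧ m = ∑ i, (g i : ℕ) then 1 else 0 := fun g => by
      split_ifs with h2 h3 h3
      · rw [PowerSeries.coeff_X_pow, if_pos h3.2]
      · rw [PowerSeries.coeff_X_pow, if_neg fun h4 => h3 ⟨h2, h4⟩]
      · exact absurd h3.1 h2
      · rw [map_zero]
    rw [Finset.sum_congr rfl fun g _ => h1 g, Finset.sum_boole]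
    congr 1
    symm
    refine Finset.card_bij (fun g _ i => (g i : ℕ)) ?_ ?_ ?_
    · intro g hg
      simp only [Finset.mem_filter, Finset.mem_univ, true_and] at hg
      rw [Finset.mem_filter, mem_piAntidiag_univ]
      exact ⟨hg.2.symm, hg.1⟩
    · intro g _ g' _ h2
      funext i
      exact Fin.ext (congrFun h2 i)
    · intro κ hκ
      rw [Finset.mem_filter, mem_piAntidiag_univ] at hκ
      have h2 : ∀ i, κ i < M := fun i => by
        have := Finset.single_le_sum (f := κ) (fun _ _ => Nat.zero_le _) (Finset.mem_univ i)
        omega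
      refine ⟨fun i => ⟨κ i, h2 i⟩, ?_, rfl⟩
      simp only [Finset.mem_filter, Finset.mem_univ, true_and]
      exact ⟨hκ.2, hκ.1.symm⟩
  rw [h, map_sum]
  refine Finset.sum_congr rfl fun g _ => ?_
  split_ifs
  · rw [map_pow]
  · rw [map_zero]

theorem sum_reverse {ι₁ ι₂ ι₃ ι₄ M : Type*} [AddCommMonoid M] (s₁ : Finset ι₁) (s₂ : Finset ι₂)
    (s₃ : Finset ι₃) (s₄ : Finset ι₄) (T : ι₁ → ι₂ → ι₃ → ι₄ → M) :
    ∑ a ∈ s₁, ∑ b ∈ s₂, ∑ c ∈ s₃, ∑ d ∈ s₄, T a b c d =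
      ∑ d ∈ s₄, ∑ c ∈ s₃, ∑ b ∈ s₂, ∑ a ∈ s₁, T a b c d := by
  have h3 : ∀ a, ∑ b ∈ s₂, ∑ c ∈ s₃, ∑ d ∈ s₄, T a b c d =
      ∑ d ∈ s₄, ∑ c ∈ s₃, ∑ b ∈ s₂, T a b c d := fun a => by
    rw [Finset.sum_comm, Finset.sum_comm (s := s₄)]
    exact Finset.sum_congr rfl fun c _ => Finset.sum_comm
  rw [Finset.sum_congr rfl fun a _ => h3 a, Finset.sum_comm]
  refine Finset.sum_congr rfl fun d _ => ?_
  rw [Finset.sum_comm]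
  exact Finset.sum_congr rfl fun c _ => Finset.sum_comm

/-- The identity behind the difference operators: the Cauchy determinant paired with
`∏_i Φ(z_i) A(1/z_i)`, as an identity of power series in `s`. -/
theorem formal_base (A : ℝ[X]) (hA : A.coeff 0 = 1) {D N : ℕ} (hD : A.natDegree ≤ D)
    (hN : r * D < N) :
    algebraMap ℝ (PowerSeries ℝ) (esymMatrix y).det *
      ∑ a ∈ Fintype.piFinset fun _ : Fin r => Finset.range N,
        ∑ b ∈ Fintype.piFinset fun _ : Fin r => Finset.range (D + 1),
          (∏ i, phiCoeff y (PowerSeries.X : PowerSeries ℝ) (a i)) *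
            algebraMap ℝ (PowerSeries ℝ) (∏ i, A.coeff (b i)) *
              circSeries (fun i => (a i : ℤ) - b i) =
      (r ! : PowerSeries ℝ) * ∑ I : Finset (Fin k) with I.card ≤ r,
        tauSeries k (r - I.card) * (algebraMap ℝ (PowerSeries ℝ) (∏ l ∈ I, A.eval (y l)) *
          detShift (algebraMap ℝ (PowerSeries ℝ) ∘ y) PowerSeries.X I) := by
  classical
  ext n
  -- the coefficient of `s^n` is compared modulo `s^(k + l)`, where the matrices become finite
  set l := n + 1 with hl
  set J := Ideal.span {(PowerSeries.X : PowerSeries ℝ) ^ (k + l)} with hJ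
  suffices h : Ideal.Quotient.mk J (algebraMap ℝ (PowerSeries ℝ) (esymMatrix y).det *
      ∑ a ∈ Fintype.piFinset fun _ : Fin r => Finset.range N,
        ∑ b ∈ Fintype.piFinset fun _ : Fin r => Finset.range (D + 1),
          (∏ i, phiCoeff y (PowerSeries.X : PowerSeries ℝ) (a i)) *
            algebraMap ℝ (PowerSeries ℝ) (∏ i, A.coeff (b i)) *
              circSeries (fun i => (a i : ℤ) - b i)) =
      Ideal.Quotient.mk J ((r ! : PowerSeries ℝ) * ∑ I : Finset (Fin k) with I.card ≤ r,
        tauSeries k (r - I.card) * (algebraMap ℝ (PowerSeries ℝ) (∏ l ∈ I, A.eval (y l)) *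
          detShift (algebraMap ℝ (PowerSeries ℝ) ∘ y) PowerSeries.X I)) by
    rw [Ideal.Quotient.eq, hJ, Ideal.mem_span_singleton, PowerSeries.X_pow_dvd_iff] at h
    have := h n (by omega)
    rwa [map_sub, sub_eq_zero] at this
  let pr : PowerSeries ℝ →ₐ[ℝ] PowerSeries ℝ ⧸ J := Ideal.Quotient.mkₐ ℝ J
  have hpr : ∀ f, Ideal.Quotient.mk J f = pr f := fun f => rfl
  set s := pr PowerSeries.X with hs
  have hs0 : s ^ (k + l) = 0 := by
    rw [hs, ← map_pow, ← hpr, Ideal.Quotient.eq_zero_iff_mem]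
    exact Ideal.mem_span_singleton_self _
  set f := algebraMap ℝ (PowerSeries ℝ ⧸ J) with hf
  have hA' : (A.map f).coeff 0 = 1 := by rw [Polynomial.coeff_map, hA, map_one]
  have hdet := congrArg (fun p => Polynomial.coeff p r)
    (toeplitz_det (f ∘ y) (map_revPoly_inv_mul y) (A.map f) hs0 hA')
  simp only [Polynomial.coeff_C_mul] at hdet
  set B : Matrix (Fin (k + l)) (Fin (k + l)) (PowerSeries ℝ ⧸ J) := Matrix.of fun i j =>
    s ^ (i : ℕ) * ∑ b ∈ Finset.range (D + 1), f (A.coeff b) *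
      if (i : ℕ) ≤ b + j then phiCoeff y s (b + j - i) else 0 with hB
  have hBT : (Matrix.of fun i j : Fin (k + l) => s ^ (i : ℕ) *
      (opT (PowerSeries.rescale s (revPoly (f ∘ y) : PowerSeries (PowerSeries ℝ ⧸ J)) *
        PowerSeries.map f ((revPoly y : PowerSeries ℝ)⁻¹)) (A.map f * X ^ (j : ℕ))).coeff i) = B := by
    ext i j
    exact congrArg (s ^ (i : ℕ) * ·) (coeff_opT_phi y s A hD i j)
  -- the left side is a sum of determinants
  have hL : pr (∑ a ∈ Fintype.piFinset fun _ : Fin r => Finset.range N,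
        ∑ b ∈ Fintype.piFinset fun _ : Fin r => Finset.range (D + 1),
          (∏ i, phiCoeff y (PowerSeries.X : PowerSeries ℝ) (a i)) *
            algebraMap ℝ (PowerSeries ℝ) (∏ i, A.coeff (b i)) *
              circSeries (fun i => (a i : ℤ) - b i)) =
      ∑ g : Fin r → Fin (k + l), (B.submatrix g g).det := by
    have h1 : ∀ g : Fin r → Fin (k + l), (B.submatrix g g).det =
        ∑ σ : Equiv.Perm (Fin r), ∑ b ∈ Fintype.piFinset fun _ : Fin r => Finset.range (D + 1),
          ∑ a ∈ Fintype.piFinset fun _ : Fin r => Finset.range N,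
            (∏ i, phiCoeff y s (a i)) * f (∏ i, A.coeff (b i)) * ((Equiv.Perm.sign σ : ℤ) •
              if (fun i => (g i : ℕ)) ∈ shiftSet σ (fun i => (a i : ℤ) - b i) then
                s ^ (∑ i, (g i : ℕ)) else 0) := fun g => by
      rw [← Matrix.det_transpose, Matrix.det_apply]
      refine Finset.sum_congr rfl fun σ _ => ?_
      simp only [Matrix.transpose_apply, Matrix.submatrix_apply, hB, Matrix.of_apply]
      rw [Finset.prod_mul_distrib, Finset.prod_univ_sum, Finset.prod_pow_eq_pow_sum,
        Units.smul_def, Finset.mul_sum, Finset.smul_sum]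
      refine Finset.sum_congr rfl fun b hb => ?_
      rw [Finset.prod_mul_distrib, prod_phiCoeff y s hN σ (fun i => (g i : ℕ)) hb, Finset.mul_sum,
        Finset.mul_sum, Finset.smul_sum]
      refine Finset.sum_congr rfl fun a _ => ?_
      simp only [mem_shiftSet]
      rw [map_prod]
      split_ifs
      · rw [mul_smul_comm]
        congr 1
        ring
      · simp
    rw [Finset.sum_congr rfl fun g _ => h1 g, sum_reverse, map_sum]
    refine Finset.sum_congr rfl fun a _ => ?_
    rw [map_sum]
    refine Finset.sum_congr rfl fun b _ => ?_
    rw [map_mul, map_mul, map_prod, AlgHom.commutes, circSeries, map_sum, Finset.mul_sum]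
    refine Finset.sum_congr rfl fun σ _ => ?_
    rw [map_zsmul, ← hpr (countSeries _), mk_countSeries, ← Finset.mul_sum, ← Finset.smul_sum]
    simp only [map_phiCoeff]
    rfl
  rw [hpr, hpr, map_mul, hL, sum_det_submatrix, map_mul, map_natCast, AlgHom.commutes,
    mul_left_comm]
  congr 1
  rw [det_esymMatrix_map, hBT] at hdet
  rw [hdet, det_one_add_X_mul, Finset.sum_mul, Polynomial.finsetSum_coeff, map_sum,
    Finset.sum_filter]
  refine Finset.sum_congr rfl fun I _ => ?_
  obtain ⟨hc0, hc⟩ := coeff_prod_one_add hs0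
  have htau : ∀ j, pr (tauSeries k j) =
      (∏ m : Fin l, (1 + X * C (s ^ (k + (m : ℕ)))) : (PowerSeries ℝ ⧸ J)[X]).coeff j := fun j => by
    induction j with
    | zero => rw [hc0, tauSeries, map_one]
    | succ j ih =>
      have hu : IsUnit (1 - s ^ (j + 1)) := by
        refine IsNilpotent.isUnit_one_sub ⟨k + l, ?_⟩
        rw [← pow_mul, mul_comm, pow_mul, hs0, zero_pow (Nat.succ_ne_zero j)]
      refine hu.mul_left_cancel ?_
      rw [hc, ← ih, hs, ← map_pow, ← map_pow, ← map_mul, ← tauSeries_succ, map_mul, map_sub, map_one]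
  rw [mul_assoc, Polynomial.coeff_C_mul, Polynomial.coeff_X_pow_mul']
  split_ifs with hI
  · rw [map_mul, htau, map_mul, AlgHom.commutes, mul_comm]
    congr 2
    · rw [map_prod]
      refine Finset.prod_congr rfl fun a _ => ?_
      rw [Function.comp_apply, Polynomial.eval_map_algebraMap, hf]
      exact Polynomial.aeval_algebraMap_apply_eq_algebraMap_eval _ _
    · have := detShift_map (pr : PowerSeries ℝ →+* PowerSeries ℝ ⧸ J)
        (algebraMap ℝ (PowerSeries ℝ) ∘ y) PowerSeries.X I
      rw [show (pr : PowerSeries ℝ →+* PowerSeries ℝ ⧸ J) ∘ (algebraMap ℝ (PowerSeries ℝ) ∘ y) =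
        f ∘ y from funext fun i => AlgHom.commutes pr (y i)] at this
      exact this
  · rw [mul_zero]

end Base

section Polarize

open Polynomial

variable {k r : ℕ} (y : Fin k → ℝ)

/-- The truncation `∑_{a_i < N} ∏_i φ_{a_i} z_i^{a_i}` of `∏_i Φ(z_i)`. -/
def truncPhi (t : ℝ) (r N : ℕ) : Laurent r :=
  ∑ a ∈ Fintype.piFinset fun _ : Fin r => Finset.range N,
    (∏ i, phiCoeff y t⁻¹ (a i)) • AddMonoidAlgebra.single (fun i => (a i : ℤ)) 1

/-- The homomorphism `X_i ↦ z_i⁻¹`. -/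
def invVars (r : ℕ) : MvPolynomial (Fin r) ℝ →ₐ[ℝ] Laurent r :=
  MvPolynomial.aeval fun i => zPow i (-1)

theorem zPow_pow (i : Fin r) (c : ℤ) (n : ℕ) : zPow i c ^ n = zPow i (n * c) := by
  rw [zPow, AddMonoidAlgebra.single_pow, one_pow, zPow]
  congr 1
  funext j
  simp [Pi.single_apply]

theorem invVars_prod (A : ℝ[X]) {D : ℕ} (hD : A.natDegree ≤ D) :
    invVars r (∏ i, Polynomial.aeval (MvPolynomial.X i) A) =
      ∑ b ∈ Fintype.piFinset fun _ : Fin r => Finset.range (D + 1),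
        (∏ i, A.coeff (b i)) • AddMonoidAlgebra.single (fun i => -(b i : ℤ)) 1 := by
  have h1 : ∀ i : Fin r, invVars r (Polynomial.aeval (MvPolynomial.X i) A) =
      ∑ b ∈ Finset.range (D + 1), A.coeff b • zPow i (b * (-1)) := fun i => by
    rw [Polynomial.aeval_eq_sum_range' (n := D + 1) (by omega), map_sum]
    refine Finset.sum_congr rfl fun b _ => ?_
    rw [map_smul, map_pow, invVars, MvPolynomial.aeval_X, zPow_pow]
  rw [map_prod, Finset.prod_congr rfl fun i _ => h1 i, Finset.prod_univ_sum]
  refine Finset.sum_congr rfl fun b _ => ?_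
  rw [Finset.prod_smul]
  simp only [zPow]
  rw [single_prod]
  congr 2
  funext j
  simp [Finset.sum_apply, Pi.single_apply]

/-- The identity `formal_base` at the value `t⁻¹` of `s`: both sides are expansions of rational
functions without pole there. -/
theorem numeric_base {t : ℝ} (ht : 1 < t⁻¹) (A : ℝ[X]) (hA : A.coeff 0 = 1) {D N : ℕ}
    (hD : A.natDegree ≤ D) (hN : r * D < N) :
    (esymMatrix y).det * circForm t (truncPhi y t r N *
      invVars r (∏ i, Polynomial.aeval (MvPolynomial.X i) A)) =
      (r ! : ℝ) * ∑ I : Finset (Fin k) with I.card ≤ r,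
        tauValue t⁻¹ k (r - I.card) * ((∏ l ∈ I, A.eval (y l)) * detShift y t⁻¹ I) := by
  have hC : ∀ c : ℝ, HasRatVal t⁻¹ (algebraMap ℝ (PowerSeries ℝ) c) c := fun c => by
    have := hasRatVal_coe (s₀ := t⁻¹) (Polynomial.C c)
    rwa [Polynomial.eval_C, Polynomial.coe_C] at this
  have hphi : ∀ a, HasRatVal t⁻¹ (phiCoeff y (PowerSeries.X : PowerSeries ℝ) a)
      (phiCoeff y t⁻¹ a) := fun a => by
    have h := hasRatVal_coe (s₀ := t⁻¹) (phiCoeff y (Polynomial.X : ℝ[X]) a)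
    have h1 : (phiCoeff y (Polynomial.X : ℝ[X]) a).eval t⁻¹ = phiCoeff y t⁻¹ a := by
      have := map_phiCoeff y (Polynomial.aeval t⁻¹ : ℝ[X] →ₐ[ℝ] ℝ) Polynomial.X a
      rwa [Polynomial.aeval_X, Polynomial.coe_aeval_eq_eval] at this
    have h2 : ((phiCoeff y (Polynomial.X : ℝ[X]) a : ℝ[X]) : PowerSeries ℝ) =
        phiCoeff y PowerSeries.X a := by
      have := map_phiCoeff y (Polynomial.coeToPowerSeries.algHom ℝ : ℝ[X] →ₐ[ℝ] PowerSeries ℝ)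
        Polynomial.X a
      simpa using this
    rwa [h1, h2] at h
  have hprod : ∀ (s : Finset (Fin r)) (a : Fin r → ℕ), HasRatVal t⁻¹
      (∏ i ∈ s, phiCoeff y (PowerSeries.X : PowerSeries ℝ) (a i))
      (∏ i ∈ s, phiCoeff y t⁻¹ (a i)) := fun s a => by
    classical
    induction s using Finset.induction_on with
    | empty => simpa using hC 1
    | insert i s hi ih =>
      rw [Finset.prod_insert hi, Finset.prod_insert hi]
      exact (hphi _).mul ih
  have hdet : ∀ I : Finset (Fin k), HasRatVal t⁻¹
      (detShift (algebraMap ℝ (PowerSeries ℝ) ∘ y) PowerSeries.X I) (detShift y t⁻¹ I) := fun I => by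
    have h := hasRatVal_coe (s₀ := t⁻¹) (detShift (Polynomial.C ∘ y) (Polynomial.X : ℝ[X]) I)
    have h1 : (detShift (Polynomial.C ∘ y) (Polynomial.X : ℝ[X]) I).eval t⁻¹ = detShift y t⁻¹ I := by
      have := detShift_map (Polynomial.evalRingHom t⁻¹) (Polynomial.C ∘ y) Polynomial.X I
      rw [Polynomial.coe_evalRingHom, Polynomial.eval_X] at this
      rw [← this]
      congr 1
      funext i
      simp
    have h2 : ((detShift (Polynomial.C ∘ y) (Polynomial.X : ℝ[X]) I : ℝ[X]) : PowerSeries ℝ) =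
        detShift (algebraMap ℝ (PowerSeries ℝ) ∘ y) PowerSeries.X I := by
      have := detShift_map (Polynomial.coeToPowerSeries.ringHom : ℝ[X] →+* PowerSeries ℝ)
        (Polynomial.C ∘ y) Polynomial.X I
      simp only [Polynomial.coeToPowerSeries.ringHom_apply, Polynomial.coe_X] at this
      rw [← this]
      congr 1
      funext i
      simp
    rwa [h1, h2] at h
  have hR := ((hC (r ! : ℝ)).mul (HasRatVal.sum fun I (_ : I ∈ Finset.univ.filter
    fun I : Finset (Fin k) => I.card ≤ r) => (hasRatVal_tauSeries ht k (r - I.card)).mul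
      ((hC (∏ l ∈ I, A.eval (y l))).mul (hdet I))))
  have hL := (hC (esymMatrix y).det).mul
    (HasRatVal.sum fun a (_ : a ∈ Fintype.piFinset fun _ : Fin r => Finset.range N) =>
      HasRatVal.sum fun b (_ : b ∈ Fintype.piFinset fun _ : Fin r => Finset.range (D + 1)) =>
        ((hprod Finset.univ a).mul (hC (∏ i, A.coeff (b i)))).mul
          (hasRatVal_circSeries ht fun i => (a i : ℤ) - b i))
  rw [formal_base y A hA hD hN] at hL
  rw [map_natCast] at hR
  rw [← hL.unique hR, truncPhi, invVars_prod A hD, Finset.sum_mul, map_sum]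
  congr 1
  refine Finset.sum_congr rfl fun a _ => ?_
  rw [Finset.mul_sum, map_sum]
  refine Finset.sum_congr rfl fun b _ => ?_
  rw [smul_mul_smul_comm, AddMonoidAlgebra.single_mul_single, one_mul, map_smul, circForm,
    laurentLift_single, one_smul, smul_eq_mul]
  rfl

/-- Polarization: a linear functional that vanishes on all products `∏_i A(z_i)` with `A(0) = 1`
vanishes on the products of power sums. -/
theorem polarize (L : MvPolynomial (Fin r) ℝ →ₗ[ℝ] ℝ) {D : ℕ}
    (h : ∀ A : ℝ[X], A.coeff 0 = 1 → A.natDegree ≤ D →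
      L (∏ i, Polynomial.aeval (MvPolynomial.X i) A) = 0) (e : ℕ+ →₀ ℕ) :
    ∀ A : ℝ[X], A.coeff 0 = 1 → A.natDegree + wt e ≤ D →
      L ((∏ i, Polynomial.aeval (MvPolynomial.X i) A) *
        mpow (fun n : ℕ+ => ∑ i, (MvPolynomial.X i : MvPolynomial (Fin r) ℝ) ^ (n : ℕ)) e) = 0 := by
  classical
  induction e using multiIndex_induction with
  | h0 =>
    intro A hA hD
    rw [mpow_zero, mul_one]
    exact h A hA (by omega)
  | h e n ih =>
    intro A hA hD
    rw [wt_add, wt_single] at hD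
    set M := mpow (fun n : ℕ+ => ∑ i, (MvPolynomial.X i : MvPolynomial (Fin r) ℝ) ^ (n : ℕ)) e with hM
    set P := ∏ i : Fin r, Polynomial.aeval (MvPolynomial.X i : MvPolynomial (Fin r) ℝ) A with hP
    -- the polynomial in `ε` obtained by replacing `A` by `A (1 + ε X^n)`
    set Q : ℝ[X] := ∑ S : Finset (Fin r), C (L (P * M * ∏ i ∈ S, MvPolynomial.X i ^ (n : ℕ))) *
      X ^ S.card with hQ
    have hQ0 : Q = 0 := by
      refine Polynomial.funext fun ε => ?_
      have h1 : (A * (1 + C ε * X ^ (n : ℕ))).natDegree ≤ A.natDegree + n := by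
        refine Polynomial.natDegree_mul_le.trans (Nat.add_le_add_left ?_ _)
        refine (Polynomial.natDegree_add_le _ _).trans (max_le (by simp) ?_)
        exact Polynomial.natDegree_C_mul_X_pow_le _ _
      have h2 := ih (A * (1 + C ε * X ^ (n : ℕ))) (by
        rw [Polynomial.coeff_zero_eq_eval_zero] at hA ⊢
        simp [hA]) (by omega)
      have h3 : ∏ i : Fin r, Polynomial.aeval (MvPolynomial.X i : MvPolynomial (Fin r) ℝ)
          (A * (1 + C ε * X ^ (n : ℕ))) = P * ∑ S : Finset (Fin r),
            ε ^ S.card • ∏ i ∈ S, MvPolynomial.X i ^ (n : ℕ) := by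
        simp only [map_mul, map_add, map_one, map_pow, Polynomial.aeval_X, Polynomial.aeval_C]
        rw [Finset.prod_mul_distrib, Finset.prod_one_add, Finset.powerset_univ]
        congr 1
        refine Finset.sum_congr rfl fun S _ => ?_
        rw [Finset.prod_mul_distrib, Finset.prod_const, ← map_pow, ← Algebra.smul_def]
      rw [h3] at h2
      rw [Polynomial.eval_zero, hQ, Polynomial.eval_finsetSum, ← h2, mul_right_comm, Finset.mul_sum,
        map_sum]
      refine Finset.sum_congr rfl fun S _ => ?_
      rw [mul_smul_comm, map_smul, Polynomial.eval_mul, Polynomial.eval_C, Polynomial.eval_pow,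
        Polynomial.eval_X, smul_eq_mul, mul_comm]
    have hc := congrArg (fun p => Polynomial.coeff p 1) hQ0
    simp only [hQ, Polynomial.finsetSum_coeff, Polynomial.coeff_C_mul, Polynomial.coeff_X_pow,
      Polynomial.coeff_zero, mul_ite, mul_one, mul_zero] at hc
    rw [← Finset.sum_filter] at hc
    have h4 : (Finset.univ.filter fun S : Finset (Fin r) => 1 = S.card) =
        Finset.univ.map ⟨singleton, Finset.singleton_injective⟩ := by
      ext S
      simp only [Finset.mem_filter, Finset.mem_univ, true_and, Finset.mem_map,
        Function.Embedding.coeFn_mk, eq_comm (a := 1), Finset.card_eq_one]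
      exact ⟨fun ⟨a, ha⟩ => ⟨a, ha.symm⟩, fun ⟨a, ha⟩ => ⟨a, ha.symm⟩⟩
    rw [h4, Finset.sum_map] at hc
    simp only [Function.Embedding.coeFn_mk, Finset.prod_singleton] at hc
    rw [mpow_add, mpow_single, pow_one, ← mul_assoc, Finset.mul_sum, map_sum]
    exact hc

/-- The point of `ℝ^r` with the coordinates `y_l`, `l ∈ I`, followed by zeros. -/
def padPoint (r : ℕ) (I : Finset (Fin k)) (i : Fin r) : ℝ :=
  if h : (i : ℕ) < I.card then y (I.orderEmbOfFin rfl ⟨i, h⟩) else 0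

/-- The added coordinates vanish, so they do not contribute to a product of values of a function
with value `1` at `0`. -/
theorem prod_padPoint {M : Type*} [CommMonoid M] {I : Finset (Fin k)} (hI : I.card ≤ r) (f : ℝ → M)
    (hf : f 0 = 1) : ∏ i, f (padPoint y r I i) = ∏ l ∈ I, f (y l) := by
  have h1 : ∏ j : Fin I.card, f (y (I.orderEmbOfFin rfl j)) = ∏ i, f (padPoint y r I i) := by
    refine Fintype.prod_of_injective (Fin.castLE hI) (Fin.castLE_injective hI) _ _ ?_ ?_
    · intro i hi
      rw [padPoint, dif_neg, hf]
      intro h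
      exact hi ⟨⟨i, h⟩, rfl⟩
    · intro j
      rw [padPoint, dif_pos (show ((Fin.castLE hI j : Fin r) : ℕ) < I.card from j.isLt)]
      rfl
  rw [← h1, ← Finset.prod_coe_sort I fun l => f (y l)]
  exact Fintype.prod_equiv (I.orderIsoOfFin rfl).toEquiv _ _ fun j => rfl

/-- The identity behind the difference operators, for products of power sums. -/
theorem circForm_truncPhi_mul {t : ℝ} (ht : 1 < t⁻¹) (e : ℕ+ →₀ ℕ) {N : ℕ} (hN : r * wt e < N) :
    (esymMatrix y).det * circForm t (truncPhi y t r N *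
      mpow (fun n : ℕ+ => ∑ i, zPow i (-(n : ℕ) : ℤ)) e) =
      (r ! : ℝ) * ∑ I : Finset (Fin k) with I.card ≤ r,
        tauValue t⁻¹ k (r - I.card) * (mpow (fun n : ℕ+ => ∑ l ∈ I, y l ^ (n : ℕ)) e *
          detShift y t⁻¹ I) := by
  classical
  let L : MvPolynomial (Fin r) ℝ →ₗ[ℝ] ℝ :=
    (esymMatrix y).det • (circForm t ∘ₗ LinearMap.mulLeft ℝ (truncPhi y t r N) ∘ₗ
      (invVars r).toLinearMap) -
    (r ! : ℝ) • ∑ I : Finset (Fin k) with I.card ≤ r, (tauValue t⁻¹ k (r - I.card) *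
      detShift y t⁻¹ I) • (MvPolynomial.aeval (padPoint y r I) :
        MvPolynomial (Fin r) ℝ →ₐ[ℝ] ℝ).toLinearMap
  have hL : ∀ G, L G = (esymMatrix y).det * circForm t (truncPhi y t r N * invVars r G) -
      (r ! : ℝ) * ∑ I : Finset (Fin k) with I.card ≤ r, (tauValue t⁻¹ k (r - I.card) *
        detShift y t⁻¹ I) * MvPolynomial.aeval (padPoint y r I) G := fun G => by
    simp only [L, LinearMap.sub_apply, LinearMap.smul_apply, LinearMap.sum_apply,
      LinearMap.comp_apply, smul_eq_mul, AlgHom.toLinearMap_apply, LinearMap.mulLeft_apply]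
  have h := polarize L (D := wt e) (fun A hA hD => by
    rw [hL, numeric_base y ht A hA hD hN, sub_eq_zero]
    congr 1
    refine Finset.sum_congr rfl fun I hI => ?_
    have h1 : MvPolynomial.aeval (padPoint y r I) (∏ i, Polynomial.aeval
        (MvPolynomial.X i : MvPolynomial (Fin r) ℝ) A) = ∏ l ∈ I, A.eval (y l) := by
      rw [map_prod, ← prod_padPoint y (Finset.mem_filter.mp hI).2 (fun x => A.eval x)
        (by rw [← Polynomial.coeff_zero_eq_eval_zero, hA])]
      refine Finset.prod_congr rfl fun i _ => ?_
      rw [← Polynomial.aeval_algHom_apply, MvPolynomial.aeval_X, Polynomial.coe_aeval_eq_eval]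
    rw [h1]
    ring) e 1 (by simp) (by simp)
  rw [hL, sub_eq_zero] at h
  simp only [map_one, Finset.prod_const_one, one_mul] at h
  rw [map_mpow] at h
  have h2 : (fun n : ℕ+ => invVars r (∑ i, (MvPolynomial.X i : MvPolynomial (Fin r) ℝ) ^ (n : ℕ))) =
      fun n : ℕ+ => ∑ i, zPow i (-(n : ℕ) : ℤ) := by
    funext n
    rw [map_sum]
    refine Finset.sum_congr rfl fun i _ => ?_
    rw [map_pow, invVars, MvPolynomial.aeval_X, zPow_pow, mul_neg_one]
  rw [h2] at h
  rw [h]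
  congr 1
  refine Finset.sum_congr rfl fun I hI => ?_
  rw [map_mpow]
  have h3 : (fun n : ℕ+ => MvPolynomial.aeval (padPoint y r I)
      (∑ i, (MvPolynomial.X i : MvPolynomial (Fin r) ℝ) ^ (n : ℕ))) =
      fun n : ℕ+ => ∑ l ∈ I, y l ^ (n : ℕ) := by
    funext n
    have := prod_padPoint y (Finset.mem_filter.mp hI).2
      (fun x => Multiplicative.ofAdd (x ^ (n : ℕ))) (by rw [zero_pow n.ne_zero]; rfl)
    rw [map_sum]
    simp only [map_pow, MvPolynomial.aeval_X]
    exact this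
  rw [h3]
  ring

end Polarize

theorem locFin_sum {ι κ σ R : Type*} [CommRing R] (s : Finset κ) {f : κ → ι → MvPowerSeries σ R}
    (hf : ∀ i, LocFin (f i)) : LocFin fun n => ∑ i ∈ s, f i n := by
  classical
  induction s using Finset.induction_on with
  | empty =>
    intro d
    simp only [Finset.sum_empty, map_zero]
    convert Set.finite_empty
    ext
    simp
  | insert i s hi ih =>
    simp only [Finset.sum_insert hi]
    exact (hf i).add ih

theorem formalSum_sum {ι κ σ R : Type*} [CommRing R] (s : Finset κ) {f : κ → ι → MvPowerSeries σ R}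
    (hf : ∀ i, LocFin (f i)) :
    (formalSum fun n => ∑ i ∈ s, f i n) = ∑ i ∈ s, formalSum (f i) := by
  classical
  induction s using Finset.induction_on with
  | empty => simp [formalSum_zero]
  | insert i s hi ih =>
    simp only [Finset.sum_insert hi]
    rw [formalSum_add (hf i) (locFin_sum s hf), ih]

/-! ### The free field operators -/

section Operator

variable (q t : ℝ) {r k : ℕ}

/-- The coefficients `(1 - t^{-n}) / n * ∑ z_i^n`. -/
def betaZ (t : ℝ) (r : ℕ) (n : ℕ+) : Laurent r :=
  ((1 - t⁻¹ ^ (n : ℕ)) / (n : ℕ)) • ∑ i, zPow i ((n : ℕ) : ℤ)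

/-- The coefficients `-(1 - q^n) * ∑ z_i^{-n}`. -/
def gammaZ (q : ℝ) (r : ℕ) (n : ℕ+) : Laurent r :=
  (-(1 - q ^ (n : ℕ))) • ∑ i, zPow i (-(n : ℕ) : ℤ)

/-- The matrix entries, in the basis of the `p^d`, of the operator
`f ↦ (1 / r!) ∫ D^r z det(1 / (z_i - t⁻¹ z_j)) exp(∑ β_n p_n) f(p + γ)`. -/
def opCoeff (r : ℕ) (d e : ℕ+ →₀ ℕ) : ℝ :=
  (r ! : ℝ)⁻¹ * circForm t (MvPowerSeries.coeff d (expLin (betaZ t r) * shiftPow (gammaZ q r) e))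

/-- The multi-indices of weight `m`. -/
def wtFinset (m : ℕ) : Finset (ℕ+ →₀ ℕ) :=
  ((finite_wt_le m).subset fun _ (h : wt _ = m) => h.le).toFinset

@[simp] theorem mem_wtFinset {m : ℕ} {d : ℕ+ →₀ ℕ} : d ∈ wtFinset m ↔ wt d = m :=
  Set.Finite.mem_toFinset _

/-- The operator whose eigenfunctions are the Macdonald symmetric functions. -/
def opE (r : ℕ) : Lam →ₗ[ℝ] Lam :=
  (MvPolynomial.basisMonomials ℕ+ ℝ).constr ℝ fun e =>
    ∑ d ∈ wtFinset (wt e), opCoeff q t r d e • MvPolynomial.monomial d (1 : ℝ)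

theorem opE_monomial (e : ℕ+ →₀ ℕ) : opE q t r (MvPolynomial.monomial e 1) =
    ∑ d ∈ wtFinset (wt e), opCoeff q t r d e • MvPolynomial.monomial d (1 : ℝ) := by
  rw [opE]
  have := (MvPolynomial.basisMonomials ℕ+ ℝ).constr_basis ℝ (fun e =>
    ∑ d ∈ wtFinset (wt e), opCoeff q t r d e • MvPolynomial.monomial d (1 : ℝ)) e
  rwa [MvPolynomial.coe_basisMonomials] at this

/-- The value at `p_n = c_n` of the part of weight `m`. -/
def gradedEval (c : ℕ+ → ℝ) (m : ℕ) (F : MvPowerSeries ℕ+ (Laurent r)) : Laurent r :=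
  ∑ d ∈ wtFinset m, mpow c d • MvPowerSeries.coeff d F

theorem gradedEval_add (c : ℕ+ → ℝ) (m : ℕ) (F G : MvPowerSeries ℕ+ (Laurent r)) :
    gradedEval c m (F + G) = gradedEval c m F + gradedEval c m G := by
  simp only [gradedEval, map_add, smul_add, Finset.sum_add_distrib]

theorem gradedEval_C_mul (c : ℕ+ → ℝ) (m : ℕ) (a : Laurent r) (F : MvPowerSeries ℕ+ (Laurent r)) :
    gradedEval c m (MvPowerSeries.C a * F) = a * gradedEval c m F := by
  rw [gradedEval, gradedEval, Finset.mul_sum]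
  refine Finset.sum_congr rfl fun d _ => ?_
  rw [MvPowerSeries.coeff_C_mul, mul_smul_comm]

theorem gradedEval_X_mul (c : ℕ+ → ℝ) (m : ℕ) (n : ℕ+) (F : MvPowerSeries ℕ+ (Laurent r)) :
    gradedEval c (m + n) (MvPowerSeries.X n * F) = c n • gradedEval c m F := by
  classical
  rw [gradedEval, gradedEval, Finset.smul_sum]
  symm
  refine Finset.sum_of_injOn (fun d => d + Finsupp.single n 1) (fun _ _ _ _ h => by simpa using h)
    ?_ ?_ ?_
  · intro d hd
    simp only [Finset.mem_coe, mem_wtFinset] at hd ⊢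
    rw [wt_add, wt_single, hd, mul_one]
  · intro d hd hd'
    by_cases h : d n = 0
    · rw [coeff_X_mul_of_eq_zero h, smul_zero]
    · obtain ⟨d', rfl⟩ := exists_add_single h
      exfalso
      refine hd' ⟨d', ?_, rfl⟩
      simp only [Finset.mem_coe, mem_wtFinset] at hd ⊢
      rw [wt_add, wt_single] at hd
      omega
  · intro d _
    rw [coeff_add_single_X_mul, mpow_add, mpow_single, pow_one, smul_smul, mul_comm]

variable (y : Fin k → ℝ)

/-- The power sums of the numbers `y_l`. -/
def psums (y : Fin k → ℝ) (n : ℕ+) : ℝ := ∑ l, y l ^ (n : ℕ)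

/-- The series `∑_a φ_a z_i^a X^a`. -/
def phiSeries (t : ℝ) (r : ℕ) (i : Fin r) : PowerSeries (Laurent r) :=
  PowerSeries.mk fun a => phiCoeff y t⁻¹ a • zPow i (a : ℤ)

/-- The homomorphism `X ↦ z_i X`. -/
def zScale (i : Fin r) : PowerSeries ℝ →+* PowerSeries (Laurent r) :=
  (PowerSeries.rescale (zPow i 1)).comp (PowerSeries.map (algebraMap ℝ (Laurent r)))

theorem C_real_smul {σ A : Type*} [CommRing A] [Algebra ℝ A] (a : ℝ) (b : A) :
    (MvPowerSeries.C (a • b) : MvPowerSeries σ A) = a • MvPowerSeries.C b := by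
  classical
  refine MvPowerSeries.ext fun d => ?_
  have h : MvPowerSeries.coeff d (a • (MvPowerSeries.C b : MvPowerSeries σ A)) =
    a • MvPowerSeries.coeff d (MvPowerSeries.C b) := rfl
  rw [h, MvPowerSeries.coeff_C, MvPowerSeries.coeff_C]
  split_ifs <;> simp

/-- The terms of `log(1 - c X)`. -/
def logTerm (c : Laurent r) (n : ℕ+) : MvPowerSeries Unit (Laurent r) :=
  -((((n : ℕ) : ℝ)⁻¹) • (MvPowerSeries.C c * MvPowerSeries.X ()) ^ (n : ℕ))

theorem vanishBelow_logTerm (c : Laurent r) (n : ℕ+) : VanishBelow n (logTerm c n) := by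
  have h : VanishBelow 1 (MvPowerSeries.C c * MvPowerSeries.X () :
      MvPowerSeries Unit (Laurent r)) := (vanishBelow_X ()).mul_left _
  have h2 := ((h.pow n).smul (((n : ℕ) : ℝ)⁻¹)).neg
  rwa [one_mul] at h2

/-- The series `log(1 - c X)`. -/
def logLin (c : Laurent r) : MvPowerSeries Unit (Laurent r) := formalSum (logTerm c)

theorem vanishBelow_logLin (c : Laurent r) : VanishBelow 1 (logLin c) :=
  vanishBelow_formalSum_pnat (vanishBelow_logTerm c)

theorem formalExp_logLin (c : Laurent r) :
    formalExp (logLin c) = 1 - MvPowerSeries.C c * MvPowerSeries.X () :=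
  (one_sub_eq_formalExp ((vanishBelow_X ()).mul_left _)).symm

theorem rescale_C {R : Type*} [CommSemiring R] (a c : R) :
    PowerSeries.rescale a (PowerSeries.C c) = PowerSeries.C c := by
  ext n
  rw [PowerSeries.coeff_rescale, PowerSeries.coeff_C]
  split_ifs with h <;> simp [h]

theorem zScale_one_sub (i : Fin r) (c : ℝ) :
    zScale i (1 - PowerSeries.C c * PowerSeries.X) = formalExp (logLin (c • zPow i 1)) := by
  rw [formalExp_logLin]
  have : zScale i (1 - PowerSeries.C c * PowerSeries.X) =
      1 - PowerSeries.C (c • zPow i 1) * PowerSeries.X := by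
    rw [zScale, map_sub, map_one, map_mul]
    simp only [RingHom.comp_apply, PowerSeries.map_C, PowerSeries.map_X, PowerSeries.rescale_X,
      rescale_C]
    rw [← mul_assoc, ← map_mul, ← Algebra.smul_def]
  exact this

theorem zScale_prod (i : Fin r) (c : Fin k → ℝ) :
    zScale i (∏ l, (1 - PowerSeries.C (c l) * PowerSeries.X)) =
      formalExp (∑ l, logLin (c l • zPow i 1)) := by
  rw [map_prod]
  have h := formalExp_sum (s := Finset.univ) (a := fun l => logLin (c l • (zPow i 1 : Laurent r)))
    fun l _ => vanishBelow_logLin _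
  exact (Finset.prod_congr rfl fun l _ => zScale_one_sub i (c l)).trans h.symm

theorem coe_revPoly : (revPoly y : PowerSeries ℝ) =
    ∏ l, (1 - PowerSeries.C (y l) * PowerSeries.X) := by
  rw [revPoly, ← Polynomial.coeToPowerSeries.ringHom_apply, map_prod]
  refine Finset.prod_congr rfl fun l _ => ?_
  simp

theorem rescale_revPoly (s : ℝ) : PowerSeries.rescale s (revPoly y : PowerSeries ℝ) =
    ∏ l, (1 - PowerSeries.C (s * y l) * PowerSeries.X) := by
  rw [coe_revPoly, map_prod]
  refine Finset.prod_congr rfl fun l _ => ?_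
  rw [map_sub, map_one, map_mul, rescale_C, PowerSeries.rescale_X, ← mul_assoc,
    ← map_mul, mul_comm (y l)]

theorem phiSeries_eq_mul (i : Fin r) : phiSeries y t r i =
    zScale i (PowerSeries.rescale t⁻¹ (revPoly y : PowerSeries ℝ)) *
      zScale i ((revPoly y : PowerSeries ℝ)⁻¹) := by
  rw [← map_mul]
  ext1 a
  rw [phiSeries, PowerSeries.coeff_mk, zScale, RingHom.comp_apply, PowerSeries.coeff_rescale,
    PowerSeries.coeff_map, phiCoeff_eq, zPow_pow, mul_one, Algebra.smul_def, mul_comm]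
  simp

theorem phiSeries_eq (i : Fin r) : phiSeries y t r i = formalExp (σ := Unit)
    (∑ l, (logLin ((t⁻¹ * y l) • zPow i 1) - logLin (y l • zPow i 1))) := by
  have h1 := phiSeries_eq_mul t y i
  have h4 : zScale i ((revPoly y : PowerSeries ℝ)⁻¹) * zScale i (revPoly y : PowerSeries ℝ) =
      1 := by
    rw [← map_mul, revPoly_inv_mul, map_one]
  have h5 := zScale_prod i y
  rw [← coe_revPoly] at h5
  have h6 := zScale_prod i fun l => t⁻¹ * y l
  rw [← rescale_revPoly] at h6
  have hS : ∀ c : Fin k → Laurent r, VanishBelow 1 (∑ l, logLin (c l)) :=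
    fun c => VanishBelow.sum fun l _ => vanishBelow_logLin _
  rw [Finset.sum_sub_distrib, sub_eq_add_neg, formalExp_add (hS _) (hS _).neg, ← h6, h1]
  have h7 : formalExp (∑ l, logLin (y l • (zPow i 1 : Laurent r))) *
      formalExp (-(∑ l, logLin (y l • (zPow i 1 : Laurent r)))) = 1 := by
    rw [← formalExp_add (hS _) (hS _).neg, add_neg_cancel, formalExp_zero]
  rw [h5] at h4
  have h8 := left_inv_eq_right_inv h4 h7
  rw [h8]

theorem sum_logTerm (n : ℕ+) :
    ∑ i : Fin r, ∑ l, (logTerm ((t⁻¹ * y l) • zPow i 1) n - logTerm (y l • zPow i 1) n) =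
      MvPowerSeries.C (psums y n • betaZ t r n) * MvPowerSeries.X () ^ (n : ℕ) := by
  have hterm : ∀ (i : Fin r) (l : Fin k),
      logTerm ((t⁻¹ * y l) • zPow i 1) n - logTerm (y l • zPow i 1) n =
        MvPowerSeries.C ((y l ^ (n : ℕ) * ((1 - t⁻¹ ^ (n : ℕ)) / (n : ℕ))) •
          zPow i ((n : ℕ) : ℤ)) * MvPowerSeries.X () ^ (n : ℕ) := fun i l => by
    simp only [logTerm, mul_pow, ← map_pow, smul_pow, zPow_pow, mul_one, C_real_smul, smul_mul_assoc,
      smul_smul, neg_sub_neg]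
    rw [← sub_smul]
    congr 1
    ring
  simp only [hterm, ← Finset.sum_mul, ← map_sum]
  congr 2
  rw [psums, betaZ, smul_smul, Finset.smul_sum]
  refine Finset.sum_congr rfl fun i _ => ?_
  rw [Finset.sum_mul, Finset.sum_smul]

/-- Logarithms turn the product of the `Φ(z_i)` into `exp (∑ β_n p_n(y))`. -/
theorem prod_phiSeries : ∏ i, phiSeries y t r i =
    mexp (σ := Unit) fun n : ℕ+ => MvPowerSeries.C (psums y n • betaZ t r n) *
      MvPowerSeries.X () ^ (n : ℕ) := by
  have hl : ∀ c : Laurent r, LocFin (logTerm c) := fun c => locFin_pnat (vanishBelow_logTerm c)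
  have hsub : ∀ a b : Laurent r, LocFin fun n => logTerm a n - logTerm b n := fun a b => by
    simp only [sub_eq_add_neg]
    exact (hl a).add (hl b).neg
  rw [mexp_eq_formalExp fun n => by
    simpa using (vanishBelow_X_pow () (n : ℕ)).mul_left (MvPowerSeries.C (psums y n • betaZ t r n))]
  have h1 := formalExp_sum (s := Finset.univ) (a := fun i : Fin r =>
    ∑ l, (logLin ((t⁻¹ * y l) • zPow i 1) - logLin (y l • (zPow i 1 : Laurent r))))
    fun i _ => VanishBelow.sum fun l _ => by
      rw [sub_eq_add_neg]
      exact (vanishBelow_logLin _).add (vanishBelow_logLin _).neg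
  refine (Finset.prod_congr rfl fun i _ => phiSeries_eq t y i).trans (h1.symm.trans ?_)
  refine congrArg _ ?_
  have h2 : ∀ i : Fin r, ∑ l, (logLin ((t⁻¹ * y l) • zPow i 1) - logLin (y l • (zPow i 1 : Laurent r)))
      = formalSum fun n => ∑ l, (logTerm ((t⁻¹ * y l) • zPow i 1) n -
        logTerm (y l • (zPow i 1 : Laurent r)) n) := fun i => by
    rw [formalSum_sum _ fun l => hsub _ _]
    refine Finset.sum_congr rfl fun l _ => ?_
    rw [formalSum_sub (hl _) (hl _), logLin, logLin]
  rw [Finset.sum_congr rfl fun i _ => h2 i, ← formalSum_sum _ fun i => locFin_sum _ fun l => hsub _ _]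
  exact formalSum_congr fun n => sum_logTerm t y n

theorem mpow_pow_wt {A : Type*} [CommMonoid A] (x : A) (j : ℕ+ →₀ ℕ) :
    mpow (fun n : ℕ+ => x ^ (n : ℕ)) j = x ^ wt j := by
  simp only [mpow, wt, Finsupp.prod, Finsupp.sum, ← pow_mul, Finset.prod_pow_eq_pow_sum]

theorem gradedEval_expLin (m : ℕ) : gradedEval (psums y) m (expLin (betaZ t r)) =
    PowerSeries.coeff m (∏ i, phiSeries y t r i) := by
  classical
  have hterm : ∀ j : ℕ+ →₀ ℕ, dpow (fun n : ℕ+ => (MvPowerSeries.C (psums y n • betaZ t r n) *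
      MvPowerSeries.X () ^ (n : ℕ) : MvPowerSeries Unit (Laurent r))) j =
      MvPowerSeries.C (mpow (psums y) j • dpow (betaZ t r) j) * MvPowerSeries.X () ^ wt j := by
    intro j
    rw [dpow_mul, mpow_pow_wt, dpow, ← map_mpow, ← C_real_smul]
    congr 2
    simp only [Algebra.smul_def]
    rw [mpow_mul, ← map_mpow]
    simp only [dpow, Algebra.smul_def]
    ring
  have hc : ∀ j : ℕ+ →₀ ℕ, MvPowerSeries.coeff (Finsupp.single () m) (MvPowerSeries.C
      (mpow (psums y) j • dpow (betaZ t r) j) * MvPowerSeries.X () ^ wt j) =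
      if j ∈ wtFinset m then mpow (psums y) j • dpow (betaZ t r) j else 0 := by
    intro j
    rw [MvPowerSeries.coeff_C_mul, MvPowerSeries.coeff_X_pow, mul_ite, mul_one, mul_zero]
    refine if_congr ?_ rfl rfl
    rw [mem_wtFinset]
    constructor
    · intro h
      simpa using (DFunLike.congr_fun h ()).symm
    · rintro rfl
      rfl
  rw [prod_phiSeries, mexp]
  show _ = ∑ᶠ j, MvPowerSeries.coeff (Finsupp.single () m) _
  simp only [hterm, hc]
  rw [finsum_eq_sum_of_support_subset (s := wtFinset m), gradedEval]
  · refine Finset.sum_congr rfl fun d hd => ?_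
    rw [if_pos hd, coeff_expLin]
  · intro j hj
    by_contra h
    exact hj (if_neg h)

/-- `circForm` only sees Laurent monomials of degree `0`, so that the grading may be replaced by a
truncation. -/
theorem circForm_coeff_prod_phiSeries {m N : ℕ} (hN : m < N) (c : Fin r → ℤ)
    (hc : ∑ i, c i = -m) :
    circForm t (PowerSeries.coeff m (∏ i, phiSeries y t r i) * AddMonoidAlgebra.single c 1) =
      circForm t (truncPhi y t r N * AddMonoidAlgebra.single c 1) := by
  classical
  have hprod : ∀ a : Fin r → ℕ, (∏ i, PowerSeries.coeff (a i) (phiSeries y t r i)) =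
      (∏ i, phiCoeff y t⁻¹ (a i)) • AddMonoidAlgebra.single (fun i => (a i : ℤ)) 1 := fun a => by
    simp only [phiSeries, PowerSeries.coeff_mk, zPow, Finset.prod_smul, single_prod]
    congr 2
    funext i
    rw [Finset.sum_apply]
    simp [Pi.single_apply]
  rw [PowerSeries.coeff_prod, truncPhi, Finset.sum_mul, Finset.sum_mul, map_sum, map_sum]
  simp only [hprod]
  refine Finset.sum_bij_ne_zero (fun b _ _ i => b i) ?_ ?_ ?_ ?_
  · intro b hb _
    rw [Finset.mem_finsuppAntidiag] at hb
    refine Fintype.mem_piFinset.mpr fun i => Finset.mem_range.mpr ?_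
    refine lt_of_le_of_lt ?_ hN
    rw [← hb.1]
    exact Finset.single_le_sum (fun i _ => Nat.zero_le (b i)) (Finset.mem_univ i)
  · intro a _ _ b _ _ h
    exact DFunLike.coe_injective h
  · intro a ha ha'
    have hsum : ∑ i, a i = m := by
      by_contra h
      refine ha' ?_
      rw [smul_mul_assoc, AddMonoidAlgebra.single_mul_single, map_smul, circForm_single_eq_zero,
        smul_zero]
      simp only [Pi.add_apply, Finset.sum_add_distrib, hc]
      intro h'
      apply h
      have : ((∑ i, a i : ℕ) : ℤ) = m := by push_cast; linarith
      exact_mod_cast this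
    refine ⟨Finsupp.equivFunOnFinite.symm a, ?_, ?_, rfl⟩
    · rw [Finset.mem_finsuppAntidiag]
      exact ⟨hsum, Finset.subset_univ _⟩
    · exact ha'
  · intro b _ _
    rfl

theorem circForm_coeff_prod_phiSeries_mul {m N : ℕ} (hN : m < N) (e : ℕ+ →₀ ℕ) (he : wt e = m) :
    circForm t (PowerSeries.coeff m (∏ i, phiSeries y t r i) *
        mpow (fun n : ℕ+ => ∑ i, zPow i (-(n : ℕ) : ℤ)) e) =
      circForm t (truncPhi y t r N * mpow (fun n : ℕ+ => ∑ i, zPow i (-(n : ℕ) : ℤ)) e) := by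
  have key : ∀ c : Fin r → ℤ, (∑ i, c i - wt e = -m) →
      circForm t (PowerSeries.coeff m (∏ i, phiSeries y t r i) * (AddMonoidAlgebra.single c 1 *
        mpow (fun n : ℕ+ => ∑ i, zPow i (-(n : ℕ) : ℤ)) e)) =
      circForm t (truncPhi y t r N * (AddMonoidAlgebra.single c 1 *
        mpow (fun n : ℕ+ => ∑ i, zPow i (-(n : ℕ) : ℤ)) e)) := by
    clear he
    induction e using multiIndex_induction with
    | h0 =>
      intro c hc
      rw [mpow_zero, mul_one]
      exact circForm_coeff_prod_phiSeries t y hN c (by simpa using hc)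
    | h e n ih =>
      intro c hc
      rw [mpow_add, mpow_single, pow_one, mul_comm (mpow _ e),
        ← mul_assoc (AddMonoidAlgebra.single c 1), Finset.mul_sum, Finset.sum_mul, Finset.mul_sum,
        Finset.mul_sum, map_sum, map_sum]
      refine Finset.sum_congr rfl fun i _ => ?_
      rw [zPow, AddMonoidAlgebra.single_mul_single, mul_one]
      refine ih _ ?_
      rw [wt_add, wt_single] at hc
      simp only [Pi.add_apply, Finset.sum_add_distrib, Finset.sum_pi_single', Finset.mem_univ,
        if_true]
      push_cast at hc
      linarith
  have := key 0 (by simp [he])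
  rw [← AddMonoidAlgebra.one_def] at this
  simpa using this

variable (r) in
/-- The sum over subsets `∑_I τ det_I g(I)`, where the factor `τ` depends on `|I|` only. -/
def subsetSum (t : ℝ) (g : Finset (Fin k) → ℝ) : ℝ :=
  ∑ I with I.card ≤ r, tauValue t⁻¹ k (r - I.card) * (g I * detShift y t⁻¹ I)

/-- The factors `p_n + γ_n` are expanded one at a time: the summand `p_n` is a number, and the
summand `γ_n` is absorbed by `e'`. The case `e = 0` is the polarized determinant identity. -/
theorem det_mul_circForm (ht : 1 < t⁻¹) (e e' : ℕ+ →₀ ℕ) :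
    (esymMatrix y).det * circForm t (gradedEval (psums y) (wt e + wt e')
        (expLin (betaZ t r) * shiftPow (gammaZ q r) e) * mpow (gammaZ q r) e') =
      r ! * subsetSum r y t fun I =>
        mpow (fun n => psums y n - (1 - q ^ (n : ℕ)) * ∑ l ∈ I, y l ^ (n : ℕ)) e *
        mpow (fun n : ℕ+ => -(1 - q ^ (n : ℕ)) * ∑ l ∈ I, y l ^ (n : ℕ)) e' := by
  induction e using multiIndex_induction generalizing e' with
  | h0 =>
    have h1 : mpow (gammaZ q r) e' = (mpow (fun n : ℕ+ => -(1 - q ^ (n : ℕ))) e') •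
        mpow (fun n : ℕ+ => ∑ i : Fin r, zPow i (-(n : ℕ) : ℤ)) e' := by
      rw [Algebra.smul_def, map_mpow, ← mpow_mul]
      congr 1
      funext n
      rw [gammaZ, Algebra.smul_def]
    rw [wt_zero, zero_add, shiftPow_zero, mul_one, gradedEval_expLin, h1, mul_smul_comm, map_smul,
      circForm_coeff_prod_phiSeries_mul t y (N := wt e' + r * wt e' + 1) (by omega) e' rfl,
      smul_eq_mul, mul_left_comm, circForm_truncPhi_mul y ht e' (by omega), mul_left_comm,
      subsetSum]
    congr 1
    rw [Finset.mul_sum]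
    refine Finset.sum_congr rfl fun I _ => ?_
    rw [mpow_zero, one_mul, mpow_mul]
    ring
  | h e n ih =>
    have h1 := ih e'
    have h2 := ih (e' + Finsupp.single n 1)
    have hn : wt e + wt (e' + Finsupp.single n 1) = wt e + n + wt e' := by
      rw [wt_add, wt_single, mul_one]
      omega
    have hw : wt (e + Finsupp.single n 1) + wt e' = wt e + wt e' + n := by
      rw [wt_add, wt_single, mul_one]
      omega
    rw [hn] at h2
    have h3 : wt e + n + wt e' = wt e + wt e' + n := by omega
    rw [shiftPow_add_single, mul_left_comm, add_mul, gradedEval_add, gradedEval_C_mul, hw,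
      gradedEval_X_mul, add_mul, map_add, mul_add, smul_mul_assoc, map_smul, smul_eq_mul,
      mul_left_comm, h1]
    rw [h3, mpow_add, mpow_single, pow_one, ← mul_assoc, mul_right_comm] at h2
    rw [mul_comm (gammaZ q r n), h2]
    rw [subsetSum, subsetSum, subsetSum, mul_left_comm, ← mul_add, Finset.mul_sum,
      ← Finset.sum_add_distrib]
    refine congrArg _ (Finset.sum_congr rfl fun I _ => ?_)
    rw [mpow_add, mpow_single, mpow_add, mpow_single]
    generalize ∑ l ∈ I, y l ^ (n : ℕ) = S
    ring

/-- The numbers `y_l`, multiplied by `q` for `l ∈ I`. -/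
def scaleOn {A : Type*} [Mul A] (q : A) (I : Finset (Fin k)) (y : Fin k → A) (l : Fin k) : A :=
  if l ∈ I then q * y l else y l

theorem psums_scaleOn (I : Finset (Fin k)) (n : ℕ+) :
    psums (scaleOn q I y) n = psums y n - (1 - q ^ (n : ℕ)) * ∑ l ∈ I, y l ^ (n : ℕ) := by
  classical
  have h : ∑ l ∈ I, y l ^ (n : ℕ) = ∑ l, if l ∈ I then y l ^ (n : ℕ) else 0 := by
    rw [Finset.sum_ite_mem, Finset.univ_inter]
  rw [h, psums, psums, Finset.mul_sum, ← Finset.sum_sub_distrib]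
  refine Finset.sum_congr rfl fun l _ => ?_
  rw [scaleOn]
  split_ifs
  · rw [mul_pow]
    ring
  · ring

/-- On symmetric polynomials in `k` variables the operator becomes a `q`-difference operator. -/
theorem aeval_opE (ht : 1 < t⁻¹) (f : Lam) :
    (esymMatrix y).det * MvPolynomial.aeval (psums y) (opE q t r f) =
      subsetSum r y t fun I => MvPolynomial.aeval (psums (scaleOn q I y)) f := by
  have hm : ∀ e : ℕ+ →₀ ℕ, (esymMatrix y).det *
      MvPolynomial.aeval (psums y) (opE q t r (MvPolynomial.monomial e 1)) =
      subsetSum r y t fun I =>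
        MvPolynomial.aeval (psums (scaleOn q I y)) (MvPolynomial.monomial e (1 : ℝ)) := by
    intro e
    have h := det_mul_circForm q t y ht e 0 (r := r)
    simp only [mpow_zero, mul_one, wt_zero, add_zero] at h
    have h2 : MvPolynomial.aeval (psums y) (opE q t r (MvPolynomial.monomial e 1)) =
        (r ! : ℝ)⁻¹ * circForm t (gradedEval (psums y) (wt e)
          (expLin (betaZ t r) * shiftPow (gammaZ q r) e)) := by
      rw [opE_monomial, map_sum, gradedEval, map_sum, Finset.mul_sum]
      refine Finset.sum_congr rfl fun d _ => ?_
      rw [map_smul, MvPolynomial.aeval_monomial, map_one, one_mul, opCoeff, map_smul, smul_eq_mul,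
        smul_eq_mul, mpow]
      ring
    rw [h2, mul_left_comm, h, inv_mul_cancel_left₀ (Nat.cast_ne_zero.mpr r.factorial_ne_zero)]
    congr 1
    funext I
    rw [MvPolynomial.aeval_monomial, map_one, one_mul, mpow]
    simp only [psums_scaleOn]
  induction f using MvPolynomial.induction_on' with
  | monomial e a =>
    have h : MvPolynomial.monomial e a = a • MvPolynomial.monomial e (1 : ℝ) := by
      rw [MvPolynomial.smul_monomial, smul_eq_mul, mul_one]
    simp only [h, map_smul, smul_eq_mul, mul_left_comm _ a, hm]
    simp only [subsetSum, Finset.mul_sum, mul_left_comm, mul_assoc]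
  | add f g hf hg =>
    simp only [map_add, mul_add, hf, hg, subsetSum, add_mul, Finset.sum_add_distrib]

end Operator

/-! ### Triangularity in dominance order -/

section Prefix

variable {k : ℕ}

/-- The sum of the first `j` exponents of a monomial. -/
def pre (j : ℕ) (b : Fin k →₀ ℕ) : ℕ :=
  ∑ i ∈ Finset.univ.filter (fun i : Fin k => (i : ℕ) < j), b i

theorem pre_add (j : ℕ) (a b : Fin k →₀ ℕ) : pre j (a + b) = pre j a + pre j b := by
  simp [pre, Finset.sum_add_distrib]

theorem pre_succ (i : Fin k) (b : Fin k →₀ ℕ) : pre (i + 1) b = pre i b + b i := by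
  classical
  rw [pre, pre, add_comm (∑ m ∈ _, b m), ← Finset.sum_insert (a := i)
    (s := Finset.univ.filter fun m : Fin k => (m : ℕ) < i) (by simp)]
  refine Finset.sum_congr ?_ fun _ _ => rfl
  ext m
  simp only [Finset.mem_filter, Finset.mem_univ, true_and, Finset.mem_insert, Fin.ext_iff]
  omega

theorem eq_of_pre_eq {a b : Fin k →₀ ℕ} (h : ∀ j, pre j a = pre j b) : a = b := by
  ext i
  have h1 := h (i + 1)
  rw [pre_succ, pre_succ, h i] at h1
  omega

/-- All monomials of `p` are dominated by `a`, in the sense of partial sums of exponents. -/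
def PrefixLE (p : MvPolynomial (Fin k) ℝ) (a : Fin k →₀ ℕ) : Prop :=
  ∀ b, p.coeff b ≠ 0 → ∀ j, pre j b ≤ pre j a

theorem PrefixLE.sum {ι : Type*} {s : Finset ι} {p : ι → MvPolynomial (Fin k) ℝ} {a : Fin k →₀ ℕ}
    (h : ∀ i ∈ s, PrefixLE (p i) a) : PrefixLE (∑ i ∈ s, p i) a := fun b hb => by
  rw [MvPolynomial.coeff_sum] at hb
  obtain ⟨i, hi, hi'⟩ := Finset.exists_ne_zero_of_sum_ne_zero hb
  exact h i hi b hi'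

theorem PrefixLE.C_mul {p : MvPolynomial (Fin k) ℝ} {a : Fin k →₀ ℕ} (h : PrefixLE p a) (c : ℝ) :
    PrefixLE (MvPolynomial.C c * p) a := fun b hb => by
  rw [MvPolynomial.coeff_C_mul] at hb
  exact h b (right_ne_zero_of_mul hb)

theorem PrefixLE.mul {p q : MvPolynomial (Fin k) ℝ} {a b : Fin k →₀ ℕ} (hp : PrefixLE p a)
    (hq : PrefixLE q b) : PrefixLE (p * q) (a + b) := fun c hc j => by
  classical
  rw [MvPolynomial.coeff_mul] at hc
  obtain ⟨x, hx, hx'⟩ := Finset.exists_ne_zero_of_sum_ne_zero hc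
  rw [← Finset.HasAntidiagonal.mem_antidiagonal.mp hx, pre_add, pre_add]
  exact add_le_add (hp _ (left_ne_zero_of_mul hx') j) (hq _ (right_ne_zero_of_mul hx') j)

theorem PrefixLE.coeff_mul {p q : MvPolynomial (Fin k) ℝ} {a b : Fin k →₀ ℕ} (hp : PrefixLE p a)
    (hq : PrefixLE q b) : (p * q).coeff (a + b) = p.coeff a * q.coeff b := by
  classical
  rw [MvPolynomial.coeff_mul]
  refine Finset.sum_eq_single (a, b) (fun x hx hne => ?_) fun h =>
    absurd (Finset.HasAntidiagonal.mem_antidiagonal.mpr (rfl : (a, b).1 + (a, b).2 = a + b)) h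
  by_contra h0
  have hx1 := hp _ (left_ne_zero_of_mul h0)
  have hx2 := hq _ (right_ne_zero_of_mul h0)
  have hs := Finset.HasAntidiagonal.mem_antidiagonal.mp hx
  have hj : ∀ j, pre j x.1 + pre j x.2 = pre j a + pre j b := fun j => by
    rw [← pre_add, hs, pre_add]
  refine hne (Prod.ext (eq_of_pre_eq fun j => ?_) (eq_of_pre_eq fun j => ?_))
  · have := hx1 j; have := hx2 j; have := hj j; show pre j x.1 = pre j a; omega
  · have := hx1 j; have := hx2 j; have := hj j; show pre j x.2 = pre j b; omega

theorem prefixLE_one : PrefixLE (1 : MvPolynomial (Fin k) ℝ) 0 := fun b hb j => by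
  classical
  rw [MvPolynomial.coeff_one] at hb
  have : b = 0 := by
    by_contra h
    exact hb (if_neg (Ne.symm h))
  rw [this]

theorem PrefixLE.prod {ι : Type*} (s : Finset ι) {p : ι → MvPolynomial (Fin k) ℝ}
    {a : ι → Fin k →₀ ℕ} (h : ∀ i ∈ s, PrefixLE (p i) (a i)) :
    PrefixLE (∏ i ∈ s, p i) (∑ i ∈ s, a i) ∧
      (∏ i ∈ s, p i).coeff (∑ i ∈ s, a i) = ∏ i ∈ s, (p i).coeff (a i) := by
  classical
  induction s using Finset.induction_on with
  | empty => exact ⟨prefixLE_one, by simp⟩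
  | insert i s hi ih =>
    obtain ⟨h1, h2⟩ := ih fun j hj => h j (Finset.mem_insert_of_mem hj)
    have h3 := h i (Finset.mem_insert_self i s)
    rw [Finset.prod_insert hi, Finset.sum_insert hi, Finset.prod_insert hi]
    exact ⟨h3.mul h1, by rw [h3.coeff_mul h1, h2]⟩

/-- The homomorphism which records the sum of the first `j` exponents as the degree in an
additional variable. -/
def preGrade (j : ℕ) : MvPolynomial (Fin k) ℝ →ₐ[ℝ] Polynomial (MvPolynomial (Fin k) ℝ) :=
  MvPolynomial.aeval fun i => Polynomial.C (MvPolynomial.X i) *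
    if (i : ℕ) < j then Polynomial.X else 1

theorem preGrade_monomial (j : ℕ) (b : Fin k →₀ ℕ) (c : ℝ) :
    preGrade j (MvPolynomial.monomial b c) =
      Polynomial.monomial (pre j b) (MvPolynomial.monomial b c) := by
  rw [preGrade, MvPolynomial.aeval_monomial, Finsupp.prod_fintype _ _ (by simp)]
  simp only [mul_pow, Finset.prod_mul_distrib, ite_pow, one_pow, Finset.prod_ite,
    Finset.prod_const_one, mul_one, Finset.prod_pow_eq_pow_sum]
  rw [← Polynomial.C_mul_X_pow_eq_monomial, ← mul_assoc, pre]
  congr 1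
  rw [MvPolynomial.monomial_eq, Finsupp.prod_fintype _ _ (by simp), map_mul, map_prod]
  simp only [map_pow]
  rfl

theorem coeff_coeff_preGrade (j d : ℕ) (b : Fin k →₀ ℕ) (p : MvPolynomial (Fin k) ℝ) :
    ((preGrade j p).coeff d).coeff b = if pre j b = d then p.coeff b else 0 := by
  classical
  induction p using MvPolynomial.induction_on' with
  | monomial a c =>
    rw [preGrade_monomial, Polynomial.coeff_monomial, MvPolynomial.coeff_monomial]
    by_cases h : a = b
    · subst h
      by_cases h2 : pre j a = d <;> simp [h2]
    · by_cases h2 : pre j a = d <;> simp [h, h2, MvPolynomial.coeff_monomial]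
  | add p q hp hq =>
    rw [map_add, Polynomial.coeff_add, MvPolynomial.coeff_add, hp, hq, MvPolynomial.coeff_add]
    split_ifs <;> simp

/-- Dominance of the exponents is expressed by degree bounds for the gradings by the first `j`
variables, which makes it multiplicative. -/
theorem prefixLE_iff {p : MvPolynomial (Fin k) ℝ} {a : Fin k →₀ ℕ} :
    PrefixLE p a ↔ ∀ j, (preGrade j p).natDegree ≤ pre j a := by
  constructor
  · intro h j
    rw [Polynomial.natDegree_le_iff_coeff_eq_zero]
    intro d hd
    ext b
    rw [coeff_coeff_preGrade, MvPolynomial.coeff_zero]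
    split_ifs with h1
    · by_contra h2
      have := h b h2 j
      omega
    · rfl
  · intro h b hb j
    refine le_trans (Polynomial.le_natDegree_of_ne_zero fun h0 => hb ?_) (h j)
    have := coeff_coeff_preGrade j (pre j b) b p
    rwa [h0, if_pos rfl, MvPolynomial.coeff_zero, eq_comm] at this

/-- Dominance can be cancelled from a product, since degrees are additive. -/
theorem PrefixLE.of_mul {p g : MvPolynomial (Fin k) ℝ} {a b : Fin k →₀ ℕ}
    (hp : p.coeff a ≠ 0) (h : PrefixLE (p * g) (a + b)) : PrefixLE g b := by
  rw [prefixLE_iff] at h ⊢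
  intro j
  have h1 := h j
  have hne : ((preGrade j p).coeff (pre j a)) ≠ 0 := fun h0 => hp (by
    have := coeff_coeff_preGrade j (pre j a) a p
    rwa [h0, if_pos rfl, MvPolynomial.coeff_zero, eq_comm] at this)
  by_cases hg : preGrade j g = 0
  · simp [hg]
  have h2 := Polynomial.le_natDegree_of_ne_zero hne
  rw [map_mul, Polynomial.natDegree_mul (fun h0 => hne (by simp [h0])) hg, pre_add] at h1
  omega

end Prefix

section Leading

variable {k : ℕ}

/-- The exponent of the monomial `∏_{m ∈ T} y_m`. -/
def ind (T : Finset (Fin k)) : Fin k →₀ ℕ := Finsupp.equivFunOnFinite.symm fun m => if m ∈ T then 1 else 0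

theorem ind_apply (T : Finset (Fin k)) (m : Fin k) : ind T m = if m ∈ T then 1 else 0 := rfl

theorem ind_injective : Function.Injective (ind (k := k)) := fun S T h => by
  ext m
  have := DFunLike.congr_fun h m
  rw [ind_apply, ind_apply] at this
  split_ifs at this <;> simp_all

theorem pre_ind (j : ℕ) (T : Finset (Fin k)) : pre j (ind T) = (T.filter fun m : Fin k => (m : ℕ) < j).card := by
  rw [pre]
  simp only [ind_apply, Finset.sum_ite, Finset.sum_const_zero, Finset.sum_const, smul_eq_mul, mul_one,
    add_zero]
  congr 1
  ext m
  simp [and_comm]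

theorem monomial_ind (T : Finset (Fin k)) :
    (MvPolynomial.monomial (ind T) 1 : MvPolynomial (Fin k) ℝ) = ∏ m ∈ T, MvPolynomial.X m := by
  rw [MvPolynomial.monomial_eq, Finsupp.prod_fintype _ _ (by simp)]
  simp only [ind_apply, map_one, one_mul, pow_ite, pow_one, pow_zero, Finset.prod_ite_mem,
    Finset.univ_inter]

theorem esymMatrix_X (i l : Fin k) :
    esymMatrix (MvPolynomial.X : Fin k → MvPolynomial (Fin k) ℝ) i l =
      ∑ T ∈ (Finset.univ.erase l).powersetCard i, MvPolynomial.monomial (ind T) ((-1) ^ (i : ℕ)) := by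
  classical
  rw [esymMatrix, Matrix.of_apply, revPolyErase]
  simp only [sub_eq_add_neg]
  rw [Finset.prod_one_add, Polynomial.finsetSum_coeff]
  have h : ∀ T : Finset (Fin k), (∏ m ∈ T, -(Polynomial.C (MvPolynomial.X m : MvPolynomial (Fin k) ℝ) *
      Polynomial.X)).coeff (i : ℕ) = if T.card = i then MvPolynomial.monomial (ind T) ((-1) ^ (i : ℕ))
        else 0 := fun T => by
    have h1 : (∏ m ∈ T, -(Polynomial.C (MvPolynomial.X m : MvPolynomial (Fin k) ℝ) *
        Polynomial.X)) = Polynomial.C ((-1) ^ T.card * MvPolynomial.monomial (ind T) 1) *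
          Polynomial.X ^ T.card := by
      simp only [← neg_one_mul (Polynomial.C (_ : MvPolynomial (Fin k) ℝ) * Polynomial.X)]
      rw [Finset.prod_mul_distrib, Finset.prod_const, Finset.prod_mul_distrib, Finset.prod_const, monomial_ind, map_mul,
        map_pow, map_neg, map_one, map_prod, mul_assoc]
    rw [h1, Polynomial.coeff_C_mul_X_pow]
    by_cases hT : T.card = i
    · rw [if_pos hT.symm, if_pos hT, hT, ← MvPolynomial.C_1, ← MvPolynomial.C_neg,
        ← MvPolynomial.C_pow, MvPolynomial.C_mul_monomial, mul_one]
    · rw [if_neg (Ne.symm hT), if_neg hT]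
  simp only [h]
  rw [← Finset.sum_filter, Finset.powersetCard_eq_filter]

/-- The exponent of `y_0 ⋯ y_{i-1}`. -/
def topExp (i : Fin k) : Fin k →₀ ℕ := ind (Finset.Iio i)

theorem pre_le_topExp {i : Fin k} {T : Finset (Fin k)} (hT : T.card = i) (j : ℕ) :
    pre j (ind T) ≤ pre j (topExp i) := by
  rw [topExp, pre_ind, pre_ind]
  by_cases hj : j ≤ i
  · have h1 : (Finset.Iio i).filter (fun m : Fin k => (m : ℕ) < j) =
        Finset.univ.filter fun m : Fin k => (m : ℕ) < j := by
      ext m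
      simp only [Finset.mem_filter, Finset.mem_Iio, Finset.mem_univ, true_and, and_iff_right_iff_imp,
        Fin.lt_def]
      omega
    rw [h1]
    exact Finset.card_le_card (Finset.filter_subset_filter _ (Finset.subset_univ _))
  · have h1 : (Finset.Iio i).filter (fun m : Fin k => (m : ℕ) < j) = Finset.Iio i := by
      refine Finset.filter_true_of_mem fun m hm => ?_
      have := Fin.lt_def.mp (Finset.mem_Iio.mp hm)
      omega
    rw [h1, Fin.card_Iio, ← hT]
    exact Finset.card_filter_le _ _

theorem prefixLE_esymMatrix (i l : Fin k) :
    PrefixLE (esymMatrix (MvPolynomial.X : Fin k → MvPolynomial (Fin k) ℝ) i l) (topExp i) := by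
  classical
  rw [esymMatrix_X]
  refine PrefixLE.sum fun T hT b hb j => ?_
  rw [MvPolynomial.coeff_monomial] at hb
  have : ind T = b := by
    by_contra h
    exact hb (if_neg h)
  rw [← this]
  exact pre_le_topExp (Finset.mem_powersetCard.mp hT).2 j

/-- The leading monomial `X_0 ⋯ X_{i-1}` of `e_i` survives exactly when the erased variable is not
among the first `i`. -/
theorem coeff_esymMatrix (i l : Fin k) :
    (esymMatrix (MvPolynomial.X : Fin k → MvPolynomial (Fin k) ℝ) i l).coeff (topExp i) =
      if i ≤ l then (-1) ^ (i : ℕ) else 0 := by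
  classical
  rw [esymMatrix_X, MvPolynomial.coeff_sum]
  simp only [MvPolynomial.coeff_monomial, topExp, ind_injective.eq_iff]
  rw [Finset.sum_ite_eq']
  refine if_congr ?_ rfl rfl
  rw [Finset.mem_powersetCard, Fin.card_Iio]
  simp [Finset.subset_iff]
  constructor
  · intro h
    by_contra h'
    exact h (not_le.mp h') rfl
  · rintro h x hx rfl
    exact absurd hx (not_lt.mpr h)

theorem perm_eq_one_of_le (σ : Equiv.Perm (Fin k)) (h : ∀ i, i ≤ σ i) : σ = 1 := by
  have h1 : ∑ i : Fin k, (i : ℕ) = ∑ i, (σ i : ℕ) := (Equiv.sum_comp σ fun i : Fin k => (i : ℕ)).symm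
  rw [Finset.sum_eq_sum_iff_of_le fun i _ => Fin.le_def.mp (h i)] at h1
  ext i
  exact (h1 i (Finset.mem_univ i)).symm

/-- The exponent of the leading monomial of the Vandermonde determinant. -/
def deltaExp (k : ℕ) : Fin k →₀ ℕ := ∑ i, topExp i

/-- All terms of the determinant are bounded by the exponent `deltaExp k`, and only the identity
permutation contributes to its coefficient. -/
theorem leading_detShift (s : ℝ) (I : Finset (Fin k)) :
    PrefixLE (detShift (MvPolynomial.X : Fin k → MvPolynomial (Fin k) ℝ) (MvPolynomial.C s) I)
      (deltaExp k) ∧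
    (detShift (MvPolynomial.X : Fin k → MvPolynomial (Fin k) ℝ) (MvPolynomial.C s) I).coeff
      (deltaExp k) = (∏ i : Fin k, (-1) ^ (i : ℕ)) * ∏ i ∈ I, s ^ (i : ℕ) := by
  classical
  have hM : ∀ σ : Equiv.Perm (Fin k), (∏ i, (Matrix.of fun a i : Fin k =>
      esymMatrix (MvPolynomial.X : Fin k → MvPolynomial (Fin k) ℝ) i a *
        if a ∈ I then (MvPolynomial.C s) ^ (i : ℕ) else 1) (σ i) i) =
      ∏ i, (MvPolynomial.C (if σ i ∈ I then s ^ (i : ℕ) else 1) *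
        esymMatrix (MvPolynomial.X : Fin k → MvPolynomial (Fin k) ℝ) i (σ i)) := fun σ => by
    refine Finset.prod_congr rfl fun i _ => ?_
    rw [Matrix.of_apply, mul_comm]
    split_ifs <;> simp
  have hp := fun σ : Equiv.Perm (Fin k) => PrefixLE.prod Finset.univ
    fun i _ => (prefixLE_esymMatrix i (σ i)).C_mul (if σ i ∈ I then s ^ (i : ℕ) else 1)
  rw [detShift, Matrix.det_apply]
  simp only [hM]
  constructor
  · refine PrefixLE.sum fun σ _ => ?_
    have := (hp σ).1.C_mul ((Equiv.Perm.sign σ : ℤ) : ℝ)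
    rw [Units.smul_def, zsmul_eq_mul, deltaExp]
    simpa using this
  · rw [MvPolynomial.coeff_sum, Finset.sum_eq_single 1]
    · rw [Equiv.Perm.sign_one, one_smul, deltaExp, (hp 1).2]
      simp only [MvPolynomial.coeff_C_mul, coeff_esymMatrix, Equiv.Perm.one_apply, le_refl, if_true]
      rw [Finset.prod_mul_distrib, mul_comm]
      congr 1
      exact (Finset.prod_ite_mem _ _ _).trans (by rw [Finset.univ_inter])
    · intro σ _ hσ
      have : ∃ i, ¬ i ≤ σ i := by
        by_contra h
        push Not at h
        exact hσ (perm_eq_one_of_le σ h)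
      obtain ⟨i, hi⟩ := this
      rw [MvPolynomial.coeff_smul, deltaExp, (hp σ).2, Finset.prod_eq_zero (Finset.mem_univ i),
        smul_zero]
      rw [MvPolynomial.coeff_C_mul, coeff_esymMatrix, if_neg hi, mul_zero]
    · simp

theorem coeff_scaleOn (q : ℝ) (I : Finset (Fin k)) (p : MvPolynomial (Fin k) ℝ) (b : Fin k →₀ ℕ) :
    (MvPolynomial.aeval (scaleOn (MvPolynomial.C q) I
      (MvPolynomial.X : Fin k → MvPolynomial (Fin k) ℝ)) p).coeff b =
      (∏ l ∈ I, q ^ b l) * p.coeff b := by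
  classical
  induction p using MvPolynomial.induction_on' with
  | monomial a c =>
    have hs : ∀ l, scaleOn (MvPolynomial.C q) I (MvPolynomial.X : Fin k → MvPolynomial (Fin k) ℝ) l =
        MvPolynomial.C (if l ∈ I then q else 1) * MvPolynomial.X l := fun l => by
      rw [scaleOn]
      split_ifs <;> simp
    have h : MvPolynomial.aeval (scaleOn (MvPolynomial.C q) I
        (MvPolynomial.X : Fin k → MvPolynomial (Fin k) ℝ)) (MvPolynomial.monomial a c) =
        MvPolynomial.C (∏ l ∈ I, q ^ a l) * MvPolynomial.monomial a c := by
      rw [MvPolynomial.aeval_monomial, Finsupp.prod_fintype _ _ (by simp)]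
      simp only [hs, mul_pow, Finset.prod_mul_distrib]
      rw [MvPolynomial.monomial_eq, Finsupp.prod_fintype _ _ (by simp), mul_left_comm]
      congr 1
      rw [map_prod]
      conv_rhs => rw [← Finset.univ_inter I, ← Finset.prod_ite_mem]
      refine Finset.prod_congr rfl fun l _ => ?_
      split_ifs
      · simp
      · simp
    rw [h, MvPolynomial.coeff_C_mul, MvPolynomial.coeff_monomial]
    split_ifs with hab
    · rw [hab]
    · simp
  | add p q hp hq => rw [map_add, MvPolynomial.coeff_add, MvPolynomial.coeff_add, hp, hq, mul_add]

theorem PrefixLE.scaleOn {p : MvPolynomial (Fin k) ℝ} {a : Fin k →₀ ℕ} (h : PrefixLE p a) (q : ℝ)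
    (I : Finset (Fin k)) : PrefixLE (MvPolynomial.aeval (scaleOn (MvPolynomial.C q) I
      (MvPolynomial.X : Fin k → MvPolynomial (Fin k) ℝ)) p) a := fun b hb => by
  rw [coeff_scaleOn] at hb
  exact h b (right_ne_zero_of_mul hb)

theorem eval_reduce (y : Fin k → ℝ) (f : Lam) :
    MvPolynomial.eval y (reduce k f) = MvPolynomial.aeval (psums y) f := by
  rw [← MvPolynomial.coe_aeval_eq_eval, reduce]
  have : ((MvPolynomial.aeval y : MvPolynomial (Fin k) ℝ →ₐ[ℝ] ℝ).comp (MvPolynomial.aeval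
      fun n : ℕ+ => MvPolynomial.psum (Fin k) ℝ (n : ℕ))) = MvPolynomial.aeval (psums y) := by
    refine MvPolynomial.algHom_ext fun n => ?_
    rw [AlgHom.comp_apply, MvPolynomial.aeval_X, MvPolynomial.aeval_X, psums, MvPolynomial.psum,
      map_sum]
    simp
  exact DFunLike.congr_fun this f

/-- The operator acts on symmetric polynomials as a `q`-difference operator. -/
theorem det_mul_reduce_opE {q t : ℝ} (ht : 1 < t⁻¹) (r : ℕ) (f : Lam) :
    (esymMatrix (MvPolynomial.X : Fin k → MvPolynomial (Fin k) ℝ)).det * reduce k (opE q t r f) =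
      ∑ I : Finset (Fin k) with I.card ≤ r, MvPolynomial.C (tauValue t⁻¹ k (r - I.card)) *
        (detShift MvPolynomial.X (MvPolynomial.C t⁻¹) I *
          MvPolynomial.aeval (scaleOn (MvPolynomial.C q) I MvPolynomial.X) (reduce k f)) := by
  refine MvPolynomial.funext fun y => ?_
  have hX : (MvPolynomial.eval y : MvPolynomial (Fin k) ℝ →+* ℝ) ∘ MvPolynomial.X = y := by
    funext i
    simp
  have h1 := det_esymMatrix_map (MvPolynomial.eval y)
    (MvPolynomial.X : Fin k → MvPolynomial (Fin k) ℝ)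
  rw [hX] at h1
  rw [map_mul, ← h1, eval_reduce, aeval_opE q t y ht f, subsetSum, map_sum]
  refine Finset.sum_congr rfl fun I _ => ?_
  have h2 := detShift_map (MvPolynomial.eval y)
    (MvPolynomial.X : Fin k → MvPolynomial (Fin k) ℝ) (MvPolynomial.C t⁻¹) I
  rw [hX, MvPolynomial.eval_C] at h2
  rw [map_mul, map_mul, MvPolynomial.eval_C, ← h2, mul_comm (detShift y t⁻¹ I)]
  congr 2
  have h3 : (MvPolynomial.aeval y : MvPolynomial (Fin k) ℝ →ₐ[ℝ] ℝ).comp (MvPolynomial.aeval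
      (scaleOn (MvPolynomial.C q) I (MvPolynomial.X : Fin k → MvPolynomial (Fin k) ℝ))) =
      MvPolynomial.aeval (scaleOn q I y) := by
    refine MvPolynomial.algHom_ext fun l => ?_
    rw [AlgHom.comp_apply, MvPolynomial.aeval_X, MvPolynomial.aeval_X, scaleOn, scaleOn]
    split_ifs <;> simp
  rw [← eval_reduce]
  exact (DFunLike.congr_fun h3 (reduce k f)).symm

/-- The eigenvalues of the operator. -/
def eigenvalue (q t : ℝ) (r k : ℕ) (a : Fin k → ℕ) : ℝ :=
  ∑ I : Finset (Fin k) with I.card ≤ r, tauValue t⁻¹ k (r - I.card) *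
    ∏ l ∈ I, (t⁻¹ ^ (l : ℕ) * q ^ a l)

/-- The operator is triangular with respect to dominance. -/
theorem leading_opE {q t : ℝ} (ht : 1 < t⁻¹) (r : ℕ) {f : Lam} {a : Fin k →₀ ℕ}
    (h : PrefixLE (reduce k f) a) : PrefixLE (reduce k (opE q t r f)) a ∧
      (reduce k (opE q t r f)).coeff a = eigenvalue q t r k a * (reduce k f).coeff a := by
  have hV := leading_detShift (k := k) t⁻¹ ∅
  have hV' : detShift (MvPolynomial.X : Fin k → MvPolynomial (Fin k) ℝ) (MvPolynomial.C t⁻¹) ∅ =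
      (esymMatrix (MvPolynomial.X : Fin k → MvPolynomial (Fin k) ℝ)).det := by
    rw [detShift, ← Matrix.det_transpose]
    congr 1
    ext i l
    simp
  rw [hV', Finset.prod_empty, mul_one] at hV
  have hne : (∏ i : Fin k, (-1 : ℝ) ^ (i : ℕ)) ≠ 0 :=
    Finset.prod_ne_zero_iff.mpr fun i _ => pow_ne_zero _ (by norm_num)
  have hm := det_mul_reduce_opE (k := k) (q := q) ht r f
  have hI := fun I : Finset (Fin k) => (leading_detShift t⁻¹ I).1.mul (h.scaleOn q I)
  have h1 : PrefixLE (reduce k (opE q t r f)) a := by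
    refine PrefixLE.of_mul (p := (esymMatrix (MvPolynomial.X : Fin k → MvPolynomial (Fin k) ℝ)).det)
      (a := deltaExp k) (by rw [hV.2]; exact hne) ?_
    rw [hm]
    exact PrefixLE.sum fun I _ => (hI I).C_mul _
  refine ⟨h1, mul_left_cancel₀ hne ?_⟩
  rw [← hV.2, ← hV.1.coeff_mul h1, hm, MvPolynomial.coeff_sum, eigenvalue, hV.2, Finset.sum_mul,
    Finset.mul_sum]
  refine Finset.sum_congr rfl fun I _ => ?_
  rw [MvPolynomial.coeff_C_mul, (leading_detShift t⁻¹ I).1.coeff_mul (h.scaleOn q I),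
    (leading_detShift t⁻¹ I).2, coeff_scaleOn, Finset.prod_mul_distrib]
  ring

end Leading

/-! ### Newton's identities and the eigenvalues -/

section Newton

variable {A : Type*} [CommRing A] [Algebra ℝ A]

theorem elem_succ (r : ℕ) : ((r : ℝ) + 1) • elem (r + 1) =
    ∑ i : Fin (r + 1), (-1) ^ (i : ℕ) * elem (r - (i : ℕ)) * powerSum ⟨(i : ℕ) + 1, Nat.succ_pos _⟩ := by
  rw [elem, ← MvPolynomial.smul_eq_C_mul, smul_smul, mul_inv_cancel₀ (by positivity), one_smul]

/-- The generating function of the elementary symmetric functions is characterized by its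
logarithmic derivative. -/
theorem elem_eq_coeff (ρ : Lam →ₐ[ℝ] A) {B : PowerSeries A} (h0 : PowerSeries.coeff 0 B = 1)
    (hB : PowerSeries.derivative A B = B * PowerSeries.mk fun n =>
      (-1) ^ n * ρ (powerSum ⟨n + 1, Nat.succ_pos _⟩)) (r : ℕ) :
    ρ (elem r) = PowerSeries.coeff r B := by
  induction r using Nat.strong_induction_on with
  | _ r ih =>
    cases r with
    | zero => rw [h0, elem, map_one]
    | succ r =>
      have h1 := congrArg (PowerSeries.coeff r) hB
      rw [PowerSeries.coeff_derivative, PowerSeries.coeff_mul,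
        Finset.Nat.sum_antidiagonal_eq_sum_range_succ_mk, ← Finset.sum_range_reflect,
        Finset.sum_range] at h1
      have h2 := congrArg ρ (elem_succ r)
      rw [map_smul, map_sum] at h2
      have h3 : ∀ i : Fin (r + 1), ρ ((-1) ^ (i : ℕ) * elem (r - (i : ℕ)) *
          powerSum ⟨(i : ℕ) + 1, Nat.succ_pos _⟩) =
          PowerSeries.coeff (r + 1 - 1 - (i : ℕ)) B * PowerSeries.coeff (r - (r + 1 - 1 - (i : ℕ)))
            (PowerSeries.mk fun n => (-1) ^ n * ρ (powerSum ⟨n + 1, Nat.succ_pos _⟩)) := fun i => by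
        have hi : r - (r + 1 - 1 - (i : ℕ)) = i := by have := i.2; omega
        rw [hi, PowerSeries.coeff_mk, map_mul, map_mul, map_pow, map_neg, map_one,
          ih _ (by omega), Nat.add_sub_cancel]
        ring
      rw [Finset.sum_congr rfl fun i _ => h3 i, ← h1] at h2
      have h4 : ((r : ℝ) + 1) • PowerSeries.coeff (r + 1) B = PowerSeries.coeff (r + 1) B * (r + 1) := by
        rw [Algebra.smul_def, mul_comm]
        simp
      rw [← h4] at h2
      have h5 := congrArg (fun z => ((r : ℝ) + 1)⁻¹ • z) h2
      simp only [smul_smul] at h5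
      rwa [inv_mul_cancel₀ (by positivity), one_smul, one_smul] at h5

theorem derivative_prod_one_add {ι : Type*} (s : Finset ι) (x : ι → A) :
    PowerSeries.derivative A (∏ l ∈ s, (1 + PowerSeries.C (x l) * PowerSeries.X)) =
      (∏ l ∈ s, (1 + PowerSeries.C (x l) * PowerSeries.X)) *
        PowerSeries.mk fun n => (-1) ^ n * ∑ l ∈ s, x l ^ (n + 1) := by
  classical
  have hg : ∀ c : A, PowerSeries.C c = (1 + PowerSeries.C c * PowerSeries.X) *
      PowerSeries.mk fun n => (-1) ^ n * c ^ (n + 1) := fun c => by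
    ext n
    rw [add_mul, one_mul, mul_assoc, map_add, PowerSeries.coeff_C_mul, PowerSeries.coeff_mk]
    cases n with
    | zero => simp
    | succ n =>
      rw [PowerSeries.coeff_succ_X_mul, PowerSeries.coeff_mk, PowerSeries.coeff_C,
        if_neg (Nat.succ_ne_zero n)]
      ring
  induction s using Finset.induction_on with
  | empty =>
    rw [Finset.prod_empty, PowerSeries.derivative_one, one_mul]
    ext n
    simp
  | insert i s hi ih =>
    have h1 : (PowerSeries.mk fun n => (-1) ^ n * ∑ l ∈ insert i s, x l ^ (n + 1)) =
        (PowerSeries.mk fun n => (-1) ^ n * x i ^ (n + 1)) +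
          PowerSeries.mk fun n => (-1) ^ n * ∑ l ∈ s, x l ^ (n + 1) := by
      ext n
      rw [map_add, PowerSeries.coeff_mk, PowerSeries.coeff_mk, PowerSeries.coeff_mk,
        Finset.sum_insert hi, mul_add]
    have h2 : PowerSeries.derivative A (1 + PowerSeries.C (x i) * PowerSeries.X) =
        PowerSeries.C (x i) := by
      rw [map_add, PowerSeries.derivative_one, Derivation.leibniz, PowerSeries.derivative_C,
        PowerSeries.derivative_X]
      simp
    rw [Finset.prod_insert hi, Derivation.leibniz, ih, h2, h1, smul_eq_mul, smul_eq_mul, mul_add]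
    linear_combination (∏ l ∈ s, (1 + PowerSeries.C (x l) * PowerSeries.X)) * hg (x i)

theorem coeff_zero_prod_one_add {ι : Type*} (s : Finset ι) (x : ι → A) :
    PowerSeries.coeff 0 (∏ l ∈ s, (1 + PowerSeries.C (x l) * PowerSeries.X)) = 1 := by
  rw [PowerSeries.coeff_zero_eq_constantCoeff, map_prod]
  simp

theorem prod_one_add_eq {ι : Type*} [Fintype ι] [DecidableEq ι] (x : ι → A) :
    ∏ l, (1 + PowerSeries.C (x l) * PowerSeries.X) =
      ∑ I : Finset ι, PowerSeries.C (∏ l ∈ I, x l) * PowerSeries.X ^ I.card := by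
  rw [Finset.prod_one_add, Finset.powerset_univ]
  refine Finset.sum_congr rfl fun I _ => ?_
  rw [Finset.prod_mul_distrib, Finset.prod_const, map_prod]

/-- The elementary symmetric functions defined through Newton's identities agree with the elementary
symmetric polynomials. -/
theorem reduce_elem (k r : ℕ) : reduce k (elem r) = MvPolynomial.esymm (Fin k) ℝ r := by
  classical
  rw [elem_eq_coeff (reduce k) (coeff_zero_prod_one_add Finset.univ MvPolynomial.X), prod_one_add_eq,
    map_sum, MvPolynomial.esymm, Finset.powersetCard_eq_filter, Finset.sum_filter,
    Finset.powerset_univ]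
  · refine Finset.sum_congr rfl fun I _ => ?_
    rw [PowerSeries.coeff_C_mul, PowerSeries.coeff_X_pow, mul_ite, mul_one, mul_zero]
    simp only [eq_comm]
  · rw [derivative_prod_one_add]
    have h : ∀ n : ℕ+, reduce k (powerSum n) = ∑ l, MvPolynomial.X l ^ (n : ℕ) := fun n => by
      rw [reduce, powerSum, MvPolynomial.aeval_X]
      rfl
    congr 2
    funext n
    exact congrArg _ (h ⟨n + 1, Nat.succ_pos _⟩).symm

end Newton

section Eigenvalue

/-- The generating function `∑_m τ_m X^m`. -/
def tauGen (s : ℝ) (k : ℕ) : PowerSeries ℝ := PowerSeries.mk (tauValue s k)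

variable {s : ℝ}

theorem tauGen_eq (hs : ∀ n : ℕ, 1 - s ^ (n + 1) ≠ 0) (k : ℕ) :
    tauGen s k = (1 + PowerSeries.C (s ^ k) * PowerSeries.X) * PowerSeries.rescale s (tauGen s k) := by
  ext n
  rw [add_mul, one_mul, mul_assoc, map_add, PowerSeries.coeff_C_mul, PowerSeries.coeff_rescale,
    tauGen, PowerSeries.coeff_mk]
  cases n with
  | zero => simp
  | succ n =>
    rw [PowerSeries.coeff_succ_X_mul, PowerSeries.coeff_rescale, PowerSeries.coeff_mk]
    have h : (1 - s ^ (n + 1)) * tauValue s k (n + 1) = s ^ (k + n) * tauValue s k n := by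
      rw [tauValue, mul_div_cancel₀ _ (hs n)]
    rw [pow_add s k n] at h
    linarith

theorem derivative_rescale (s : ℝ) (f : PowerSeries ℝ) :
    PowerSeries.derivative ℝ (PowerSeries.rescale s f) =
      PowerSeries.C s * PowerSeries.rescale s (PowerSeries.derivative ℝ f) := by
  ext n
  rw [PowerSeries.coeff_derivative, PowerSeries.coeff_rescale, PowerSeries.coeff_C_mul,
    PowerSeries.coeff_rescale, PowerSeries.coeff_derivative]
  ring

/-- The logarithmic derivative of the generating function solves the functional equation that
follows from `tauGen_eq`, and this equation determines it. -/
theorem derivative_tauGen (hs : ∀ n : ℕ, 1 - s ^ (n + 1) ≠ 0) (k : ℕ) :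
    PowerSeries.derivative ℝ (tauGen s k) = tauGen s k * PowerSeries.mk fun n =>
      (-1) ^ n * (s ^ ((n + 1) * k) / (1 - s ^ (n + 1))) := by
  set H := tauGen s k with hH
  set P : PowerSeries ℝ := PowerSeries.mk fun n => (-1) ^ n * (s ^ ((n + 1) * k) / (1 - s ^ (n + 1)))
    with hP
  set L : PowerSeries ℝ := 1 + PowerSeries.C (s ^ k) * PowerSeries.X with hL
  have h1 : H = L * PowerSeries.rescale s H := tauGen_eq hs k
  have h2 : L * P = PowerSeries.C (s ^ k) + L * (PowerSeries.C s * PowerSeries.rescale s P) := by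
    rw [← sub_eq_iff_eq_add, ← mul_sub]
    ext n
    rw [hL, add_mul, one_mul, mul_assoc, map_add, PowerSeries.coeff_C_mul]
    have h3 : ∀ n, PowerSeries.coeff n (P - PowerSeries.C s * PowerSeries.rescale s P) =
        (-1) ^ n * s ^ ((n + 1) * k) := fun n => by
      rw [map_sub, PowerSeries.coeff_C_mul, PowerSeries.coeff_rescale, hP, PowerSeries.coeff_mk]
      have := hs n
      field_simp
      ring
    rw [h3]
    cases n with
    | zero => simp
    | succ n =>
      rw [PowerSeries.coeff_succ_X_mul, h3, PowerSeries.coeff_C, if_neg (Nat.succ_ne_zero n)]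
      ring
  have hdL : PowerSeries.derivative ℝ L = PowerSeries.C (s ^ k) := by
    rw [hL, map_add, PowerSeries.derivative_one, Derivation.leibniz, PowerSeries.derivative_C,
      PowerSeries.derivative_X]
    simp
  -- the defect satisfies a homogeneous functional equation
  set D := PowerSeries.derivative ℝ H - H * P with hD
  have h4 : D = L * (PowerSeries.C s * PowerSeries.rescale s D) := by
    have h5 : PowerSeries.derivative ℝ H = PowerSeries.C (s ^ k) * PowerSeries.rescale s H +
        L * (PowerSeries.C s * PowerSeries.rescale s (PowerSeries.derivative ℝ H)) := by
      conv_lhs => rw [h1, Derivation.leibniz, hdL, derivative_rescale]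
      simp only [smul_eq_mul]
      ring
    have h6 : H * P = PowerSeries.rescale s H * (PowerSeries.C (s ^ k) +
        L * (PowerSeries.C s * PowerSeries.rescale s P)) := by
      rw [← h2]
      conv_lhs => rw [h1]
      ring
    rw [hD, map_sub, map_mul, h6]
    conv_lhs => rw [h5]
    ring
  have h5 : D = 0 := by
    ext n
    rw [map_zero]
    induction n with
    | zero =>
      have := congrArg (PowerSeries.coeff 0) h4
      rw [hL, add_mul, one_mul, mul_assoc, map_add, PowerSeries.coeff_C_mul, PowerSeries.coeff_C_mul,
        PowerSeries.coeff_rescale, PowerSeries.coeff_zero_X_mul] at this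
      have h6 := hs 0
      have h7 : (1 - s ^ (0 + 1)) * PowerSeries.coeff 0 D = 0 := by
        simp only [pow_zero, one_mul, mul_zero, add_zero, zero_add, pow_one] at this ⊢
        linarith
      exact (mul_eq_zero.mp h7).resolve_left h6
    | succ n ih =>
      have := congrArg (PowerSeries.coeff (n + 1)) h4
      rw [hL, add_mul, one_mul, mul_assoc, map_add, PowerSeries.coeff_C_mul, PowerSeries.coeff_C_mul,
        PowerSeries.coeff_rescale, PowerSeries.coeff_succ_X_mul, PowerSeries.coeff_C_mul,
        PowerSeries.coeff_rescale, ih, mul_zero, mul_zero, mul_zero, add_zero] at this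
      have h7 : (1 - s ^ (n + 1 + 1)) * PowerSeries.coeff (n + 1) D = 0 := by
        rw [pow_succ s (n + 1)]
        linarith
      exact (mul_eq_zero.mp h7).resolve_left (hs _)
  exact sub_eq_zero.mp h5

/-- The generating function of the eigenvalues. -/
theorem eigenvalue_eq_coeff (q t : ℝ) (r k : ℕ) (a : Fin k → ℕ) :
    eigenvalue q t r k a = PowerSeries.coeff r (tauGen t⁻¹ k *
      ∏ l : Fin k, (1 + PowerSeries.C (t⁻¹ ^ (l : ℕ) * q ^ a l) * PowerSeries.X)) := by
  classical
  rw [prod_one_add_eq, Finset.mul_sum, map_sum, eigenvalue, Finset.sum_filter]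
  refine Finset.sum_congr rfl fun I _ => ?_
  rw [mul_left_comm, PowerSeries.coeff_C_mul, PowerSeries.coeff_mul_X_pow', tauGen,
    PowerSeries.coeff_mk]
  split_ifs
  · ring
  · simp

theorem rowList_length (lam : Ptn) : (rowList lam.2).length = lam.length := by
  rw [rowList, Multiset.length_sort, Ptn.length]

theorem row_eq_zero {lam : Ptn} {i : ℕ} (h : lam.length ≤ i) : lam.row i = 0 := by
  rw [Ptn.row, List.getD_eq_default]
  rwa [rowList_length]

theorem one_sub_pow_ne_zero (hs : 1 < s) (n : ℕ) : 1 - s ^ (n + 1) ≠ 0 :=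
  (sub_neg.mpr (one_lt_pow₀ hs n.succ_ne_zero)).ne

/-- The number of rows that are taken into account does not matter, as long as it is at least the
length. -/
theorem qtSpec_powerSum {q t : ℝ} (ht : 1 < t⁻¹) (lam : Ptn) {k : ℕ} (hk : lam.length ≤ k) (n : ℕ+) :
    qtSpec q t lam 1 (powerSum n) = ∑ l : Fin k, (t⁻¹ ^ (l : ℕ) * q ^ lam.row l) ^ (n : ℕ) +
      t⁻¹ ^ ((n : ℕ) * k) / (1 - t⁻¹ ^ (n : ℕ)) := by
  rw [qtSpec, powerSum, MvPolynomial.aeval_X, Finset.sum_range]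
  have h1 : ∀ i : ℕ, t ^ (-((i : ℤ) + 1) + 1) = t⁻¹ ^ i := fun i => by
    rw [neg_add, neg_add_cancel_right, zpow_neg, zpow_natCast, inv_pow]
  have h2 : t ^ (-((n : ℕ) : ℤ) * ((lam.length : ℤ) - 1 + 1)) = t⁻¹ ^ ((n : ℕ) * lam.length) := by
    rw [sub_add_cancel, neg_mul, zpow_neg, inv_pow, ← zpow_natCast]
    push_cast
    rfl
  have h3 : t ^ (-((n : ℕ) : ℤ)) = t⁻¹ ^ (n : ℕ) := by rw [zpow_neg, zpow_natCast, inv_pow]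
  simp only [h1, h2, h3]
  have hs : 1 - t⁻¹ ^ (n : ℕ) ≠ 0 := by
    have := one_lt_pow₀ ht n.ne_zero
    linarith
  rw [← Finset.sum_range fun i => (q ^ lam.row i * t⁻¹ ^ i) ^ (n : ℕ),
    ← Finset.sum_range fun l => (t⁻¹ ^ l * q ^ lam.row l) ^ (n : ℕ)]
  induction k, hk using Nat.le_induction with
  | base =>
    congr 1
    exact Finset.sum_congr rfl fun l _ => by rw [mul_comm]
  | succ k hk ih =>
    rw [ih, Finset.sum_range_succ, row_eq_zero hk, pow_zero, mul_one, add_assoc, mul_add, pow_add,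
      mul_one, ← pow_mul, mul_comm k]
    congr 1
    generalize t⁻¹ ^ ((n : ℕ) * k) = A
    generalize t⁻¹ ^ (n : ℕ) = w at hs ⊢
    field_simp
    ring

/-- The observables are the eigenvalues. -/
theorem obsE_eq_eigenvalue {q t : ℝ} (ht : 1 < t⁻¹) (r : ℕ) (lam : Ptn) {k : ℕ}
    (hk : lam.length ≤ k) : obsE q t r lam = eigenvalue q t r k fun l => lam.row l := by
  have hs := one_sub_pow_ne_zero ht
  rw [eigenvalue_eq_coeff, obsE]
  refine elem_eq_coeff _ ?_ ?_ r
  · rw [PowerSeries.coeff_zero_eq_constantCoeff, map_mul, ← PowerSeries.coeff_zero_eq_constantCoeff,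
      coeff_zero_prod_one_add, tauGen,
      PowerSeries.coeff_mk, mul_one]
    rfl
  · rw [Derivation.leibniz, derivative_tauGen hs, derivative_prod_one_add, smul_eq_mul, smul_eq_mul]
    have : (PowerSeries.mk fun n => (-1) ^ n * qtSpec q t lam 1 (powerSum ⟨n + 1, Nat.succ_pos _⟩)) =
        (PowerSeries.mk fun n => (-1) ^ n * ∑ l : Fin k, (t⁻¹ ^ (l : ℕ) * q ^ lam.row l) ^ (n + 1)) +
        PowerSeries.mk fun n => (-1) ^ n * (t⁻¹ ^ ((n + 1) * k) / (1 - t⁻¹ ^ (n + 1))) := by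
      ext n
      rw [map_add, PowerSeries.coeff_mk, PowerSeries.coeff_mk, PowerSeries.coeff_mk,
        ← mul_add]
      exact congrArg _ (qtSpec_powerSum ht lam hk ⟨n + 1, Nat.succ_pos _⟩)
    rw [this]
    ring

theorem row_antitone (lam : Ptn) : Antitone lam.row := by
  intro i j hij
  rcases lt_or_ge j lam.length with hj | hj
  · rw [Ptn.row, Ptn.row, List.getD_eq_getElem _ _ (by rwa [rowList_length]),
      List.getD_eq_getElem _ _ (by rw [rowList_length]; omega)]
    rcases hij.eq_or_lt with h | h
    · simp [h]
    · exact List.pairwise_iff_getElem.mp (Multiset.pairwise_sort lam.2.parts (· ≥ ·)) i j _ _ h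
  · rw [row_eq_zero hj]
    exact Nat.zero_le _

theorem eq_of_row_eq {lam mu : Ptn} (h : ∀ i, lam.row i = mu.row i) : lam = mu := by
  have hpos : ∀ (nu : Ptn) (i : ℕ), i < nu.length → nu.row i ≠ 0 := fun nu i hi => by
    rw [Ptn.row, List.getD_eq_getElem _ _ (by rwa [rowList_length])]
    refine (nu.2.parts_pos ?_).ne'
    rw [← Multiset.mem_sort (· ≥ ·)]
    exact List.getElem_mem _
  have hle : ∀ lam mu : Ptn, (∀ i, lam.row i = mu.row i) → lam.length ≤ mu.length := by
    intro lam mu h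
    by_contra! hlt
    exact hpos lam _ hlt ((h _).trans (row_eq_zero le_rfl))
  have hlen : lam.length = mu.length := (hle _ _ h).antisymm (hle _ _ fun i => (h i).symm)
  have hlist : rowList lam.2 = rowList mu.2 := by
    refine List.ext_getElem (by rw [rowList_length, rowList_length, hlen]) fun i h1 h2 => ?_
    have := h i
    rwa [Ptn.row, Ptn.row, List.getD_eq_getElem _ _ h1, List.getD_eq_getElem _ _ h2] at this
  have hparts : lam.2.parts = mu.2.parts := by
    rw [← Multiset.sort_eq lam.2.parts (· ≥ ·), ← Multiset.sort_eq mu.2.parts (· ≥ ·)]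
    exact congrArg _ hlist
  obtain ⟨n, lam⟩ := lam
  obtain ⟨m, mu⟩ := mu
  have hn : n = m := by rw [← lam.parts_sum, ← mu.parts_sum, hparts]
  subst hn
  exact congrArg (Sigma.mk n) (Nat.Partition.ext hparts)

/-- The observables separate the partitions. -/
theorem eq_of_obsE_eq {q t : ℝ} (hq : 0 < q) (hq' : q < 1) (ht : 1 < t⁻¹) {lam mu : Ptn}
    (h : ∀ r, obsE q t r lam = obsE q t r mu) : lam = mu := by
  refine eq_of_row_eq fun i => ?_
  set k := lam.length + mu.length + i + 1 with hk
  have hx : ∀ nu : Ptn, StrictMono fun l : Fin k => t⁻¹ ^ (l : ℕ) * q ^ nu.row l := by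
    intro nu l m hlm
    have h1 : q ^ nu.row l ≤ q ^ nu.row m :=
      pow_le_pow_of_le_one hq.le hq'.le (row_antitone nu (le_of_lt hlm))
    have h2 : t⁻¹ ^ (l : ℕ) < t⁻¹ ^ (m : ℕ) := pow_lt_pow_right₀ ht hlm
    exact mul_lt_mul h2 h1 (by positivity) (by positivity)
  have hx0 : ∀ (nu : Ptn) (l : Fin k), t⁻¹ ^ (l : ℕ) * q ^ nu.row l ≠ 0 := fun nu l =>
    mul_ne_zero (pow_ne_zero _ (by linarith)) (pow_ne_zero _ hq.ne')
  have h1 : ∏ l : Fin k, (1 + PowerSeries.C (t⁻¹ ^ (l : ℕ) * q ^ lam.row l) * PowerSeries.X) =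
      ∏ l : Fin k, (1 + PowerSeries.C (t⁻¹ ^ (l : ℕ) * q ^ mu.row l) * PowerSeries.X) := by
    have h0 : tauGen t⁻¹ k ≠ 0 := fun h0 => by
      have := congrArg (PowerSeries.coeff 0) h0
      rw [tauGen, PowerSeries.coeff_mk, map_zero] at this
      exact one_ne_zero this
    refine mul_left_cancel₀ h0 ?_
    ext r
    rw [← eigenvalue_eq_coeff q t r k (fun l => lam.row l),
      ← eigenvalue_eq_coeff q t r k (fun l => mu.row l), ← obsE_eq_eigenvalue ht r lam (by omega),
      ← obsE_eq_eigenvalue ht r mu (by omega), h r]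
  have h2 : ∏ l : Fin k, (1 + Polynomial.C (t⁻¹ ^ (l : ℕ) * q ^ lam.row l) * Polynomial.X) =
      ∏ l : Fin k, (1 + Polynomial.C (t⁻¹ ^ (l : ℕ) * q ^ mu.row l) * Polynomial.X) := by
    apply Polynomial.coe_injective
    rw [← Polynomial.coeToPowerSeries.ringHom_apply, ← Polynomial.coeToPowerSeries.ringHom_apply,
      map_prod, map_prod]
    simpa using h1
  have key : ∀ x x' : Fin k → ℝ, (∀ l, x l ≠ 0) →
      ∏ l : Fin k, (1 + Polynomial.C (x l) * Polynomial.X) =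
      ∏ l : Fin k, (1 + Polynomial.C (x' l) * Polynomial.X) → Set.range x ⊆ Set.range x' := by
    rintro x x' h0 h _ ⟨l, rfl⟩
    have h3 := congrArg (Polynomial.eval (-(x l)⁻¹)) h
    rw [Polynomial.eval_prod, Polynomial.eval_prod, Finset.prod_eq_zero (Finset.mem_univ l)] at h3
    · obtain ⟨m, -, hm⟩ := Finset.prod_eq_zero_iff.mp h3.symm
      refine ⟨m, ?_⟩
      simp only [Polynomial.eval_add, Polynomial.eval_one, Polynomial.eval_mul, Polynomial.eval_C,
        Polynomial.eval_X] at hm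
      have := h0 l
      field_simp at hm
      linarith
    · have := h0 l
      simp [this]
  have h3 := (StrictMono.range_inj (hx lam) (hx mu)).mp
    ((key _ _ (hx0 lam) h2).antisymm (key _ _ (hx0 mu) h2.symm))
  have h4 := congrFun h3 ⟨i, by omega⟩
  simp only at h4
  have h5 := mul_left_cancel₀ (pow_ne_zero _ (by linarith)) h4
  exact pow_right_injective₀ hq hq'.ne h5

end Eigenvalue

/-! ### Monomial expansions of symmetric functions -/

section Shape

variable {σ τ : Type*}

/-- The multiset of the nonzero exponents of a monomial. -/
def shape (b : σ →₀ ℕ) : Multiset ℕ := b.support.val.map b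

theorem shape_mapDomain {f : σ → τ} (hf : Function.Injective f) (b : σ →₀ ℕ) :
    shape (b.mapDomain f) = shape b := by
  classical
  rw [shape, shape, Finsupp.mapDomain_support_of_injective hf,
    Finset.image_val_of_injOn hf.injOn, Multiset.map_map]
  exact Multiset.map_congr rfl fun i _ => Finsupp.mapDomain_apply hf b i

theorem count_shape [Fintype σ] (b : σ →₀ ℕ) {c : ℕ} (hc : c ≠ 0) :
    (shape b).count c = Fintype.card {i // b i = c} := by
  classical
  rw [shape, Multiset.count_map, Fintype.card_subtype]
  congr 1
  rw [← Finset.filter_val]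
  congr 1
  ext i
  simp only [Finset.mem_filter, Finsupp.mem_support_iff, Finset.mem_univ, true_and]
  constructor
  · rintro ⟨-, h⟩
    exact h.symm
  · rintro rfl
    exact ⟨hc, rfl⟩

theorem card_shape [Fintype σ] (b : σ →₀ ℕ) :
    (shape b).card + Fintype.card {i // b i = 0} = Fintype.card σ := by
  classical
  rw [shape, Multiset.card_map, Fintype.card_subtype, ← Finset.card_def,
    ← Finset.card_union_of_disjoint, ← Finset.card_univ]
  · congr 1
    ext i
    simp only [Finset.mem_union, Finsupp.mem_support_iff, Finset.mem_filter, Finset.mem_univ,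
      true_and, iff_true]
    exact ne_or_eq _ _
  · rw [Finset.disjoint_left]
    intro i hi hi'
    simp only [Finset.mem_filter, Finset.mem_univ, true_and] at hi'
    exact (Finsupp.mem_support_iff.mp hi) hi'

/-- Monomials of the same shape are related by a permutation of the variables. -/
theorem exists_perm_of_shape_eq [Fintype σ] {b b' : σ →₀ ℕ} (h : shape b = shape b') :
    ∃ e : σ ≃ σ, b.mapDomain e = b' := by
  classical
  have hc : ∀ c, Nonempty ({i // b i = c} ≃ {i // b' i = c}) := fun c => by
    rw [← Fintype.card_eq]
    by_cases h0 : c = 0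
    · subst h0
      have h1 := card_shape b
      have h2 := card_shape b'
      rw [h] at h1
      omega
    · rw [← count_shape b h0, ← count_shape b' h0, h]
  refine ⟨Equiv.ofFiberEquiv fun c => (hc c).some, ?_⟩
  ext i
  obtain ⟨j, rfl⟩ := (Equiv.ofFiberEquiv fun c => (hc c).some).surjective i
  rw [Finsupp.mapDomain_apply (Equiv.injective _)]
  exact (Equiv.ofFiberEquiv_map (g := b') (fun c => (hc c).some) j).symm

theorem sum_shape [Fintype σ] (b : σ →₀ ℕ) : (shape b).sum = b.degree := rfl

end Shape

section Reduce

theorem reduce_powerSum (k : ℕ) (n : ℕ+) :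
    reduce k (powerSum n) = ∑ l, MvPolynomial.X l ^ (n : ℕ) := by
  rw [reduce, powerSum, MvPolynomial.aeval_X]
  rfl

theorem rename_reduce {k : ℕ} (e : Fin k ≃ Fin k) (f : Lam) :
    MvPolynomial.rename e (reduce k f) = reduce k f := by
  have h : (MvPolynomial.rename e).comp (reduce k) = reduce k := by
    refine MvPolynomial.algHom_ext fun n => ?_
    show MvPolynomial.rename e (reduce k (powerSum n)) = reduce k (powerSum n)
    rw [reduce_powerSum, map_sum]
    simp only [map_pow, MvPolynomial.rename_X]
    exact Equiv.sum_comp e fun l => (MvPolynomial.X l : MvPolynomial (Fin k) ℝ) ^ (n : ℕ)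
  exact DFunLike.congr_fun h f

theorem killCompl_reduce {k K : ℕ} {g : Fin k → Fin K} (hg : Function.Injective g) (f : Lam) :
    MvPolynomial.killCompl hg (reduce K f) = reduce k f := by
  classical
  have h : (MvPolynomial.killCompl hg).comp (reduce K) = reduce k := by
    refine MvPolynomial.algHom_ext fun n => ?_
    show MvPolynomial.killCompl hg (reduce K (powerSum n)) = reduce k (powerSum n)
    rw [reduce_powerSum, reduce_powerSum, map_sum]
    symm
    refine Finset.sum_of_injOn g hg.injOn (fun _ _ => by simp) ?_ ?_
    · intro i _ hi
      have : i ∉ Set.range g := by simpa using hi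
      rw [map_pow, MvPolynomial.killCompl, MvPolynomial.aeval_X, dif_neg this, zero_pow n.ne_zero]
    · intro i _
      rw [map_pow, ← MvPolynomial.rename_X, MvPolynomial.killCompl_rename_app]
  exact DFunLike.congr_fun h f

/-- The coefficients of symmetric functions depend only on the shape of the monomials. -/
theorem coeff_reduce_eq_of_shape_eq {k K : ℕ} {b : Fin k →₀ ℕ} {b' : Fin K →₀ ℕ}
    (h : shape b = shape b') (f : Lam) : (reduce k f).coeff b = (reduce K f).coeff b' := by
  have h1 := Fin.castAdd_injective k K
  have h2 := Fin.natAdd_injective K k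
  rw [← killCompl_reduce h1, ← killCompl_reduce h2, MvPolynomial.coeff_killCompl,
    MvPolynomial.coeff_killCompl]
  obtain ⟨e, he⟩ := exists_perm_of_shape_eq (b := b.mapDomain (Fin.castAdd K))
    (b' := b'.mapDomain (Fin.natAdd k)) (by rw [shape_mapDomain h1, shape_mapDomain h2, h])
  rw [← he]
  conv_rhs => rw [← rename_reduce e]
  rw [MvPolynomial.coeff_rename_mapDomain _ e.injective]

theorem prod_map_X {σ : Type*} [DecidableEq σ] (s : Multiset σ) :
    (s.map (MvPolynomial.X : σ → MvPolynomial σ ℝ)).prod =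
      MvPolynomial.monomial (Multiset.toFinsupp s) 1 := by
  induction s using Multiset.induction_on with
  | empty => simp
  | cons a s ih =>
    rw [Multiset.map_cons, Multiset.prod_cons, ih, ← Multiset.singleton_add, map_add,
      Multiset.toFinsupp_singleton, MvPolynomial.X, MvPolynomial.monomial_mul, one_mul]

theorem coeff_msymm {k n : ℕ} (mu : n.Partition) (b : Fin k →₀ ℕ) :
    (MvPolynomial.msymm (Fin k) ℝ mu).coeff b = if shape b = mu.parts then 1 else 0 := by
  classical
  have hshape : ∀ s : Sym (Fin k) n, (Nat.Partition.ofSym s).parts =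
      shape (Multiset.toFinsupp (s : Multiset (Fin k))) := fun s => rfl
  rw [MvPolynomial.msymm, MvPolynomial.coeff_sum]
  have hterm : ∀ s : {a : Sym (Fin k) n // .ofSym a = mu},
      MvPolynomial.coeff b (s.1.1.map (MvPolynomial.X : Fin k → MvPolynomial (Fin k) ℝ)).prod =
      if Multiset.toFinsupp s.1.1 = b then 1 else 0 := fun s => by
    rw [prod_map_X, MvPolynomial.coeff_monomial]
  simp only [hterm]
  split_ifs with h
  · have hb : (Finsupp.toMultiset b).card = n := by
      rw [Finsupp.card_toMultiset, ← mu.parts_sum, ← h]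
      rfl
    have hs : Nat.Partition.ofSym (⟨Finsupp.toMultiset b, hb⟩ : Sym (Fin k) n) = mu :=
      Nat.Partition.ext ((hshape _).trans (by
        rw [← h]
        exact congrArg shape (Finsupp.toMultiset_toFinsupp b)))
    rw [Finset.sum_eq_single ⟨⟨Finsupp.toMultiset b, hb⟩, hs⟩]
    · exact if_pos (Finsupp.toMultiset_toFinsupp b)
    · intro s _ hne
      refine if_neg fun h' => hne (Subtype.ext (Subtype.ext ?_))
      show s.1.1 = Finsupp.toMultiset b
      rw [← h', Multiset.toFinsupp_toMultiset]
    · exact fun h' => absurd (Finset.mem_univ _) h'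
  · refine Finset.sum_eq_zero fun s _ => if_neg fun h' => h ?_
    rw [← h']
    exact (hshape s.1).symm.trans (congrArg Nat.Partition.parts s.2)

end Reduce

section Rows

variable {n : ℕ}

/-- The rows of a partition as the exponents of a monomial in `k` variables. -/
def rowExp (k : ℕ) (lam : Ptn) : Fin k →₀ ℕ := Finsupp.equivFunOnFinite.symm fun l => lam.row l

theorem rowExp_apply (k : ℕ) (lam : Ptn) (l : Fin k) : rowExp k lam l = lam.row l := rfl

theorem row_ne_zero {lam : Ptn} {i : ℕ} (hi : i < lam.length) : lam.row i ≠ 0 := by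
  rw [Ptn.row, List.getD_eq_getElem _ _ (by rwa [rowList_length])]
  refine (lam.2.parts_pos ?_).ne'
  rw [← Multiset.mem_sort (· ≥ ·)]
  exact List.getElem_mem _

theorem shape_rowExp {k : ℕ} {lam : Ptn} (hk : lam.length ≤ k) :
    shape (rowExp k lam) = lam.2.parts := by
  have h1 : (rowExp lam.length lam).mapDomain (Fin.castLE hk) = rowExp k lam := by
    ext i
    by_cases hi : (i : ℕ) < lam.length
    · have : i = Fin.castLE hk ⟨i, hi⟩ := rfl
      rw [this, Finsupp.mapDomain_apply (Fin.castLE_injective hk)]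
      rfl
    · rw [Finsupp.mapDomain_of_notMem_range, rowExp_apply, row_eq_zero (not_lt.mp hi)]
      rintro ⟨j, rfl⟩
      exact hi j.2
  rw [← h1, shape_mapDomain (Fin.castLE_injective hk), shape]
  have h2 : (rowExp lam.length lam).support = Finset.univ := by
    ext i
    simp only [Finsupp.mem_support_iff, Finset.mem_univ, iff_true]
    exact row_ne_zero i.2
  rw [h2]
  have h3 : List.ofFn (fun i : Fin lam.length => lam.row i) = rowList lam.2 := by
    refine List.ext_getElem (by rw [List.length_ofFn, rowList_length]) fun i h h' => ?_
    rw [List.getElem_ofFn, Ptn.row, List.getD_eq_getElem]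
  conv_rhs => rw [← Multiset.sort_eq lam.2.parts (· ≥ ·)]
  show _ = ((rowList lam.2 : List ℕ) : Multiset ℕ)
  rw [← h3, ← Fin.univ_val_map]
  rfl

theorem length_le_size (lam : Ptn) : lam.length ≤ lam.size := by
  have h := Multiset.card_nsmul_le_sum (s := lam.2.parts) (a := 1) fun x hx => lam.2.parts_pos hx
  rw [lam.2.parts_sum] at h
  rw [smul_eq_mul, mul_one] at h
  exact h

theorem sum_take_eq (l : List ℕ) (j : ℕ) :
    (l.take j).sum = ∑ i ∈ Finset.range j, l.getD i 0 := by
  induction j with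
  | zero => simp
  | succ j ih =>
    rw [Finset.sum_range_succ, ← ih]
    rcases lt_or_ge j l.length with h | h
    · rw [List.sum_take_succ _ _ h, List.getD_eq_getElem _ _ h]
    · rw [List.getD_eq_default _ _ h, add_zero, List.take_of_length_le h,
        List.take_of_length_le (by omega)]

theorem pre_rowExp {k : ℕ} {lam : Ptn} (hk : lam.length ≤ k) (j : ℕ) :
    pre j (rowExp k lam) = ((rowList lam.2).take j).sum := by
  rw [sum_take_eq, pre, Finset.sum_filter]
  simp only [rowExp_apply]
  rw [Fin.sum_univ_eq_sum_range (fun i => if i < j then lam.row i else 0) k, ← Finset.sum_filter]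
  refine Finset.sum_subset (fun i hi => Finset.mem_range.mpr (Finset.mem_filter.mp hi).2) ?_
  intro i hi hi'
  refine row_eq_zero (hk.trans ?_)
  by_contra! h
  exact hi' (Finset.mem_filter.mpr ⟨Finset.mem_range.mpr h, Finset.mem_range.mp hi⟩)

/-- In a decreasing list the sum of `j` entries is at most the sum of the first `j` entries. -/
theorem sum_le_sum_take {l : List ℕ} (hl : l.Pairwise (· ≥ ·)) {j : ℕ} {T : Multiset ℕ}
    (hT : T ≤ ↑l) (hj : T.card ≤ j) : T.sum ≤ (l.take j).sum := by
  induction l generalizing j T with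
  | nil =>
    have : T = 0 := by simpa using hT
    simp [this]
  | cons a l ih =>
    rw [List.pairwise_cons] at hl
    rcases Multiset.empty_or_exists_mem T with rfl | ⟨x, hx⟩
    · simp
    obtain ⟨j, rfl⟩ : ∃ i, j = i + 1 := ⟨j - 1, by
      have := Multiset.card_pos_iff_exists_mem.mpr ⟨x, hx⟩
      omega⟩
    rw [List.take_succ_cons, List.sum_cons]
    by_cases ha : a ∈ T
    · rw [← Multiset.cons_erase ha, Multiset.sum_cons]
      refine add_le_add le_rfl (ih hl.2 ?_ ?_)
      · rw [Multiset.erase_le_iff_le_cons]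
        exact hT
      · rw [Multiset.card_erase_of_mem ha, Nat.pred_eq_sub_one]
        omega
    · have hT' : T ≤ ↑l := by
        rw [← Multiset.erase_of_notMem ha, Multiset.erase_le_iff_le_cons]
        exact hT
      rw [← Multiset.cons_erase hx, Multiset.sum_cons]
      refine add_le_add (hl.1 x (by simpa using Multiset.mem_of_le hT' hx))
        (ih hl.2 ((Multiset.erase_le x T).trans hT') ?_)
      rw [Multiset.card_erase_of_mem hx, Nat.pred_eq_sub_one]
      omega

/-- A sum of `j` parts is at most the sum of the `j` largest parts. -/
theorem pre_le_of_shape {k : ℕ} {b : Fin k →₀ ℕ} {lam : Ptn} (h : shape b = lam.2.parts) (j : ℕ) :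
    pre j b ≤ ((rowList lam.2).take j).sum := by
  classical
  set T : Finset (Fin k) := b.support.filter fun i : Fin k => (i : ℕ) < j with hT
  have h1 : pre j b = (T.val.map b).sum := by
    show _ = ∑ i ∈ T, b i
    rw [pre, hT]
    symm
    refine Finset.sum_subset (Finset.filter_subset_filter _ (Finset.subset_univ _)) ?_
    intro i hi hi'
    by_contra h0
    exact hi' (Finset.mem_filter.mpr ⟨Finsupp.mem_support_iff.mpr h0, (Finset.mem_filter.mp hi).2⟩)
  rw [h1]
  refine sum_le_sum_take (Multiset.pairwise_sort _ _) ?_ ?_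
  · rw [Multiset.sort_eq, ← h, shape]
    exact Multiset.map_le_map (Finset.val_le_iff.mpr (Finset.filter_subset _ _))
  · rw [Multiset.card_map]
    have : (T.map ⟨Fin.val, Fin.val_injective⟩).card ≤ (Finset.range j).card :=
      Finset.card_le_card fun i hi => by
        obtain ⟨m, hm, rfl⟩ := Finset.mem_map.mp hi
        exact Finset.mem_range.mpr (Finset.mem_filter.mp hm).2
    rwa [Finset.card_map, Finset.card_range] at this

end Rows

/-! ### The graded pieces of the ring of symmetric functions -/

section Graded

/-- The symmetric functions of degree `n`. -/
def degPart (n : ℕ) : Submodule ℝ Lam := MvPolynomial.restrictSupport ℝ {e : ℕ+ →₀ ℕ | wt e = n}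

theorem mem_degPart {n : ℕ} {f : Lam} : f ∈ degPart n ↔ ∀ e, f.coeff e ≠ 0 → wt e = n := by
  rw [degPart, MvPolynomial.mem_restrictSupport_iff]
  constructor
  · intro h e he
    exact h (MvPolynomial.mem_support_iff.mpr he)
  · intro h e he
    exact h e (MvPolynomial.mem_support_iff.mp he)

/-- The projection to degree `n`. -/
def degProj (n : ℕ) (f : Lam) : Lam := ∑ e ∈ wtFinset n, MvPolynomial.monomial e (f.coeff e)

theorem coeff_degProj (n : ℕ) (f : Lam) (e : ℕ+ →₀ ℕ) :
    (degProj n f).coeff e = if wt e = n then f.coeff e else 0 := by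
  classical
  rw [degProj, MvPolynomial.coeff_sum]
  simp only [MvPolynomial.coeff_monomial, Finset.sum_ite_eq', mem_wtFinset]

theorem degProj_mem (n : ℕ) (f : Lam) : degProj n f ∈ degPart n := mem_degPart.mpr fun e he => by
  rw [coeff_degProj] at he
  by_contra h
  exact he (if_neg h)

theorem reduce_monomial_isHomogeneous (k : ℕ) (e : ℕ+ →₀ ℕ) :
    (reduce k (MvPolynomial.monomial e 1)).IsHomogeneous (wt e) := by
  rw [reduce, MvPolynomial.aeval_monomial, map_one, one_mul, Finsupp.prod, wt, Finsupp.sum]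
  refine MvPolynomial.IsHomogeneous.prod _ _ _ fun n _ => MvPolynomial.IsHomogeneous.pow ?_ _
  rw [MvPolynomial.psum]
  refine MvPolynomial.IsHomogeneous.sum _ _ _ fun i _ => ?_
  simpa using (MvPolynomial.isHomogeneous_X ℝ i).pow (n : ℕ)

theorem coeff_reduce_monomial {k : ℕ} {e : ℕ+ →₀ ℕ} (c : ℝ) {b : Fin k →₀ ℕ} (h : b.degree ≠ wt e) :
    (reduce k (MvPolynomial.monomial e c)).coeff b = 0 := by
  have h1 : MvPolynomial.monomial e c = c • MvPolynomial.monomial e (1 : ℝ) := by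
    rw [MvPolynomial.smul_monomial, smul_eq_mul, mul_one]
  rw [h1, map_smul, MvPolynomial.coeff_smul,
    (reduce_monomial_isHomogeneous k e).coeff_eq_zero h, smul_zero]

/-- Only the part of the right degree contributes to a coefficient. -/
theorem coeff_reduce_degProj {k : ℕ} (f : Lam) (b : Fin k →₀ ℕ) :
    (reduce k (degProj b.degree f)).coeff b = (reduce k f).coeff b := by
  classical
  conv_rhs => rw [f.as_sum]
  rw [degProj, map_sum, map_sum, MvPolynomial.coeff_sum, MvPolynomial.coeff_sum]
  have h1 : ∀ e, MvPolynomial.coeff b (reduce k (MvPolynomial.monomial e (f.coeff e))) ≠ 0 →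
      e ∈ f.support ∧ e ∈ wtFinset b.degree := fun e he => by
    constructor
    · rw [MvPolynomial.mem_support_iff]
      intro h0
      rw [h0, MvPolynomial.monomial_zero, map_zero] at he
      exact he rfl
    · rw [mem_wtFinset]
      by_contra h0
      exact he (coeff_reduce_monomial _ (Ne.symm h0))
  rw [← Finset.sum_filter_ne_zero, ← Finset.sum_filter_ne_zero f.support]
  refine Finset.sum_congr ?_ fun _ _ => rfl
  ext e
  simp only [Finset.mem_filter]
  constructor
  · rintro ⟨-, h⟩
    exact ⟨(h1 e h).1, h⟩
  · rintro ⟨-, h⟩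
    exact ⟨(h1 e h).2, h⟩

variable {n : ℕ}

/-- The coefficient of the monomial symmetric function `m_mu`. -/
def monoCoeff (mu : n.Partition) (f : Lam) : ℝ := (reduce n f).coeff (rowExp n ⟨n, mu⟩)

theorem monoCoeff_add (mu : n.Partition) (f g : Lam) :
    monoCoeff mu (f + g) = monoCoeff mu f + monoCoeff mu g := by
  rw [monoCoeff, map_add, MvPolynomial.coeff_add, monoCoeff, monoCoeff]

theorem monoCoeff_smul (mu : n.Partition) (c : ℝ) (f : Lam) :
    monoCoeff mu (c • f) = c * monoCoeff mu f := by
  rw [monoCoeff, map_smul, MvPolynomial.coeff_smul, smul_eq_mul, monoCoeff]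

theorem length_le (mu : n.Partition) : Ptn.length ⟨n, mu⟩ ≤ n := length_le_size ⟨n, mu⟩

theorem degree_of_shape {k : ℕ} {b : Fin k →₀ ℕ} {mu : n.Partition} (h : shape b = mu.parts) :
    b.degree = n := by
  rw [← sum_shape, h, mu.parts_sum]

theorem coeff_reduce_eq_monoCoeff {k : ℕ} {b : Fin k →₀ ℕ} {mu : n.Partition}
    (h : shape b = mu.parts) (f : Lam) : (reduce k f).coeff b = monoCoeff mu f :=
  coeff_reduce_eq_of_shape_eq (h.trans (shape_rowExp (lam := ⟨n, mu⟩) (length_le mu)).symm) f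

/-- The monomial expansion of a symmetric function of degree `n`. -/
theorem reduce_eq_sum {f : Lam} (hf : f ∈ degPart n) (k : ℕ) :
    reduce k f = ∑ mu : n.Partition, monoCoeff mu f • MvPolynomial.msymm (Fin k) ℝ mu := by
  classical
  ext b
  rw [MvPolynomial.coeff_sum]
  simp only [MvPolynomial.coeff_smul, coeff_msymm, smul_eq_mul, mul_ite, mul_one, mul_zero]
  by_cases hb : b.degree = n
  · have hpos : ∀ {i}, i ∈ shape b → 0 < i := fun {i} hi => by
      obtain ⟨l, hl, rfl⟩ := Multiset.mem_map.mp hi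
      exact Nat.pos_of_ne_zero (Finsupp.mem_support_iff.mp hl)
    set mu : n.Partition := ⟨shape b, hpos, (sum_shape b).trans hb⟩ with hmu
    rw [Finset.sum_eq_single mu, if_pos rfl]
    · exact coeff_reduce_eq_monoCoeff rfl f
    · intro nu _ hne
      exact if_neg fun h => hne (Nat.Partition.ext h.symm)
    · exact fun h => absurd (Finset.mem_univ _) h
  · rw [Finset.sum_eq_zero fun mu _ => if_neg fun h => hb (degree_of_shape h),
      ← coeff_reduce_degProj]
    have h0 : degProj b.degree f = 0 := by
      ext e
      rw [coeff_degProj, MvPolynomial.coeff_zero]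
      split_ifs with he
      · by_contra h0
        exact hb (he.symm.trans (mem_degPart.mp hf e h0))
      · rfl
    rw [h0, map_zero, MvPolynomial.coeff_zero]

/-- The monomial coefficients as a linear map. -/
def monoMap (n : ℕ) : degPart n →ₗ[ℝ] (n.Partition → ℝ) where
  toFun f mu := monoCoeff mu f.1
  map_add' _ _ := funext fun mu => monoCoeff_add mu _ _
  map_smul' c _ := funext fun mu => monoCoeff_smul mu c _

theorem monoCoeff_degProj (mu : n.Partition) (f : Lam) :
    monoCoeff mu (degProj n f) = monoCoeff mu f := by
  have h := degree_of_shape (shape_rowExp (lam := ⟨n, mu⟩) (length_le mu))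
  have h2 := coeff_reduce_degProj (k := n) f (rowExp n ⟨n, mu⟩)
  rw [h] at h2
  exact h2

theorem exists_reduce_eq (k : ℕ) {p : MvPolynomial (Fin k) ℝ} (hp : p.IsSymmetric) :
    ∃ f : Lam, reduce k f = p := by
  obtain ⟨g, hg⟩ := MvPolynomial.esymmAlgHom_surjective (σ := Fin k) ℝ (n := k) (by simp)
    ⟨p, hp⟩
  refine ⟨MvPolynomial.aeval (fun i : Fin k => elem (i + 1)) g, ?_⟩
  have h1 := MvPolynomial.esymmAlgHom_apply (σ := Fin k) (R := ℝ) g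
  rw [hg] at h1
  rw [← AlgHom.comp_apply]
  refine Eq.trans (DFunLike.congr_fun (MvPolynomial.algHom_ext fun i => ?_) g) h1.symm
  rw [AlgHom.comp_apply, MvPolynomial.aeval_X, MvPolynomial.aeval_X, reduce_elem]

/-- Every monomial symmetric polynomial in `n` variables is a polynomial in the elementary symmetric
ones, hence the image of a symmetric function. -/
theorem monoMap_surjective (n : ℕ) : Function.Surjective (monoMap n) := by
  classical
  have h1 : ∀ mu : n.Partition, ∃ f : degPart n, monoMap n f = Pi.single mu 1 := fun mu => by
    obtain ⟨f, hf⟩ := exists_reduce_eq n (MvPolynomial.msymm_isSymmetric (σ := Fin n) (R := ℝ) mu)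
    refine ⟨⟨degProj n f, degProj_mem n f⟩, funext fun nu => ?_⟩
    show monoCoeff nu (degProj n f) = _
    rw [monoCoeff_degProj, monoCoeff, hf, coeff_msymm, shape_rowExp (length_le nu), Pi.single_apply]
    exact if_congr (Nat.Partition.ext_iff).symm rfl rfl
  choose f hf using h1
  intro g
  refine ⟨∑ mu, g mu • f mu, ?_⟩
  rw [map_sum]
  simp only [map_smul, hf]
  funext mu
  simp [Finset.sum_apply, Pi.single_apply]

theorem sum_map_toMultiset (e : ℕ+ →₀ ℕ) :
    ((Finsupp.toMultiset e).map ((↑) : ℕ+ → ℕ)).sum = wt e := by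
  induction e using multiIndex_induction with
  | h0 => simp
  | h j m ih =>
    rw [map_add, Multiset.map_add, Multiset.sum_add, ih, wt_add, wt_single]
    simp

theorem card_wtFinset_le (n : ℕ) : (wtFinset n).card ≤ Fintype.card n.Partition := by
  classical
  have hp : ∀ e : wtFinset n, ((Finsupp.toMultiset e.1).map ((↑) : ℕ+ → ℕ)).sum = n := fun e => by
    have h := mem_wtFinset.mp e.2
    rw [sum_map_toMultiset, h]
  rw [← Fintype.card_coe]
  refine Fintype.card_le_of_injective (fun e : wtFinset n => (⟨(Finsupp.toMultiset e.1).map (↑),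
    fun {i} hi => ?_, hp e⟩ : n.Partition)) ?_
  · obtain ⟨m, -, rfl⟩ := Multiset.mem_map.mp hi
    exact m.pos
  · intro e e' h
    have h1 := congrArg Nat.Partition.parts h
    exact Subtype.ext ((Function.LeftInverse.injective Finsupp.toMultiset_toFinsupp)
      (Multiset.map_injective PNat.coe_injective h1))

/-- The monomials in the power sums of degree `n` are indexed by the partitions of `n`, so the
dimensions agree and surjectivity suffices. -/
theorem monoMap_injective (n : ℕ) : Function.Injective (monoMap n) := by
  classical
  have hfin : Fintype ↥{e : ℕ+ →₀ ℕ | wt e = n} :=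
    Fintype.ofEquiv (wtFinset n) (Equiv.subtypeEquivRight fun e => mem_wtFinset)
  have b := MvPolynomial.basisRestrictSupport ℝ {e : ℕ+ →₀ ℕ | wt e = n}
  have : Module.Finite ℝ (degPart n) := Module.Finite.of_basis b
  have h1 : Module.finrank ℝ (degPart n) ≤ Fintype.card n.Partition := by
    rw [degPart, Module.finrank_eq_card_basis b]
    refine le_trans (le_of_eq ?_) (card_wtFinset_le n)
    rw [← Fintype.card_coe]
    exact Fintype.card_congr (Equiv.subtypeEquivRight fun e => mem_wtFinset.symm)
  have h2 := LinearMap.finrank_le_finrank_of_surjective (monoMap_surjective n)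
  rw [Module.finrank_fintype_fun_eq_card] at h2
  refine (LinearMap.injective_iff_surjective_of_finrank_eq_finrank ?_).mpr (monoMap_surjective n)
  rw [Module.finrank_fintype_fun_eq_card]
  exact le_antisymm h1 h2

/-- Symmetric functions are determined by their images in all polynomial rings. -/
theorem eq_zero_of_reduce_eq_zero {f : Lam} (h : ∀ k, reduce k f = 0) : f = 0 := by
  have h1 : ∀ n, degProj n f = 0 := fun n => by
    have h2 : monoMap n ⟨degProj n f, degProj_mem n f⟩ = monoMap n 0 := by
      rw [map_zero]
      funext mu
      show monoCoeff mu (degProj n f) = 0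
      rw [monoCoeff_degProj, monoCoeff, h, MvPolynomial.coeff_zero]
    exact congrArg Subtype.val (monoMap_injective n h2)
  ext e
  have := congrArg (MvPolynomial.coeff e) (h1 (wt e))
  rwa [coeff_degProj, if_pos rfl] at this

end Graded

/-! ### The scalar product and self-adjointness -/

section Pairing

variable {q t : ℝ} {A : Type*} [CommRing A] [Algebra ℝ A]

/-- The factor `n (1 - q^n) / (1 - t^n)`. -/
def kappa (q t : ℝ) (n : ℕ+) : ℝ := ((n : ℕ) : ℝ) * ((1 - q ^ (n : ℕ)) / (1 - t ^ (n : ℕ)))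

theorem one_sub_pow_pos {x : ℝ} (h : 0 < x) (h' : x < 1) (n : ℕ+) : 0 < 1 - x ^ (n : ℕ) :=
  sub_pos.mpr (pow_lt_one₀ h.le h' n.ne_zero)

theorem kappa_pos (hq : 0 < q) (hq' : q < 1) (ht : 0 < t) (ht' : t < 1) (n : ℕ+) :
    0 < kappa q t n :=
  mul_pos (Nat.cast_pos.mpr n.pos) (div_pos (one_sub_pow_pos hq hq' n) (one_sub_pow_pos ht ht' n))

theorem zFactor_eq (d : ℕ+ →₀ ℕ) : zFactor q t d = mfact d * mpow (kappa q t) d := by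
  rw [zFactor, mfact, mpow, ← Finsupp.prod_mul]
  simp only [kappa, mul_pow, mul_assoc]

theorem mpow_pos {ι : Type*} {g : ι → ℝ} (hg : ∀ i, 0 < g i) (d : ι →₀ ℕ) : 0 < mpow g d :=
  Finset.prod_pos fun i _ => pow_pos (hg i) _

theorem zFactor_pos (hq : 0 < q) (hq' : q < 1) (ht : 0 < t) (ht' : t < 1) (d : ℕ+ →₀ ℕ) :
    0 < zFactor q t d := by
  rw [zFactor_eq]
  exact mul_pos (mfact_pos d) (mpow_pos (kappa_pos hq hq' ht ht') d)

theorem pairing_eq_sum {f g : MvPolynomial ℕ+ A} {S : Finset (ℕ+ →₀ ℕ)}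
    (h : ∀ d, f.coeff d ≠ 0 → d ∈ S) :
    pairing q t f g = ∑ d ∈ S, algebraMap ℝ A (zFactor q t d) * f.coeff d * g.coeff d := by
  rw [pairing]
  refine Finset.sum_subset (fun d hd => h d (MvPolynomial.mem_support_iff.mp hd)) fun d _ hd => ?_
  rw [MvPolynomial.notMem_support_iff.mp hd, mul_zero, zero_mul]

theorem pairing_comm (f g : MvPolynomial ℕ+ A) : pairing q t f g = pairing q t g f := by
  classical
  rw [pairing_eq_sum (S := f.support ∪ g.support) fun d hd =>
      Finset.mem_union_left _ (MvPolynomial.mem_support_iff.mpr hd),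
    pairing_eq_sum (S := f.support ∪ g.support) fun d hd =>
      Finset.mem_union_right _ (MvPolynomial.mem_support_iff.mpr hd)]
  exact Finset.sum_congr rfl fun d _ => mul_right_comm _ _ _

theorem pairing_add_right (f g h : MvPolynomial ℕ+ A) :
    pairing q t f (g + h) = pairing q t f g + pairing q t f h := by
  simp only [pairing, MvPolynomial.coeff_add, mul_add, Finset.sum_add_distrib]

theorem pairing_smul_right (c : ℝ) (f g : MvPolynomial ℕ+ A) :
    pairing q t f (c • g) = c • pairing q t f g := by
  simp only [pairing, MvPolynomial.coeff_smul, mul_smul_comm, Finset.smul_sum]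

theorem pairing_add_left (f g h : MvPolynomial ℕ+ A) :
    pairing q t (f + g) h = pairing q t f h + pairing q t g h := by
  rw [pairing_comm, pairing_add_right, pairing_comm h, pairing_comm h]

theorem pairing_smul_left (c : ℝ) (f g : MvPolynomial ℕ+ A) :
    pairing q t (c • f) g = c • pairing q t f g := by
  rw [pairing_comm, pairing_smul_right, pairing_comm]

/-- The scalar product as a bilinear form. -/
def pairingForm (q t : ℝ) : Lam →ₗ[ℝ] Lam →ₗ[ℝ] ℝ :=
  LinearMap.mk₂ ℝ (pairing q t) pairing_add_left pairing_smul_left pairing_add_right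
    pairing_smul_right

theorem pairingForm_apply (f g : Lam) : pairingForm q t f g = pairing q t f g := rfl

theorem pairing_sum_right {ι : Type*} (s : Finset ι) (f : Lam) (g : ι → Lam) :
    pairing q t f (∑ i ∈ s, g i) = ∑ i ∈ s, pairing q t f (g i) := by
  simp only [← pairingForm_apply, map_sum]

theorem eq_zero_of_pairing_self (hq : 0 < q) (hq' : q < 1) (ht : 0 < t) (ht' : t < 1) {f : Lam}
    (h : pairing q t f f = 0) : f = 0 := by
  have h1 : ∀ d ∈ f.support, 0 ≤ algebraMap ℝ ℝ (zFactor q t d) * f.coeff d * f.coeff d := by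
    intro d _
    rw [mul_assoc]
    exact mul_nonneg (zFactor_pos hq hq' ht ht' d).le (mul_self_nonneg _)
  rw [pairing, Finset.sum_eq_zero_iff_of_nonneg h1] at h
  by_contra hf
  obtain ⟨d, hd⟩ := MvPolynomial.support_nonempty.mpr hf
  have h2 := h d hd
  have h3 := MvPolynomial.mem_support_iff.mp hd
  have h4 := (zFactor_pos hq hq' ht ht' d).ne'
  simp only [Algebra.algebraMap_self, RingHom.id_apply, mul_eq_zero, h3, h4, or_self] at h2

theorem pairing_self_pos (hq : 0 < q) (hq' : q < 1) (ht : 0 < t) (ht' : t < 1) {f : Lam}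
    (h : f ≠ 0) : 0 < pairing q t f f := by
  refine lt_of_le_of_ne (Finset.sum_nonneg fun d _ => ?_) fun h0 =>
    h (eq_zero_of_pairing_self hq hq' ht ht' h0.symm)
  rw [mul_assoc]
  exact mul_nonneg (zFactor_pos hq hq' ht ht' d).le (mul_self_nonneg _)

theorem pairing_eq_zero_of_ne {m n : ℕ} (hmn : m ≠ n) {f g : Lam} (hf : f ∈ degPart m)
    (hg : g ∈ degPart n) : pairing q t f g = 0 := by
  refine Finset.sum_eq_zero fun d hd => ?_
  have h1 := mem_degPart.mp hf d (MvPolynomial.mem_support_iff.mp hd)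
  have h2 : g.coeff d = 0 := by
    by_contra h0
    exact hmn (h1.symm.trans (mem_degPart.mp hg d h0))
  rw [h2, mul_zero]

end Pairing

section Adjoint

variable {q t : ℝ} {r : ℕ}

/-- The substitution `z_i ↦ z_i⁻¹`. -/
def invLaurent (r : ℕ) : Laurent r →ₐ[ℝ] Laurent r :=
  AddMonoidAlgebra.mapDomainAlgHom ℝ ℝ (negAddMonoidHom : (Fin r → ℤ) →+ (Fin r → ℤ))

theorem invLaurent_single (a : Fin r → ℤ) (c : ℝ) :
    invLaurent r (AddMonoidAlgebra.single a c) = AddMonoidAlgebra.single (-a) c := by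
  simp [invLaurent]

theorem circForm_invLaurent (t : ℝ) (G : Laurent r) : circForm t (invLaurent r G) = circForm t G := by
  have h : (circForm t).comp (invLaurent r).toLinearMap = circForm t := by
    refine laurent_hom_ext fun a => ?_
    rw [LinearMap.comp_apply, AlgHom.toLinearMap_apply, invLaurent_single, circForm_single_neg]
  exact DFunLike.congr_fun h G

theorem invLaurent_zPow (i : Fin r) (n : ℤ) : invLaurent r (zPow i n) = zPow i (-n) := by
  rw [zPow, invLaurent_single, zPow, Pi.single_neg]

/-- The operators `exp (∑ β_n p_n)` and `f ↦ f(p + γ)` are adjoint to each other, up to the inversion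
of the variables and a factor that depends on the degree only. -/
theorem kappa_smul_betaZ (ht : 0 < t) (ht' : t < 1) (n : ℕ+) :
    kappa q t n • betaZ t r n = (t⁻¹ ^ (n : ℕ)) • invLaurent r (gammaZ q r n) := by
  rw [gammaZ, betaZ, map_smul, map_sum, smul_smul, smul_smul]
  simp only [invLaurent_zPow, neg_neg]
  congr 1
  have h1 := (one_sub_pow_pos ht ht' n).ne'
  have h2 : ((n : ℕ) : ℝ) ≠ 0 := Nat.cast_ne_zero.mpr n.ne_zero
  have h3 := (pow_pos ht (n : ℕ)).ne'
  rw [kappa, inv_pow]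
  field_simp
  ring

/-- The Laurent polynomial `γ(1/z)^{d-f} γ(z)^{e-f}`, whose values under `circForm` make up the Gram
matrix of the operator. -/
def gramTerm (q : ℝ) (r : ℕ) (d e f : ℕ+ →₀ ℕ) : Laurent r :=
  mpow (fun n => invLaurent r (gammaZ q r n)) (d - f) * mpow (gammaZ q r) (e - f)

/-- The Gram matrix of the operator before the integration. The summands are symmetric in `d` and
`e`, when `wt d = wt e`, up to the inversion of the variables. -/
theorem zFactor_smul_coeff [DecidableEq (ℕ+ →₀ ℕ)] (ht : 0 < t)
    (ht' : t < 1) (d e : ℕ+ →₀ ℕ) :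
    zFactor q t d • MvPowerSeries.coeff d (expLin (betaZ t r) * shiftPow (gammaZ q r) e) =
      ∑ f ∈ Finset.Iic d ∩ Finset.Iic e, (mfact d * mfact e * mpow (kappa q t) f /
        (mfact f * mfact (d - f) * mfact (e - f)) * t⁻¹ ^ wt (d - f)) • gramTerm q r d e f := by
  classical
  have hterm : ∀ f, f ≤ d → zFactor q t d • (MvPowerSeries.coeff (d - f) (expLin (betaZ t r)) *
      MvPowerSeries.coeff f (shiftPow (gammaZ q r) e)) = if f ≤ e then
        (mfact d * mfact e * mpow (kappa q t) f /
        (mfact f * mfact (d - f) * mfact (e - f)) * t⁻¹ ^ wt (d - f)) • gramTerm q r d e f else 0 := by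
    intro f hf
    rw [coeff_expLin, coeff_shiftPow]
    split_ifs with he
    · have h1 : mpow (kappa q t) (d - f) • mpow (betaZ t r) (d - f) = (t⁻¹ ^ wt (d - f)) •
          mpow (fun n => invLaurent r (gammaZ q r n)) (d - f) := by
        have h2 : (fun n => kappa q t n • betaZ t r n) = fun n : ℕ+ => (t⁻¹ ^ (n : ℕ)) •
          invLaurent r (gammaZ q r n) := funext fun n => kappa_smul_betaZ ht ht' n
        have h3 := congrArg (fun g => mpow g (d - f)) h2
        simp only [Algebra.smul_def, mpow_mul] at h3
        rw [← map_mpow, ← map_mpow, mpow_pow_wt] at h3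
        simp only [Algebra.smul_def]
        exact h3
      have h4 : zFactor q t d = mfact d * (mpow (kappa q t) f * mpow (kappa q t) (d - f)) := by
        rw [zFactor_eq, ← mpow_add, add_tsub_cancel_of_le hf]
      rw [gramTerm, h4, dpow, dpow]
      have e1 : (mfact d * (mpow (kappa q t) f * mpow (kappa q t) (d - f))) •
          ((mfact (d - f))⁻¹ • mpow (betaZ t r) (d - f) *
            (mfact e / mfact f) • (mfact (e - f))⁻¹ • mpow (gammaZ q r) (e - f)) =
          (mfact d * mpow (kappa q t) f * (mfact (d - f))⁻¹ * (mfact e / mfact f) *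
            (mfact (e - f))⁻¹) • (mpow (kappa q t) (d - f) • mpow (betaZ t r) (d - f) *
              mpow (gammaZ q r) (e - f)) := by
        simp only [smul_mul_assoc, mul_smul_comm, smul_smul]
        congr 1
        ring
      rw [e1, h1, smul_mul_assoc, smul_smul]
      congr 1
      have := mfact_ne_zero f
      have := mfact_ne_zero (d - f)
      have := mfact_ne_zero (e - f)
      field_simp
    · rw [mul_zero, smul_zero]
  rw [MvPowerSeries.coeff_mul, Finset.smul_sum]
  have hI : Finset.Iic d ∩ Finset.Iic e = (Finset.Iic d).filter (· ≤ e) := by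
    ext f
    simp
  rw [hI, Finset.sum_filter]
  symm
  refine Finset.sum_bij (fun f _ => (d - f, f)) ?_ ?_ ?_ ?_
  · intro f hf
    exact Finset.HasAntidiagonal.mem_antidiagonal.mpr (tsub_add_cancel_of_le (Finset.mem_Iic.mp hf))
  · intro f _ f' _ h
    exact congrArg Prod.snd h
  · rintro ⟨a, f⟩ h
    have h := Finset.HasAntidiagonal.mem_antidiagonal.mp h
    simp only at h
    refine ⟨f, Finset.mem_Iic.mpr (h ▸ le_add_self), ?_⟩
    rw [← h, add_tsub_cancel_right]
  · intro f hf
    exact (hterm f (Finset.mem_Iic.mp hf)).symm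

theorem invLaurent_gramTerm (d e f : ℕ+ →₀ ℕ) :
    invLaurent r (gramTerm q r d e f) = gramTerm q r e d f := by
  have h : ∀ G : Laurent r, invLaurent r (invLaurent r G) = G := fun G => by
    have : (invLaurent r).comp (invLaurent r) = AlgHom.id ℝ (Laurent r) := by
      refine AlgHom.toLinearMap_injective (laurent_hom_ext fun a => ?_)
      simp [invLaurent_single]
    exact DFunLike.congr_fun this G
  rw [gramTerm, gramTerm, map_mul, map_mpow, map_mpow, mul_comm]
  simp only [h]

/-- Self-adjointness on monomials: `circForm` is invariant under `z_i ↦ z_i⁻¹`. -/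
theorem zFactor_mul_opCoeff (ht : 0 < t) (ht' : t < 1)
    {d e : ℕ+ →₀ ℕ} (h : wt d = wt e) :
    zFactor q t d * opCoeff q t r d e = zFactor q t e * opCoeff q t r e d := by
  classical
  rw [opCoeff, opCoeff, mul_left_comm, mul_left_comm (zFactor q t e), ← smul_eq_mul (zFactor q t d),
    ← smul_eq_mul (zFactor q t e), ← map_smul (circForm t), ← map_smul (circForm t), zFactor_smul_coeff ht ht',
    zFactor_smul_coeff ht ht', Finset.inter_comm, map_sum, map_sum]
  congr 1
  refine Finset.sum_congr rfl fun f hf => ?_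
  obtain ⟨hfe, hfd⟩ := Finset.mem_inter.mp hf
  have h1 : wt (d - f) = wt (e - f) := by
    have hd := congrArg wt (tsub_add_cancel_of_le (Finset.mem_Iic.mp hfd))
    have he := congrArg wt (tsub_add_cancel_of_le (Finset.mem_Iic.mp hfe))
    rw [wt_add] at hd he
    omega
  rw [map_smul, map_smul, ← invLaurent_gramTerm e d, circForm_invLaurent, h1]
  congr 1
  ring

theorem coeff_opE_monomial (d e : ℕ+ →₀ ℕ) :
    (opE q t r (MvPolynomial.monomial e 1)).coeff d =
      if wt d = wt e then opCoeff q t r d e else 0 := by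
  classical
  rw [opE_monomial, MvPolynomial.coeff_sum]
  simp only [MvPolynomial.coeff_smul, MvPolynomial.coeff_monomial, smul_eq_mul, mul_ite, mul_one,
    mul_zero, Finset.sum_ite_eq', mem_wtFinset]

theorem pairing_monomial_right (f : Lam) (d : ℕ+ →₀ ℕ) :
    pairing q t f (MvPolynomial.monomial d 1) = zFactor q t d * f.coeff d := by
  classical
  rw [pairing_comm, pairing_eq_sum (S := {d}) fun e he => ?_]
  · simp
  · rw [MvPolynomial.coeff_monomial] at he
    rw [Finset.mem_singleton]
    by_contra h
    exact he (if_neg (Ne.symm h))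

theorem lam_linear_ext {M : Type*} [AddCommMonoid M] [Module ℝ M] {f g : Lam →ₗ[ℝ] M}
    (h : ∀ e, f (MvPolynomial.monomial e 1) = g (MvPolynomial.monomial e 1)) : f = g :=
  (MvPolynomial.basisMonomials ℕ+ ℝ).ext fun e => by
    rw [MvPolynomial.coe_basisMonomials]
    exact h e

/-- The operator is self-adjoint for the Macdonald scalar product. -/
theorem pairing_opE (ht : 0 < t) (ht' : t < 1) (f g : Lam) :
    pairing q t (opE q t r f) g = pairing q t f (opE q t r g) := by
  have h : (pairingForm q t).comp (opE q t r) = (pairingForm q t).compl₂ (opE q t r) := by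
    refine lam_linear_ext fun e => lam_linear_ext fun d => ?_
    show pairing q t _ _ = pairing q t _ _
    rw [pairing_monomial_right, pairing_comm, pairing_monomial_right, coeff_opE_monomial,
      coeff_opE_monomial]
    by_cases hde : wt d = wt e
    · rw [if_pos hde, if_pos hde.symm, zFactor_mul_opCoeff ht ht' hde]
    · rw [if_neg hde, if_neg (Ne.symm hde), mul_zero, mul_zero]
  exact DFunLike.congr_fun (DFunLike.congr_fun h f) g

theorem opE_mem_degPart {n : ℕ} {f : Lam} (hf : f ∈ degPart n) : opE q t r f ∈ degPart n := by
  classical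
  rw [f.as_sum, map_sum]
  refine Submodule.sum_mem _ fun e he => ?_
  have h1 : MvPolynomial.monomial e (f.coeff e) = f.coeff e • MvPolynomial.monomial e (1 : ℝ) := by
    rw [MvPolynomial.smul_monomial, smul_eq_mul, mul_one]
  rw [h1, map_smul]
  refine Submodule.smul_mem _ _ (mem_degPart.mpr fun d hd => ?_)
  rw [coeff_opE_monomial] at hd
  have h2 := mem_degPart.mp hf e (MvPolynomial.mem_support_iff.mp he)
  by_contra h0
  exact hd (if_neg fun h => h0 (h.trans h2))

end Adjoint

/-! ### Macdonald symmetric functions as eigenfunctions -/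

section Macdonald

variable {n : ℕ}

theorem DominatedBy.trans {a b c : n.Partition} (h : DominatedBy a b) (h' : DominatedBy b c) :
    DominatedBy a c := by
  refine ⟨?_, fun k => (h.2 k).trans (h'.2 k)⟩
  rintro rfl
  refine h.1 ?_
  have h2 : rowExp n ⟨n, a⟩ = rowExp n ⟨n, b⟩ := eq_of_pre_eq fun j => by
    rw [pre_rowExp (length_le a), pre_rowExp (length_le b)]
    exact le_antisymm (h.2 j) (h'.2 j)
  have h3 := shape_rowExp (lam := ⟨n, a⟩) (length_le a)
  rw [h2, shape_rowExp (lam := ⟨n, b⟩) (length_le b)] at h3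
  exact (Nat.Partition.ext h3).symm

theorem wellFounded_dominatedBy : WellFounded (DominatedBy (n := n)) := by
  have : IsTrans n.Partition DominatedBy := ⟨fun _ _ _ => DominatedBy.trans⟩
  have : Std.Irrefl (DominatedBy (n := n)) := ⟨fun _ h => h.1 rfl⟩
  exact Finite.wellFounded_of_trans_of_irrefl _

/-- The monomial symmetric function `m_mu`. -/
def mono (mu : n.Partition) : Lam :=
  ((LinearEquiv.ofBijective (monoMap n) ⟨monoMap_injective n, monoMap_surjective n⟩).symm
    (open Classical in Pi.single mu 1)).1

theorem mono_mem (mu : n.Partition) : mono mu ∈ degPart n := Subtype.prop _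

open Classical in
theorem monoCoeff_mono (mu nu : n.Partition) :
    monoCoeff nu (mono mu) = if nu = mu then 1 else 0 := by
  have h := LinearEquiv.apply_symm_apply
    (LinearEquiv.ofBijective (monoMap n) ⟨monoMap_injective n, monoMap_surjective n⟩)
    (Pi.single mu 1)
  have h2 := congrFun h nu
  rw [Pi.single_apply] at h2
  exact h2

theorem monoCoeff_sum {ι : Type*} (s : Finset ι) (mu : n.Partition) (f : ι → Lam) :
    monoCoeff mu (∑ i ∈ s, f i) = ∑ i ∈ s, monoCoeff mu (f i) := by
  simp only [monoCoeff, map_sum, MvPolynomial.coeff_sum]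

theorem eq_of_monoCoeff_eq {f g : Lam} (hf : f ∈ degPart n) (hg : g ∈ degPart n)
    (h : ∀ mu : n.Partition, monoCoeff mu f = monoCoeff mu g) : f = g :=
  congrArg Subtype.val (monoMap_injective n (a₁ := ⟨f, hf⟩) (a₂ := ⟨g, hg⟩) (funext h))

theorem eq_sum_mono {f : Lam} (hf : f ∈ degPart n) : f = ∑ mu : n.Partition, monoCoeff mu f • mono mu := by
  classical
  refine eq_of_monoCoeff_eq hf (Submodule.sum_mem _ fun mu _ =>
    Submodule.smul_mem _ _ (mono_mem mu)) fun nu => ?_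
  rw [monoCoeff_sum]
  simp [monoCoeff_smul, monoCoeff_mono]

/-- The span of the `m_mu` with `mu < lam`. -/
def lower (lam : n.Partition) : Submodule ℝ Lam where
  carrier := {f | f ∈ degPart n ∧ ∀ mu : n.Partition, monoCoeff mu f ≠ 0 → DominatedBy mu lam}
  zero_mem' := ⟨Submodule.zero_mem _, fun mu h => absurd (by
    rw [monoCoeff, map_zero, MvPolynomial.coeff_zero]) h⟩
  add_mem' := fun {f g} hf hg => ⟨Submodule.add_mem _ hf.1 hg.1, fun mu h => by
    rw [monoCoeff_add] at h
    by_cases hf0 : monoCoeff mu f = 0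
    · rw [hf0, zero_add] at h
      exact hg.2 mu h
    · exact hf.2 mu hf0⟩
  smul_mem' := fun c f hf => ⟨Submodule.smul_mem _ _ hf.1, fun mu h => by
    rw [monoCoeff_smul] at h
    exact hf.2 mu (right_ne_zero_of_mul h)⟩

/-- Linear combinations of `m_lam` and the `m_mu` with `mu < lam`. -/
def IsTriangular (lam : n.Partition) (f : Lam) : Prop :=
  f ∈ degPart n ∧ ∀ mu : n.Partition, monoCoeff mu f ≠ 0 → mu = lam ∨ DominatedBy mu lam

theorem mem_lower_of_isTriangular {lam : n.Partition} {f : Lam} (h : IsTriangular lam f)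
    (h0 : monoCoeff lam f = 0) : f ∈ lower lam :=
  ⟨h.1, fun mu hmu => (h.2 mu hmu).resolve_left fun he => hmu (he ▸ h0)⟩

theorem isTriangular_of_mem_lower {lam : n.Partition} {f : Lam} (h : f ∈ lower lam) :
    IsTriangular lam f := ⟨h.1, fun mu hmu => Or.inr (h.2 mu hmu)⟩

theorem isTriangular_mono (mu : n.Partition) : IsTriangular mu (mono mu) :=
  ⟨mono_mem mu, fun nu h => Or.inl (by
    classical
    rw [monoCoeff_mono] at h
    by_contra h0
    exact h (if_neg h0))⟩

theorem IsTriangular.add {lam : n.Partition} {f g : Lam} (hf : IsTriangular lam f)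
    (hg : IsTriangular lam g) : IsTriangular lam (f + g) :=
  ⟨Submodule.add_mem _ hf.1 hg.1, fun mu h => by
    rw [monoCoeff_add] at h
    by_cases hf0 : monoCoeff mu f = 0
    · rw [hf0, zero_add] at h
      exact hg.2 mu h
    · exact hf.2 mu hf0⟩

theorem IsTriangular.smul {lam : n.Partition} {f : Lam} (hf : IsTriangular lam f) (c : ℝ) :
    IsTriangular lam (c • f) :=
  ⟨Submodule.smul_mem _ _ hf.1, fun mu h => by
    rw [monoCoeff_smul] at h
    exact hf.2 mu (right_ne_zero_of_mul h)⟩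

theorem IsTriangular.prefixLE {lam : n.Partition} {f : Lam} (h : IsTriangular lam f) :
    PrefixLE (reduce n f) (rowExp n ⟨n, lam⟩) := by
  classical
  rw [reduce_eq_sum h.1]
  refine PrefixLE.sum fun mu _ b hb j => ?_
  rw [MvPolynomial.coeff_smul, coeff_msymm, smul_eq_mul] at hb
  have h1 := h.2 mu (left_ne_zero_of_mul hb)
  have h2 : shape b = mu.parts := by
    by_contra h0
    exact right_ne_zero_of_mul hb (if_neg h0)
  rw [pre_rowExp (length_le lam)]
  refine (pre_le_of_shape (lam := ⟨n, mu⟩) h2 j).trans ?_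
  rcases h1 with rfl | h1
  · exact le_rfl
  · exact h1.2 j

variable {q t : ℝ}

theorem IsTriangular.opE (ht : 1 < t⁻¹) (r : ℕ) {lam : n.Partition} {f : Lam}
    (h : IsTriangular lam f) : IsTriangular lam (opE q t r f) ∧
      monoCoeff lam (PeriodicMacdonald.opE q t r f) = obsE q t r ⟨n, lam⟩ * monoCoeff lam f := by
  obtain ⟨h1, h2⟩ := leading_opE (q := q) ht r h.prefixLE
  refine ⟨⟨opE_mem_degPart h.1, fun mu hmu => ?_⟩, ?_⟩
  · by_cases he : mu = lam
    · exact Or.inl he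
    · refine Or.inr ⟨he, fun j => ?_⟩
      have := h1 _ hmu j
      rwa [pre_rowExp (length_le mu), pre_rowExp (length_le lam)] at this
  · rw [obsE_eq_eigenvalue ht r ⟨n, lam⟩ (length_le lam)]
    exact h2

theorem opE_mem_lower (ht : 1 < t⁻¹) (r : ℕ) {lam : n.Partition} {f : Lam} (h : f ∈ lower lam) :
    opE q t r f ∈ lower lam := by
  rw [eq_sum_mono h.1, map_sum]
  refine Submodule.sum_mem _ fun mu _ => ?_
  rw [map_smul]
  by_cases h0 : monoCoeff mu f = 0
  · rw [h0, zero_smul]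
    exact Submodule.zero_mem _
  · refine Submodule.smul_mem _ _ ⟨opE_mem_degPart (mono_mem mu), fun nu hnu => ?_⟩
    have hd := h.2 mu h0
    rcases ((isTriangular_mono mu).opE ht r).1.2 nu hnu with rfl | h1
    · exact hd
    · exact h1.trans hd

variable (hq : 0 < q) (hq' : q < 1) (ht : 0 < t) (ht' : t < 1)

include hq hq' ht ht'

/-- Triangularity and orthogonality to the lower terms make an eigenfunction. -/
theorem opE_eq_smul (r : ℕ) {lam : n.Partition} {f : Lam} (h : IsTriangular lam f)
    (horth : ∀ g ∈ lower lam, pairing q t f g = 0) :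
    opE q t r f = obsE q t r ⟨n, lam⟩ • f := by
  have hs : 1 < t⁻¹ := (one_lt_inv₀ ht).mpr ht'
  obtain ⟨h1, h2⟩ := h.opE (q := q) hs r
  set g := opE q t r f + (-obsE q t r ⟨n, lam⟩) • f with hg
  have hgl : g ∈ lower lam := by
    refine mem_lower_of_isTriangular (h1.add (h.smul _)) ?_
    rw [monoCoeff_add, monoCoeff_smul, h2]
    ring
  have h0 : pairing q t g g = 0 := by
    conv_lhs => rw [hg]
    rw [pairing_add_left, pairing_smul_left, pairing_opE ht ht', horth _ hgl,
      horth _ (opE_mem_lower hs r hgl), smul_zero, add_zero]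
  have h3 := eq_zero_of_pairing_self hq hq' ht ht' h0
  rw [hg, neg_smul, ← sub_eq_add_neg, sub_eq_zero] at h3
  exact h3

/-- Orthogonal projection to the span of the lower terms. -/
theorem exists_mem_lower (lam : n.Partition) (f : Lam) :
    ∃ g ∈ lower lam, ∀ v ∈ lower lam, pairing q t (f + g) v = 0 := by
  have hfin : Module.Finite ℝ (degPart n) := Module.Finite.of_surjective
    (LinearEquiv.ofBijective (monoMap n) ⟨monoMap_injective n, monoMap_surjective n⟩).symm.toLinearMap
    (LinearEquiv.surjective _)
  have hle : lower lam ≤ degPart n := fun f hf => hf.1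
  have hfin' : Module.Finite ℝ (lower lam) := Submodule.finiteDimensional_of_le hle
  set L : lower lam →ₗ[ℝ] Module.Dual ℝ (lower lam) :=
    ((pairingForm q t).comp (lower lam).subtype).compl₂ (lower lam).subtype with hL
  have hinj : Function.Injective L := by
    rw [← LinearMap.ker_eq_bot, LinearMap.ker_eq_bot']
    intro g hg
    have h1 : pairing q t g.1 g.1 = 0 := DFunLike.congr_fun hg g
    exact Subtype.ext (eq_zero_of_pairing_self hq hq' ht ht' h1)
  have hsurj := (LinearMap.injective_iff_surjective_of_finrank_eq_finrank
    Subspace.dual_finrank_eq.symm).mp hinj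
  obtain ⟨g, hg⟩ := hsurj ((pairingForm q t f).comp (lower lam).subtype)
  refine ⟨(-1 : ℝ) • g.1, Submodule.smul_mem _ _ g.2, fun v hv => ?_⟩
  have h1 : pairing q t g.1 v = pairing q t f v := DFunLike.congr_fun hg ⟨v, hv⟩
  rw [pairing_add_left, pairing_smul_left, h1]
  simp

/-- The Macdonald symmetric functions exist. -/
theorem isMacdonaldFamily_macP : IsMacdonaldFamily q t (macP q t) := by
  have hs : 1 < t⁻¹ := (one_lt_inv₀ ht).mpr ht'
  refine Classical.epsilon_spec (p := IsMacdonaldFamily q t) ?_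
  choose g hg hg' using fun (lam : Ptn) => exists_mem_lower hq hq' ht ht' lam.2 (mono lam.2)
  have htri : ∀ lam : Ptn, IsTriangular lam.2 (mono lam.2 + g lam) := fun lam =>
    (isTriangular_mono _).add (isTriangular_of_mem_lower (hg lam))
  refine ⟨fun lam => mono lam.2 + g lam, fun n lam => ⟨fun mu => monoCoeff mu (g ⟨n, lam⟩),
    fun k => ?_⟩, fun lam mu hne => ?_⟩
  · classical
    rw [map_add, reduce_eq_sum (mono_mem lam), reduce_eq_sum (hg ⟨n, lam⟩).1]
    congr 1
    · rw [Finset.sum_eq_single lam]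
      · rw [monoCoeff_mono, if_pos rfl, one_smul]
      · intro mu _ hmu
        rw [monoCoeff_mono, if_neg hmu, zero_smul]
      · exact fun h => absurd (Finset.mem_univ _) h
    · symm
      rw [Finset.sum_filter]
      refine Finset.sum_congr rfl fun mu _ => ?_
      split_ifs with h
      · rfl
      · have : monoCoeff mu (g ⟨n, lam⟩) = 0 := by
          by_contra h0
          exact h ((hg ⟨n, lam⟩).2 mu h0)
        rw [this, zero_smul]
  · by_cases hsize : lam.1 = mu.1
    · obtain ⟨r, hr⟩ : ∃ r, obsE q t r lam ≠ obsE q t r mu := by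
        by_contra! h
        exact hne (eq_of_obsE_eq hq hq' hs h)
      have h1 := pairing_opE (r := r) (q := q) ht ht' (mono lam.2 + g lam) (mono mu.2 + g mu)
      rw [opE_eq_smul hq hq' ht ht' r (htri lam) (hg' lam),
        opE_eq_smul hq hq' ht ht' r (htri mu) (hg' mu), pairing_smul_left, pairing_smul_right,
        ← sub_eq_zero, ← sub_smul, smul_eq_mul] at h1
      exact (mul_eq_zero.mp h1).resolve_left (sub_ne_zero.mpr hr)
    · exact pairing_eq_zero_of_ne hsize (htri lam).1 (htri mu).1

theorem macP_eq (lam : n.Partition) : ∃ g ∈ lower lam, macP q t ⟨n, lam⟩ = mono lam + g := by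
  classical
  obtain ⟨c, hc⟩ := (isMacdonaldFamily_macP hq hq' ht ht').1 n lam
  refine ⟨∑ mu : n.Partition with DominatedBy mu lam, c mu • mono mu, Submodule.sum_mem _ fun mu hmu =>
    Submodule.smul_mem _ _ ⟨mono_mem mu, fun nu hnu => ?_⟩, ?_⟩
  · rw [monoCoeff_mono] at hnu
    have : nu = mu := by
      by_contra h0
      exact hnu (if_neg h0)
    rw [this]
    exact (Finset.mem_filter.mp hmu).2
  · rw [← sub_eq_zero]
    have hm : ∀ (mu : n.Partition) (k : ℕ), reduce k (mono mu) = MvPolynomial.msymm (Fin k) ℝ mu := by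
      intro mu k
      rw [reduce_eq_sum (mono_mem mu), Finset.sum_eq_single mu]
      · rw [monoCoeff_mono, if_pos rfl, one_smul]
      · intro nu _ hnu
        rw [monoCoeff_mono, if_neg hnu, zero_smul]
      · exact fun h => absurd (Finset.mem_univ _) h
    refine eq_zero_of_reduce_eq_zero fun k => ?_
    rw [map_sub, hc k, map_add, map_sum]
    simp only [map_smul, hm]
    exact sub_self _

theorem macP_mem (lam : Ptn) : macP q t lam ∈ degPart lam.1 := by
  obtain ⟨g, hg, h⟩ := macP_eq hq hq' ht ht' lam.2
  rw [h]
  exact Submodule.add_mem _ (mono_mem _) hg.1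

theorem pairing_macP_of_ne {lam mu : Ptn} (h : lam ≠ mu) :
    pairing q t (macP q t lam) (macP q t mu) = 0 :=
  (isMacdonaldFamily_macP hq hq' ht ht').2 lam mu h

/-- A function orthogonal to `P_nu` for all `nu ≤ mu` is orthogonal to `m_mu`. -/
theorem pairing_mono_eq_zero {f : Lam} {mu : n.Partition}
    (h : ∀ nu : n.Partition, nu = mu ∨ DominatedBy nu mu → pairing q t f (macP q t ⟨n, nu⟩) = 0) :
    pairing q t f (mono mu) = 0 := by
  induction mu using wellFounded_dominatedBy.induction with
  | _ mu ih =>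
    obtain ⟨g, hg, hP⟩ := macP_eq hq hq' ht ht' mu
    have h1 := h mu (Or.inl rfl)
    have h2 : pairing q t f g = 0 := by
      rw [eq_sum_mono hg.1, pairing_sum_right]
      refine Finset.sum_eq_zero fun nu _ => ?_
      rw [pairing_smul_right]
      by_cases h0 : monoCoeff nu g = 0
      · rw [h0, zero_smul]
      · have hd := hg.2 nu h0
        rw [ih nu hd fun ka hka => h ka (Or.inr ?_), smul_zero]
        rcases hka with rfl | hka
        · exact hd
        · exact hka.trans hd
    rwa [hP, pairing_add_right, h2, add_zero] at h1

/-- The Macdonald symmetric functions are eigenfunctions; the eigenvalues are the observables. -/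
theorem opE_macP (r : ℕ) (lam : Ptn) : opE q t r (macP q t lam) = obsE q t r lam • macP q t lam := by
  obtain ⟨n, lam⟩ := lam
  obtain ⟨g, hg, hP⟩ := macP_eq hq hq' ht ht' lam
  refine opE_eq_smul hq hq' ht ht' r ?_ fun v hv => ?_
  · rw [hP]
    exact (isTriangular_mono _).add (isTriangular_of_mem_lower hg)
  · rw [eq_sum_mono hv.1, pairing_sum_right]
    refine Finset.sum_eq_zero fun nu _ => ?_
    rw [pairing_smul_right]
    by_cases h0 : monoCoeff nu v = 0
    · rw [h0, zero_smul]
    · have hd := hv.2 nu h0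
      rw [pairing_mono_eq_zero hq hq' ht ht' fun ka hka => ?_, smul_zero]
      refine pairing_macP_of_ne hq hq' ht ht' fun he => ?_
      have hlt : DominatedBy ka lam := by
        rcases hka with rfl | hka
        · exact hd
        · exact hka.trans hd
      exact hlt.1 (eq_of_heq (Sigma.mk.inj he).2).symm

theorem macP_ne_zero (lam : Ptn) : macP q t lam ≠ 0 := fun h0 => by
  classical
  obtain ⟨g, hg, hP⟩ := macP_eq hq hq' ht ht' lam.2
  have h1 : monoCoeff lam.2 (macP q t lam) = 1 := by
    have h2 : monoCoeff lam.2 g = 0 := by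
      by_contra h
      exact (hg.2 _ h).1 rfl
    rw [show macP q t lam = mono lam.2 + g from hP, monoCoeff_add, h2, monoCoeff_mono, if_pos rfl,
      add_zero]
  rw [h0, monoCoeff, map_zero, MvPolynomial.coeff_zero] at h1
  exact zero_ne_one h1

theorem pairing_macP_self_pos (lam : Ptn) : 0 < pairing q t (macP q t lam) (macP q t lam) :=
  pairing_self_pos hq hq' ht ht' (macP_ne_zero hq hq' ht ht' lam)

theorem macQ_mem (lam : Ptn) : macQ q t lam ∈ degPart lam.1 :=
  Submodule.smul_mem _ _ (macP_mem hq hq' ht ht' lam)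

/-- The expansion in Macdonald symmetric functions. -/
theorem eq_sum_macP {f : Lam} (hf : f ∈ degPart n) :
    f = ∑ lam : n.Partition, pairing q t f (macQ q t ⟨n, lam⟩) • macP q t ⟨n, lam⟩ := by
  classical
  set g := f + (-1 : ℝ) • ∑ lam : n.Partition, pairing q t f (macQ q t ⟨n, lam⟩) • macP q t ⟨n, lam⟩
    with hg
  have hgn : g ∈ degPart n := Submodule.add_mem _ hf (Submodule.smul_mem _ _
    (Submodule.sum_mem _ fun lam _ => Submodule.smul_mem _ _ (macP_mem hq hq' ht ht' _)))
  have h1 : ∀ mu : n.Partition, pairing q t g (macP q t ⟨n, mu⟩) = 0 := fun mu => by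
    rw [hg, pairing_add_left, pairing_smul_left, pairing_comm (∑ _, _), pairing_sum_right,
      Finset.sum_eq_single mu]
    · have hne := (pairing_macP_self_pos hq hq' ht ht' ⟨n, mu⟩).ne'
      rw [macQ, pairing_smul_right, pairing_smul_right]
      simp only [smul_eq_mul]
      field_simp
      ring
    · intro nu _ hnu
      rw [pairing_smul_right, pairing_macP_of_ne hq hq' ht ht', smul_zero]
      intro he
      exact hnu (eq_of_heq (Sigma.mk.inj he).2).symm
    · exact fun h => absurd (Finset.mem_univ _) h
  have h2 : pairing q t g g = 0 := by
    have h2' := congrArg (pairing q t g) (eq_sum_mono hgn)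
    rw [pairing_sum_right] at h2'
    rw [h2']
    refine Finset.sum_eq_zero fun mu _ => ?_
    rw [pairing_smul_right, pairing_mono_eq_zero hq hq' ht ht' fun nu _ => h1 nu, smul_zero]
  have h3 := eq_zero_of_pairing_self hq hq' ht ht' h2
  rw [hg, neg_one_smul, ← sub_eq_add_neg, sub_eq_zero] at h3
  exact h3

end Macdonald

/-! ### Sums over partitions -/

section PartitionSums

variable {ι κ σ R : Type*} [CommRing R]

/-- A sum may be computed by first summing over the fibres of a function. -/
theorem formalSum_fiberwise [DecidableEq κ] {f : ι → MvPowerSeries σ R} (hf : LocFin f) (w : ι → κ) :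
    formalSum f = formalSum fun k => formalSum fun i => if w i = k then f i else 0 := by
  let F : κ × ι → MvPowerSeries σ R := fun p => if w p.2 = p.1 then f p.2 else 0
  have hF : LocFin F := fun d => by
    refine ((hf d).image fun i => (w i, i)).subset fun p hp => ?_
    by_cases h : w p.2 = p.1
    · refine ⟨p.2, ?_, Prod.ext h rfl⟩
      have : F p = f p.2 := if_pos h
      simpa only [Function.mem_support, this] using hp
    · refine absurd ?_ hp
      simp [F, h]
  rw [formalSum_comm hF]
  refine formalSum_congr fun i => ?_
  ext d
  rw [coeff_formalSum, finsum_eq_single _ (w i)]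
  · simp [F]
  · intro k hk
    simp [F, hk.symm]

/-- A sum over partitions agrees with a sum over multi-indices as soon as the parts of each
weight agree. -/
theorem formalSum_ptn_eq {f : Ptn → MvPowerSeries σ R} {g : (ℕ+ →₀ ℕ) → MvPowerSeries σ R}
    (hf : LocFin f) (hg : LocFin g)
    (h : ∀ n, ∑ lam : n.Partition, f ⟨n, lam⟩ = ∑ e ∈ wtFinset n, g e) :
    formalSum f = formalSum g := by
  rw [formalSum_fiberwise hf Sigma.fst, formalSum_fiberwise hg wt]
  refine formalSum_congr fun n => ?_
  have h1 : (formalSum fun lam : Ptn => if lam.1 = n then f lam else 0) =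
      ∑ lam : n.Partition, f ⟨n, lam⟩ := by
    rw [← formalSum_fintype, ← formalSum_injective (sigma_mk_injective (i := n))]
    · exact formalSum_congr fun lam => if_pos rfl
    · rintro ⟨m, lam⟩ hm
      refine if_neg fun he => hm ?_
      obtain rfl : m = n := he
      exact ⟨lam, rfl⟩
  have h2 : (formalSum fun e => if wt e = n then g e else 0) = ∑ e ∈ wtFinset n, g e := by
    ext d
    rw [coeff_formalSum, map_sum, finsum_eq_sum_of_support_subset (s := wtFinset n)]
    · exact Finset.sum_congr rfl fun e he => by rw [if_pos (mem_wtFinset.mp he)]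
    · intro e he
      rw [Finset.mem_coe, mem_wtFinset]
      by_contra h0
      exact he (by simp [h0])
  rw [h1, h2, h]

theorem finite_ptn_le (N : ℕ) : {lam : Ptn | lam.1 ≤ N}.Finite := by
  refine ((Set.finite_le_nat N).biUnion fun n _ =>
    Set.finite_range (Sigma.mk n : n.Partition → Ptn)).subset fun lam h => ?_
  exact Set.mem_biUnion (x := lam.1) h ⟨lam.2, rfl⟩

end PartitionSums

/-! ### Skew functions -/

section Skew

variable {q t : ℝ} {A : Type*} [CommRing A] [Algebra ℝ A]

/-- The translation `p_n ↦ p_n + ρ(p_n)`, that is, `f ↦ f(ρ, Y)`. -/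
def shiftHom (rho : Lam →ₐ[ℝ] A) : Lam →ₐ[ℝ] MvPolynomial ℕ+ A :=
  MvPolynomial.aeval fun n => MvPolynomial.C (rho (powerSum n)) + MvPolynomial.X n

/-- The coefficient of `p^e` in `f(ρ, Y)`. -/
def skewCoeff (rho : Lam →ₐ[ℝ] A) (e : ℕ+ →₀ ℕ) : Lam →ₗ[ℝ] A :=
  ((MvPolynomial.lcoeff A e).restrictScalars ℝ).comp (shiftHom rho).toLinearMap

theorem skewCoeff_apply (rho : Lam →ₐ[ℝ] A) (e : ℕ+ →₀ ℕ) (f : Lam) :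
    skewCoeff rho e f = (shiftHom rho f).coeff e := rfl

theorem skewCoeff_monomial (rho : Lam →ₐ[ℝ] A) (e g : ℕ+ →₀ ℕ) :
    skewCoeff rho e (MvPolynomial.monomial g 1) =
      MvPowerSeries.coeff e (shiftPow (fun n => rho (powerSum n)) g) := by
  rw [skewCoeff_apply, shiftHom, MvPolynomial.aeval_monomial, map_one, one_mul,
    ← MvPolynomial.coeff_coe]
  congr 1
  have h := map_mpow (MvPolynomial.coeToMvPowerSeries.ringHom (σ := ℕ+) (R := A))
    (fun n => MvPolynomial.C (rho (powerSum n)) + MvPolynomial.X n) g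
  refine h.trans ?_
  rw [shiftPow]
  congr 1
  funext n
  simp [add_comm]

theorem skewCoeff_monomial_add (rho : Lam →ₐ[ℝ] A) (e h : ℕ+ →₀ ℕ) :
    skewCoeff rho e (MvPolynomial.monomial (e + h) 1) =
      (mfact (e + h) / mfact e) • dpow (fun n => rho (powerSum n)) h := by
  rw [skewCoeff_monomial, coeff_shiftPow_add]

theorem skewCoeff_monomial_of_not_le (rho : Lam →ₐ[ℝ] A) {e g : ℕ+ →₀ ℕ} (h : ¬ e ≤ g) :
    skewCoeff rho e (MvPolynomial.monomial g 1) = 0 := by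
  rw [skewCoeff_monomial, coeff_shiftPow_of_not_le h]

theorem map_coeff_twoSets (rho : Lam →ₐ[ℝ] A) (f : Lam) (e : ℕ+ →₀ ℕ) :
    rho ((twoSets f).coeff e) = skewCoeff rho e f := by
  have h : (MvPolynomial.mapAlgHom rho).comp twoSets = shiftHom rho := by
    refine MvPolynomial.algHom_ext fun n => ?_
    simp [twoSets, shiftHom]
  rw [skewCoeff_apply, ← h]
  simp [MvPolynomial.coeff_map]

/-- A specialization of a skew function, in the basis of the products of power sums. -/
theorem map_pairing_twoSets (rho : Lam →ₐ[ℝ] A) (f : Lam) {g : Lam} {m : ℕ} (hg : g ∈ degPart m) :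
    rho (pairing q t (twoSets f) (onlyY g)) =
      ∑ e ∈ wtFinset m, (zFactor q t e * g.coeff e) • skewCoeff rho e f := by
  rw [pairing_comm, pairing_eq_sum (S := wtFinset m) fun e he => ?_, map_sum]
  · refine Finset.sum_congr rfl fun e _ => ?_
    rw [map_mul, map_mul, map_coeff_twoSets, onlyY, MvPolynomial.coeff_map, AlgHom.commutes,
      AlgHom.commutes, ← map_mul, Algebra.smul_def]
  · rw [mem_wtFinset]
    refine mem_degPart.mp hg e fun h0 => he ?_
    rw [onlyY, MvPolynomial.coeff_map, h0, map_zero]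

theorem monomial_mem_degPart (e : ℕ+ →₀ ℕ) : (MvPolynomial.monomial e 1 : Lam) ∈ degPart (wt e) := by
  classical
  refine mem_degPart.mpr fun d hd => ?_
  rw [MvPolynomial.coeff_monomial] at hd
  by_contra h
  exact hd (if_neg fun he => h (congrArg wt he).symm)

theorem eq_sum_monomial {f : Lam} {n : ℕ} (hf : f ∈ degPart n) :
    f = ∑ e ∈ wtFinset n, f.coeff e • (MvPolynomial.monomial e 1 : Lam) := by
  classical
  ext d
  rw [MvPolynomial.coeff_sum]
  simp only [MvPolynomial.coeff_smul, MvPolynomial.coeff_monomial, smul_eq_mul, mul_ite, mul_one,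
    mul_zero, Finset.sum_ite_eq', mem_wtFinset]
  split_ifs with h
  · rfl
  · by_contra h0
    exact h (mem_degPart.mp hf d h0)

/-- The Cauchy identity in a fixed degree, with an operator that is diagonal in the Macdonald
functions inserted. -/
theorem sum_macQ_mul_macP (hq : 0 < q) (hq' : q < 1) (ht : 0 < t) (ht' : t < 1)
    (Φ Ψ : Lam →ₗ[ℝ] A) {E : Lam →ₗ[ℝ] Lam} {c : Ptn → ℝ}
    (hE : ∀ lam, E (macP q t lam) = c lam • macP q t lam) (n : ℕ) :
    ∑ lam : n.Partition, c ⟨n, lam⟩ • (Φ (macQ q t ⟨n, lam⟩) * Ψ (macP q t ⟨n, lam⟩)) =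
      ∑ e ∈ wtFinset n, (zFactor q t e)⁻¹ • (Φ (MvPolynomial.monomial e 1) *
        Ψ (E (MvPolynomial.monomial e 1))) := by
  have h1 : ∀ lam : n.Partition, Φ (macQ q t ⟨n, lam⟩) = ∑ e ∈ wtFinset n,
      (macQ q t ⟨n, lam⟩).coeff e • Φ (MvPolynomial.monomial e 1) := fun lam => by
    have h2 := congrArg Φ (eq_sum_monomial (macQ_mem hq hq' ht ht' ⟨n, lam⟩))
    rw [map_sum] at h2
    exact h2.trans (Finset.sum_congr rfl fun e _ => map_smul _ _ _)
  have h3 : ∀ e ∈ wtFinset n, Ψ (E (MvPolynomial.monomial e 1)) = ∑ lam : n.Partition,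
      (zFactor q t e * (macQ q t ⟨n, lam⟩).coeff e * c ⟨n, lam⟩) • Ψ (macP q t ⟨n, lam⟩) := by
    intro e he
    have h4 := eq_sum_macP hq hq' ht ht' (n := n) (f := MvPolynomial.monomial e 1)
      (mem_wtFinset.mp he ▸ monomial_mem_degPart e)
    have h5 := congrArg (fun f => Ψ (E f)) h4
    simp only [map_sum, map_smul] at h5
    refine h5.trans (Finset.sum_congr rfl fun lam _ => ?_)
    rw [hE, map_smul, smul_smul, pairing_comm, pairing_monomial_right]
  have h6 : ∑ e ∈ wtFinset n, (zFactor q t e)⁻¹ • (Φ (MvPolynomial.monomial e 1) *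
        Ψ (E (MvPolynomial.monomial e 1))) = ∑ e ∈ wtFinset n, ∑ lam : n.Partition,
      c ⟨n, lam⟩ • ((macQ q t ⟨n, lam⟩).coeff e • Φ (MvPolynomial.monomial e 1) *
        Ψ (macP q t ⟨n, lam⟩)) := by
    refine Finset.sum_congr rfl fun e he => ?_
    rw [h3 e he, Finset.mul_sum, Finset.smul_sum]
    refine Finset.sum_congr rfl fun lam _ => ?_
    have := (zFactor_pos hq hq' ht ht' e).ne'
    rw [mul_smul_comm, smul_smul, smul_mul_assoc, smul_smul]
    congr 1
    field_simp
  rw [h6, Finset.sum_comm]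
  refine Finset.sum_congr rfl fun lam _ => ?_
  rw [h1, Finset.sum_mul, Finset.smul_sum]

/-- The sum over `mu` of products of skew functions. -/
theorem sum_skewQ_mul_skewP (hq : 0 < q) (hq' : q < 1) (ht : 0 < t) (ht' : t < 1)
    (rp rm : Lam →ₐ[ℝ] A) (lam : Ptn) (m : ℕ) :
    ∑ mu : m.Partition, rm (skewQ q t lam ⟨m, mu⟩) * rp (skewP q t lam ⟨m, mu⟩) =
      ∑ e ∈ wtFinset m, zFactor q t e • (skewCoeff rm e (macQ q t lam) *
        skewCoeff rp e (macP q t lam)) := by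
  classical
  let F : (Lam →ₐ[ℝ] A) → Lam → Lam →ₗ[ℝ] A := fun rho f =>
    ∑ e ∈ wtFinset m, (LinearMap.toSpanSingleton ℝ A (skewCoeff rho e f)).comp
      (zFactor q t e • MvPolynomial.lcoeff ℝ e)
  have hF : ∀ rho f g, F rho f g =
      ∑ e ∈ wtFinset m, (zFactor q t e * g.coeff e) • skewCoeff rho e f := fun rho f g => by
    simp [F, LinearMap.sum_apply]
  have hm : ∀ rho f, ∀ e ∈ wtFinset m, F rho f (MvPolynomial.monomial e 1) =
      zFactor q t e • skewCoeff rho e f := fun rho f e he => by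
    rw [hF, Finset.sum_eq_single e]
    · rw [MvPolynomial.coeff_monomial, if_pos rfl, mul_one]
    · intro d _ hd
      rw [MvPolynomial.coeff_monomial, if_neg (Ne.symm hd), mul_zero, zero_smul]
    · exact fun h => absurd he h
  have h := sum_macQ_mul_macP hq hq' ht ht' (F rp (macP q t lam)) (F rm (macQ q t lam))
    (E := LinearMap.id) (c := fun _ => 1) (fun _ => (one_smul _ _).symm) m
  simp only [one_smul, LinearMap.id_apply] at h
  have h2 : ∀ mu : m.Partition, rm (skewQ q t lam ⟨m, mu⟩) * rp (skewP q t lam ⟨m, mu⟩) =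
      F rp (macP q t lam) (macQ q t ⟨m, mu⟩) * F rm (macQ q t lam) (macP q t ⟨m, mu⟩) := by
    intro mu
    rw [hF, hF, skewQ, skewP, map_pairing_twoSets rm _ (macP_mem hq hq' ht ht' ⟨m, mu⟩),
      map_pairing_twoSets rp _ (macQ_mem hq hq' ht ht' ⟨m, mu⟩), mul_comm]
  rw [Finset.sum_congr rfl fun mu _ => h2 mu, h]
  refine Finset.sum_congr rfl fun e he => ?_
  rw [hm _ _ e he, hm _ _ e he, smul_mul_smul_comm, smul_smul, mul_comm (skewCoeff rp e _)]
  congr 1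
  have := (zFactor_pos hq hq' ht ht' e).ne'
  field_simp

end Skew

/-! ### The formal weights -/

section Weights

variable {q t : ℝ}

theorem scaled_powerSum (rho : Lam →ₐ[ℝ] ℝ) (c : FormalRing) (n : ℕ+) :
    scaled rho c (powerSum n) = rho (powerSum n) • c ^ (n : ℕ) := by
  rw [scaled, powerSum, MvPolynomial.aeval_X]
  rfl

theorem dpow_smul_pow (a : ℕ+ → ℝ) (c : FormalRing) (h : ℕ+ →₀ ℕ) :
    dpow (fun n : ℕ+ => a n • c ^ (n : ℕ)) h = dpow a h • c ^ wt h := by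
  have h1 : (fun n : ℕ+ => a n • c ^ (n : ℕ)) =
      fun n : ℕ+ => Algebra.ofId ℝ FormalRing (a n) * c ^ (n : ℕ) :=
    funext fun n => Algebra.smul_def _ _
  rw [h1, dpow_mul, mpow_pow_wt, ← map_dpow, Algebra.smul_def]
  rfl

/-- Homogeneity: `scaled` multiplies a skew coefficient of degree `n - wt e` by `c^(n - wt e)`. -/
theorem skewCoeff_scaled (rho : Lam →ₐ[ℝ] ℝ) (c : FormalRing) (e : ℕ+ →₀ ℕ) {f : Lam} {n : ℕ}
    (hf : f ∈ degPart n) :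
    skewCoeff (scaled rho c) e f = skewCoeff rho e f • c ^ (n - wt e) := by
  rw [eq_sum_monomial hf, map_sum, map_sum, Finset.sum_smul]
  refine Finset.sum_congr rfl fun g hg => ?_
  rw [map_smul, map_smul, smul_assoc]
  congr 1
  by_cases hle : e ≤ g
  · obtain ⟨h, rfl⟩ := exists_add_of_le hle
    have h1 : n - wt e = wt h := by
      have := mem_wtFinset.mp hg
      rw [wt_add] at this
      omega
    rw [skewCoeff_monomial_add, skewCoeff_monomial_add, h1]
    simp only [scaled_powerSum]
    rw [dpow_smul_pow, smul_assoc]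
  · rw [skewCoeff_monomial_of_not_le _ hle, skewCoeff_monomial_of_not_le _ hle, zero_smul]

theorem skewCoeff_eq_zero {A : Type*} [CommRing A] [Algebra ℝ A] (rho : Lam →ₐ[ℝ] A)
    {e : ℕ+ →₀ ℕ} {f : Lam} {n : ℕ} (hf : f ∈ degPart n) (h : n < wt e) :
    skewCoeff rho e f = 0 := by
  rw [eq_sum_monomial hf, map_sum]
  refine Finset.sum_eq_zero fun g hg => ?_
  rw [map_smul, skewCoeff_monomial_of_not_le, smul_zero]
  intro hle
  obtain ⟨h, rfl⟩ := exists_add_of_le hle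
  have := mem_wtFinset.mp hg
  rw [wt_add] at this
  omega

theorem formalWeight_eq (hq : 0 < q) (hq' : q < 1) (ht : 0 < t) (ht' : t < 1)
    (rp rm : Lam →ₐ[ℝ] ℝ) (lam mu : Ptn) :
    formalWeight q t rp rm lam mu = (rm (skewQ q t lam mu) * rp (skewP q t lam mu)) •
      (MvPowerSeries.X 2 ^ mu.1 * MvPowerSeries.X 1 ^ (lam.1 - mu.1) *
        MvPowerSeries.X 0 ^ (lam.1 - mu.1)) := by
  have h : ∀ (rho : Lam →ₐ[ℝ] ℝ) (c : FormalRing) {f g : Lam}, f ∈ degPart lam.1 →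
      g ∈ degPart mu.1 → scaled rho c (pairing q t (twoSets f) (onlyY g)) =
        rho (pairing q t (twoSets f) (onlyY g)) • c ^ (lam.1 - mu.1) := by
    intro rho c f g hf hg
    rw [map_pairing_twoSets _ _ hg, map_pairing_twoSets _ _ hg, Finset.sum_smul]
    refine Finset.sum_congr rfl fun e he => ?_
    rw [skewCoeff_scaled _ _ _ hf, mem_wtFinset.mp he, smul_assoc]
  rw [formalWeight, weight, skewQ, skewP,
    h rm _ (macQ_mem hq hq' ht ht' lam) (macP_mem hq hq' ht ht' mu),
    h rp _ (macP_mem hq hq' ht ht' lam) (macQ_mem hq hq' ht ht' mu), mul_smul_comm,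
    mul_smul_comm, smul_mul_assoc, smul_smul, mul_comm (rp _)]
  rfl

theorem map_skewP_eq_zero (hq : 0 < q) (hq' : q < 1) (ht : 0 < t) (ht' : t < 1)
    {A : Type*} [CommRing A] [Algebra ℝ A] (rho : Lam →ₐ[ℝ] A) {lam mu : Ptn}
    (h : lam.1 < mu.1) : rho (skewP q t lam mu) = 0 := by
  rw [skewP, map_pairing_twoSets _ _ (macQ_mem hq hq' ht ht' mu)]
  refine Finset.sum_eq_zero fun e he => ?_
  rw [skewCoeff_eq_zero _ (macP_mem hq hq' ht ht' lam) (by rwa [mem_wtFinset.mp he]), smul_zero]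

theorem vanishBelow_formalWeight (hq : 0 < q) (hq' : q < 1) (ht : 0 < t) (ht' : t < 1)
    (rp rm : Lam →ₐ[ℝ] ℝ) (lam mu : Ptn) :
    VanishBelow (max lam.1 mu.1) (formalWeight q t rp rm lam mu) := by
  rw [formalWeight_eq hq hq' ht ht']
  by_cases h : lam.1 < mu.1
  · rw [map_skewP_eq_zero hq hq' ht ht' rp h, mul_zero, zero_smul]
    exact fun _ _ => map_zero _
  · refine ((((vanishBelow_X_pow _ _).mul (vanishBelow_X_pow _ _)).mul_right _).smul _).mono ?_
    omega

theorem locFin_formalWeight (hq : 0 < q) (hq' : q < 1) (ht : 0 < t) (ht' : t < 1)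
    (rp rm : Lam →ₐ[ℝ] ℝ) :
    LocFin fun s : Ptn × Ptn => formalWeight q t rp rm s.1 s.2 := by
  refine locFin_of_vanishBelow (fun s => max s.1.1 s.2.1)
    (fun s => vanishBelow_formalWeight hq hq' ht ht' rp rm s.1 s.2) fun N => ?_
  refine ((finite_ptn_le N).prod (finite_ptn_le N)).subset fun s hs => ?_
  simpa only [Set.mem_prod, Set.mem_ofPred_eq, max_le_iff] using hs

/-- The sum of the weights, with the eigenvalues of an operator inserted, as a trace over the
polynomial ring in the power sums. -/
theorem formalSum_weight (hq : 0 < q) (hq' : q < 1) (ht : 0 < t) (ht' : t < 1)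
    (rp rm : Lam →ₐ[ℝ] ℝ) {E : Lam →ₗ[ℝ] Lam} {c : Ptn → ℝ}
    (hE : ∀ lam, E (macP q t lam) = c lam • macP q t lam) :
    (formalSum fun s : Ptn × Ptn => c s.1 • formalWeight q t rp rm s.1 s.2) =
      formalSum fun e : ℕ+ →₀ ℕ => mpow (fun n : ℕ+ => MvPowerSeries.X 2 ^ (n : ℕ)) e *
        formalSum fun h : ℕ+ →₀ ℕ =>
          dpow (fun n : ℕ+ => ((kappa q t n)⁻¹ * rm (powerSum n)) • MvPowerSeries.X 1 ^ (n : ℕ)) h *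
            skewCoeff (scaled rp (MvPowerSeries.X 0)) e
              (E (MvPolynomial.monomial (e + h) 1)) := by
  classical
  set ρp := scaled rp (MvPowerSeries.X 0)
  set ρm := scaled rm (MvPowerSeries.X 1)
  let U : FormalRing := MvPowerSeries.X 2
  let F : Ptn × (ℕ+ →₀ ℕ) → FormalRing := fun p => c p.1 • (U ^ wt p.2 *
    (zFactor q t p.2 • (skewCoeff ρm p.2 (macQ q t p.1) * skewCoeff ρp p.2 (macP q t p.1))))
  have hF : LocFin F := by
    refine locFin_of_vanishBelow (fun p => max p.1.1 (wt p.2)) (fun p => ?_) fun N => ?_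
    · have h1 := skewCoeff_scaled rm (MvPowerSeries.X 1) p.2 (macQ_mem hq hq' ht ht' p.1)
      have h2 : VanishBelow (p.1.1 - wt p.2) (skewCoeff ρm p.2 (macQ q t p.1)) := by
        rw [h1]
        exact (vanishBelow_X_pow _ _).smul _
      refine (((vanishBelow_X_pow _ (wt p.2)).mul ((h2.mul_right _).smul _)).smul _).mono ?_
      omega
    · refine ((finite_ptn_le N).prod (finite_wt_le N)).subset fun p hp => ?_
      simpa only [Set.mem_prod, Set.mem_ofPred_eq, max_le_iff] using hp
  -- the sum over `mu`: the `P_mu` and `Q_mu` are dual bases, like the monomials in the `p_n`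
  have h1 : ∀ lam : Ptn, (formalSum fun mu => c lam • formalWeight q t rp rm lam mu) =
      formalSum fun e => F (lam, e) := by
    intro lam
    refine formalSum_ptn_eq
      (((locFin_formalWeight hq hq' ht ht' rp rm).comp_injective
        (Prod.mk_right_injective lam)).smul _)
      (hF.comp_injective (Prod.mk_right_injective lam)) fun m => ?_
    have h2 := sum_skewQ_mul_skewP hq hq' ht ht' ρp ρm lam m
    have h3 : ∀ mu : m.Partition, c lam • formalWeight q t rp rm lam ⟨m, mu⟩ =
        c lam • (U ^ m * (ρm (skewQ q t lam ⟨m, mu⟩) * ρp (skewP q t lam ⟨m, mu⟩))) := fun mu => by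
      rw [formalWeight, weight, mul_assoc]
      rfl
    simp only [h3]
    rw [← Finset.smul_sum, ← Finset.mul_sum, h2, Finset.mul_sum, Finset.smul_sum]
    refine Finset.sum_congr rfl fun e he => ?_
    simp only [F, mem_wtFinset.mp he]
  -- the sum over `lam`, where the eigenvalues are absorbed by the operator
  have h4 : ∀ e, (formalSum fun lam : Ptn => F (lam, e)) = formalSum fun g : ℕ+ →₀ ℕ =>
      U ^ wt e * (zFactor q t e • ((zFactor q t g)⁻¹ •
        (skewCoeff ρm e (MvPolynomial.monomial g 1) *
          skewCoeff ρp e (E (MvPolynomial.monomial g 1))))) := by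
    intro e
    refine formalSum_ptn_eq (hF.comp_injective (Prod.mk_left_injective e)) ?_ fun n => ?_
    · refine locFin_wt fun g => ?_
      have h1 := skewCoeff_scaled rm (MvPowerSeries.X 1) e (monomial_mem_degPart g)
      have h2 : VanishBelow (wt g - wt e) (skewCoeff ρm e (MvPolynomial.monomial g 1)) := by
        rw [h1]
        exact (vanishBelow_X_pow _ _).smul _
      refine ((vanishBelow_X_pow _ (wt e)).mul (((h2.mul_right _).smul _).smul _)).mono ?_
      omega
    · have h5 := sum_macQ_mul_macP hq hq' ht ht' (skewCoeff ρm e) (skewCoeff ρp e) hE n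
      rw [← Finset.mul_sum, ← Finset.smul_sum, ← h5, Finset.smul_sum, Finset.mul_sum]
      refine Finset.sum_congr rfl fun lam _ => ?_
      simp only [F]
      rw [mul_smul_comm, mul_smul_comm, mul_smul_comm, smul_comm]
  rw [formalSum_prod ((locFin_formalWeight hq hq' ht ht' rp rm).smul fun s => c s.1)]
  refine (formalSum_congr h1).trans ?_
  rw [formalSum_comm hF]
  refine formalSum_congr fun e => ?_
  rw [h4, mpow_pow_wt, ← formalSum_mul_left]
  · rw [← formalSum_injective (g := fun h : ℕ+ →₀ ℕ => e + h) (add_right_injective _)]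
    · refine formalSum_congr fun h => ?_
      congr 1
      rw [skewCoeff_monomial_add, zFactor_eq, zFactor_eq, mpow_add]
      have h6 : (fun n : ℕ+ => ((kappa q t n)⁻¹ * rm (powerSum n)) •
          (MvPowerSeries.X 1 : FormalRing) ^ (n : ℕ)) = fun n =>
          Algebra.ofId ℝ FormalRing (kappa q t n)⁻¹ * ρm (powerSum n) := funext fun n => by
        rw [mul_smul, scaled_powerSum, Algebra.smul_def]
        rfl
      have h7 : mpow (fun n => (kappa q t n)⁻¹) h = (mpow (kappa q t) h)⁻¹ := by
        simp [mpow, Finsupp.prod, inv_pow]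
      rw [h6]
      have h8 : dpow (fun n => Algebra.ofId ℝ FormalRing (kappa q t n)⁻¹ * ρm (powerSum n)) h =
          (mpow (kappa q t) h)⁻¹ • dpow (fun n => ρm (powerSum n)) h := by
        simp only [mul_comm _ (ρm _)]
        rw [dpow_mul, ← map_mpow, h7, mul_comm, Algebra.smul_def]
        rfl
      rw [h8, smul_mul_assoc, smul_mul_assoc, smul_smul, smul_smul]
      congr 1
      have e1 := (mpow_pos (kappa_pos hq hq' ht ht') e).ne'
      have e2 := (mpow_pos (kappa_pos hq hq' ht ht') h).ne'
      have e3 := mfact_ne_zero e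
      have e4 := mfact_ne_zero (e + h)
      field_simp
    · intro g hg
      rw [skewCoeff_monomial_of_not_le ρm fun hle => hg ?_, zero_mul, smul_zero, smul_zero,
        mul_zero]
      obtain ⟨h, rfl⟩ := exists_add_of_le hle
      exact ⟨h, rfl⟩
  · exact locFin_wt fun h => VanishBelow.mul_dpow
      (fun n => (vanishBelow_X_pow _ _).smul _) h _

end Weights

/-! ### Coefficientwise maps -/

section CoeffLocal

variable {ι σ τ R S : Type*} [CommRing R] [CommRing S]

/-- Every coefficient of the image depends additively on a single coefficient of the argument. Such
maps commute with locally finite sums. -/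
def CoeffLocal (T : MvPowerSeries σ R → MvPowerSeries τ S) : Prop :=
  ∀ D, ∃ (d : σ →₀ ℕ) (η : R →+ S), ∀ Y, MvPowerSeries.coeff D (T Y) = η (MvPowerSeries.coeff d Y)

theorem CoeffLocal.formalSum {T : MvPowerSeries σ R → MvPowerSeries τ S} (hT : CoeffLocal T)
    {f : ι → MvPowerSeries σ R} (hf : LocFin f) : T (formalSum f) = formalSum fun i => T (f i) := by
  ext D
  obtain ⟨d, η, h⟩ := hT D
  rw [h, coeff_formalSum, coeff_formalSum]
  simp only [h]
  exact map_finsum η (hf d)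

theorem CoeffLocal.locFin {T : MvPowerSeries σ R → MvPowerSeries τ S} (hT : CoeffLocal T)
    {f : ι → MvPowerSeries σ R} (hf : LocFin f) : LocFin fun i => T (f i) := fun D => by
  obtain ⟨d, η, h⟩ := hT D
  refine (hf d).subset fun i hi h0 => hi ?_
  show MvPowerSeries.coeff D (T (f i)) = 0
  rw [h, show MvPowerSeries.coeff d (f i) = 0 from h0, map_zero]

variable [Algebra ℝ R] [Algebra ℝ S] {T : MvPowerSeries σ R →ₐ[ℝ] MvPowerSeries τ S}

theorem CoeffLocal.mexp (hT : CoeffLocal T) {g : ℕ+ → MvPowerSeries σ R}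
    (hg : ∀ n : ℕ+, VanishBelow n (g n)) : T (mexp g) = mexp fun n => T (g n) := by
  rw [PeriodicMacdonald.mexp, PeriodicMacdonald.mexp, hT.formalSum (locFin_dpow hg)]
  exact formalSum_congr fun j => map_dpow T g j

theorem CoeffLocal.geomZ (hT : CoeffLocal T) {w : ℕ+ → MvPowerSeries σ R}
    (hw : ∀ n : ℕ+, VanishBelow n (w n)) : T (geomZ w) = geomZ fun n => T (w n) := by
  rw [PeriodicMacdonald.geomZ, PeriodicMacdonald.geomZ, hT.formalSum (locFin_wt (vanishBelow_mpow hw))]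
  exact formalSum_congr fun j => map_mpow T w j

theorem map_inv1 {F : MvPowerSeries σ R} (hF : VanishBelow 1 F) (hT : VanishBelow 1 (T F)) :
    T (inv1 (1 - F)) = inv1 (1 - T F) := by
  have h1 := congrArg T (inv1_mul hF)
  rw [map_mul, map_sub, map_one] at h1
  have h2 := inv1_mul hT
  linear_combination inv1 (1 - T F) * h1 - T (inv1 (1 - F)) * h2

/-- The embedding of the series with real coefficients. -/
def mapReal (σ R : Type*) [CommRing R] [Algebra ℝ R] : MvPowerSeries σ ℝ →ₐ[ℝ] MvPowerSeries σ R :=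
  MvPowerSeries.mapAlgHom (Algebra.ofId ℝ R)

theorem coeff_mapReal (F : MvPowerSeries σ ℝ) (d : σ →₀ ℕ) :
    MvPowerSeries.coeff d (mapReal σ R F) = algebraMap ℝ R (MvPowerSeries.coeff d F) := rfl

theorem coeffLocal_mapReal : CoeffLocal (mapReal σ R) := fun D =>
  ⟨D, (algebraMap ℝ R).toAddMonoidHom, fun _ => rfl⟩

theorem VanishBelow.mapReal {n : ℕ} {F : MvPowerSeries σ ℝ} (h : VanishBelow n F) :
    VanishBelow n (mapReal σ R F) := fun d hd => by
  rw [coeff_mapReal, h d hd, map_zero]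

theorem mapReal_X (i : σ) : mapReal σ R (MvPowerSeries.X i) = MvPowerSeries.X i :=
  MvPowerSeries.map_X _ _

end CoeffLocal

/-! ### The trace formula -/

section CircSum

variable {q t : ℝ} {r : ℕ}

/-- The functional `circForm`, applied to all coefficients. -/
def circSum (t : ℝ) : MvPowerSeries (Fin 3) (Laurent r) →ₗ[ℝ] FormalRing where
  toFun F := fun d => circForm t (MvPowerSeries.coeff d F)
  map_add' F G := by
    ext d
    exact map_add (circForm t) _ _
  map_smul' c F := by
    ext d
    exact map_smul (circForm t) c (MvPowerSeries.coeff d F)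

theorem coeff_circSum (F : MvPowerSeries (Fin 3) (Laurent r)) (d : Fin 3 →₀ ℕ) :
    MvPowerSeries.coeff d (circSum t F) = circForm t (MvPowerSeries.coeff d F) := rfl

theorem coeffLocal_circSum : CoeffLocal (circSum (r := r) t) := fun D =>
  ⟨D, (circForm t).toAddMonoidHom, fun _ => rfl⟩

theorem circSum_mapReal_mul (G : FormalRing) (F : MvPowerSeries (Fin 3) (Laurent r)) :
    circSum t (mapReal _ _ G * F) = G * circSum t F := by
  classical
  ext d
  rw [coeff_circSum, MvPowerSeries.coeff_mul, MvPowerSeries.coeff_mul, map_sum]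
  refine Finset.sum_congr rfl fun p _ => ?_
  rw [coeff_mapReal, ← Algebra.smul_def, map_smul, smul_eq_mul, coeff_circSum]

theorem circSum_C (c : Laurent r) :
    circSum t (MvPowerSeries.C c) = MvPowerSeries.C (circForm t c) := by
  classical
  ext d
  rw [coeff_circSum, MvPowerSeries.coeff_C, MvPowerSeries.coeff_C]
  split_ifs <;> simp

/-- The substitution `z_i ↦ 2 z_i`; it detects the degree of a Laurent polynomial. -/
def doubleZ (r : ℕ) : Laurent r →ₐ[ℝ] Laurent r :=
  AddMonoidAlgebra.lift ℝ (Laurent r) (Fin r → ℤ)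
    { toFun := fun a => AddMonoidAlgebra.single a.toAdd ((2 : ℝ) ^ ∑ i, a.toAdd i)
      map_one' := by simp [AddMonoidAlgebra.one_def]
      map_mul' := fun a b => by
        rw [AddMonoidAlgebra.single_mul_single, toAdd_mul, ← zpow_add₀ two_ne_zero,
          ← Finset.sum_add_distrib]
        rfl }

theorem doubleZ_single (a : Fin r → ℤ) : doubleZ r (AddMonoidAlgebra.single a 1) =
    ((2 : ℝ) ^ ∑ i, a i) • AddMonoidAlgebra.single a 1 := by
  rw [doubleZ, AddMonoidAlgebra.lift_single, one_smul]
  simp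

/-- Homogeneity of the Cauchy determinant. -/
theorem circForm_doubleZ (G : Laurent r) : circForm t (doubleZ r G) = circForm t G := by
  have h : (circForm t).comp (doubleZ r).toLinearMap = circForm t := by
    refine laurent_hom_ext fun a => ?_
    rw [LinearMap.comp_apply, AlgHom.toLinearMap_apply, doubleZ_single, map_smul]
    by_cases h : ∑ i, a i = 0
    · rw [h, zpow_zero, one_smul]
    · rw [circForm_single_eq_zero h, smul_zero]
  exact DFunLike.congr_fun h G

theorem doubleZ_zPow (i : Fin r) (k : ℤ) : doubleZ r (zPow i k) = ((2 : ℝ) ^ k) • zPow i k := by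
  rw [zPow, doubleZ_single]
  simp

theorem dpow_pow_smul {A : Type*} [CommRing A] [Algebra ℝ A] (c : ℝ) (g : ℕ+ → A) (j : ℕ+ →₀ ℕ) :
    dpow (fun n : ℕ+ => c ^ (n : ℕ) • g n) j = c ^ wt j • dpow g j := by
  have h : (fun n : ℕ+ => c ^ (n : ℕ) • g n) =
      fun n : ℕ+ => g n * Algebra.ofId ℝ A (c ^ (n : ℕ)) :=
    funext fun n => by rw [Algebra.smul_def, mul_comm]; rfl
  rw [h, dpow_mul, ← map_mpow, mpow_pow_wt, mul_comm, Algebra.smul_def]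
  rfl

theorem doubleZ_dpow_betaZ (j : ℕ+ →₀ ℕ) :
    doubleZ r (dpow (betaZ t r) j) = (2 : ℝ) ^ wt j • dpow (betaZ t r) j := by
  rw [map_dpow, ← dpow_pow_smul]
  congr 1
  funext n
  rw [betaZ, map_smul, map_sum, smul_comm]
  simp only [doubleZ_zPow, zpow_natCast, Finset.smul_sum]

theorem doubleZ_dpow_gammaZ (j : ℕ+ →₀ ℕ) :
    doubleZ r (dpow (gammaZ q r) j) = (2⁻¹ : ℝ) ^ wt j • dpow (gammaZ q r) j := by
  rw [map_dpow, ← dpow_pow_smul]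
  congr 1
  funext n
  rw [gammaZ, map_smul, map_sum, smul_comm]
  simp only [doubleZ_zPow, zpow_neg, zpow_natCast, inv_pow, Finset.smul_sum]

/-- The operator preserves the weight, because `circForm` only sees Laurent monomials of
degree `0`. -/
theorem opCoeff_eq_zero {d e : ℕ+ →₀ ℕ} (h : wt d ≠ wt e) : opCoeff q t r d e = 0 := by
  classical
  set G := MvPowerSeries.coeff d (expLin (betaZ t r) * shiftPow (gammaZ q r) e) with hG
  have h1 : doubleZ r G = ((2 : ℝ) ^ ((wt d : ℤ) - wt e)) • G := by
    rw [hG, MvPowerSeries.coeff_mul, map_sum, Finset.smul_sum]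
    refine Finset.sum_congr rfl fun p hp => ?_
    have hd : wt p.1 + wt p.2 = wt d := by
      rw [← wt_add, Finset.HasAntidiagonal.mem_antidiagonal.mp hp]
    rw [map_mul, coeff_expLin, coeff_shiftPow]
    split_ifs with hle
    · have he : wt p.2 + wt (e - p.2) = wt e := by rw [← wt_add, add_tsub_cancel_of_le hle]
      rw [map_smul, doubleZ_dpow_betaZ, doubleZ_dpow_gammaZ, smul_mul_assoc, smul_comm _ ((2⁻¹ : ℝ) ^ _),
        mul_smul_comm, smul_smul]
      congr 1
      rw [← hd, ← he, inv_pow, ← zpow_natCast, ← zpow_natCast, ← zpow_neg, ← zpow_add₀ two_ne_zero]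
      congr 1
      push_cast
      ring
    · rw [map_zero, mul_zero, mul_zero, smul_zero]
  have h2 : ((2 : ℝ) ^ ((wt d : ℤ) - wt e) - 1) * circForm t G = 0 := by
    have h3 := circForm_doubleZ (t := t) G
    rw [h1, map_smul, smul_eq_mul] at h3
    linear_combination h3
  -- an eigenvalue of the scaling other than `1`
  have h4 : (2 : ℝ) ^ ((wt d : ℤ) - wt e) - 1 ≠ 0 := by
    rw [sub_ne_zero, Ne, zpow_eq_one_iff_right₀ zero_le_two (by norm_num)]
    omega
  rw [opCoeff, (mul_eq_zero.mp h2).resolve_left h4, mul_zero]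

/-- Coefficients of `exp (∑ b_n p_n) (p + c)^e`, with constants that are regarded as power series.
-/
theorem coeff_expLin_C_mul (b c : ℕ+ → Laurent r) (d e : ℕ+ →₀ ℕ) :
    MvPowerSeries.coeff d (shiftPow (fun n => (MvPowerSeries.C (c n) :
      MvPowerSeries (Fin 3) (Laurent r))) e * expLin fun n => MvPowerSeries.C (b n)) =
        MvPowerSeries.C (MvPowerSeries.coeff d (expLin b * shiftPow c e)) := by
  let η : Laurent r →+* MvPowerSeries (Fin 3) (Laurent r) := MvPowerSeries.C
  have h1 : MvPowerSeries.map η (shiftPow c e) = shiftPow (fun n => η (c n)) e := by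
    rw [shiftPow, shiftPow, map_mpow]
    simp
  have h2 : MvPowerSeries.map η (expLin b) = expLin fun n => η (b n) := by
    ext1 j
    rw [MvPowerSeries.coeff_map, coeff_expLin, coeff_expLin, dpow, dpow, ← map_mpow]
    exact C_real_smul _ _
  show MvPowerSeries.coeff d (shiftPow (fun n => η (c n)) e * expLin fun n => η (b n)) = η _
  rw [← h1, ← h2, ← map_mul, MvPowerSeries.coeff_map, mul_comm]

/-- The operator in terms of translations and multiplications by exponentials. -/
theorem skewCoeff_opE (rp : Lam →ₐ[ℝ] ℝ) (e g : ℕ+ →₀ ℕ) :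
    skewCoeff (scaled rp (MvPowerSeries.X 0)) e (opE q t r (MvPolynomial.monomial g 1)) =
      (r ! : ℝ)⁻¹ • circSum t (MvPowerSeries.coeff e (translate
        (fun n : ℕ+ => mapReal _ (Laurent r) (rp (powerSum n) • MvPowerSeries.X 0 ^ (n : ℕ)))
        (shiftPow (fun n => MvPowerSeries.C (gammaZ q r n)) g *
          expLin fun n => MvPowerSeries.C (betaZ t r n)))) := by
  classical
  set ρ := scaled rp (MvPowerSeries.X 0) with hρ
  have hα : ∀ n : ℕ+, VanishBelow n (rp (powerSum n) • (MvPowerSeries.X 0 : FormalRing) ^ (n : ℕ)) :=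
    fun n => (vanishBelow_X_pow _ _).smul _
  rw [coeff_translate, coeffLocal_circSum.formalSum
    (locFin_wt fun h => (VanishBelow.mul_dpow (fun n => (hα n).mapReal) h _).smul _),
    ← formalSum_smul]
  · have h1 : ∀ h : ℕ+ →₀ ℕ, (r ! : ℝ)⁻¹ • circSum t ((mfact (e + h) / mfact e) •
        (dpow (fun n : ℕ+ => mapReal _ (Laurent r) (rp (powerSum n) • MvPowerSeries.X 0 ^ (n : ℕ))) h *
          MvPowerSeries.coeff (e + h) (shiftPow (fun n => MvPowerSeries.C (gammaZ q r n)) g *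
          expLin fun n => MvPowerSeries.C (betaZ t r n)))) =
        opCoeff q t r (e + h) g • skewCoeff ρ e (MvPolynomial.monomial (e + h) 1) := by
      intro h
      rw [coeff_expLin_C_mul, ← map_dpow, map_smul, circSum_mapReal_mul, circSum_C,
        skewCoeff_monomial_add, opCoeff, hρ]
      simp only [scaled_powerSum]
      rw [mul_comm _ (MvPowerSeries.C _), ← MvPowerSeries.smul_eq_C_mul, smul_smul, smul_smul, smul_smul]
      congr 1
      ring
    simp only [h1]
    rw [formalSum_injective (g := fun h : ℕ+ →₀ ℕ => e + h)
      (f := fun d => opCoeff q t r d g • skewCoeff ρ e (MvPolynomial.monomial d 1))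
      (add_right_injective _)]
    · ext D
      rw [opE_monomial, map_sum, coeff_formalSum, map_sum,
        finsum_eq_sum_of_support_subset (s := wtFinset (wt g))]
      · exact Finset.sum_congr rfl fun d _ => by rw [map_smul]
      · intro d hd
        rw [Finset.mem_coe, mem_wtFinset]
        by_contra h0
        exact hd (by simp [opCoeff_eq_zero h0])
    · intro d hd
      rw [skewCoeff_monomial_of_not_le, smul_zero]
      intro hle
      obtain ⟨h, rfl⟩ := exists_add_of_le hle
      exact hd ⟨h, rfl⟩
  · exact coeffLocal_circSum.locFin
      (locFin_wt fun h => (VanishBelow.mul_dpow (fun n => (hα n).mapReal) h _).smul _)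

end CircSum

section TraceFormula

variable (q t : ℝ) (rp rm : Lam →ₐ[ℝ] ℝ) (r : ℕ)

/-- The variables `p_n(ρ⁺) x^n`. -/
def plusVar (n : ℕ+) : FormalRing := rp (powerSum n) • MvPowerSeries.X 0 ^ (n : ℕ)

/-- The variables `p_n(ρ⁻) y^n`, normalized by the scalar product. -/
def minusVar (n : ℕ+) : FormalRing :=
  ((kappa q t n)⁻¹ * rm (powerSum n)) • MvPowerSeries.X 1 ^ (n : ℕ)

/-- The powers `u^n`. -/
def uPow (n : ℕ+) : FormalRing := MvPowerSeries.X 2 ^ (n : ℕ)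

theorem vanishBelow_plusVar (n : ℕ+) : VanishBelow n (plusVar rp n) := (vanishBelow_X_pow _ _).smul _

theorem vanishBelow_minusVar (n : ℕ+) : VanishBelow n (minusVar q t rm n) :=
  (vanishBelow_X_pow _ _).smul _

theorem vanishBelow_uPow (n : ℕ+) : VanishBelow n (uPow n) := vanishBelow_X_pow _ _

variable {q t}

/-- The partition function in closed form. -/
theorem formalPartitionFunction_eq (hq : 0 < q) (hq' : q < 1) (ht : 0 < t) (ht' : t < 1) :
    formalPartitionFunction q t rp rm = geomZ uPow * mexp fun n => inv1 (1 - uPow n) *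
      (plusVar rp n * minusVar q t rm n) := by
  have h := formalSum_weight hq hq' ht ht' rp rm (E := LinearMap.id) (c := fun _ => 1)
    fun _ => (one_smul _ _).symm
  simp only [one_smul, LinearMap.id_apply] at h
  have h2 := gaussian_trace (vanishBelow_plusVar rp) (vanishBelow_minusVar q t rm) vanishBelow_uPow
    (fun _ => 0) (fun _ => 0)
  simp only [mul_zero, zero_add, add_zero, zero_mul] at h2
  rw [formalPartitionFunction, h, ← h2]
  refine formalSum_congr fun e => ?_
  congr 1
  refine formalSum_congr fun g => ?_
  congr 1
  rw [skewCoeff_monomial, translate_shiftPow_mul (vanishBelow_plusVar rp),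
    translate_expLin (vanishBelow_plusVar rp)]
  have h4 : ∀ (B : Type) [CommRing B] [Algebra ℝ B] (j : ℕ+ →₀ ℕ),
      dpow (fun _ : ℕ+ => (0 : B)) j = if j = 0 then 1 else 0 := by
    intro B _ _ j
    split_ifs with hj
    · rw [hj, dpow_zero]
    · obtain ⟨n, hn⟩ := Finsupp.ne_iff.mp hj
      rw [dpow, mpow, Finsupp.prod, Finset.prod_eq_zero (Finsupp.mem_support_iff.mpr hn)
        (zero_pow hn), smul_zero]
  have h5 : expLin (fun _ : ℕ+ => (0 : FormalRing)) = 1 := by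
    classical
    ext1 d
    rw [coeff_expLin, h4, MvPowerSeries.coeff_one]
  have h6 : (mexp fun n => plusVar rp n * 0) = (1 : FormalRing) := by
    simp only [mul_zero]
    rw [mexp_eq_formalExp (fun n _ _ => map_zero _), formalSum_zero, formalExp_zero]
  rw [h5, h6, map_one, mul_one, mul_one]
  simp only [zero_add, scaled_powerSum]
  rfl

/-- The exponential part of the integrand. -/
def integrandExp (q t : ℝ) (rp rm : Lam →ₐ[ℝ] ℝ) (r : ℕ) : MvPowerSeries (Fin 3) (Laurent r) :=
  mexp fun n => inv1 (1 - mapReal _ _ (uPow n)) *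
    (mapReal _ _ (plusVar rp n) * MvPowerSeries.C (betaZ t r n) +
      MvPowerSeries.C (gammaZ q r n) * mapReal _ _ (minusVar q t rm n) +
      mapReal _ _ (uPow n) * (MvPowerSeries.C (gammaZ q r n) * MvPowerSeries.C (betaZ t r n)))

/-- The unnormalized expectation value of an observable. -/
theorem formalSum_obsE_weight (hq : 0 < q) (hq' : q < 1) (ht : 0 < t) (ht' : t < 1) :
    (formalSum fun s : Ptn × Ptn => obsE q t r s.1 • formalWeight q t rp rm s.1 s.2) =
      formalPartitionFunction q t rp rm *
        ((r ! : ℝ)⁻¹ • circSum t (integrandExp q t rp rm r)) := by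
  have hδ : ∀ n : ℕ+, VanishBelow n (mapReal _ (Laurent r) (minusVar q t rm n)) :=
    fun n => (vanishBelow_minusVar q t rm n).mapReal
  have hα : ∀ n : ℕ+, VanishBelow n (mapReal _ (Laurent r) (plusVar rp n)) :=
    fun n => (vanishBelow_plusVar rp n).mapReal
  have hw : ∀ n : ℕ+, VanishBelow n (mapReal _ (Laurent r) (uPow n)) :=
    fun n => (vanishBelow_uPow n).mapReal
  have hw1 : ∀ n : ℕ+, VanishBelow 1 (uPow n) := fun n => (vanishBelow_uPow n).mono n.pos
  have h := formalSum_weight hq hq' ht ht' rp rm (E := opE q t r) (c := obsE q t r)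
    (opE_macP hq hq' ht ht' r)
  have hg := gaussian_trace hα hδ hw (fun n => MvPowerSeries.C (betaZ t r n))
    (fun n => MvPowerSeries.C (gammaZ q r n))
  have h1 : ∀ (e : ℕ+ →₀ ℕ), LocFin fun g => dpow (fun n => mapReal _ (Laurent r) (minusVar q t rm n)) g *
      MvPowerSeries.coeff e (translate (fun n => mapReal _ (Laurent r) (plusVar rp n))
        (shiftPow (fun n => MvPowerSeries.C (gammaZ q r n)) (e + g) *
          expLin fun n => MvPowerSeries.C (betaZ t r n))) :=
    fun e => locFin_wt fun g => VanishBelow.mul_dpow hδ g _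
  have hr : (r ! : ℝ)⁻¹ • circSum t (geomZ (fun n => mapReal _ (Laurent r) (uPow n)) * mexp fun n =>
      inv1 (1 - mapReal _ (Laurent r) (uPow n)) *
        (mapReal _ _ (plusVar rp n) * MvPowerSeries.C (betaZ t r n) +
          mapReal _ _ (plusVar rp n) * mapReal _ _ (minusVar q t rm n) +
          MvPowerSeries.C (gammaZ q r n) * mapReal _ _ (minusVar q t rm n) +
          mapReal _ _ (uPow n) * (MvPowerSeries.C (gammaZ q r n) *
            MvPowerSeries.C (betaZ t r n)))) =
      formalSum fun s : Ptn × Ptn => obsE q t r s.1 • formalWeight q t rp rm s.1 s.2 := by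
    rw [h, ← hg, coeffLocal_circSum.formalSum
      (locFin_wt fun e => (vanishBelow_mpow hw e).mul_right _), ← formalSum_smul]
    · refine formalSum_congr fun e => ?_
      rw [← map_mpow, circSum_mapReal_mul, coeffLocal_circSum.formalSum (h1 e), ← mul_smul_comm,
        ← formalSum_smul]
      · refine congrArg₂ (· * ·) rfl (formalSum_congr fun g => ?_)
        rw [← map_dpow, circSum_mapReal_mul, skewCoeff_opE, mul_smul_comm]
        rfl
      · simp only [← map_dpow, circSum_mapReal_mul]
        exact locFin_wt fun g => VanishBelow.mul_dpow (vanishBelow_minusVar q t rm) g _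
    · simp only [← map_mpow, circSum_mapReal_mul]
      exact locFin_wt fun g => (vanishBelow_mpow vanishBelow_uPow g).mul_right _
  -- the part of the exponent without `z` is the partition function
  have hsplit : (mexp fun n => inv1 (1 - mapReal _ (Laurent r) (uPow n)) *
        (mapReal _ _ (plusVar rp n) * MvPowerSeries.C (betaZ t r n) +
          mapReal _ _ (plusVar rp n) * mapReal _ _ (minusVar q t rm n) +
          MvPowerSeries.C (gammaZ q r n) * mapReal _ _ (minusVar q t rm n) +
          mapReal _ _ (uPow n) * (MvPowerSeries.C (gammaZ q r n) *
            MvPowerSeries.C (betaZ t r n)))) =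
      mapReal _ _ (mexp fun n => inv1 (1 - uPow n) * (plusVar rp n * minusVar q t rm n)) *
        integrandExp q t rp rm r := by
    rw [coeffLocal_mapReal.mexp fun n => ((vanishBelow_plusVar rp n).mul_right _).mul_left _,
      integrandExp, ← mexp_add]
    · congr 1
      funext n
      rw [map_mul, map_mul, map_inv1 (hw1 n) ((hw n).mono n.pos)]
      ring
    · intro n
      exact (((vanishBelow_plusVar rp n).mul_right _).mul_left _).mapReal
    · intro n
      exact ((((hα n).mul_right _).add ((hδ n).mul_left _)).add ((hw n).mul_right _)).mul_left _
  rw [← hr, hsplit, ← coeffLocal_mapReal.geomZ vanishBelow_uPow, ← mul_assoc, ← map_mul,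
    circSum_mapReal_mul, formalPartitionFunction_eq rp rm hq hq' ht ht', mul_smul_comm]

end TraceFormula

/-! ### The integrand as an exponential -/

section Kernel

variable {q t : ℝ} {rp rm : Lam →ₐ[ℝ] ℝ} {r : ℕ}

theorem vanishBelow_plusTerm (i : Fin r) (n : ℕ+) : VanishBelow n (plusTerm t rp i n) :=
  (((vanishBelow_X_pow _ _).mul_left _).mul_right _).smul _

theorem vanishBelow_minusTerm (i : Fin r) (n : ℕ+) : VanishBelow n (minusTerm t rm i n) :=
  (((vanishBelow_X_pow _ _).mul_left _).mul_right _).smul _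

theorem processKernel_one (t : ℝ) (rp rm : Lam →ₐ[ℝ] ℝ) (i j : Fin r) :
    processKernel t 1 (fun _ => rp) (fun _ => rm) 1 i j = kernel t rp rm i j := by
  have hp : ∀ n : ℕ+, VanishBelow n (plusTerm t rp i n) := vanishBelow_plusTerm i
  have hm : ∀ n : ℕ+, VanishBelow n (-minusTerm t rm i n) := fun n => (vanishBelow_minusTerm i n).neg
  rw [processKernel, kernel]
  simp only [Finset.univ_unique, Finset.prod_singleton, Fin.default_eq_zero, Fin.val_zero,
    show ¬ (1 ≤ 0) by omega, if_false, one_mul, zero_add, lt_irrefl, sub_eq_add_neg]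
  rw [formalSum_add (locFin_pnat hp) (locFin_pnat hm), formalExp_add (vanishBelow_formalSum_pnat hp)
    (vanishBelow_formalSum_pnat hm), mul_assoc]

/-- The lift to formal integrands, as a homomorphism of real algebras. -/
def liftReal (r : ℕ) : MvPowerSeries (Fin 3) (Laurent r) →ₐ[ℝ] Integrand r :=
  (liftSeries r).restrictScalars ℝ

theorem coeffLocal_liftReal : CoeffLocal (liftReal r) := fun D => by
  by_cases h : D 0 = 0
  · refine ⟨D.tail, AddMonoidHom.id _, fun Y => ?_⟩
    have h1 : D = Finsupp.cons 0 D.tail := by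
      conv_lhs => rw [← Finsupp.cons_tail D, h]
    conv_lhs => rw [h1]
    exact coeff_cons_liftSeries Y _
  · exact ⟨0, 0, fun Y => coeff_liftSeries_of_ne_zero Y h⟩

theorem liftReal_X (i : Fin 3) : liftReal r (MvPowerSeries.X i) = MvPowerSeries.X i.succ :=
  MvPowerSeries.rename_X _ _

theorem liftReal_C (c : Laurent r) : liftReal r (MvPowerSeries.C c) = MvPowerSeries.C c :=
  MvPowerSeries.rename_C _ _

/-- The terms of `log (u z_j / z_i; u)_∞`. -/
def ratioTerm (i j : Fin r) (n : ℕ+) : Integrand r :=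
  -((((n : ℕ) : ℝ)⁻¹) • (uVar r ^ (n : ℕ) * MvPowerSeries.C (zPow j (n : ℕ) * zPow i (-(n : ℕ))) *
    inv1 (1 - uVar r ^ (n : ℕ))))

theorem vanishBelow_ratioTerm (i j : Fin r) (n : ℕ+) : VanishBelow n (ratioTerm i j n) :=
  ((((vanishBelow_X_pow _ _).mul_right _).mul_right _).smul _).neg

theorem ratioPoch_eq (c : ℝ) (i j : Fin r) :
    ratioPoch c i j = formalExp (formalSum fun n : ℕ+ => c ^ (n : ℕ) • ratioTerm i j n) := by
  have hu : VanishBelow 1 (uVar r) := vanishBelow_X _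
  rw [ratioPoch, pochhammer_eq_formalExp ((hu.mul_right _).smul c) hu]
  congr 2
  funext n
  rw [ratioTerm, smul_pow, mul_pow, ← map_pow, mul_pow, zPow_pow, zPow_pow, mul_one, mul_neg_one,
    smul_mul_assoc, smul_neg, smul_comm]

theorem deltaPart_eq (q s : ℝ) : deltaPart r q s = formalExp (formalSum fun n : ℕ+ =>
    ∑ i : Fin r, ∑ j : Fin r, ((1 - q ^ (n : ℕ)) * (1 - s ^ (n : ℕ))) • ratioTerm i j n) := by
  have hv : ∀ (c : ℕ+ → ℝ) (i j : Fin r) (n : ℕ+), VanishBelow n (c n • ratioTerm i j n) :=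
    fun c i j n => (vanishBelow_ratioTerm i j n).smul _
  have h1 : ∀ (c : ℕ+ → ℝ) (i j : Fin r), VanishBelow 1 (formalSum fun n => c n • ratioTerm i j n) :=
    fun c i j => vanishBelow_formalSum_pnat (hv c i j)
  have h2 : ∀ i j : Fin r, ratioPoch 1 i j * ratioPoch (q * s) i j *
      inv1 (ratioPoch q i j * ratioPoch s i j) = formalExp (formalSum fun n : ℕ+ =>
        ((1 - q ^ (n : ℕ)) * (1 - s ^ (n : ℕ))) • ratioTerm i j n) := by
    intro i j
    have hf : ∀ c : ℝ, VanishBelow 1 (formalSum fun n : ℕ+ => c ^ (n : ℕ) • ratioTerm i j n) :=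
      fun c => h1 (fun n => c ^ (n : ℕ)) i j
    have hl : ∀ c : ℝ, LocFin fun n : ℕ+ => c ^ (n : ℕ) • ratioTerm i j n :=
      fun c => locFin_pnat (hv (fun n => c ^ (n : ℕ)) i j)
    simp only [ratioPoch_eq]
    rw [← formalExp_add (hf _) (hf _), ← formalExp_add (hf _) (hf _),
      inv1_formalExp ((hf _).add (hf _)), ← formalExp_add ((hf _).add (hf _)) ((hf _).add (hf _)).neg,
      ← formalSum_add (hl _) (hl _), ← formalSum_add (hl _) (hl _), ← formalSum_neg,
      ← formalSum_add ((hl _).add (hl _)) ((hl _).add (hl _)).neg]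
    congr 2
    funext n
    rw [← add_smul, ← add_smul, ← sub_eq_add_neg, ← sub_smul, mul_pow, one_pow]
    congr 1
    ring
  have hd : ∀ (i j : Fin r) (n : ℕ+), VanishBelow n
      (((1 - q ^ (n : ℕ)) * (1 - s ^ (n : ℕ))) • ratioTerm i j n) :=
    fun i j n => (vanishBelow_ratioTerm i j n).smul _
  rw [deltaPart]
  simp only [h2]
  rw [formalSum_sum _ fun i => locFin_sum _ fun j => locFin_pnat (hd i j),
    formalExp_sum (a := fun i => formalSum fun n : ℕ+ => ∑ j : Fin r,
        ((1 - q ^ (n : ℕ)) * (1 - s ^ (n : ℕ))) • ratioTerm i j n)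
      fun i _ => vanishBelow_formalSum_pnat fun n => VanishBelow.sum fun j _ => hd i j n]
  refine Finset.prod_congr rfl fun i _ => ?_
  rw [formalSum_sum _ fun j => locFin_pnat (hd i j), formalExp_sum fun j _ => vanishBelow_formalSum_pnat (hd i j)]

/-- The exponent of the integrand. -/
theorem liftReal_exponent (hq : 0 < q) (hq' : q < 1) (ht : 0 < t) (ht' : t < 1) (n : ℕ+) :
    liftReal r (inv1 (1 - mapReal _ _ (uPow n)) *
      (mapReal _ _ (plusVar rp n) * MvPowerSeries.C (betaZ t r n) +
        MvPowerSeries.C (gammaZ q r n) * mapReal _ _ (minusVar q t rm n) +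
        mapReal _ _ (uPow n) * (MvPowerSeries.C (gammaZ q r n) * MvPowerSeries.C (betaZ t r n)))) =
      ∑ i : Fin r, (plusTerm t rp i n - minusTerm t rm i n) +
        ∑ i : Fin r, ∑ j : Fin r,
          ((1 - q ^ (n : ℕ)) * (1 - t⁻¹ ^ (n : ℕ))) • ratioTerm i j n := by
  have hu : liftReal r (mapReal _ _ (uPow n)) = uVar r ^ (n : ℕ) := by
    rw [uPow, map_pow, map_pow, mapReal_X, liftReal_X]
    rfl
  have hx : liftReal r (mapReal _ _ (plusVar rp n)) = rp (powerSum n) • xVar r ^ (n : ℕ) := by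
    rw [plusVar, map_smul, map_smul, map_pow, map_pow, mapReal_X, liftReal_X]
    rfl
  have hy : liftReal r (mapReal _ _ (minusVar q t rm n)) =
      ((kappa q t n)⁻¹ * rm (powerSum n)) • yVar r ^ (n : ℕ) := by
    rw [minusVar, map_smul, map_smul, map_pow, map_pow, mapReal_X, liftReal_X]
    rfl
  have hw : VanishBelow 1 (mapReal _ (Laurent r) (uPow n)) :=
    ((vanishBelow_uPow n).mono n.pos).mapReal
  have hw' : VanishBelow 1 (liftReal r (mapReal _ _ (uPow n))) := by
    rw [hu]
    exact (vanishBelow_X_pow _ _).mono n.pos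
  rw [map_mul, map_inv1 hw hw', map_add, map_add, map_mul, map_mul, map_mul, map_mul, liftReal_C,
    liftReal_C, hu, hx, hy]
  set I := inv1 (1 - uVar r ^ (n : ℕ)) with hI
  have hb : (MvPowerSeries.C (betaZ t r n) : Integrand r) = ((1 - t⁻¹ ^ (n : ℕ)) / (n : ℕ)) •
      ∑ i, MvPowerSeries.C (zPow i ((n : ℕ) : ℤ)) := by
    rw [betaZ, C_real_smul, map_sum]
  have hg : (MvPowerSeries.C (gammaZ q r n) : Integrand r) = (-(1 - q ^ (n : ℕ))) •
      ∑ i, MvPowerSeries.C (zPow i (-(n : ℕ) : ℤ)) := by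
    rw [gammaZ, C_real_smul, map_sum]
  have hplus : ∑ i : Fin r, plusTerm t rp i n = ((1 - t⁻¹ ^ (n : ℕ)) * rp (powerSum n) / (n : ℕ)) •
      (I * xVar r ^ (n : ℕ) * ∑ i, MvPowerSeries.C (zPow i ((n : ℕ) : ℤ))) := by
    rw [Finset.mul_sum, Finset.smul_sum]
    rfl
  have hminus : ∑ i : Fin r, minusTerm t rm i n = ((1 - t ^ (n : ℕ)) * rm (powerSum n) / (n : ℕ)) •
      (I * yVar r ^ (n : ℕ) * ∑ i, MvPowerSeries.C (zPow i (-(n : ℕ) : ℤ))) := by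
    rw [Finset.mul_sum, Finset.smul_sum]
    rfl
  have hratio : ∑ i : Fin r, ∑ j : Fin r,
      ((1 - q ^ (n : ℕ)) * (1 - t⁻¹ ^ (n : ℕ))) • ratioTerm i j n =
      (((1 - q ^ (n : ℕ)) * (1 - t⁻¹ ^ (n : ℕ))) * -(((n : ℕ) : ℝ)⁻¹)) •
        (uVar r ^ (n : ℕ) * ((∑ i, MvPowerSeries.C (zPow i (-(n : ℕ) : ℤ))) *
          ∑ j, MvPowerSeries.C (zPow j ((n : ℕ) : ℤ))) * I) := by
    rw [Finset.sum_mul_sum, Finset.mul_sum, Finset.sum_mul, Finset.smul_sum]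
    refine Finset.sum_congr rfl fun i _ => ?_
    rw [Finset.mul_sum, Finset.sum_mul, Finset.smul_sum]
    refine Finset.sum_congr rfl fun j _ => ?_
    rw [ratioTerm, ← neg_smul, smul_smul, map_mul, mul_comm (MvPowerSeries.C (zPow j _))]
  rw [Finset.sum_sub_distrib, hplus, hminus, hratio, hb, hg]
  set Zp : Integrand r := ∑ i, MvPowerSeries.C (zPow i ((n : ℕ) : ℤ))
  set Zm : Integrand r := ∑ i, MvPowerSeries.C (zPow i (-(n : ℕ) : ℤ))
  have h1 := (one_sub_pow_pos ht ht' n).ne'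
  have h2 := (one_sub_pow_pos hq hq' n).ne'
  have h3 : ((n : ℕ) : ℝ) ≠ 0 := Nat.cast_ne_zero.mpr n.ne_zero
  have hk : (1 - t ^ (n : ℕ)) * rm (powerSum n) / (n : ℕ) =
      (1 - q ^ (n : ℕ)) * ((kappa q t n)⁻¹ * rm (powerSum n)) := by
    rw [kappa]
    field_simp
  rw [hk]
  simp only [Algebra.smul_def, map_mul, map_neg, div_eq_mul_inv]
  ring

/-- The integrand is the product of the determinant of the formal series `(z_i - t⁻¹ z_j)⁻¹` and an
exponential without the variable `s`. -/
theorem det_kernel_mul_deltaPart (hq : 0 < q) (hq' : q < 1) (ht : 0 < t) (ht' : t < 1) :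
    Matrix.det (Matrix.of fun i j : Fin r => kernel t rp rm i j) * deltaPart r q t⁻¹ =
      Matrix.det (Matrix.of fun i j : Fin r => cauchy i j) *
        liftSeries r (integrandExp q t rp rm r) := by
  have hpm : ∀ (i : Fin r) (n : ℕ+), VanishBelow n (plusTerm t rp i n - minusTerm t rm i n) :=
    fun i n => by
      rw [sub_eq_add_neg]
      exact (vanishBelow_plusTerm i n).add (vanishBelow_minusTerm i n).neg
  have hr : ∀ n : ℕ+, VanishBelow n (∑ i : Fin r, ∑ j : Fin r,
      ((1 - q ^ (n : ℕ)) * (1 - t⁻¹ ^ (n : ℕ))) • ratioTerm i j n) := fun n =>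
    VanishBelow.sum fun i _ => VanishBelow.sum fun j _ => (vanishBelow_ratioTerm i j n).smul _
  have hs : ∀ n : ℕ+, VanishBelow n (∑ i : Fin r, (plusTerm t rp i n - minusTerm t rm i n)) :=
    fun n => VanishBelow.sum fun i _ => hpm i n
  have h1 : Matrix.det (Matrix.of fun i j : Fin r => kernel t rp rm i j) =
      (∏ i : Fin r, formalExp (formalSum fun n : ℕ+ => plusTerm t rp i n - minusTerm t rm i n)) *
        Matrix.det (Matrix.of fun i j : Fin r => cauchy i j) := by
    rw [← Matrix.det_mul_column]
    congr 1
    ext i j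
    rw [Matrix.of_apply, Matrix.of_apply, kernel, mul_comm]
    rfl
  have h2 : liftSeries r (integrandExp q t rp rm r) = formalExp (formalSum fun n : ℕ+ =>
      ∑ i : Fin r, (plusTerm t rp i n - minusTerm t rm i n) + ∑ i : Fin r, ∑ j : Fin r,
      ((1 - q ^ (n : ℕ)) * (1 - t⁻¹ ^ (n : ℕ))) • ratioTerm i j n) := by
    refine (coeffLocal_liftReal.mexp fun n => ?_).trans ?_
    · exact (((((vanishBelow_plusVar rp n).mapReal).mul_right _).add
        (((vanishBelow_minusVar q t rm n).mapReal).mul_left _)).add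
          (((vanishBelow_uPow n).mapReal).mul_right _)).mul_left _
    · simp only [liftReal_exponent hq hq' ht ht']
      exact mexp_eq_formalExp fun n => (hs n).add (hr n)
  rw [h1, h2, deltaPart_eq, formalSum_add (locFin_pnat hs) (locFin_pnat hr),
    formalExp_add (vanishBelow_formalSum_pnat hs) (vanishBelow_formalSum_pnat hr),
    formalSum_sum _ fun i => locFin_pnat (hpm i),
    formalExp_sum fun i _ => vanishBelow_formalSum_pnat (hpm i)]
  ring

/-- The Cauchy determinant is the only part of the integrand that involves the geometric series, and
`residue_det_cauchy` evaluates it. -/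
theorem firstSeriesIntegral_eq (hq : 0 < q) (hq' : q < 1) (ht : 0 < t) (ht' : t < 1) :
    firstSeriesIntegral q t rp rm r = (r ! : ℝ)⁻¹ • circSum t (integrandExp q t rp rm r) := by
  rw [firstSeriesIntegral, det_kernel_mul_deltaPart hq hq' ht ht',
    residue_det_cauchy (one_lt_inv_iff₀.mpr ⟨ht, ht'⟩)]
  rfl

theorem constantCoeff_geomZ {w : ℕ+ → FormalRing} (hw : ∀ n : ℕ+, VanishBelow n (w n)) :
    MvPowerSeries.constantCoeff (geomZ w) = 1 := by
  rw [geomZ, ← MvPowerSeries.coeff_zero_eq_constantCoeff_apply, coeff_formalSum,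
    finsum_eq_single _ 0]
  · simp
  · intro j hj
    refine vanishBelow_mpow hw j 0 ?_
    obtain ⟨n, hn⟩ := Finsupp.ne_iff.mp hj
    have := le_wt (n := n) hn
    have := n.pos
    simp only [map_zero]
    omega

theorem constantCoeff_formalPartitionFunction (hq : 0 < q) (hq' : q < 1) (ht : 0 < t)
    (ht' : t < 1) : MvPowerSeries.constantCoeff (formalPartitionFunction q t rp rm) = 1 := by
  have hv : ∀ n : ℕ+, VanishBelow n (inv1 (1 - uPow n) * (plusVar rp n * minusVar q t rm n)) :=
    fun n => ((vanishBelow_plusVar rp n).mul_right _).mul_left _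
  rw [formalPartitionFunction_eq rp rm hq hq' ht ht', map_mul, constantCoeff_geomZ vanishBelow_uPow,
    mexp_eq_formalExp hv, constantCoeff_formalExp (vanishBelow_formalSum_pnat hv), mul_one]

theorem inv1_mul_formalPartitionFunction (hq : 0 < q) (hq' : q < 1) (ht : 0 < t) (ht' : t < 1) :
    inv1 (formalPartitionFunction q t rp rm) * formalPartitionFunction q t rp rm = 1 :=
  MvPowerSeries.invOfUnit_mul _ _
    (by rw [constantCoeff_formalPartitionFunction hq hq' ht ht', Units.val_one])

/-- The unnormalized form of the identity. -/
theorem formalSum_obsE_weight_eq (hq : 0 < q) (hq' : q < 1) (ht : 0 < t) (ht' : t < 1) :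
    (formalSum fun s : Ptn × Ptn => obsE q t r s.1 • formalWeight q t rp rm s.1 s.2) =
      formalPartitionFunction q t rp rm * firstSeriesIntegral q t rp rm r := by
  rw [firstSeriesIntegral_eq hq hq' ht ht', formalSum_obsE_weight rp rm r hq hq' ht ht']

/-- The identity of formal series. -/
theorem formalExpectation_eq (hq : 0 < q) (hq' : q < 1) (ht : 0 < t) (ht' : t < 1) :
    formalExpectation q t rp rm (obsE q t r) = firstSeriesIntegral q t rp rm r := by
  have hl := locFin_formalWeight hq hq' ht ht' rp rm
  have h1 : ∀ lam : Ptn, obsE q t r lam • formalMeasure q t rp rm lam =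
      inv1 (formalPartitionFunction q t rp rm) *
        formalSum fun mu : Ptn => obsE q t r lam • formalWeight q t rp rm lam mu := fun lam => by
    rw [formalMeasure, formalSum_smul (hl.comp_injective (Prod.mk_right_injective lam)),
      mul_smul_comm]
  have hl' := hl.smul fun s => obsE q t r s.1
  rw [formalExpectation, formalSum_congr h1, formalSum_mul_left hl'.formalSum,
    ← formalSum_prod hl', formalSum_obsE_weight_eq hq hq' ht ht', ← mul_assoc,
    inv1_mul_formalPartitionFunction hq hq' ht ht', one_mul]

end Kernel

/-! ### Positivity of the partition function -/

section Positivity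

variable {ι σ : Type*}

/-- All coefficients are nonnegative. -/
def NonnegCoeff (F : MvPowerSeries σ ℝ) : Prop := ∀ d, 0 ≤ MvPowerSeries.coeff d F

theorem nonnegCoeff_one : NonnegCoeff (1 : MvPowerSeries σ ℝ) := fun d => by
  classical
  rw [MvPowerSeries.coeff_one]
  split_ifs <;> norm_num

theorem nonnegCoeff_X (i : σ) : NonnegCoeff (MvPowerSeries.X i : MvPowerSeries σ ℝ) := fun d => by
  classical
  rw [MvPowerSeries.coeff_X]
  split_ifs <;> norm_num

theorem NonnegCoeff.mul {F G : MvPowerSeries σ ℝ} (hF : NonnegCoeff F) (hG : NonnegCoeff G) :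
    NonnegCoeff (F * G) := fun d => by
  classical
  rw [MvPowerSeries.coeff_mul]
  exact Finset.sum_nonneg fun p _ => mul_nonneg (hF _) (hG _)

theorem NonnegCoeff.pow {F : MvPowerSeries σ ℝ} (hF : NonnegCoeff F) (n : ℕ) :
    NonnegCoeff (F ^ n) := by
  induction n with
  | zero => rw [pow_zero]; exact nonnegCoeff_one
  | succ n ih => rw [pow_succ]; exact ih.mul hF

theorem NonnegCoeff.smul {F : MvPowerSeries σ ℝ} (hF : NonnegCoeff F) {c : ℝ} (hc : 0 ≤ c) :
    NonnegCoeff (c • F) := fun d => mul_nonneg hc (hF d)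

theorem NonnegCoeff.formalSum {f : ι → MvPowerSeries σ ℝ} (h : ∀ i, NonnegCoeff (f i)) :
    NonnegCoeff (formalSum f) := fun d => by
  rw [coeff_formalSum]
  exact finsum_nonneg fun i => h i d

variable {q t : ℝ} {rp rm : Lam →ₐ[ℝ] ℝ}

theorem map_macQ_nonneg (hq : 0 < q) (hq' : q < 1) (ht : 0 < t) (ht' : t < 1)
    (h : MacdonaldPositive q t rm) (lam : Ptn) : 0 ≤ rm (macQ q t lam) := by
  rw [macQ, map_smul]
  exact mul_nonneg (inv_nonneg.mpr (pairing_macP_self_pos hq hq' ht ht' lam).le) (h lam)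

/-- The numbers whose power sum exponential is the Cauchy product of two specializations. -/
def cauchyCoeff (q t : ℝ) (rp rm : Lam →ₐ[ℝ] ℝ) (n : ℕ+) : ℝ :=
  rp (powerSum n) * ((kappa q t n)⁻¹ * rm (powerSum n))

/-- The Cauchy identity: the exponential is `∑ lam, P_lam(ρ⁺) * Q_lam(ρ⁻) * v ^ |lam|`. -/
theorem mexp_cauchyCoeff (hq : 0 < q) (hq' : q < 1) (ht : 0 < t) (ht' : t < 1)
    {v : FormalRing} (hv : VanishBelow 1 v) :
    (mexp fun n => cauchyCoeff q t rp rm n • v ^ (n : ℕ)) =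
      formalSum fun lam : Ptn => (rm (macQ q t lam) * rp (macP q t lam)) • v ^ lam.1 := by
  have hp : ∀ n : ℕ, VanishBelow n (v ^ n) := fun n => by simpa using hv.pow n
  rw [mexp, show dpow (fun n : ℕ+ => cauchyCoeff q t rp rm n • v ^ (n : ℕ)) =
    fun e => dpow (cauchyCoeff q t rp rm) e • v ^ wt e from funext fun e => dpow_smul_pow _ _ e]
  symm
  refine formalSum_ptn_eq ?_ (locFin_wt fun e => (hp _).smul _) fun n => ?_
  · exact locFin_of_vanishBelow (fun lam => lam.1) (fun lam => (hp _).smul _) finite_ptn_le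
  · have h := sum_macQ_mul_macP hq hq' ht ht' rm.toLinearMap rp.toLinearMap
      (E := LinearMap.id) (c := fun _ => 1) (fun _ => (one_smul _ _).symm) n
    simp only [one_smul, LinearMap.id_apply, AlgHom.toLinearMap_apply] at h
    show (∑ lam : n.Partition, (rm (macQ q t ⟨n, lam⟩) * rp (macP q t ⟨n, lam⟩)) • v ^ n) = _
    rw [← Finset.sum_smul, h, Finset.sum_smul]
    refine Finset.sum_congr rfl fun e he => ?_
    have hmono : ∀ rho : Lam →ₐ[ℝ] ℝ, rho (MvPolynomial.monomial e 1) =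
        mpow (fun n => rho (powerSum n)) e := fun rho => by
      have h1 : (MvPolynomial.monomial e (1 : ℝ)) = mpow powerSum e := by
        rw [MvPolynomial.monomial_eq, map_one, one_mul]
        rfl
      rw [h1, map_mpow]
    have hk : mpow (fun n => (kappa q t n)⁻¹) e = (mpow (kappa q t) e)⁻¹ := by
      simp [mpow, Finsupp.prod, inv_pow]
    rw [mem_wtFinset.mp he, hmono, hmono, zFactor_eq]
    congr 1
    show _ = dpow (fun n => rp (powerSum n) * ((kappa q t n)⁻¹ * rm (powerSum n))) e
    rw [dpow, mpow_mul, mpow_mul, hk, mul_inv, smul_eq_mul, smul_eq_mul]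
    ring

/-- The coefficients of the partition function are nonnegative: the exponential in its closed form
is the product over `m` of the Cauchy sums at `v = x y u ^ m`, of which only finitely many
contribute to a given coefficient. -/
theorem nonnegCoeff_formalPartitionFunction (hq : 0 < q) (hq' : q < 1) (ht : 0 < t) (ht' : t < 1)
    (hp : MacdonaldPositive q t rp) (hm : MacdonaldPositive q t rm) :
    NonnegCoeff (formalPartitionFunction q t rp rm) := by
  let XY : FormalRing := MvPowerSeries.X 0 * MvPowerSeries.X 1
  let U : FormalRing := MvPowerSeries.X 2
  have hXY : VanishBelow 1 XY := (vanishBelow_X _).mul_right _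
  have hU : VanishBelow 1 U := vanishBelow_X _
  have hinv : ∀ n : ℕ+, inv1 (1 - U ^ (n : ℕ)) * (1 - U ^ (n : ℕ)) = 1 := fun n =>
    inv1_mul ((hU.pow n).mono (by rw [one_mul]; exact n.pos))
  set c := cauchyCoeff q t rp rm
  have hterm : ∀ (v : FormalRing), VanishBelow 1 v → ∀ n : ℕ+, VanishBelow n (c n • v ^ (n : ℕ)) :=
    fun v hv n => by simpa using (hv.pow n).smul (c n)
  have hfac : ∀ m : ℕ, NonnegCoeff (mexp fun n => c n • (XY * U ^ m) ^ (n : ℕ)) := fun m => by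
    rw [mexp_cauchyCoeff hq hq' ht ht' (hXY.mul_right _)]
    exact NonnegCoeff.formalSum fun lam => ((((nonnegCoeff_X _).mul (nonnegCoeff_X _)).mul
      ((nonnegCoeff_X _).pow _)).pow _).smul (mul_nonneg (map_macQ_nonneg hq hq' ht ht' hm lam) (hp lam))
  let rest : ℕ → ℕ+ → FormalRing := fun K n =>
    inv1 (1 - U ^ (n : ℕ)) * (c n • (XY * U ^ K) ^ (n : ℕ))
  have hrest : ∀ K n, VanishBelow (n : ℕ+) (rest K n) := fun K n =>
    (hterm _ (hXY.mul_right _) n).mul_left _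
  have hrestK : ∀ K, VanishBelow K (mexp (rest K) - 1) := fun K => by
    rw [mexp_eq_formalExp (hrest K)]
    have h1 : VanishBelow (1 + K) (formalSum (rest K)) := VanishBelow.formalSum fun n => by
      have h2 : VanishBelow (1 + K) (XY * U ^ K) := by simpa using hXY.mul (hU.pow K)
      exact (((h2.pow n).smul _).mul_left _).mono (Nat.le_mul_of_pos_right _ n.pos)
    exact (h1.formalExp_sub_one (by omega)).mono (by omega)
  have hprod : ∀ K, mexp (rest 0) =
      (∏ m ∈ Finset.range K, mexp fun n => c n • (XY * U ^ m) ^ (n : ℕ)) * mexp (rest K) := by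
    intro K
    induction K with
    | zero => rw [Finset.prod_range_zero, one_mul]
    | succ K ih =>
      have h1 : rest K = fun n => c n • (XY * U ^ K) ^ (n : ℕ) + rest (K + 1) n := by
        funext n
        simp only [rest]
        have h2 : (XY * U ^ (K + 1)) ^ (n : ℕ) = (XY * U ^ K) ^ (n : ℕ) * U ^ (n : ℕ) := by
          rw [← mul_pow]
          ring
        rw [h2, mul_smul_comm, mul_smul_comm, ← smul_add]
        congr 1
        linear_combination (XY * U ^ K) ^ (n : ℕ) * hinv n
      rw [ih, Finset.prod_range_succ, h1, mexp_add (hterm _ (hXY.mul_right _)) (hrest (K + 1))]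
      exact (mul_assoc _ _ _).symm
  have hZ : formalPartitionFunction q t rp rm = geomZ uPow * mexp (rest 0) := by
    rw [formalPartitionFunction_eq rp rm hq hq' ht ht']
    congr 2
    funext n
    simp only [rest, pow_zero, one_pow, mul_one, plusVar, minusVar, uPow, XY, U, mul_pow,
      smul_mul_smul_comm]
    rfl
  rw [hZ]
  refine NonnegCoeff.mul (NonnegCoeff.formalSum fun j => ?_) fun d => ?_
  · show NonnegCoeff (mpow (fun n : ℕ+ => U ^ (n : ℕ)) j)
    rw [mpow_pow_wt]
    exact (nonnegCoeff_X _).pow _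
  · rw [hprod (d.degree + 1), coeff_mul_of_vanishBelow (hrestK _) (Nat.lt_succ_self _)]
    exact Finset.prod_induction _ NonnegCoeff (fun _ _ => NonnegCoeff.mul) nonnegCoeff_one
      (fun m _ => hfac m) d

end Positivity

/-! ### Convergence -/

section Numeric

variable {q t : ℝ} {rp rm : Lam →ₐ[ℝ] ℝ}

/-- The value of a sum of monomials at `x = y = 1` may be computed by collecting coefficients. -/
theorem hasSum_coeff_formalSum {ι : Type*} {a : ι → ℝ} {m : ι → Fin 3 →₀ ℕ}
    {f : ι → FormalRing} (hf : ∀ s, f s = MvPowerSeries.monomial (m s) (a s)) (hl : LocFin f)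
    {u A : ℝ} (h : HasSum (fun s => a s * u ^ m s 2) A) :
    HasSum (fun d => MvPowerSeries.coeff d (formalSum f) * u ^ d 2) A := by
  classical
  have h1 := h.tsum_fiberwise m
  refine (congrArg (fun g : (Fin 3 →₀ ℕ) → ℝ => HasSum g A) (funext fun d => ?_)).mpr h1
  rw [coeff_formalSum, ← tsum_eq_finsum (L := .unconditional ι) (hl d), ← tsum_mul_right,
    tsum_subtype (m ⁻¹' {d}) fun s => a s * u ^ m s 2]
  refine tsum_congr fun s => ?_
  rw [hf, MvPowerSeries.coeff_monomial, Set.indicator_apply]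
  by_cases hd : m s = d
  · rw [if_pos hd.symm, if_pos (show s ∈ m ⁻¹' {d} from hd), hd]
  · rw [if_neg (Ne.symm hd), if_neg (show s ∉ m ⁻¹' {d} from hd), zero_mul]

/-- The exponents of `x`, `y` and `u` in a weight. -/
def weightExponent (s : Ptn × Ptn) : Fin 3 →₀ ℕ := Finsupp.single 2 s.2.1 +
  Finsupp.single 1 (s.1.1 - s.2.1) + Finsupp.single 0 (s.1.1 - s.2.1)

theorem weightExponent_two (s : Ptn × Ptn) : weightExponent s 2 = s.2.1 := by simp [weightExponent]

theorem formalWeight_eq_monomial (hq : 0 < q) (hq' : q < 1) (ht : 0 < t) (ht' : t < 1)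
    (rp rm : Lam →ₐ[ℝ] ℝ) (s : Ptn × Ptn) :
    formalWeight q t rp rm s.1 s.2 = MvPowerSeries.monomial (weightExponent s)
      (rm (skewQ q t s.1 s.2) * rp (skewP q t s.1 s.2)) := by
  rw [weightExponent, formalWeight_eq hq hq' ht ht', MvPowerSeries.X_pow_eq, MvPowerSeries.X_pow_eq,
    MvPowerSeries.X_pow_eq, MvPowerSeries.monomial_mul_monomial,
    MvPowerSeries.monomial_mul_monomial, ← map_smul]
  simp

theorem weight_eq (u : ℝ) (s : Ptn × Ptn) : weight q t u rp rm s.1 s.2 =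
    rm (skewQ q t s.1 s.2) * rp (skewP q t s.1 s.2) * u ^ weightExponent s 2 := by
  rw [weight, weightExponent_two, Ptn.size]
  ring

/-- The numerical partition function is the value of the formal one. -/
theorem hasSum_partitionFunction (hq : 0 < q) (hq' : q < 1) (ht : 0 < t) (ht' : t < 1) {u : ℝ}
    (hZ : Summable fun s : Ptn × Ptn => weight q t u rp rm s.1 s.2) :
    HasSum (fun d => MvPowerSeries.coeff d (formalPartitionFunction q t rp rm) * u ^ d 2)
      (partitionFunction q t u rp rm) := by
  have h := hZ.hasSum
  simp only [weight_eq] at h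
  rw [partitionFunction]
  simp only [weight_eq]
  exact hasSum_coeff_formalSum (formalWeight_eq_monomial hq hq' ht ht' rp rm)
    (locFin_formalWeight hq hq' ht ht' rp rm) h

theorem hasSum_obsE_weight (hq : 0 < q) (hq' : q < 1) (ht : 0 < t) (ht' : t < 1) {r : ℕ} {u : ℝ}
    (hN : Summable fun s : Ptn × Ptn => obsE q t r s.1 * weight q t u rp rm s.1 s.2) :
    HasSum (fun d => MvPowerSeries.coeff d
      (formalPartitionFunction q t rp rm * firstSeriesIntegral q t rp rm r) * u ^ d 2)
      (∑' s : Ptn × Ptn, obsE q t r s.1 * weight q t u rp rm s.1 s.2) := by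
  have h := hN.hasSum
  simp only [weight_eq, ← mul_assoc] at h ⊢
  rw [← formalSum_obsE_weight_eq hq hq' ht ht']
  refine hasSum_coeff_formalSum (fun s => ?_)
    ((locFin_formalWeight hq hq' ht ht' rp rm).smul fun s => obsE q t r s.1) h
  rw [formalWeight_eq_monomial hq hq' ht ht', ← map_smul, smul_eq_mul, mul_assoc]

/-- The constant term of the formal partition function is `1`, and no coefficient is negative. -/
theorem partitionFunction_pos (hq : 0 < q) (hq' : q < 1) (ht : 0 < t) (ht' : t < 1) {u : ℝ}
    (hp : MacdonaldPositive q t rp) (hm : MacdonaldPositive q t rm) (hu : 0 < u)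
    (hZ : Summable fun s : Ptn × Ptn => weight q t u rp rm s.1 s.2) :
    0 < partitionFunction q t u rp rm := by
  have h := le_hasSum (hasSum_partitionFunction hq hq' ht ht' hZ) 0 fun d _ => mul_nonneg
    (nonnegCoeff_formalPartitionFunction hq hq' ht ht' hp hm d) (pow_nonneg hu.le _)
  rw [MvPowerSeries.coeff_zero_eq_constantCoeff_apply,
    constantCoeff_formalPartitionFunction hq hq' ht ht', Finsupp.coe_zero, Pi.zero_apply, pow_zero,
    mul_one] at h
  exact zero_lt_one.trans_le h

/-- The unnormalized identity of formal series is evaluated at `u`. It can be divided by the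
partition function, which is positive. -/
theorem expectation_eq (hq : 0 < q) (hq' : q < 1) (ht : 0 < t) (ht' : t < 1) {r : ℕ} {u : ℝ}
    (hp : MacdonaldPositive q t rp) (hm : MacdonaldPositive q t rm) (hu : 0 < u)
    (hZ : Summable fun s : Ptn × Ptn => weight q t u rp rm s.1 s.2)
    (hN : Summable fun s : Ptn × Ptn => obsE q t r s.1 * weight q t u rp rm s.1 s.2)
    (hI : Summable fun d : Fin 3 →₀ ℕ =>
      MvPowerSeries.coeff d (firstSeriesIntegral q t rp rm r) * u ^ d 2) :
    expectation q t u rp rm (obsE q t r) =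
      ∑' d : Fin 3 →₀ ℕ, MvPowerSeries.coeff d (firstSeriesIntegral q t rp rm r) * u ^ d 2 := by
  classical
  have h1 := hasSum_partitionFunction hq hq' ht ht' hZ
  have h2 := hasSum_obsE_weight hq hq' ht ht' hN
  have hpos := partitionFunction_pos hq hq' ht ht' hp hm hu hZ
  -- the Cauchy product of the two absolutely convergent series
  have h4 := h1.summable.tsum_mul_tsum_eq_tsum_sum_antidiagonal hI
    (summable_mul_of_summable_norm h1.summable.norm hI.norm)
  have h5 : ∀ d : Fin 3 →₀ ℕ, ∑ p ∈ Finset.HasAntidiagonal.antidiagonal d,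
      MvPowerSeries.coeff p.1 (formalPartitionFunction q t rp rm) * u ^ p.1 2 *
        (MvPowerSeries.coeff p.2 (firstSeriesIntegral q t rp rm r) * u ^ p.2 2) =
      MvPowerSeries.coeff d (formalPartitionFunction q t rp rm * firstSeriesIntegral q t rp rm r) *
        u ^ d 2 := by
    intro d
    rw [MvPowerSeries.coeff_mul, Finset.sum_mul]
    refine Finset.sum_congr rfl fun p hp => ?_
    rw [← Finset.HasAntidiagonal.mem_antidiagonal.mp hp, Finsupp.add_apply, pow_add]
    ring
  rw [tsum_congr h5, h2.tsum_eq, h1.tsum_eq] at h4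
  have h6 : expectation q t u rp rm (obsE q t r) =
      (∑' s : Ptn × Ptn, obsE q t r s.1 * weight q t u rp rm s.1 s.2) /
        partitionFunction q t u rp rm := by
    rw [expectation, hN.tsum_prod, ← tsum_div_const]
    refine tsum_congr fun lam => ?_
    show _ = (∑' mu : Ptn, obsE q t r lam * weight q t u rp rm lam mu) / _
    rw [measure, tsum_mul_left, mul_div_assoc]
  rw [h6, div_eq_iff hpos.ne', mul_comm, h4]

end Numeric

end PeriodicMacdonald

end

theorem mainTheorem3 (q t : ℝ) (hq : 0 < q) (hq' : q < 1) (ht : 0 < t) (ht' : t < 1)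
    (rp rm : PeriodicMacdonald.Lam →ₐ[ℝ] ℝ) (r : ℕ) :
    -- the kernel of the one-step process simplifies
    (∀ i j : Fin r,
      PeriodicMacdonald.processKernel t 1 (fun _ => rp) (fun _ => rm) 1 i j =
        PeriodicMacdonald.kernel t rp rm i j) ∧
    -- the identity of formal series
    PeriodicMacdonald.formalExpectation q t rp rm (PeriodicMacdonald.obsE q t r) =
      PeriodicMacdonald.firstSeriesIntegral q t rp rm r ∧
    -- the numerical identity, wherever both sides converge
    (PeriodicMacdonald.MacdonaldPositive q t rp → PeriodicMacdonald.MacdonaldPositive q t rm →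
      ∀ u : ℝ, 0 < u → u < 1 →
      Summable (fun s : PeriodicMacdonald.Ptn × PeriodicMacdonald.Ptn =>
        PeriodicMacdonald.weight q t u rp rm s.1 s.2) →
      Summable (fun s : PeriodicMacdonald.Ptn × PeriodicMacdonald.Ptn =>
        PeriodicMacdonald.obsE q t r s.1 * PeriodicMacdonald.weight q t u rp rm s.1 s.2) →
      Summable (fun d : Fin 3 →₀ ℕ => MvPowerSeries.coeff d
        (PeriodicMacdonald.firstSeriesIntegral q t rp rm r) * u ^ d 2) →
      PeriodicMacdonald.expectation q t u rp rm (PeriodicMacdonald.obsE q t r) =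
        ∑' d : Fin 3 →₀ ℕ, MvPowerSeries.coeff d
          (PeriodicMacdonald.firstSeriesIntegral q t rp rm r) * u ^ d 2) := by
  refine ⟨PeriodicMacdonald.processKernel_one t rp rm,
    PeriodicMacdonald.formalExpectation_eq hq hq' ht ht', fun hp hm u hu _ hZ hN hI => ?_⟩
  exact PeriodicMacdonald.expectation_eq hq hq' ht ht' hp hm hu hZ hN hI
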